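/- **Setting.** For $c=(c_1,c_2,c_3)\in\mathbb R^3$ put $P_c(x)=c_1(1-x)+c_2(1+x)+c_3(1-x^2)$, and for $c_1,c_2\ge-1$ put $\bar c_3(c_1,c_2)=-\tfrac12(\sqrt{1+c_1}+\sqrt{1+c_2})(\sqrt{1+c_1}+\sqrt{1+c_2}+2)$ and $J=\{c: c_1,c_2\ge -1,\ c_3\ge\bar c_3(c_1,c_2)\}$. For $c\in J$ let $[\gamma^-(c),\gamma^+(c)]$ be the set of the values $U(0)$ of the solutions $U\in C^1(-1,1)$ of $$(1-x^2)U'+2xU+\tfrac12U^2=P_c\quad\text{on }(-1,1),$$ and for $\gamma$ in this interval let $U^{c,\gamma}_\theta$ be the solution with $U^{c,\gamma}_\theta(0)=\gamma$, $U^{c,\gamma}=(U^{c,\gamma}_\theta,0)$, with boundary values $U^{c,\gamma}_\theta(\pm1)$ understood as limits. Let - $I_{1,2}$, $I_{2,2}$ be the sets of $(c,\gamma)$ with $c_3>\bar c_3(c_1,c_2)$, $c_2>-1$, $\gamma=\gamma^+(c)$ and, respectively, $-1<c_1<-\frac34$, $c_1=-1$; - $I_{1,3}$, $I_{3,3}$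 be the sets of $(c,\gamma)$ with $c_3>\bar c_3(c_1,c_2)$, $c_1>-1$, $\gamma=\gamma^-(c)$ and, respectively, $-1<c_2<-\frac34$, $c_2=-1$. Put $\psi[f](x)=\int_0^x\int_0^l\int_0^t\frac{2f f'}{1-s^2}\,ds\,dt\,dl$ and $\varphi_{c,\gamma}[f]=(1-x^2)f'+(2x+U^{c,\gamma}_\theta)f+\frac12f^2$, and consider, for constants $\hat c\in\mathbb R^3$, the system $$(\ast)_{\hat c}\qquad (1-x^2)U_\theta'+2xU_\theta+\tfrac12U_\theta^2+\psi[U_\phi]=P_{\hat c},\qquad (1-x^2)U_\phi''+U_\theta U_\phi'=0\qquad\text{on }(-1,1).$$ With $a_{c,\gamma}(x)=\int_0^x\frac{2s+U^{c,\gamma}_\theta(s)}{1-s^2}ds$ and $b_{c,\gamma}(x)=\int_0^x\frac{U^{c,\gamma}_\theta(s)}{1-s^2}ds$ let $$V^{2a}_{c,\gamma}=\Big(e^{-a_{c,\gamma}(x)}\!\int_{-1}^x e^{a_{c,\gamma}},\,0\Big),\quad V^{2b}_{c,\gamma}=\Big(e^{-a_{c,\gamma}(x)}\!\int_{1}^x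 e^{a_{c,\gamma}},\,0\Big),\quad V^3_{c,\gamma}=\Big(0,\int_0^xe^{-b_{c,\gamma}}\Big),\quad V^4_{c,\gamma}=(0,1).$$ Call $\epsilon\in(0,\frac12)$ admissible for a set $K$ of pairs $(c,\gamma)$ if for every $(c,\gamma)\in K$: $\epsilon>\frac14U^{c,\gamma}_\theta(-1)$ if $U^{c,\gamma}_\theta(-1)<2$, $\epsilon>\frac12U^{c,\gamma}_\theta(-1)-1$ if $U^{c,\gamma}_\theta(-1)\ge2$, $\epsilon>-\frac14U^{c,\gamma}_\theta(1)$ if $U^{c,\gamma}_\theta(1)>-2$, and $\epsilon>-\frac12U^{c,\gamma}_\theta(1)-1$ if $U^{c,\gamma}_\theta(1)\le-2$. Let $\mathbf M_1$ be the space of $f\in C^3(-\frac12,\frac12)\cap C^1(-1,1)\cap C[-1,1]$ with $f(\pm1)=0$ and finite norm $$\|(1-x^2)^{-1+2\epsilon}f\|_{L^\infty(-1,1)}+\|(1-x^2)^{2\epsilon}f'\|_{L^\infty(-1,1)}+\|f''\|_{L^\infty(-\frac12,\frac12)}+\|f'''\|_{L^\infty(-\frac12,\frac12)},$$ $\mathbf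 M_2$ the space of $f\in C^2(-1,1)$ with finite norm $\|(1-x^2)^{\epsilon}f\|_{L^\infty(-1,1)}+\|(1-x^2)^{1+\epsilon}f'\|_{L^\infty(-1,1)}+\|(1-x^2)^{2+\epsilon}f''\|_{L^\infty(-1,1)}$, and $\mathbf X=\mathbf M_1\times\mathbf M_2$ with the sum of the norms. Let $\mathbf X_{2a}=\mathbf X_{2b}=\{V\in\mathbf X: V_\theta(0)=V_\phi'(0)=V_\phi(0)=0\}$. **Theorem.** Let $K$ be a compact subset of $I_{1,2}$ or a compact subset of $I_{2,2}$ (respectively, of $I_{1,3}$ or of $I_{3,3}$). Then an admissible $\epsilon$ for $K$ exists, and for every admissible $\epsilon$ there are $\delta>0$ and $V\in C^\infty(K\times B_\delta(0),\mathbf X_{2a})$ (respectively $C^\infty(K\times B_\delta(0),\mathbf X_{2b})$), i.e. $V$ is the restriction of a smooth map on $\Omega\times B_\delta(0)$ for some open $\Omega\subset\mathbb R^4$ containing $K$, where $B_\delta(0)\subset\mathbb R^3$ and $\beta=(\beta_2,\beta_3,\beta_4)$, such that $V(c,\gamma,0)=0$ and $\frac{\partial V}{\partial\beta_i}\big|_{\beta=0}=0$,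 $i=2,3,4$, for $(c,\gamma)\in K$, and such that for all $(c,\gamma)\in K$ and $\beta\in B_\delta(0)$ $$U=U^{c,\gamma}+\tilde U,\qquad \tilde U=\beta_2V^{2a}_{c,\gamma}+\beta_3V^3_{c,\gamma}+\beta_4V^4_{c,\gamma}+V(c,\gamma,\beta)\in\mathbf X \tag{1}$$ (respectively with $V^{2b}_{c,\gamma}$ in place of $V^{2a}_{c,\gamma}$) satisfies $(\ast)_{\hat c}$ with $\hat c_1=c_1+\frac12\psi[\tilde U_\phi](-1)$, $\hat c_2=c_2+\frac12\psi[\tilde U_\phi](1)$, $\hat c_3=c_3-\frac12(\varphi_{c,\gamma}[\tilde U_\theta])''(0)$. Moreover, there is $\delta'>0$ such that whenever $(c,\gamma)\in K$, $U-U^{c,\gamma}\in\mathbf X$, $\|U-U^{c,\gamma}\|_{\mathbf X}<\delta'$ and $U$ satisfies $(\ast)_{\hat c}$ for some constants $\hat c$, then $U$ has the form (1) for some $\beta$ with $|\beta|<\delta$. -/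

import Mathlib

open Set Filter Topology
open scoped ContDiff

namespace HomNS

noncomputable section

/-! ### The no-swirl solutions `U^{c,γ}` and the parameter sets -/

/-- `P_c(x) = c₁(1-x) + c₂(1+x) + c₃(1-x²)`, with `c = (c 0, c 1, c 2)`. -/
def P (c : Fin 3 → ℝ) (x : ℝ) : ℝ :=
  c 0 * (1 - x) + c 1 * (1 + x) + c 2 * (1 - x ^ 2)

/-- `U` is a `C¹` solution on `(-1,1)` of `(1-x²)U' + 2xU + U²/2 = P_c`. -/
def IsNoSwirl (c : Fin 3 → ℝ) (U : ℝ → ℝ) : Prop :=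
  ContDiffOn ℝ 1 U (Ioo (-1) 1) ∧
    ∀ x ∈ Ioo (-1 : ℝ) 1,
      (1 - x ^ 2) * deriv U x + 2 * x * U x + (1 / 2) * U x ^ 2 = P c x

/-- The values at `0` of the solutions on `(-1,1)`; this is the interval `[γ⁻(c), γ⁺(c)]`. -/
def initialValues (c : Fin 3 → ℝ) : Set ℝ :=
  {γ | ∃ U : ℝ → ℝ, IsNoSwirl c U ∧ U 0 = γ}

def gammaPlus (c : Fin 3 → ℝ) : ℝ := sSup (initialValues c)

def gammaMinus (c : Fin 3 → ℝ) : ℝ := sInf (initialValues c)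

open Classical in
/-- `U^{c,γ}_θ`: the solution with value `γ` at `0` (its values on `(-1,1)` are determined by this
initial condition; only these values are used below). -/
def Ubar (c : Fin 3 → ℝ) (γ : ℝ) : ℝ → ℝ :=
  if h : ∃ U : ℝ → ℝ, IsNoSwirl c U ∧ U 0 = γ then h.choose else 0

/-- The boundary value `U^{c,γ}_θ(-1)`. -/
def UbarLeft (c : Fin 3 → ℝ) (γ : ℝ) : ℝ := limUnder (𝓝[>] (-1 : ℝ)) (Ubar c γ)

/-- The boundary value `U^{c,γ}_θ(1)`. -/
def UbarRight (c : Fin 3 → ℝ) (γ : ℝ) : ℝ := limUnder (𝓝[<] (1 : ℝ)) (Ubar c γ)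

def c3bar (c₁ c₂ : ℝ) : ℝ :=
  -(1 / 2) * (√(1 + c₁) + √(1 + c₂)) * (√(1 + c₁) + √(1 + c₂) + 2)

def J : Set (Fin 3 → ℝ) := {c | -1 ≤ c 0 ∧ -1 ≤ c 1 ∧ c3bar (c 0) (c 1) ≤ c 2}

def J1 : Set (Fin 3 → ℝ) := {c ∈ J | -1 < c 0 ∧ -1 < c 1 ∧ c3bar (c 0) (c 1) < c 2}

def J2 : Set (Fin 3 → ℝ) := {c ∈ J | c 0 = -1 ∧ -1 < c 1 ∧ c3bar (c 0) (c 1) < c 2}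

def J3 : Set (Fin 3 → ℝ) := {c ∈ J | -1 < c 0 ∧ c 1 = -1 ∧ c3bar (c 0) (c 1) < c 2}

def I : Set ((Fin 3 → ℝ) × ℝ) :=
  {p | p.1 ∈ J ∧ gammaMinus p.1 ≤ p.2 ∧ p.2 ≤ gammaPlus p.1}

def I12 : Set ((Fin 3 → ℝ) × ℝ) := {p ∈ I | p.1 ∈ J1 ∧ p.1 0 < -(3 / 4) ∧ p.2 = gammaPlus p.1}

def I22 : Set ((Fin 3 → ℝ) × ℝ) := {p ∈ I | p.1 ∈ J2 ∧ p.1 0 < -(3 / 4) ∧ p.2 = gammaPlus p.1}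

def I13 : Set ((Fin 3 → ℝ) × ℝ) := {p ∈ I | p.1 ∈ J1 ∧ p.1 1 < -(3 / 4) ∧ p.2 = gammaMinus p.1}

def I33 : Set ((Fin 3 → ℝ) × ℝ) := {p ∈ I | p.1 ∈ J3 ∧ p.1 1 < -(3 / 4) ∧ p.2 = gammaMinus p.1}

/-- The condition under which the exponent `ε` of the weighted spaces may be used at `(c,γ)`. -/
def AdmissibleAt (ε : ℝ) (c : Fin 3 → ℝ) (γ : ℝ) : Prop :=
  (UbarLeft c γ < 2 → UbarLeft c γ / 4 < ε) ∧
  (2 ≤ UbarLeft c γ → UbarLeft c γ / 2 - 1 < ε) ∧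
  (-2 < UbarRight c γ → -UbarRight c γ / 4 < ε) ∧
  (UbarRight c γ ≤ -2 → -UbarRight c γ / 2 - 1 < ε)

/-- `ε ∈ (0,1/2)` may be used at all points of `K`. -/
def Admissible (ε : ℝ) (K : Set ((Fin 3 → ℝ) × ℝ)) : Prop :=
  0 < ε ∧ ε < 1 / 2 ∧ ∀ p ∈ K, AdmissibleAt ε p.1 p.2

/-! ### The system with swirl -/

/-- `ψ[f,g](x) = ∫₀ˣ ∫₀ˡ ∫₀ᵗ 2 f g' / (1-s²) ds dt dl`. -/
def psi (f g : ℝ → ℝ) (x : ℝ) : ℝ :=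
  ∫ l in (0 : ℝ)..x, ∫ t in (0 : ℝ)..l, ∫ s in (0 : ℝ)..t, 2 * f s * deriv g s / (1 - s ^ 2)

/-- `φ_{c,γ}[f] = (1-x²) f' + (2x + U^{c,γ}_θ) f + f²/2`. -/
def phi (c : Fin 3 → ℝ) (γ : ℝ) (f : ℝ → ℝ) (x : ℝ) : ℝ :=
  (1 - x ^ 2) * deriv f x + (2 * x + Ubar c γ x) * f x + (1 / 2) * f x ^ 2

/-- `(Uθ, Uφ)` solves on `(-1,1)` the reduced stationary Navier-Stokes system with
constants `ĉ`. -/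
def SolvesNSE (chat : Fin 3 → ℝ) (Uθ Uφ : ℝ → ℝ) : Prop :=
  ContDiffOn ℝ 1 Uθ (Ioo (-1) 1) ∧ ContDiffOn ℝ 2 Uφ (Ioo (-1) 1) ∧
    ∀ x ∈ Ioo (-1 : ℝ) 1,
      (1 - x ^ 2) * deriv Uθ x + 2 * x * Uθ x + (1 / 2) * Uθ x ^ 2 + psi Uφ Uφ x = P chat x ∧
      (1 - x ^ 2) * iteratedDeriv 2 Uφ x + Uθ x * deriv Uφ x = 0

def a (c : Fin 3 → ℝ) (γ x : ℝ) : ℝ := ∫ s in (0 : ℝ)..x, (2 * s + Ubar c γ s) / (1 - s ^ 2)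

def b (c : Fin 3 → ℝ) (γ x : ℝ) : ℝ := ∫ s in (0 : ℝ)..x, Ubar c γ s / (1 - s ^ 2)

/-- The `θ`-component of `V^{2a}_{c,γ}` (its `φ`-component is `0`). -/
def V2a (c : Fin 3 → ℝ) (γ x : ℝ) : ℝ :=
  Real.exp (-a c γ x) * ∫ s in (-1 : ℝ)..x, Real.exp (a c γ s)

/-- The `θ`-component of `V^{2b}_{c,γ}` (its `φ`-component is `0`). -/
def V2b (c : Fin 3 → ℝ) (γ x : ℝ) : ℝ :=
  Real.exp (-a c γ x) * ∫ s in (1 : ℝ)..x, Real.exp (a c γ s)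

/-- The `φ`-component of `V^3_{c,γ}` (its `θ`-component is `0`). -/
def V3 (c : Fin 3 → ℝ) (γ x : ℝ) : ℝ := ∫ t in (0 : ℝ)..x, Real.exp (-b c γ t)

/-! ### Weighted spaces

`‖g‖_{L^∞(s)}` is taken as a supremum over `s`; it is only applied to functions that are continuous
on the open interval `s`. -/

def BddOn (s : Set ℝ) (g : ℝ → ℝ) : Prop := BddAbove (range fun x : s => |g x|)

def supOn (s : Set ℝ) (g : ℝ → ℝ) : ℝ := ⨆ x : s, |g x|

theorem le_supOn {s : Set ℝ} {g : ℝ → ℝ} (h : BddOn s g) {x : ℝ} (hx : x ∈ s) :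
    |g x| ≤ supOn s g :=
  le_ciSup (f := fun x : s => |g x|) h ⟨x, hx⟩

theorem supOn_nonneg (s : Set ℝ) (g : ℝ → ℝ) : 0 ≤ supOn s g :=
  Real.iSup_nonneg fun _ => abs_nonneg _

theorem supOn_le {s : Set ℝ} {g : ℝ → ℝ} {C : ℝ} (hC : 0 ≤ C) (h : ∀ x ∈ s, |g x| ≤ C) :
    supOn s g ≤ C :=
  Real.iSup_le (fun x => h x x.2) hC

theorem bddOn_of_le {s : Set ℝ} {g : ℝ → ℝ} {C : ℝ} (h : ∀ x ∈ s, |g x| ≤ C) : BddOn s g := by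
  refine ⟨C, ?_⟩
  rintro _ ⟨x, rfl⟩
  exact h x x.2

theorem abs_add_le_supOn {s : Set ℝ} {f g h : ℝ → ℝ} (hf : BddOn s f) (hg : BddOn s g)
    (hh : ∀ x ∈ s, h x = f x + g x) : ∀ x ∈ s, |h x| ≤ supOn s f + supOn s g := by
  intro x hx
  rw [hh x hx]
  exact (abs_add_le _ _).trans (add_le_add (le_supOn hf hx) (le_supOn hg hx))

theorem supOn_add_le {s : Set ℝ} {f g h : ℝ → ℝ} (hf : BddOn s f) (hg : BddOn s g)
    (hh : ∀ x ∈ s, h x = f x + g x) : supOn s h ≤ supOn s f + supOn s g :=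
  supOn_le (add_nonneg (supOn_nonneg _ _) (supOn_nonneg _ _)) (abs_add_le_supOn hf hg hh)

theorem bddOn_add {s : Set ℝ} {f g h : ℝ → ℝ} (hf : BddOn s f) (hg : BddOn s g)
    (hh : ∀ x ∈ s, h x = f x + g x) : BddOn s h :=
  bddOn_of_le (abs_add_le_supOn hf hg hh)

theorem bddOn_smul {s : Set ℝ} {f h : ℝ → ℝ} (r : ℝ) (hf : BddOn s f)
    (hh : ∀ x ∈ s, h x = r * f x) : BddOn s h := by
  refine bddOn_of_le (C := |r| * supOn s f) fun x hx => ?_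
  rw [hh x hx, abs_mul]
  exact mul_le_mul_of_nonneg_left (le_supOn hf hx) (abs_nonneg r)

theorem supOn_smul {s : Set ℝ} {f h : ℝ → ℝ} (r : ℝ) (hh : ∀ x ∈ s, h x = r * f x) :
    supOn s h = |r| * supOn s f := by
  unfold supOn
  rw [Real.mul_iSup_of_nonneg (abs_nonneg r)]
  congr 1
  funext x
  rw [hh x x.2, abs_mul]

theorem eq_zero_of_supOn {s : Set ℝ} {g : ℝ → ℝ} (hg : BddOn s g) (h : supOn s g = 0) {x : ℝ}
    (hx : x ∈ s) : g x = 0 :=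
  abs_eq_zero.mp (le_antisymm (h ▸ le_supOn hg hx) (abs_nonneg _))

theorem supOn_zero {s : Set ℝ} {g : ℝ → ℝ} (h : ∀ x ∈ s, g x = 0) : supOn s g = 0 :=
  le_antisymm (supOn_le le_rfl fun x hx => by simp [h x hx]) (supOn_nonneg _ _)

/-- `(1-x²)^e f^{(k)}(x)`. -/
def wt (e : ℝ) (k : ℕ) (f : ℝ → ℝ) (x : ℝ) : ℝ := (1 - x ^ 2) ^ e * iteratedDeriv k f x

theorem wt_add {e : ℝ} {k : ℕ} {f g : ℝ → ℝ} {s : Set ℝ} (hs : IsOpen s)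
    (hf : ContDiffOn ℝ k f s) (hg : ContDiffOn ℝ k g s) :
    ∀ x ∈ s, wt e k (f + g) x = wt e k f x + wt e k g x := by
  intro x hx
  unfold wt
  rw [iteratedDeriv_add (hf.contDiffAt (hs.mem_nhds hx)) (hg.contDiffAt (hs.mem_nhds hx)), mul_add]

theorem wt_smul (e : ℝ) (k : ℕ) (r : ℝ) (f : ℝ → ℝ) (x : ℝ) :
    wt e k (r • f) x = r * wt e k f x := by
  unfold wt
  rw [iteratedDeriv_const_smul_field, smul_eq_mul]
  ring

theorem wt_zero (e : ℝ) (k : ℕ) (x : ℝ) : wt e k 0 x = 0 := by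
  simpa using wt_smul e k 0 0 x

theorem wt_eq_zero {e : ℝ} {f : ℝ → ℝ} {x : ℝ} (hx : x ∈ Ioo (-1 : ℝ) 1) (h : wt e 0 f x = 0) :
    f x = 0 := by
  have h1 : 0 < 1 - x ^ 2 := by nlinarith [hx.1, hx.2]
  simpa [wt, (Real.rpow_pos_of_pos h1 e).ne'] using h

/-- Membership in `M₁(ε)`. A function on `[-1,1]` vanishing at `±1` is represented by its extension
by `0` to `ℝ`. -/
structure MemM1 (ε : ℝ) (f : ℝ → ℝ) : Prop where
  contDiffOn_half : ContDiffOn ℝ 3 f (Ioo (-(1 / 2)) (1 / 2))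
  contDiffOn : ContDiffOn ℝ 1 f (Ioo (-1) 1)
  continuousOn : ContinuousOn f (Icc (-1) 1)
  eq_zero : ∀ x ∉ Ioo (-1 : ℝ) 1, f x = 0
  bdd0 : BddOn (Ioo (-1) 1) (wt (-1 + 2 * ε) 0 f)
  bdd1 : BddOn (Ioo (-1) 1) (wt (2 * ε) 1 f)
  bdd2 : BddOn (Ioo (-(1 / 2)) (1 / 2)) (iteratedDeriv 2 f)
  bdd3 : BddOn (Ioo (-(1 / 2)) (1 / 2)) (iteratedDeriv 3 f)

/-- Membership in `M₂(ε)`. A function on `(-1,1)` is represented by its extension by `0` to `ℝ`. -/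
structure MemM2 (ε : ℝ) (f : ℝ → ℝ) : Prop where
  contDiffOn : ContDiffOn ℝ 2 f (Ioo (-1) 1)
  eq_zero : ∀ x ∉ Ioo (-1 : ℝ) 1, f x = 0
  bdd0 : BddOn (Ioo (-1) 1) (wt ε 0 f)
  bdd1 : BddOn (Ioo (-1) 1) (wt (1 + ε) 1 f)
  bdd2 : BddOn (Ioo (-1) 1) (wt (2 + ε) 2 f)

theorem iteratedDeriv_add_on {k : ℕ} {f g : ℝ → ℝ} {s : Set ℝ} (hs : IsOpen s)
    (hf : ContDiffOn ℝ k f s) (hg : ContDiffOn ℝ k g s) :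
    ∀ x ∈ s, iteratedDeriv k (f + g) x = iteratedDeriv k f x + iteratedDeriv k g x := fun _ hx =>
  iteratedDeriv_add (hf.contDiffAt (hs.mem_nhds hx)) (hg.contDiffAt (hs.mem_nhds hx))

theorem iteratedDeriv_smul_on (k : ℕ) (r : ℝ) (f : ℝ → ℝ) (x : ℝ) :
    iteratedDeriv k (r • f) x = r * iteratedDeriv k f x := by
  rw [iteratedDeriv_const_smul_field, smul_eq_mul]

theorem bddOn_zero {s : Set ℝ} {g : ℝ → ℝ} (h : ∀ x ∈ s, g x = 0) : BddOn s g :=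
  bddOn_of_le (C := 0) fun x hx => by simp [h x hx]

theorem iteratedDeriv_zero_fun (k : ℕ) (x : ℝ) : iteratedDeriv k (0 : ℝ → ℝ) x = 0 := by
  simp

def M1Submodule (ε : ℝ) : Submodule ℝ (ℝ → ℝ) where
  carrier := {f | MemM1 ε f}
  zero_mem' :=
    { contDiffOn_half := contDiffOn_const
      contDiffOn := contDiffOn_const
      continuousOn := continuousOn_const
      eq_zero := fun _ _ => rfl
      bdd0 := bddOn_zero fun x _ => wt_zero _ _ x
      bdd1 := bddOn_zero fun x _ => wt_zero _ _ x
      bdd2 := bddOn_zero fun x _ => iteratedDeriv_zero_fun _ x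
      bdd3 := bddOn_zero fun x _ => iteratedDeriv_zero_fun _ x }
  add_mem' := fun {f g} hf hg =>
    { contDiffOn_half := hf.contDiffOn_half.add hg.contDiffOn_half
      contDiffOn := hf.contDiffOn.add hg.contDiffOn
      continuousOn := hf.continuousOn.add hg.continuousOn
      eq_zero := fun x hx => by simp [hf.eq_zero x hx, hg.eq_zero x hx]
      bdd0 := bddOn_add hf.bdd0 hg.bdd0 (wt_add isOpen_Ioo
        (hf.contDiffOn.of_le (by norm_num)) (hg.contDiffOn.of_le (by norm_num)))
      bdd1 := bddOn_add hf.bdd1 hg.bdd1 (wt_add isOpen_Ioo hf.contDiffOn hg.contDiffOn)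
      bdd2 := bddOn_add hf.bdd2 hg.bdd2 (iteratedDeriv_add_on isOpen_Ioo
        (hf.contDiffOn_half.of_le (by norm_num)) (hg.contDiffOn_half.of_le (by norm_num)))
      bdd3 := bddOn_add hf.bdd3 hg.bdd3 (iteratedDeriv_add_on isOpen_Ioo
        hf.contDiffOn_half hg.contDiffOn_half) }
  smul_mem' := fun r f hf =>
    { contDiffOn_half := contDiffOn_const.smul hf.contDiffOn_half
      contDiffOn := contDiffOn_const.smul hf.contDiffOn
      continuousOn := continuousOn_const.smul hf.continuousOn
      eq_zero := fun x hx => by simp [hf.eq_zero x hx]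
      bdd0 := bddOn_smul r hf.bdd0 fun x _ => wt_smul _ _ r f x
      bdd1 := bddOn_smul r hf.bdd1 fun x _ => wt_smul _ _ r f x
      bdd2 := bddOn_smul r hf.bdd2 fun x _ => iteratedDeriv_smul_on _ r f x
      bdd3 := bddOn_smul r hf.bdd3 fun x _ => iteratedDeriv_smul_on _ r f x }

def M2Submodule (ε : ℝ) : Submodule ℝ (ℝ → ℝ) where
  carrier := {f | MemM2 ε f}
  zero_mem' :=
    { contDiffOn := contDiffOn_const
      eq_zero := fun _ _ => rfl
      bdd0 := bddOn_zero fun x _ => wt_zero _ _ x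
      bdd1 := bddOn_zero fun x _ => wt_zero _ _ x
      bdd2 := bddOn_zero fun x _ => wt_zero _ _ x }
  add_mem' := fun {f g} hf hg =>
    { contDiffOn := hf.contDiffOn.add hg.contDiffOn
      eq_zero := fun x hx => by simp [hf.eq_zero x hx, hg.eq_zero x hx]
      bdd0 := bddOn_add hf.bdd0 hg.bdd0 (wt_add isOpen_Ioo
        (hf.contDiffOn.of_le (by norm_num)) (hg.contDiffOn.of_le (by norm_num)))
      bdd1 := bddOn_add hf.bdd1 hg.bdd1 (wt_add isOpen_Ioo
        (hf.contDiffOn.of_le (by norm_num)) (hg.contDiffOn.of_le (by norm_num)))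
      bdd2 := bddOn_add hf.bdd2 hg.bdd2 (wt_add isOpen_Ioo hf.contDiffOn hg.contDiffOn) }
  smul_mem' := fun r f hf =>
    { contDiffOn := contDiffOn_const.smul hf.contDiffOn
      eq_zero := fun x hx => by simp [hf.eq_zero x hx]
      bdd0 := bddOn_smul r hf.bdd0 fun x _ => wt_smul _ _ r f x
      bdd1 := bddOn_smul r hf.bdd1 fun x _ => wt_smul _ _ r f x
      bdd2 := bddOn_smul r hf.bdd2 fun x _ => wt_smul _ _ r f x }

/-- The space `M₁(ε)`; a type of its own, so that it carries the topology of its norm and not the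
topology of pointwise convergence. -/
def M1 (ε : ℝ) : Type := M1Submodule ε

/-- The space `M₂(ε)`. -/
def M2 (ε : ℝ) : Type := M2Submodule ε

instance (ε : ℝ) : AddCommGroup (M1 ε) := inferInstanceAs (AddCommGroup (M1Submodule ε))

instance (ε : ℝ) : Module ℝ (M1 ε) := inferInstanceAs (Module ℝ (M1Submodule ε))

instance (ε : ℝ) : AddCommGroup (M2 ε) := inferInstanceAs (AddCommGroup (M2Submodule ε))

instance (ε : ℝ) : Module ℝ (M2 ε) := inferInstanceAs (Module ℝ (M2Submodule ε))

/-- The function underlying an element of `M₁(ε)`. -/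
def M1.toFun {ε : ℝ} (f : M1 ε) : ℝ → ℝ := f.1

/-- The function underlying an element of `M₂(ε)`. -/
def M2.toFun {ε : ℝ} (f : M2 ε) : ℝ → ℝ := f.1

theorem M1.mem {ε : ℝ} (f : M1 ε) : MemM1 ε f.toFun := f.2

theorem M2.mem {ε : ℝ} (f : M2 ε) : MemM2 ε f.toFun := f.2

theorem M1.toFun_add {ε : ℝ} (f g : M1 ε) : (f + g).toFun = f.toFun + g.toFun := rfl

theorem M2.toFun_add {ε : ℝ} (f g : M2 ε) : (f + g).toFun = f.toFun + g.toFun := rfl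

theorem M1.toFun_smul {ε : ℝ} (r : ℝ) (f : M1 ε) : (r • f).toFun = r • f.toFun := rfl

theorem M2.toFun_smul {ε : ℝ} (r : ℝ) (f : M2 ε) : (r • f).toFun = r • f.toFun := rfl

theorem M1.toFun_zero {ε : ℝ} : (0 : M1 ε).toFun = 0 := rfl

theorem M2.toFun_zero {ε : ℝ} : (0 : M2 ε).toFun = 0 := rfl

theorem M1.ext {ε : ℝ} {f g : M1 ε} (h : f.toFun = g.toFun) : f = g := Subtype.ext h

theorem M2.ext {ε : ℝ} {f g : M2 ε} (h : f.toFun = g.toFun) : f = g := Subtype.ext h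

instance (ε : ℝ) : Norm (M1 ε) where
  norm f := supOn (Ioo (-1) 1) (wt (-1 + 2 * ε) 0 f.toFun) +
    supOn (Ioo (-1) 1) (wt (2 * ε) 1 f.toFun) +
    supOn (Ioo (-(1 / 2)) (1 / 2)) (iteratedDeriv 2 f.toFun) +
    supOn (Ioo (-(1 / 2)) (1 / 2)) (iteratedDeriv 3 f.toFun)

instance (ε : ℝ) : Norm (M2 ε) where
  norm f := supOn (Ioo (-1) 1) (wt ε 0 f.toFun) +
    supOn (Ioo (-1) 1) (wt (1 + ε) 1 f.toFun) +
    supOn (Ioo (-1) 1) (wt (2 + ε) 2 f.toFun)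

theorem M1.norm_def {ε : ℝ} (f : M1 ε) :
    ‖f‖ = supOn (Ioo (-1) 1) (wt (-1 + 2 * ε) 0 f.toFun) +
      supOn (Ioo (-1) 1) (wt (2 * ε) 1 f.toFun) +
      supOn (Ioo (-(1 / 2)) (1 / 2)) (iteratedDeriv 2 f.toFun) +
      supOn (Ioo (-(1 / 2)) (1 / 2)) (iteratedDeriv 3 f.toFun) := rfl

theorem M2.norm_def {ε : ℝ} (f : M2 ε) :
    ‖f‖ = supOn (Ioo (-1) 1) (wt ε 0 f.toFun) +
      supOn (Ioo (-1) 1) (wt (1 + ε) 1 f.toFun) +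
      supOn (Ioo (-1) 1) (wt (2 + ε) 2 f.toFun) := rfl

theorem M1.core (ε : ℝ) : NormedSpace.Core ℝ (M1 ε) where
  norm_nonneg f := by
    rw [M1.norm_def]
    have h := supOn_nonneg
    exact add_nonneg (add_nonneg (add_nonneg (h _ _) (h _ _)) (h _ _)) (h _ _)
  norm_smul r f := by
    simp only [M1.norm_def, M1.toFun_smul, Real.norm_eq_abs]
    rw [supOn_smul r fun x _ => wt_smul _ 0 r f.toFun x,
      supOn_smul r fun x _ => wt_smul _ 1 r f.toFun x,
      supOn_smul r fun x _ => iteratedDeriv_smul_on 2 r f.toFun x,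
      supOn_smul r fun x _ => iteratedDeriv_smul_on 3 r f.toFun x]
    ring
  norm_triangle f g := by
    simp only [M1.norm_def, M1.toFun_add]
    have hf := f.mem
    have hg := g.mem
    have h0 := supOn_add_le hf.bdd0 hg.bdd0 (wt_add isOpen_Ioo
        (hf.contDiffOn.of_le (by norm_num)) (hg.contDiffOn.of_le (by norm_num)))
    have h1 := supOn_add_le hf.bdd1 hg.bdd1 (wt_add isOpen_Ioo hf.contDiffOn hg.contDiffOn)
    have h2 := supOn_add_le hf.bdd2 hg.bdd2 (iteratedDeriv_add_on isOpen_Ioo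
        (hf.contDiffOn_half.of_le (by norm_num)) (hg.contDiffOn_half.of_le (by norm_num)))
    have h3 := supOn_add_le hf.bdd3 hg.bdd3 (iteratedDeriv_add_on isOpen_Ioo
        hf.contDiffOn_half hg.contDiffOn_half)
    linarith
  norm_eq_zero_iff f := by
    constructor
    · intro h
      rw [M1.norm_def] at h
      have n0 := supOn_nonneg (Ioo (-1) 1) (wt (-1 + 2 * ε) 0 f.toFun)
      have n1 := supOn_nonneg (Ioo (-1) 1) (wt (2 * ε) 1 f.toFun)
      have n2 := supOn_nonneg (Ioo (-(1 / 2)) (1 / 2)) (iteratedDeriv 2 f.toFun)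
      have n3 := supOn_nonneg (Ioo (-(1 / 2)) (1 / 2)) (iteratedDeriv 3 f.toFun)
      refine M1.ext (funext fun x => ?_)
      by_cases hx : x ∈ Ioo (-1 : ℝ) 1
      · exact wt_eq_zero hx (eq_zero_of_supOn f.mem.bdd0 (by linarith) hx)
      · exact f.mem.eq_zero x hx
    · rintro rfl
      rw [M1.norm_def, M1.toFun_zero, supOn_zero fun x _ => wt_zero _ _ x,
        supOn_zero fun x _ => wt_zero _ _ x, supOn_zero fun x _ => iteratedDeriv_zero_fun _ x,
        supOn_zero fun x _ => iteratedDeriv_zero_fun _ x]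
      norm_num

theorem M2.core (ε : ℝ) : NormedSpace.Core ℝ (M2 ε) where
  norm_nonneg f := by
    rw [M2.norm_def]
    have h := supOn_nonneg
    exact add_nonneg (add_nonneg (h _ _) (h _ _)) (h _ _)
  norm_smul r f := by
    simp only [M2.norm_def, M2.toFun_smul, Real.norm_eq_abs]
    rw [supOn_smul r fun x _ => wt_smul _ 0 r f.toFun x,
      supOn_smul r fun x _ => wt_smul _ 1 r f.toFun x,
      supOn_smul r fun x _ => wt_smul _ 2 r f.toFun x]
    ring
  norm_triangle f g := by
    simp only [M2.norm_def, M2.toFun_add]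
    have hf := f.mem
    have hg := g.mem
    have h0 := supOn_add_le hf.bdd0 hg.bdd0 (wt_add isOpen_Ioo
        (hf.contDiffOn.of_le (by norm_num)) (hg.contDiffOn.of_le (by norm_num)))
    have h1 := supOn_add_le hf.bdd1 hg.bdd1 (wt_add isOpen_Ioo
        (hf.contDiffOn.of_le (by norm_num)) (hg.contDiffOn.of_le (by norm_num)))
    have h2 := supOn_add_le hf.bdd2 hg.bdd2 (wt_add isOpen_Ioo hf.contDiffOn hg.contDiffOn)
    linarith
  norm_eq_zero_iff f := by
    constructor
    · intro h
      rw [M2.norm_def] at h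
      have n0 := supOn_nonneg (Ioo (-1) 1) (wt ε 0 f.toFun)
      have n1 := supOn_nonneg (Ioo (-1) 1) (wt (1 + ε) 1 f.toFun)
      have n2 := supOn_nonneg (Ioo (-1) 1) (wt (2 + ε) 2 f.toFun)
      refine M2.ext (funext fun x => ?_)
      by_cases hx : x ∈ Ioo (-1 : ℝ) 1
      · exact wt_eq_zero hx (eq_zero_of_supOn f.mem.bdd0 (by linarith) hx)
      · exact f.mem.eq_zero x hx
    · rintro rfl
      rw [M2.norm_def, M2.toFun_zero, supOn_zero fun x _ => wt_zero _ _ x,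
        supOn_zero fun x _ => wt_zero _ _ x, supOn_zero fun x _ => wt_zero _ _ x]
      norm_num

instance (ε : ℝ) : NormedAddCommGroup (M1 ε) := NormedAddCommGroup.ofCore (M1.core ε)

instance (ε : ℝ) : NormedSpace ℝ (M1 ε) := NormedSpace.ofCore (M1.core ε)

instance (ε : ℝ) : NormedAddCommGroup (M2 ε) := NormedAddCommGroup.ofCore (M2.core ε)

instance (ε : ℝ) : NormedSpace ℝ (M2 ε) := NormedSpace.ofCore (M2.core ε)

/-- `X = M₁(ε) × M₂(ε)` with the norm `‖Uθ‖ + ‖Uφ‖`. -/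
abbrev X (ε : ℝ) : Type := WithLp 1 (M1 ε × M2 ε)

/-- The `θ`-component of an element of `X`. -/
def X.θ {ε : ℝ} (U : X ε) : ℝ → ℝ := U.fst.toFun

/-- The `φ`-component of an element of `X`. -/
def X.φ {ε : ℝ} (U : X ε) : ℝ → ℝ := U.snd.toFun

theorem X.norm_eq {ε : ℝ} (U : X ε) : ‖U‖ = ‖U.fst‖ + ‖U.snd‖ := WithLp.prod_norm_eq_of_L1 U

theorem deriv_add_at_zero {ε : ℝ} (f g : M2 ε) :
    deriv (f + g).toFun 0 = deriv f.toFun 0 + deriv g.toFun 0 := by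
  have h : Ioo (-1 : ℝ) 1 ∈ 𝓝 (0 : ℝ) := isOpen_Ioo.mem_nhds (by norm_num)
  rw [M2.toFun_add]
  exact deriv_add ((f.mem.contDiffOn.contDiffAt h).differentiableAt (by norm_num))
    ((g.mem.contDiffOn.contDiffAt h).differentiableAt (by norm_num))

/-- The closed subspace `X₂ = ker l₁ ∩ ker l₃ ∩ ker l₄` of `X`, where `l₁(V) = Vθ(0)`,
`l₃(V) = Vφ'(0)`, `l₄(V) = Vφ(0)`. It is the complement of `span {V^{2a}, V³, V⁴}`
(respectively of `span {V^{2b}, V³, V⁴}`) in `X`. -/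
def X2 (ε : ℝ) : Submodule ℝ (X ε) where
  carrier := {V | V.θ 0 = 0 ∧ deriv V.φ 0 = 0 ∧ V.φ 0 = 0}
  zero_mem' := by
    refine ⟨rfl, ?_, rfl⟩
    change deriv (fun _ : ℝ => (0 : ℝ)) 0 = 0
    simp
  add_mem' := by
    rintro V W ⟨h1, h3, h4⟩ ⟨k1, k3, k4⟩
    refine ⟨?_, ?_, ?_⟩
    · change V.θ 0 + W.θ 0 = 0
      rw [h1, k1, add_zero]
    · have h := deriv_add_at_zero V.snd W.snd
      change deriv (V.snd + W.snd).toFun 0 = 0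
      rw [h]
      change deriv V.φ 0 + deriv W.φ 0 = 0
      rw [h3, k3, add_zero]
    · change V.φ 0 + W.φ 0 = 0
      rw [h4, k4, add_zero]
  smul_mem' := by
    rintro r V ⟨h1, h3, h4⟩
    refine ⟨?_, ?_, ?_⟩
    · change r * V.θ 0 = 0
      rw [h1, mul_zero]
    · change deriv (r • V.φ) 0 = 0
      have h := iteratedDeriv_smul_on 1 r V.φ 0
      rw [iteratedDeriv_one, iteratedDeriv_one] at h
      rw [h, h3, mul_zero]
    · change r * V.φ 0 = 0
      rw [h4, mul_zero]

end

end HomNS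

/-! Write `U = U^{c,γ} + Ũ` and pass to the weighted unknowns `z = (1-x²)^{-1+2ε} Ũθ`, `η =
(1-x²)^{1+ε} Ũφ'` and `ζ = (1-x²)^ε Ũφ`, which are bounded exactly when the corresponding parts of
the norm of `X` are finite. Both equations then have the form `(1-x²) f' + ℓ f = y` with `f`, `y`
bounded, and the limits of `ℓ` at `±1` decide everything. If both limits have the same sign, there
is exactly one bounded solution, an integral from `-1` or from `1` (`exists_solver_left`,
`exists_solver_right`). If `ℓ` is negative at `-1` and positive at `1`, all solutions are bounded
and the value at `0` is free (`exists_initSolver`).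

For `z` the limits are `Uθ(-1) - 4ε` and `Uθ(1) + 4ε`. For `η` they are `Uθ(-1) - 2(1+ε)` and `Uθ(1)
+ 2(1+ε)`. At an extremal profile with admissible `ε`, the equation for `z` is of the first kind and
that for `η` of the second. Finiteness of the norm of `X` forces the first two constants, because
`Ũθ` vanishes at `±1` while `(1-x)` and `(1+x)` do not vanish at both ends. The increment `d` of the
third constant stays free and multiplies `(1-x²)`; the response to it is `V^{2a}` or `V^{2b}`. Hence
the linearized kernel is spanned by `V^2`, `V^3`, `V^4`, and the data `b = (Ũθ(0), Ũφ'(0), Ũφ(0))`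
are coordinates on it.

Solving for the linear part turns the system into `w = Φ((q,b),w)` for `w = (z,η)`, where `q` is the
change of the profile in the sup norm. `Φ` is analytic, and its derivative in `w` vanishes at the
origin, so the implicit function theorem gives an analytic, locally unique family
(`LocalOps.exists_fixedPoint`). Fixed points are solutions (`LocalOps.solvesNSE`), and conversely
(`LocalOps.unknowns_fixed`). Smoothness with values in `X` is tested after embedding `X` into a
product of spaces of bounded continuous functions, where the image is an explicit expression in `w`.

The profiles have to depend smoothly on `c`. A Riccati equation that linearizes to a hypergeometric
one yields a solution with the larger boundary value at each end (`exists_isTop`). A solution close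
to `2` or above it at `-1` realizes `γ⁺` (`IsNoSwirl.le_of_ge`), and a second fixed point argument
perturbs it (`IsTop.isLocalProfile`). Reflection `x ↦ -x` gives the profiles for `γ⁻`.

Local uniqueness glues the families over the compact set `K`. Rescaling `b₀ = V₂(0) β₂` and
subtracting the linear part gives the map `V`. -/

namespace HomNS

noncomputable section

/-! ### Bounded continuous functions on a set of reals -/

/-- The Banach algebra of bounded continuous functions on `s`. -/
abbrev Cb (s : Set ℝ) : Type := BoundedContinuousFunction s ℝ

open Classical in
/-- The extension by `0` of a bounded continuous function on `s`. -/
def ev {s : Set ℝ} (z : Cb s) (x : ℝ) : ℝ := if h : x ∈ s then z ⟨x, h⟩ else 0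

theorem ev_of_mem {s : Set ℝ} (z : Cb s) {x : ℝ} (h : x ∈ s) : ev z x = z ⟨x, h⟩ := dif_pos h

theorem ev_of_notMem {s : Set ℝ} (z : Cb s) {x : ℝ} (h : x ∉ s) : ev z x = 0 := dif_neg h

@[simp] theorem ev_add {s : Set ℝ} (z w : Cb s) (x : ℝ) : ev (z + w) x = ev z x + ev w x := by
  unfold ev; split_ifs <;> simp

@[simp] theorem ev_mul {s : Set ℝ} (z w : Cb s) (x : ℝ) : ev (z * w) x = ev z x * ev w x := by
  unfold ev; split_ifs <;> simp

@[simp] theorem ev_neg {s : Set ℝ} (z : Cb s) (x : ℝ) : ev (-z) x = -ev z x := by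
  unfold ev; split_ifs <;> simp

@[simp] theorem ev_sub {s : Set ℝ} (z w : Cb s) (x : ℝ) : ev (z - w) x = ev z x - ev w x := by
  unfold ev; split_ifs <;> simp

@[simp] theorem ev_smul {s : Set ℝ} (r : ℝ) (z : Cb s) (x : ℝ) : ev (r • z) x = r * ev z x := by
  unfold ev; split_ifs <;> simp

@[simp] theorem ev_zero {s : Set ℝ} (x : ℝ) : ev (0 : Cb s) x = 0 := by
  unfold ev; split_ifs <;> simp

theorem abs_ev_le {s : Set ℝ} (z : Cb s) (x : ℝ) : |ev z x| ≤ ‖z‖ := by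
  unfold ev
  split_ifs with h
  · exact z.norm_coe_le_norm ⟨x, h⟩
  · simp

theorem continuousOn_ev {s : Set ℝ} (z : Cb s) : ContinuousOn (ev z) s := by
  rw [continuousOn_iff_continuous_domRestrict]
  convert z.continuous using 1
  funext x
  exact ev_of_mem z x.2

theorem ev_ext {s : Set ℝ} {z w : Cb s} (h : ∀ x ∈ s, ev z x = ev w x) : z = w := by
  ext x
  have := h x x.2
  rwa [ev_of_mem z x.2, ev_of_mem w x.2] at this

theorem norm_le_of_ev {s : Set ℝ} {z : Cb s} {C : ℝ} (hC : 0 ≤ C) (h : ∀ x ∈ s, |ev z x| ≤ C) :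
    ‖z‖ ≤ C := by
  rw [BoundedContinuousFunction.norm_le hC]
  intro x
  have := h x x.2
  rwa [ev_of_mem z x.2] at this

open Classical in
/-- A bounded continuous function on `s`, as an element of `Cb s` (`0` for other functions). -/
def toCb (s : Set ℝ) (f : ℝ → ℝ) : Cb s :=
  if h : ContinuousOn f s ∧ ∃ C, ∀ x ∈ s, |f x| ≤ C then
    BoundedContinuousFunction.ofNormedAddCommGroup (s.domRestrict f) h.1.domRestrict h.2.choose
      fun x => h.2.choose_spec x x.2
  else 0

theorem ev_toCb {s : Set ℝ} {f : ℝ → ℝ} (hf : ContinuousOn f s) {C : ℝ} (hC : ∀ x ∈ s, |f x| ≤ C)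
    {x : ℝ} (hx : x ∈ s) : ev (toCb s f) x = f x := by
  rw [ev_of_mem _ hx, toCb, dif_pos ⟨hf, C, hC⟩]
  rfl

/-- The value at a point of `s` of a bounded continuous function, as a continuous linear form. -/
def evL {s : Set ℝ} (x : ℝ) : Cb s →L[ℝ] ℝ :=
  LinearMap.mkContinuous
    { toFun := fun z => ev z x
      map_add' := fun z w => ev_add z w x
      map_smul' := fun r z => ev_smul r z x } 1 fun z => by
    simpa using abs_ev_le z x

@[simp] theorem evL_apply {s : Set ℝ} (x : ℝ) (z : Cb s) : evL x z = ev z x := rfl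

/-- Restriction of bounded continuous functions to a smaller set. -/
def resCb {s t : Set ℝ} (h : t ⊆ s) : Cb s →L[ℝ] Cb t :=
  LinearMap.mkContinuous
    { toFun := fun z => z.compContinuous ⟨inclusion h, continuous_inclusion h⟩
      map_add' := fun z w => rfl
      map_smul' := fun r z => rfl } 1 fun z => by
    rw [one_mul]
    exact (BoundedContinuousFunction.norm_le (norm_nonneg z)).2 fun x => z.norm_coe_le_norm _

theorem ev_resCb {s t : Set ℝ} (h : t ⊆ s) (z : Cb s) {x : ℝ} (hx : x ∈ t) :
    ev (resCb h z) x = ev z x := by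
  rw [ev_of_mem _ hx, ev_of_mem _ (h hx)]
  rfl

/-- Reflection `z(x) ↦ z(-x)` of bounded continuous functions on `(-1,1)`. -/
def reflCb : Cb (Ioo (-1) 1) →L[ℝ] Cb (Ioo (-1) 1) :=
  LinearMap.mkContinuous
    { toFun := fun z => z.compContinuous
        ⟨fun x => ⟨-x, by constructor <;> linarith [x.2.1, x.2.2]⟩, by fun_prop⟩
      map_add' := fun z w => rfl
      map_smul' := fun r z => rfl } 1 fun z => by
    rw [one_mul]
    exact (BoundedContinuousFunction.norm_le (norm_nonneg z)).2 fun x => z.norm_coe_le_norm _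

theorem neg_mem_Ioo {x : ℝ} (hx : x ∈ Ioo (-1 : ℝ) 1) : -x ∈ Ioo (-1 : ℝ) 1 := by
  constructor <;> linarith [hx.1, hx.2]

theorem ev_reflCb (z : Cb (Ioo (-1) 1)) (x : ℝ) : ev (reflCb z) x = ev z (-x) := by
  by_cases hx : x ∈ Ioo (-1 : ℝ) 1
  · rw [ev_of_mem _ hx, ev_of_mem _ (neg_mem_Ioo hx)]
    rfl
  · rw [ev_of_notMem _ hx, ev_of_notMem]
    intro h
    have := neg_mem_Ioo h
    rw [neg_neg] at this
    exact hx this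

theorem one_sub_sq_pos {x : ℝ} (hx : x ∈ Ioo (-1 : ℝ) 1) : 0 < 1 - x ^ 2 := by
  nlinarith [hx.1, hx.2]

/-! ### The operator `(1-x²) d/dx + ℓ` on bounded continuous functions -/

/-- `exp ∫₀ˣ ℓ(s)/(1-s²) ds`, an integrating factor of `(1-x²) d/dx + ℓ`. -/
def gexp (ℓ : ℝ → ℝ) (x : ℝ) : ℝ := Real.exp (∫ s in (0 : ℝ)..x, ℓ s / (1 - s ^ 2))

theorem gexp_pos (ℓ : ℝ → ℝ) (x : ℝ) : 0 < gexp ℓ x := Real.exp_pos _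

@[simp] theorem gexp_zero (ℓ : ℝ → ℝ) : gexp ℓ 0 = 1 := by simp [gexp]

theorem uIcc_subset_Ioo {a b : ℝ} (ha : a ∈ Ioo (-1 : ℝ) 1) (hb : b ∈ Ioo (-1 : ℝ) 1) :
    uIcc a b ⊆ Ioo (-1) 1 := (ordConnected_Ioo).uIcc_subset ha hb

theorem zero_mem_Ioo : (0 : ℝ) ∈ Ioo (-1 : ℝ) 1 := by norm_num

theorem continuousOn_div_one_sub_sq {f : ℝ → ℝ} (hf : ContinuousOn f (Ioo (-1) 1)) :
    ContinuousOn (fun s => f s / (1 - s ^ 2)) (Ioo (-1) 1) :=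
  hf.div (by fun_prop) fun _ hx => (one_sub_sq_pos hx).ne'

theorem hasDerivAt_integral_Ioo {f : ℝ → ℝ} (hf : ContinuousOn f (Ioo (-1) 1)) {x : ℝ}
    (hx : x ∈ Ioo (-1 : ℝ) 1) : HasDerivAt (fun y => ∫ s in (0 : ℝ)..y, f s) (f x) x := by
  have hn : Ioo (-1 : ℝ) 1 ∈ 𝓝 x := isOpen_Ioo.mem_nhds hx
  exact intervalIntegral.integral_hasDerivAt_right
    ((hf.mono (uIcc_subset_Ioo zero_mem_Ioo hx)).intervalIntegrable)
    (hf.stronglyMeasurableAtFilter isOpen_Ioo x hx) (hf.continuousAt hn)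

theorem hasDerivAt_gexp {ℓ : ℝ → ℝ} (hℓ : ContinuousOn ℓ (Ioo (-1) 1)) {x : ℝ}
    (hx : x ∈ Ioo (-1 : ℝ) 1) : HasDerivAt (gexp ℓ) (gexp ℓ x * (ℓ x / (1 - x ^ 2))) x :=
  (hasDerivAt_integral_Ioo (continuousOn_div_one_sub_sq hℓ) hx).exp

theorem continuousOn_gexp {ℓ : ℝ → ℝ} (hℓ : ContinuousOn ℓ (Ioo (-1) 1)) :
    ContinuousOn (gexp ℓ) (Ioo (-1) 1) := fun _ hx =>
  (hasDerivAt_gexp hℓ hx).continuousAt.continuousWithinAt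

/-- A linear homogeneous equation is solved by its integrating factor. -/
theorem eq_div_gexp {ℓ f : ℝ → ℝ} (hℓ : ContinuousOn ℓ (Ioo (-1) 1))
    (hf : ∀ x ∈ Ioo (-1 : ℝ) 1, HasDerivAt f (-(ℓ x * f x) / (1 - x ^ 2)) x) {x : ℝ}
    (hx : x ∈ Ioo (-1 : ℝ) 1) : f x = f 0 / gexp ℓ x := by
  have hd : ∀ y ∈ Ioo (-1 : ℝ) 1, HasDerivAt (fun y => f y * gexp ℓ y) 0 y := by
    intro y hy
    refine ((hf y hy).fun_mul (hasDerivAt_gexp hℓ hy)).congr_deriv ?_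
    ring
  have := isOpen_Ioo.is_const_of_deriv_eq_zero (isPreconnected_Ioo (a := (-1 : ℝ)) (b := 1))
    (fun y hy => (hd y hy).differentiableAt.differentiableWithinAt)
    (fun y hy => (hd y hy).deriv) hx zero_mem_Ioo
  simp only [gexp_zero, mul_one] at this
  rw [eq_div_iff (gexp_pos ℓ x).ne', this]

/-- `ℓ` is positive near both ends of `(-1,1)`, in quantitative form. -/
def PosEnds (ℓ : ℝ → ℝ) : Prop :=
  ∃ m > 0, ∃ N ≥ 0, ∀ x ∈ Ioo (-1 : ℝ) 1, m ≤ ℓ x + N * (1 - x ^ 2)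

/-- `ℓ` is negative near `-1` and positive near `1`, in quantitative form. -/
def OutEnds (ℓ : ℝ → ℝ) : Prop :=
  ∃ m > 0, ∃ N ≥ 0, (∀ x ∈ Ico (0 : ℝ) 1, m ≤ ℓ x + N * (1 - x ^ 2)) ∧
    ∀ x ∈ Ioc (-1 : ℝ) 0, m ≤ -ℓ x + N * (1 - x ^ 2)

/-- `T` solves `(1-x²) f' + ℓ f = y`, and it gives the only bounded solution. -/
structure IsSolver (ℓ : ℝ → ℝ) (T : Cb (Ioo (-1) 1) →L[ℝ] Cb (Ioo (-1) 1)) : Prop where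
  hasDerivAt : ∀ y, ∀ x ∈ Ioo (-1 : ℝ) 1,
    HasDerivAt (ev (T y)) ((ev y x - ℓ x * ev (T y) x) / (1 - x ^ 2)) x
  eq_zero : ∀ f : ℝ → ℝ, (∃ C, ∀ x ∈ Ioo (-1 : ℝ) 1, |f x| ≤ C) →
    (∀ x ∈ Ioo (-1 : ℝ) 1, HasDerivAt f (-(ℓ x * f x) / (1 - x ^ 2)) x) →
    ∀ x ∈ Ioo (-1 : ℝ) 1, f x = 0

theorem IsSolver.eq {ℓ : ℝ → ℝ} {T : Cb (Ioo (-1) 1) →L[ℝ] Cb (Ioo (-1) 1)} (h : IsSolver ℓ T)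
    {f y : Cb (Ioo (-1) 1)}
    (hf : ∀ x ∈ Ioo (-1 : ℝ) 1, HasDerivAt (ev f) ((ev y x - ℓ x * ev f x) / (1 - x ^ 2)) x) :
    f = T y := by
  refine ev_ext fun x hx => ?_
  have := h.eq_zero (fun x => ev f x - ev (T y) x) ⟨‖f - T y‖, fun x _ => by
    rw [← ev_sub]; exact abs_ev_le _ x⟩ (fun x hx => by
      refine ((hf x hx).fun_sub (h.hasDerivAt y x hx)).congr_deriv ?_
      ring) x hx
  linarith

/-- `T` solves `(1-x²) f' + ℓ f = y` with `f 0 = 0`. -/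
structure IsInitSolver (ℓ : ℝ → ℝ) (T : Cb (Ioo (-1) 1) →L[ℝ] Cb (Ioo (-1) 1)) : Prop where
  continuousOn : ContinuousOn ℓ (Ioo (-1) 1)
  hasDerivAt : ∀ y, ∀ x ∈ Ioo (-1 : ℝ) 1,
    HasDerivAt (ev (T y)) ((ev y x - ℓ x * ev (T y) x) / (1 - x ^ 2)) x
  apply_zero : ∀ y, ev (T y) 0 = 0

theorem IsInitSolver.eq {ℓ : ℝ → ℝ} {T : Cb (Ioo (-1) 1) →L[ℝ] Cb (Ioo (-1) 1)}
    (h : IsInitSolver ℓ T) {f : ℝ → ℝ} {y : Cb (Ioo (-1) 1)}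
    (hf : ∀ x ∈ Ioo (-1 : ℝ) 1, HasDerivAt f ((ev y x - ℓ x * f x) / (1 - x ^ 2)) x) {x : ℝ}
    (hx : x ∈ Ioo (-1 : ℝ) 1) : f x = f 0 / gexp ℓ x + ev (T y) x := by
  have := eq_div_gexp (f := fun x => f x - ev (T y) x) h.continuousOn (fun x hx => by
      refine ((hf x hx).fun_sub (h.hasDerivAt y x hx)).congr_deriv ?_
      ring) hx
  simp only [h.apply_zero, sub_zero] at this
  linarith

theorem hasDerivAt_gexp_mul_exp {ℓ : ℝ → ℝ} (hℓ : ContinuousOn ℓ (Ioo (-1) 1)) (N : ℝ) {x : ℝ}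
    (hx : x ∈ Ioo (-1 : ℝ) 1) :
    HasDerivAt (fun y => gexp ℓ y * Real.exp (N * y))
      (gexp ℓ x * Real.exp (N * x) * ((ℓ x + N * (1 - x ^ 2)) / (1 - x ^ 2))) x := by
  have h1 : HasDerivAt (fun y => Real.exp (N * y)) (Real.exp (N * x) * N) x := by
    simpa using ((hasDerivAt_id x).const_mul N).exp
  refine ((hasDerivAt_gexp hℓ hx).fun_mul h1).congr_deriv ?_
  have := (one_sub_sq_pos hx).ne'
  field_simp

/-- The integrating factor controls its own integral against `ds/(1-s²)`. -/
theorem integral_gexp_le {ℓ : ℝ → ℝ} (hℓ : ContinuousOn ℓ (Ioo (-1) 1)) {m N : ℝ} (hm : 0 < m)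
    (hN : 0 ≤ N) {a x : ℝ} (ha : -1 < a) (hax : a ≤ x) (hx : x < 1)
    (h : ∀ s ∈ Icc a x, m ≤ ℓ s + N * (1 - s ^ 2)) :
    ∫ s in a..x, gexp ℓ s / (1 - s ^ 2) ≤ Real.exp (2 * N) / m * gexp ℓ x := by
  have hsub : Icc a x ⊆ Ioo (-1 : ℝ) 1 := fun s hs => ⟨ha.trans_le hs.1, hs.2.trans_lt hx⟩
  have hsub' : uIcc a x ⊆ Ioo (-1 : ℝ) 1 := by rwa [uIcc_of_le hax]
  have hg := continuousOn_gexp hℓ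
  have hd : ∀ s ∈ uIcc a x, HasDerivAt (fun y => gexp ℓ y * Real.exp (N * y))
      (gexp ℓ s * Real.exp (N * s) * ((ℓ s + N * (1 - s ^ 2)) / (1 - s ^ 2))) s := fun s hs =>
    hasDerivAt_gexp_mul_exp hℓ N (hsub' hs)
  have hcont : ContinuousOn (fun s => gexp ℓ s * Real.exp (N * s) *
      ((ℓ s + N * (1 - s ^ 2)) / (1 - s ^ 2))) (Ioo (-1) 1) :=
    (hg.mul (by fun_prop)).mul (continuousOn_div_one_sub_sq (hℓ.add (by fun_prop)))
  have hii := (hcont.mono hsub').intervalIntegrable (μ := MeasureTheory.volume)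
  have hF := intervalIntegral.integral_eq_sub_of_hasDerivAt hd hii
  -- The integrand on the right is a multiple of the derivative of `gexp ℓ s * exp (N s)`. It
  -- dominates because `ℓ + N(1-s²) ≥ m` and `exp N * exp (N s) ≥ 1` for `s > -1`.
  have hmono : ∫ s in a..x, gexp ℓ s / (1 - s ^ 2) ≤
      ∫ s in a..x, Real.exp N / m * (gexp ℓ s * Real.exp (N * s) *
        ((ℓ s + N * (1 - s ^ 2)) / (1 - s ^ 2))) := by
    refine intervalIntegral.integral_mono_on hax
      (((continuousOn_div_one_sub_sq hg).mono hsub').intervalIntegrable) (hii.const_mul _) ?_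
    intro s hs
    have hs1 := one_sub_sq_pos (hsub hs)
    have hs2 : (1 : ℝ) ≤ Real.exp N * Real.exp (N * s) := by
      rw [← Real.exp_add]
      apply Real.one_le_exp
      nlinarith [(hsub hs).1]
    have hs3 : 1 ≤ (ℓ s + N * (1 - s ^ 2)) / m := by
      rw [le_div_iff₀ hm]; linarith [h s hs]
    calc gexp ℓ s / (1 - s ^ 2) = gexp ℓ s / (1 - s ^ 2) * (1 * 1) := by ring
      _ ≤ gexp ℓ s / (1 - s ^ 2) *
          (Real.exp N * Real.exp (N * s) * ((ℓ s + N * (1 - s ^ 2)) / m)) := by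
        refine mul_le_mul_of_nonneg_left ?_ (div_pos (gexp_pos ℓ s) hs1).le
        exact mul_le_mul hs2 hs3 zero_le_one (zero_le_one.trans hs2)
      _ = _ := by ring
  refine hmono.trans ?_
  rw [intervalIntegral.integral_const_mul, hF]
  have h1 : 0 < gexp ℓ a * Real.exp (N * a) := mul_pos (gexp_pos ℓ a) (Real.exp_pos _)
  have h2 : Real.exp (N * x) ≤ Real.exp N := Real.exp_le_exp.2 (by nlinarith)
  have h3 : 0 < Real.exp N / m := by positivity
  calc _ ≤ Real.exp N / m * (gexp ℓ x * Real.exp N) := by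
        refine mul_le_mul_of_nonneg_left ?_ h3.le
        have := mul_le_mul_of_nonneg_left h2 (gexp_pos ℓ x).le
        linarith
    _ = _ := by rw [two_mul, Real.exp_add]; ring

/-- The substitution `x ↦ -x` replaces `ℓ(x)` by `-ℓ(-x)`; estimates at one end thereby transfer to
the other. -/
theorem gexp_neg_refl (ℓ : ℝ → ℝ) (x : ℝ) : gexp (fun s => -ℓ (-s)) (-x) = gexp ℓ x := by
  unfold gexp
  congr 1
  have := intervalIntegral.integral_comp_neg (a := (0 : ℝ)) (b := -x)
    (fun s => ℓ s / (1 - s ^ 2))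
  simp only [neg_neg, neg_zero, neg_sq] at this
  simp only [neg_div, intervalIntegral.integral_neg]
  rw [this, intervalIntegral.integral_symm 0 x, neg_neg]

theorem continuousOn_neg_refl {ℓ : ℝ → ℝ} (hℓ : ContinuousOn ℓ (Ioo (-1) 1)) :
    ContinuousOn (fun s => -ℓ (-s)) (Ioo (-1) 1) :=
  (hℓ.comp continuousOn_neg fun _ hx => neg_mem_Ioo hx).neg

/-- The integrating factor tends to `0` at `-1` at a definite rate. -/
theorem gexp_le_rpow {ℓ : ℝ → ℝ} (hℓ : ContinuousOn ℓ (Ioo (-1) 1)) {m N : ℝ}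
    (hN : 0 ≤ N) {x : ℝ} (hx : -1 < x) (hx0 : x ≤ 0)
    (h : ∀ s ∈ Ioc (-1 : ℝ) 0, m ≤ ℓ s + N * (1 - s ^ 2)) :
    gexp ℓ x ≤ Real.exp N * Real.exp (m / 2 * (Real.log (1 + x) - Real.log (1 - x))) := by
  -- The last factor is `((1-y)/(1+y))^{m/2}`, with logarithmic derivative `-m/(1-y²)`. The lower
  -- bound on `ℓ` makes `F` nondecreasing up to its value `1` at `0`.
  let F := fun y => gexp ℓ y * Real.exp (N * y) *
    Real.exp (m / 2 * (Real.log (1 - y) - Real.log (1 + y)))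
  have hsub : Icc x 0 ⊆ Ioo (-1 : ℝ) 1 := fun s hs =>
    ⟨hx.trans_le hs.1, hs.2.trans_lt one_pos⟩
  have hF : ∀ y ∈ Icc x 0, HasDerivAt F (F y * ((ℓ y + N * (1 - y ^ 2) - m) / (1 - y ^ 2))) y := by
    intro y hy
    have hy' := hsub hy
    have p1 : 0 < 1 + y := by linarith [hy'.1]
    have p2 : 0 < 1 - y := by linarith [hy'.2]
    have d1 : HasDerivAt (fun y => Real.log (1 - y)) (-1 / (1 - y)) y :=
      (((hasDerivAt_id y).const_sub 1)).log p2.ne'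
    have d2 : HasDerivAt (fun y => Real.log (1 + y)) (1 / (1 + y)) y :=
      (((hasDerivAt_id y).const_add 1)).log p1.ne'
    refine ((hasDerivAt_gexp_mul_exp hℓ N hy').fun_mul
      (((d1.fun_sub d2).const_mul (m / 2)).exp)).congr_deriv ?_
    have e : 1 - y ^ 2 = (1 - y) * (1 + y) := by ring
    simp only [F, e]
    field_simp
    ring
  have hmono : F x ≤ F 0 := by
    refine monotoneOn_of_deriv_nonneg (convex_Icc x 0)
      (fun y hy => (hF y hy).continuousAt.continuousWithinAt)
      (fun y hy => (hF y (interior_subset hy)).differentiableAt.differentiableWithinAt) ?_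
      (left_mem_Icc.2 hx0) (right_mem_Icc.2 hx0) hx0
    intro y hy
    rw [(hF y (interior_subset hy)).deriv]
    have hy' := interior_subset hy
    refine mul_nonneg (by simp only [F]; have := gexp_pos ℓ y; positivity)
      (div_nonneg ?_ (one_sub_sq_pos (hsub hy')).le)
    linarith [h y ⟨(hsub hy').1, hy'.2⟩]
  have hF0 : F 0 = 1 := by simp [F]
  rw [hF0] at hmono
  have e1 : gexp ℓ x = F x * (Real.exp (-(N * x)) *
      Real.exp (m / 2 * (Real.log (1 + x) - Real.log (1 - x)))) := by
    simp only [F]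
    rw [mul_assoc, mul_assoc, ← Real.exp_add, ← Real.exp_add, ← Real.exp_add]
    ring_nf
    simp
  rw [e1]
  calc _ ≤ 1 * (Real.exp (-(N * x)) *
      Real.exp (m / 2 * (Real.log (1 + x) - Real.log (1 - x)))) := by
        gcongr
    _ ≤ _ := by
      rw [one_mul]
      gcongr
      nlinarith

theorem tendsto_gexp_left {ℓ : ℝ → ℝ} (hℓ : ContinuousOn ℓ (Ioo (-1) 1)) {m N : ℝ} (hm : 0 < m)
    (hN : 0 ≤ N) (h : ∀ s ∈ Ioc (-1 : ℝ) 0, m ≤ ℓ s + N * (1 - s ^ 2)) :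
    Tendsto (gexp ℓ) (𝓝[>] (-1)) (𝓝 0) := by
  have h1 : Tendsto (fun x : ℝ => 1 + x) (𝓝[>] (-1)) (𝓝[>] 0) := by
    refine tendsto_nhdsWithin_of_tendsto_nhds_of_eventually_within _ ?_ ?_
    · have : Tendsto (fun x : ℝ => 1 + x) (𝓝 (-1)) (𝓝 (1 + -1)) := by
        exact (continuous_const.add continuous_id).tendsto _
      rw [add_neg_cancel] at this
      exact this.mono_left nhdsWithin_le_nhds
    · filter_upwards [self_mem_nhdsWithin] with x hx
      have : -1 < x := hx
      simp only [mem_Ioi]; linarith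
  have h2 : Tendsto (fun x : ℝ => Real.log (1 - x)) (𝓝[>] (-1)) (𝓝 (Real.log (1 - -1))) := by
    refine Tendsto.mono_left ?_ nhdsWithin_le_nhds
    exact ((continuous_const.sub continuous_id).tendsto _).log (by norm_num)
  have h3 : Tendsto (fun x : ℝ => Real.exp N *
      Real.exp (m / 2 * (Real.log (1 + x) - Real.log (1 - x)))) (𝓝[>] (-1)) (𝓝 0) := by
    have h4 := ((Real.tendsto_log_nhdsGT_zero.comp h1).atBot_add h2.neg).const_mul_atBot
      (half_pos hm)
    have h5 := (Real.tendsto_exp_atBot.comp h4).const_mul (Real.exp N)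
    rw [mul_zero] at h5
    refine h5.congr fun x => ?_
    simp [sub_eq_add_neg]
  refine squeeze_zero' (Eventually.of_forall fun x => (gexp_pos ℓ x).le) ?_ h3
  filter_upwards [Ioo_mem_nhdsGT (show (-1 : ℝ) < 0 by norm_num)] with x hx
  exact gexp_le_rpow hℓ hN hx.1 hx.2.le h

/-- The bound of `integral_gexp_le` does not depend on the lower limit, so the integrals over `[aₙ,
x]` with `aₙ → -1` stay bounded; for a nonnegative integrand this is integrability. -/
theorem intervalIntegrable_gexp_left {ℓ : ℝ → ℝ} (hℓ : ContinuousOn ℓ (Ioo (-1) 1))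
    (h : PosEnds ℓ) {x : ℝ} (hx : x ∈ Ioo (-1 : ℝ) 1) :
    IntervalIntegrable (fun s => gexp ℓ s / (1 - s ^ 2)) MeasureTheory.volume (-1) x := by
  obtain ⟨m, hm, N, hN, h⟩ := h
  rw [intervalIntegrable_iff_integrableOn_Ioc_of_le hx.1.le]
  have hc := continuousOn_div_one_sub_sq (continuousOn_gexp hℓ)
  have hpos : 0 < x + 1 := by linarith [hx.1]
  have ha1 : ∀ n : ℕ, -1 < -1 + (x + 1) * (1 / ((n : ℝ) + 1)) := fun n => by
    have : 0 < (x + 1) * (1 / ((n : ℝ) + 1)) := by positivity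
    linarith
  have ha2 : ∀ n : ℕ, -1 + (x + 1) * (1 / ((n : ℝ) + 1)) ≤ x := fun n => by
    have : 1 / ((n : ℝ) + 1) ≤ 1 := by
      rw [div_le_one (by positivity)]
      linarith [(Nat.cast_nonneg n : (0 : ℝ) ≤ n)]
    nlinarith
  have ht : Tendsto (fun n : ℕ => -1 + (x + 1) * (1 / ((n : ℝ) + 1))) atTop (𝓝 (-1)) := by
    simpa using (tendsto_one_div_add_atTop_nhds_zero_nat.const_mul (x + 1)).const_add (-1)
  refine MeasureTheory.integrableOn_Ioc_of_intervalIntegral_norm_bounded_left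
    (I := Real.exp (2 * N) / m * gexp ℓ x) (f := fun s => gexp ℓ s / (1 - s ^ 2)) ?_ ht
    (Eventually.of_forall fun n => ?_)
  · intro n
    rw [← intervalIntegrable_iff_integrableOn_Ioc_of_le (ha2 n)]
    exact (hc.mono (uIcc_subset_Ioo ⟨ha1 n, (ha2 n).trans_lt hx.2⟩ hx)).intervalIntegrable
  · rw [← intervalIntegral.integral_of_le (ha2 n)]
    have e : ∀ s ∈ Icc (-1 + (x + 1) * (1 / ((n : ℝ) + 1))) x,
        ‖gexp ℓ s / (1 - s ^ 2)‖ = gexp ℓ s / (1 - s ^ 2) := fun s hs => by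
      have := one_sub_sq_pos (x := s) ⟨(ha1 n).trans_le hs.1, hs.2.trans_lt hx.2⟩
      exact Real.norm_of_nonneg (div_pos (gexp_pos ℓ s) this).le
    have := integral_gexp_le hℓ hm hN (ha1 n) (ha2 n) hx.2
      fun s hs => h s ⟨(ha1 n).trans_le hs.1, hs.2.trans_lt hx.2⟩
    refine le_trans (le_of_eq ?_) this
    refine intervalIntegral.integral_congr fun s hs => ?_
    rw [uIcc_of_le (ha2 n)] at hs
    exact e s hs

theorem integral_gexp_left_le {ℓ : ℝ → ℝ} (hℓ : ContinuousOn ℓ (Ioo (-1) 1)) (h : PosEnds ℓ) :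
    ∃ C, 0 ≤ C ∧ ∀ x ∈ Ioo (-1 : ℝ) 1,
      ∫ s in (-1 : ℝ)..x, gexp ℓ s / (1 - s ^ 2) ≤ C * gexp ℓ x := by
  obtain ⟨m, hm, N, hN, hb⟩ := id h
  refine ⟨Real.exp (2 * N) / m, by positivity, fun x hx => ?_⟩
  have hi := intervalIntegrable_gexp_left hℓ h hx
  have hi' : MeasureTheory.IntegrableOn (fun s => gexp ℓ s / (1 - s ^ 2)) (uIcc (-1) x) := by
    rw [uIcc_of_le hx.1.le, integrableOn_Icc_iff_integrableOn_Ioc]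
    exact (intervalIntegrable_iff_integrableOn_Ioc_of_le hx.1.le).1 hi
  have hc := intervalIntegral.continuousOn_primitive_interval_left hi'
  have ht := (hc (-1) left_mem_uIcc).mono
    (show Ioo (-1) x ⊆ uIcc (-1) x by rw [uIcc_of_le hx.1.le]; exact Ioo_subset_Icc_self)
  have hne : (𝓝[Ioo (-1) x] (-1)).NeBot := left_nhdsWithin_Ioo_neBot hx.1
  refine le_of_tendsto ht ?_
  filter_upwards [self_mem_nhdsWithin] with a ha
  exact integral_gexp_le hℓ hm hN ha.1 ha.2.le hx.2
      fun s hs => hb s ⟨ha.1.trans_le hs.1, hs.2.trans_lt hx.2⟩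

theorem ev_integral_add {w : ℝ → ℝ} {e : ℝ} {y z : Cb (Ioo (-1) 1)} {x : ℝ}
    (hy : IntervalIntegrable (fun s => w s * ev y s) MeasureTheory.volume e x)
    (hz : IntervalIntegrable (fun s => w s * ev z s) MeasureTheory.volume e x) :
    ∫ s in e..x, w s * ev (y + z) s = (∫ s in e..x, w s * ev y s) + ∫ s in e..x, w s * ev z s := by
  rw [← intervalIntegral.integral_add hy hz]
  congr 1
  funext s
  rw [ev_add, mul_add]

theorem intervalIntegrable_mul_ev {w : ℝ → ℝ} {e x : ℝ} (he : e ∈ Icc (-1 : ℝ) 1)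
    (hx : x ∈ Ioo (-1 : ℝ) 1) (hw : IntervalIntegrable w MeasureTheory.volume e x)
    (y : Cb (Ioo (-1) 1)) :
    IntervalIntegrable (fun s => w s * ev y s) MeasureTheory.volume e x := by
  rw [intervalIntegrable_iff] at hw ⊢
  refine MeasureTheory.Integrable.mul_bdd (c := ‖y‖) hw ?_
    (Eventually.of_forall fun s => abs_ev_le y s)
  -- For `e = 1` the half-open interval contains the point `1`, where `ev y` is the default value
  -- `0`; it is a null set.
  have hsub : uIoc e x ⊆ Ioo (-1 : ℝ) 1 ∪ {1} := by
    intro s hs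
    rw [mem_uIoc] at hs
    rcases hs with hs | hs
    · exact Or.inl ⟨he.1.trans_lt hs.1, hs.2.trans_lt hx.2⟩
    · rcases (hs.2.trans he.2).lt_or_eq with h1 | h1
      · exact Or.inl ⟨hx.1.trans hs.1, h1⟩
      · exact Or.inr h1
  have h1 : MeasureTheory.AEStronglyMeasurable (ev y)
      (MeasureTheory.volume.restrict (Ioo (-1 : ℝ) 1 ∪ {1})) := by
    rw [aestronglyMeasurable_union_iff]
    refine ⟨(continuousOn_ev y).aestronglyMeasurable measurableSet_Ioo, ?_⟩
    rw [MeasureTheory.Measure.restrict_singleton]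
    simp
  exact h1.mono_measure (MeasureTheory.Measure.restrict_mono hsub le_rfl)

/-- An operator `y ↦ k(x) ∫ₑˣ w y` on bounded continuous functions. -/
theorem exists_integralOperator {k w : ℝ → ℝ} {e C : ℝ} (he : e ∈ Icc (-1 : ℝ) 1)
    (hk : ContinuousOn k (Ioo (-1) 1)) (hw : ContinuousOn w (Ioo (-1) 1))
    (hi : ∀ x ∈ Ioo (-1 : ℝ) 1, IntervalIntegrable w MeasureTheory.volume e x)
    (hC : 0 ≤ C) (hb : ∀ x ∈ Ioo (-1 : ℝ) 1, |k x| * |(∫ s in e..x, |w s|)| ≤ C) :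
    ∃ T : Cb (Ioo (-1) 1) →L[ℝ] Cb (Ioo (-1) 1), ∀ y, ∀ x ∈ Ioo (-1 : ℝ) 1,
      ev (T y) x = k x * ∫ s in e..x, w s * ev y s := by
  have hd : ∀ y : Cb (Ioo (-1) 1), ∀ x ∈ Ioo (-1 : ℝ) 1,
      HasDerivAt (fun x => ∫ s in e..x, w s * ev y s) (w x * ev y x) x := fun y x hx =>
    intervalIntegral.integral_hasDerivAt_right (intervalIntegrable_mul_ev he hx (hi x hx) y)
      ((hw.mul (continuousOn_ev y)).stronglyMeasurableAtFilter isOpen_Ioo x hx)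
      ((hw.mul (continuousOn_ev y)).continuousAt (isOpen_Ioo.mem_nhds hx))
  have hc : ∀ y : Cb (Ioo (-1) 1),
      ContinuousOn (fun x => k x * ∫ s in e..x, w s * ev y s) (Ioo (-1) 1) := fun y =>
    hk.mul fun x hx => (hd y x hx).continuousAt.continuousWithinAt
  have hbd : ∀ y : Cb (Ioo (-1) 1), ∀ x ∈ Ioo (-1 : ℝ) 1,
      |k x * ∫ s in e..x, w s * ev y s| ≤ C * ‖y‖ := by
    intro y x hx
    have h1 : ‖∫ s in e..x, w s * ev y s‖ ≤ |(∫ s in e..x, |w s| * ‖y‖)| := by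
      refine intervalIntegral.norm_integral_le_abs_of_norm_le
        (MeasureTheory.ae_of_all _ fun s => ?_) ((hi x hx).abs.mul_const _)
      rw [norm_mul]
      exact mul_le_mul_of_nonneg_left (abs_ev_le y s) (norm_nonneg _)
    rw [intervalIntegral.integral_mul_const, abs_mul, abs_of_nonneg (norm_nonneg y)] at h1
    rw [abs_mul]
    calc _ ≤ |k x| * (|(∫ s in e..x, |w s|)| * ‖y‖) := by gcongr; exact h1
      _ = |k x| * |(∫ s in e..x, |w s|)| * ‖y‖ := by ring
      _ ≤ _ := by gcongr; exact hb x hx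
  have hev : ∀ y : Cb (Ioo (-1) 1), ∀ x ∈ Ioo (-1 : ℝ) 1,
      ev (toCb (Ioo (-1) 1) fun x => k x * ∫ s in e..x, w s * ev y s) x =
        k x * ∫ s in e..x, w s * ev y s := fun y x hx => ev_toCb (hc y) (hbd y) hx
  refine ⟨LinearMap.mkContinuous
    { toFun := fun y => toCb (Ioo (-1) 1) fun x => k x * ∫ s in e..x, w s * ev y s
      map_add' := fun y z => ev_ext fun x hx => ?_
      map_smul' := fun r y => ev_ext fun x hx => ?_ } C fun y => ?_, fun y x hx => hev y x hx⟩
  · rw [ev_add, hev _ x hx, hev _ x hx, hev _ x hx,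
      ev_integral_add (intervalIntegrable_mul_ev he hx (hi x hx) y)
        (intervalIntegrable_mul_ev he hx (hi x hx) z), mul_add]
  · rw [RingHom.id_apply, ev_smul, hev _ x hx, hev _ x hx]
    simp only [ev_smul, mul_left_comm _ r, intervalIntegral.integral_const_mul]
  · refine norm_le_of_ev (mul_nonneg hC (norm_nonneg y)) fun x hx => ?_
    change |ev (toCb (Ioo (-1) 1) fun x => k x * ∫ s in e..x, w s * ev y s) x| ≤ _
    rw [hev y x hx]
    exact hbd y x hx

/-- The derivative of `x ↦ (∫ₑˣ G y/(1-s²)) / G` for the integrating factor `G`. -/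
theorem hasDerivAt_of_integral_formula {ℓ : ℝ → ℝ} (hℓ : ContinuousOn ℓ (Ioo (-1) 1)) {e : ℝ}
    (he : e ∈ Icc (-1 : ℝ) 1) (hi : ∀ x ∈ Ioo (-1 : ℝ) 1,
      IntervalIntegrable (fun s => gexp ℓ s / (1 - s ^ 2)) MeasureTheory.volume e x)
    {f y : Cb (Ioo (-1) 1)}
    (hf : ∀ x ∈ Ioo (-1 : ℝ) 1,
      ev f x = (gexp ℓ x)⁻¹ * ∫ s in e..x, gexp ℓ s / (1 - s ^ 2) * ev y s) {x : ℝ}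
    (hx : x ∈ Ioo (-1 : ℝ) 1) :
    HasDerivAt (ev f) ((ev y x - ℓ x * ev f x) / (1 - x ^ 2)) x := by
  have hw := continuousOn_div_one_sub_sq (continuousOn_gexp hℓ)
  have h1 : HasDerivAt (fun x => ∫ s in e..x, gexp ℓ s / (1 - s ^ 2) * ev y s)
      (gexp ℓ x / (1 - x ^ 2) * ev y x) x :=
    intervalIntegral.integral_hasDerivAt_right (intervalIntegrable_mul_ev he hx (hi x hx) y)
      ((hw.mul (continuousOn_ev y)).stronglyMeasurableAtFilter isOpen_Ioo x hx)
      ((hw.mul (continuousOn_ev y)).continuousAt (isOpen_Ioo.mem_nhds hx))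
  have hg := (gexp_pos ℓ x).ne'
  have h2 := ((hasDerivAt_gexp hℓ hx).fun_inv hg).fun_mul h1
  refine (h2.congr_deriv ?_).congr_of_eventuallyEq ?_
  · rw [hf x hx]
    have := (one_sub_sq_pos hx).ne'
    field_simp
    ring
  · filter_upwards [isOpen_Ioo.mem_nhds hx] with z hz using hf z hz

theorem abs_weight {ℓ : ℝ → ℝ} {s : ℝ} (hs : s ∈ Icc (-1 : ℝ) 1) :
    |gexp ℓ s / (1 - s ^ 2)| = gexp ℓ s / (1 - s ^ 2) :=
  abs_of_nonneg (div_nonneg (gexp_pos ℓ s).le (by nlinarith [hs.1, hs.2]))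

/-- The factor `gexp ℓ` tends to `0` at `-1`, so every nonzero homogeneous solution, a multiple of
`1/gexp ℓ`, is unbounded there, which gives uniqueness. The integral from `-1` is bounded by
`integral_gexp_left_le`, where positivity at `1` is used as well. -/
theorem exists_solver_left {ℓ : ℝ → ℝ} (hℓ : ContinuousOn ℓ (Ioo (-1) 1)) (h : PosEnds ℓ) :
    ∃ T, IsSolver ℓ T ∧ ∀ y, ∀ x ∈ Ioo (-1 : ℝ) 1,
      ev (T y) x = (gexp ℓ x)⁻¹ * ∫ s in (-1 : ℝ)..x, gexp ℓ s / (1 - s ^ 2) * ev y s := by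
  obtain ⟨C, hC, hb⟩ := integral_gexp_left_le hℓ h
  have hi := fun x (hx : x ∈ Ioo (-1 : ℝ) 1) => intervalIntegrable_gexp_left hℓ h hx
  have he : (-1 : ℝ) ∈ Icc (-1 : ℝ) 1 := by norm_num
  obtain ⟨T, hT⟩ := exists_integralOperator (k := fun x => (gexp ℓ x)⁻¹) (C := C) he
    ((continuousOn_gexp hℓ).inv₀ fun x _ => (gexp_pos ℓ x).ne')
    (continuousOn_div_one_sub_sq (continuousOn_gexp hℓ)) hi hC (fun x hx => by
      have h1 : ∫ s in (-1 : ℝ)..x, |gexp ℓ s / (1 - s ^ 2)| =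
          ∫ s in (-1 : ℝ)..x, gexp ℓ s / (1 - s ^ 2) :=
        intervalIntegral.integral_congr fun s hs => by
          rw [uIcc_of_le hx.1.le] at hs
          exact abs_weight ⟨hs.1, hs.2.trans hx.2.le⟩
      have h2 : 0 ≤ ∫ s in (-1 : ℝ)..x, |gexp ℓ s / (1 - s ^ 2)| :=
        intervalIntegral.integral_nonneg hx.1.le fun s _ => abs_nonneg _
      rw [abs_of_nonneg h2, h1, abs_of_pos (inv_pos.2 (gexp_pos ℓ x)),
        inv_mul_le_iff₀ (gexp_pos ℓ x), mul_comm]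
      exact hb x hx)
  refine ⟨T, ⟨fun y x hx => hasDerivAt_of_integral_formula hℓ he hi (hT y) hx, ?_⟩, hT⟩
  rintro f ⟨M, hM⟩ hf x hx
  obtain ⟨m, hm, N, hN, hb⟩ := h
  have ht := tendsto_gexp_left hℓ hm hN fun s hs => hb s ⟨hs.1, hs.2.trans_lt one_pos⟩
  have h0 : |f 0| ≤ 0 := by
    have h1 := ht.const_mul M
    rw [mul_zero] at h1
    refine ge_of_tendsto h1 ?_
    filter_upwards [Ioo_mem_nhdsGT (show (-1 : ℝ) < 1 by norm_num)] with y hy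
    have h2 := hM y hy
    rw [eq_div_gexp hℓ hf hy, abs_div, abs_of_pos (gexp_pos ℓ y),
      div_le_iff₀ (gexp_pos ℓ y)] at h2
    exact h2
  rw [eq_div_gexp hℓ hf hx, abs_eq_zero.1 (le_antisymm h0 (abs_nonneg _)), zero_div]

/-- The operator is conjugate under reflection to minus the one treated in `exists_solver_left`. -/
theorem exists_solver_right {ℓ : ℝ → ℝ} (hℓ : ContinuousOn ℓ (Ioo (-1) 1))
    (h : PosEnds fun x => -ℓ (-x)) :
    ∃ T, IsSolver ℓ T ∧ ∀ y, ∀ x ∈ Ioo (-1 : ℝ) 1,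
      ev (T y) x = (gexp ℓ x)⁻¹ * ∫ s in (1 : ℝ)..x, gexp ℓ s / (1 - s ^ 2) * ev y s := by
  obtain ⟨T, hT, hf⟩ := exists_solver_left (continuousOn_neg_refl hℓ) h
  have hev : ∀ y x, ev ((-(reflCb.comp (T.comp reflCb))) y) x = -ev (T (reflCb y)) (-x) := by
    intro y x
    rw [neg_apply, ev_neg, ContinuousLinearMap.comp_apply, ev_reflCb,
      ContinuousLinearMap.comp_apply]
  refine ⟨-(reflCb.comp (T.comp reflCb)), ⟨fun y x hx => ?_, ?_⟩, fun y x hx => ?_⟩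
  · have h1 := (hT.hasDerivAt (reflCb y) (-x) (neg_mem_Ioo hx))
    have h2 := (h1.comp x (hasDerivAt_neg x)).neg
    refine (h2.congr_deriv ?_).congr_of_eventuallyEq (Eventually.of_forall fun z => hev y z)
    rw [hev, ev_reflCb]
    simp only [neg_neg, neg_sq]
    ring
  · rintro f ⟨M, hM⟩ hd x hx
    have := hT.eq_zero (fun x => f (-x)) ⟨M, fun x hx => hM _ (neg_mem_Ioo hx)⟩ (fun x hx => by
      refine ((hd (-x) (neg_mem_Ioo hx)).comp x (hasDerivAt_neg x)).congr_deriv ?_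
      simp only [neg_sq]
      ring) (-x) (neg_mem_Ioo hx)
    simpa using this
  · rw [hev, hf _ _ (neg_mem_Ioo hx), gexp_neg_refl]
    have e := intervalIntegral.integral_comp_neg (a := (-1 : ℝ)) (b := -x)
      (fun s => gexp ℓ s / (1 - s ^ 2) * ev y s)
    rw [neg_neg, neg_neg] at e
    rw [← mul_neg]
    congr 1
    rw [intervalIntegral.integral_symm x 1, ← e, neg_inj]
    refine intervalIntegral.integral_congr fun s _ => ?_
    simp only [ev_reflCb, neg_sq]
    rw [← gexp_neg_refl ℓ (-s), neg_neg]

theorem gexp_ge {ℓ : ℝ → ℝ} (hℓ : ContinuousOn ℓ (Ioo (-1) 1)) {N : ℝ} (hN : 0 ≤ N)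
    (h : ∀ s ∈ Ico (0 : ℝ) 1, 0 ≤ ℓ s + N * (1 - s ^ 2)) {x : ℝ} (hx : x ∈ Ico (0 : ℝ) 1) :
    Real.exp (-N) ≤ gexp ℓ x := by
  have hsub : Icc 0 x ⊆ Ioo (-1 : ℝ) 1 := fun s hs =>
    ⟨neg_one_lt_zero.trans_le hs.1, hs.2.trans_lt hx.2⟩
  have hF := fun y (hy : y ∈ Icc 0 x) => hasDerivAt_gexp_mul_exp hℓ N (hsub hy)
  have hmono : gexp ℓ 0 * Real.exp (N * 0) ≤ gexp ℓ x * Real.exp (N * x) := by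
    refine monotoneOn_of_deriv_nonneg (f := fun y => gexp ℓ y * Real.exp (N * y))
      (convex_Icc 0 x)
      (fun y hy => (hF y hy).continuousAt.continuousWithinAt)
      (fun y hy => (hF y (interior_subset hy)).differentiableAt.differentiableWithinAt) ?_
      (left_mem_Icc.2 hx.1) (right_mem_Icc.2 hx.1) hx.1
    intro y hy
    have hy' := interior_subset hy
    rw [(hF y hy').deriv]
    have := gexp_pos ℓ y
    exact mul_nonneg (by positivity) (div_nonneg (h y ⟨hy'.1, hy'.2.trans_lt hx.2⟩)
      (one_sub_sq_pos (hsub hy')).le)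
  simp only [gexp_zero, mul_zero, Real.exp_zero, mul_one] at hmono
  rw [Real.exp_neg, inv_le_iff_one_le_mul₀ (Real.exp_pos N)]
  refine hmono.trans (mul_le_mul_of_nonneg_left (Real.exp_le_exp.2 ?_) (gexp_pos ℓ x).le)
  nlinarith [hx.1, hx.2]

/-- Now `gexp ℓ` is bounded below by a positive constant, so homogeneous solutions are bounded and a
particular solution can start at `0`. On `[0,1)` the bound is `integral_gexp_le`, on `(-1,0]` the
same bound after reflection. The second conjunct says that `toCb` does not fall back to its default
value here. -/
theorem exists_initSolver {ℓ : ℝ → ℝ} (hℓ : ContinuousOn ℓ (Ioo (-1) 1)) (h : OutEnds ℓ) :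
    (∃ T, IsInitSolver ℓ T) ∧
      ∀ x ∈ Ioo (-1 : ℝ) 1, ev (toCb (Ioo (-1) 1) fun x => (gexp ℓ x)⁻¹) x = (gexp ℓ x)⁻¹ := by
  obtain ⟨m, hm, N, hN, hr, hl⟩ := h
  have hc : ContinuousOn (fun x => (gexp ℓ x)⁻¹) (Ioo (-1) 1) :=
    (continuousOn_gexp hℓ).inv₀ fun x _ => (gexp_pos ℓ x).ne'
  have hℓ' := continuousOn_neg_refl hℓ
  have hw := continuousOn_div_one_sub_sq (continuousOn_gexp hℓ)
  have hl' : ∀ s ∈ Ico (0 : ℝ) 1, m ≤ -ℓ (-s) + N * (1 - s ^ 2) := fun s hs => by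
    simpa using hl (-s) ⟨by linarith [hs.2], by linarith [hs.1]⟩
  have hi : ∀ x ∈ Ioo (-1 : ℝ) 1,
      IntervalIntegrable (fun s => gexp ℓ s / (1 - s ^ 2)) MeasureTheory.volume 0 x := fun x hx =>
    (hw.mono (uIcc_subset_Ioo zero_mem_Ioo hx)).intervalIntegrable
  have he : (0 : ℝ) ∈ Icc (-1 : ℝ) 1 := by norm_num
  refine ⟨?_, fun x hx => ev_toCb hc (C := Real.exp N) (fun x hx => ?_) hx⟩
  · obtain ⟨T, hT⟩ := exists_integralOperator (k := fun x => (gexp ℓ x)⁻¹)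
      (w := fun s => gexp ℓ s / (1 - s ^ 2)) (e := 0)
      (C := Real.exp (2 * N) / m) he hc hw hi (by positivity) (fun x hx => by
        have h1 : ∫ s in (0 : ℝ)..x, |gexp ℓ s / (1 - s ^ 2)| =
            ∫ s in (0 : ℝ)..x, gexp ℓ s / (1 - s ^ 2) :=
          intervalIntegral.integral_congr fun s hs => by
            exact abs_weight (Ioo_subset_Icc_self (uIcc_subset_Ioo zero_mem_Ioo hx hs))
        rw [h1, abs_of_pos (inv_pos.2 (gexp_pos ℓ x)),
          inv_mul_le_iff₀ (gexp_pos ℓ x), mul_comm]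
        rcases le_total 0 x with h0 | h0
        · rw [abs_of_nonneg]
          · exact integral_gexp_le hℓ hm hN (by norm_num) h0 hx.2 fun s hs =>
              hr s ⟨hs.1, hs.2.trans_lt hx.2⟩
          · exact intervalIntegral.integral_nonneg h0 fun s hs =>
              div_nonneg (gexp_pos ℓ s).le (by nlinarith [hs.1, hs.2, hx.2])
        · have h2 := integral_gexp_le hℓ' hm hN (by norm_num : (-1 : ℝ) < 0)
            (x := -x) (by linarith) (by linarith [hx.1]) fun s hs =>
              hl' s ⟨hs.1, by linarith [hs.2, hx.1]⟩
          have h3 := intervalIntegral.integral_comp_neg (a := (0 : ℝ)) (b := -x)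
            (fun s => gexp ℓ s / (1 - s ^ 2))
          simp only [neg_neg, neg_zero, neg_sq] at h3
          have h4 : ∀ s, gexp (fun s => -ℓ (-s)) s = gexp ℓ (-s) := fun s => by
            rw [← gexp_neg_refl ℓ (-s), neg_neg]
          simp only [h4, neg_neg] at h2
          rw [h3, intervalIntegral.integral_symm] at h2
          rw [abs_of_nonpos]
          · exact h2
          · rw [intervalIntegral.integral_symm, neg_nonpos]
            exact intervalIntegral.integral_nonneg h0 fun s hs =>
              div_nonneg (gexp_pos ℓ s).le (by nlinarith [hs.1, hs.2, hx.1]))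
    exact ⟨T, hℓ, fun y x hx => hasDerivAt_of_integral_formula hℓ he hi (hT y) hx,
      fun y => by rw [hT y 0 zero_mem_Ioo]; simp⟩
  · rw [abs_of_pos (inv_pos.2 (gexp_pos ℓ x)), inv_le_comm₀ (gexp_pos ℓ x) (Real.exp_pos N),
      ← Real.exp_neg]
    rcases le_total 0 x with h0 | h0
    · exact gexp_ge hℓ hN (fun s hs => hm.le.trans (hr s hs)) ⟨h0, hx.2⟩
    · rw [← gexp_neg_refl]
      exact gexp_ge hℓ' hN (fun s hs => hm.le.trans (hl' s hs))
        ⟨by linarith, by linarith [hx.1]⟩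

/-- Near `1` the limit gives `ℓ ≥ r/2`. On the remaining compact interval `1 - x²` is bounded below,
and a large multiple of it compensates for the minimum of `ℓ`. -/
theorem exists_le_add_mul_of_tendsto {ℓ : ℝ → ℝ} (hℓ : ContinuousOn ℓ (Ico 0 1)) {r : ℝ}
    (hr : 0 < r) (h : Tendsto ℓ (𝓝[<] 1) (𝓝 r)) :
    ∃ m > 0, ∃ N ≥ 0, ∀ x ∈ Ico (0 : ℝ) 1, m ≤ ℓ x + N * (1 - x ^ 2) := by
  have h1 : ∀ᶠ x in 𝓝[<] (1 : ℝ), r / 2 < ℓ x := h.eventually (lt_mem_nhds (half_lt_self hr))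
  obtain ⟨a, ha, hb⟩ := (mem_nhdsLT_iff_exists_Ioo_subset' (show (0 : ℝ) < 1 by norm_num)).1 h1
  set b := max a 0
  have hb1 : b < 1 := max_lt ha one_pos
  have hb0 : 0 ≤ b := le_max_right _ _
  obtain ⟨M, hM⟩ := (isCompact_Icc (a := (0 : ℝ)) (b := b)).exists_bound_of_continuousOn
    (hℓ.mono fun x hx => ⟨hx.1, hx.2.trans_lt hb1⟩)
  have hc : 0 < 1 - b ^ 2 := by nlinarith
  have hM0 : 0 ≤ M := (norm_nonneg _).trans (hM 0 ⟨le_rfl, hb0⟩)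
  refine ⟨r / 2, half_pos hr, (M + r / 2) / (1 - b ^ 2), by positivity, fun x hx => ?_⟩
  rcases le_or_gt x b with hxb | hxb
  · have h2 := (abs_le.1 (hM x ⟨hx.1, hxb⟩)).1
    have h3 : M + r / 2 ≤ (M + r / 2) / (1 - b ^ 2) * (1 - x ^ 2) := by
      rw [div_mul_eq_mul_div, le_div_iff₀ hc]
      refine mul_le_mul_of_nonneg_left ?_ (by positivity)
      nlinarith [hx.1]
    linarith
  · have h2 : r / 2 < ℓ x := hb ⟨(le_max_left _ _).trans_lt hxb, hx.2⟩
    have h3 : 0 ≤ (M + r / 2) / (1 - b ^ 2) * (1 - x ^ 2) :=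
      mul_nonneg (by positivity) (by nlinarith [hx.1, hx.2])
    linarith

theorem tendsto_neg_nhdsLT_one : Tendsto (fun x : ℝ => -x) (𝓝[<] 1) (𝓝[>] (-1)) :=
  tendsto_neg_nhdsLT

theorem continuousOn_refl_Ico {ℓ : ℝ → ℝ} (hℓ : ContinuousOn ℓ (Ioo (-1) 1)) :
    ContinuousOn (fun x => ℓ (-x)) (Ico 0 1) :=
  hℓ.comp continuousOn_neg fun x hx => ⟨by linarith [hx.2], by linarith [hx.1]⟩

theorem posEnds_of_tendsto {ℓ : ℝ → ℝ} (hℓ : ContinuousOn ℓ (Ioo (-1) 1)) {l r : ℝ}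
    (hl : 0 < l) (hr : 0 < r) (h1 : Tendsto ℓ (𝓝[>] (-1)) (𝓝 l))
    (h2 : Tendsto ℓ (𝓝[<] 1) (𝓝 r)) : PosEnds ℓ := by
  obtain ⟨m, hm, N, hN, h⟩ := exists_le_add_mul_of_tendsto
    (hℓ.mono fun x hx => ⟨by linarith [hx.1], hx.2⟩) hr h2
  obtain ⟨m', hm', N', hN', h'⟩ := exists_le_add_mul_of_tendsto (continuousOn_refl_Ico hℓ) hl
    (h1.comp tendsto_neg_nhdsLT_one)
  refine ⟨min m m', lt_min hm hm', max N N', le_max_of_le_left hN, fun x hx => ?_⟩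
  have hx' := one_sub_sq_pos hx
  rcases le_total 0 x with h0 | h0
  · have := h x ⟨h0, hx.2⟩
    have := mul_le_mul_of_nonneg_right (le_max_left N N') hx'.le
    linarith [min_le_left m m']
  · have := h' (-x) ⟨by linarith, by linarith [hx.1]⟩
    rw [neg_neg, neg_sq] at this
    have := mul_le_mul_of_nonneg_right (le_max_right N N') hx'.le
    linarith [min_le_right m m']

theorem outEnds_of_tendsto {ℓ : ℝ → ℝ} (hℓ : ContinuousOn ℓ (Ioo (-1) 1)) {l r : ℝ}
    (hl : l < 0) (hr : 0 < r) (h1 : Tendsto ℓ (𝓝[>] (-1)) (𝓝 l))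
    (h2 : Tendsto ℓ (𝓝[<] 1) (𝓝 r)) : OutEnds ℓ := by
  obtain ⟨m, hm, N, hN, h⟩ := exists_le_add_mul_of_tendsto
    (hℓ.mono fun x hx => ⟨by linarith [hx.1], hx.2⟩) hr h2
  obtain ⟨m', hm', N', hN', h'⟩ := exists_le_add_mul_of_tendsto (continuousOn_refl_Ico hℓ).neg
    (neg_pos.2 hl) (h1.comp tendsto_neg_nhdsLT_one).neg
  refine ⟨min m m', lt_min hm hm', max N N', le_max_of_le_left hN, fun x hx => ?_, fun x hx => ?_⟩
  · have := h x hx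
    have := mul_le_mul_of_nonneg_right (le_max_left N N') (show 0 ≤ 1 - x ^ 2 by
      nlinarith [hx.1, hx.2])
    linarith [min_le_left m m']
  · have := h' (-x) ⟨by linarith [hx.2], by linarith [hx.1]⟩
    simp only [Pi.neg_apply, neg_neg, neg_sq] at this
    have := mul_le_mul_of_nonneg_right (le_max_right N N') (show 0 ≤ 1 - x ^ 2 by
      nlinarith [hx.1, hx.2])
    linarith [min_le_right m m']

/-! ### Smooth families of fixed points -/

/-- An analytic family of maps whose derivative vanishes at a fixed point has an analytic family
of fixed points, which are locally unique. -/
theorem exists_analytic_fixedPoint {P E : Type*} [NormedAddCommGroup P] [NormedSpace ℝ P]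
    [CompleteSpace P] [NormedAddCommGroup E] [NormedSpace ℝ E] [CompleteSpace E]
    {Φ : P × E → E} (hΦ : ContDiff ℝ ω Φ) {p₀ : P} (h0 : Φ (p₀, 0) = 0)
    (hd : HasFDerivAt (fun z => Φ (p₀, z)) (0 : E →L[ℝ] E) 0) :
    ∃ g : P → E, ∃ N : Set P, ∃ ρ > 0, IsOpen N ∧ p₀ ∈ N ∧ ContDiffOn ℝ ω g N ∧ g p₀ = 0 ∧
      (∀ p ∈ N, g p = Φ (p, g p)) ∧ ∀ p ∈ N, ∀ z, ‖z‖ < ρ → z = Φ (p, z) → z = g p := by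
  set F : P × E → E := fun q => q.2 - Φ q
  have hF : ContDiff ℝ ω F := contDiff_snd.sub hΦ
  have hFd : fderiv ℝ F (p₀, 0) ∘L .inr ℝ P E = ContinuousLinearMap.id ℝ E := by
    have h1 : HasFDerivAt F (fderiv ℝ F (p₀, 0)) (p₀, 0) :=
      (hF.differentiable (by simp) _).hasFDerivAt
    have h2 : HasFDerivAt (fun z : E => ((p₀, z) : P × E)) (.inr ℝ P E) 0 :=
      hasFDerivAt_prodMk_right p₀ 0
    have h3 := HasFDerivAt.comp (0 : E) h1 h2
    have h4 : HasFDerivAt (fun z => F (p₀, z)) (ContinuousLinearMap.id ℝ E - 0) 0 :=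
      (hasFDerivAt_id (0 : E)).fun_sub hd
    rw [sub_zero] at h4
    exact h3.unique h4
  have hinv : (fderiv ℝ F (p₀, 0) ∘L .inr ℝ P E).IsInvertible := by
    rw [hFd]; exact ⟨ContinuousLinearEquiv.refl ℝ E, rfl⟩
  have hF0 : F (p₀, 0) = 0 := by simp [F, h0]
  have cd := hF.contDiffAt (x := (p₀, (0 : E)))
  have hω : (ω : WithTop ℕ∞) ≠ 0 := by simp
  set g := cd.implicitFunction hω hinv
  have hg0 : g p₀ = 0 := cd.implicitFunction_apply_self hω hinv
  have hg : ContDiffAt ℝ ω g p₀ := cd.contDiffAt_implicitFunction hω hinv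
  have e1 := hg.eventually (by simp)
  have e2 := cd.eventually_apply_implicitFunction hω hinv
  have e3 := cd.eventually_apply_eq_iff_implicitFunction hω hinv
  simp only [hF0] at e2 e3
  -- A neighbourhood of `(p₀, 0)` on which the zeros of `F` form the graph of `g` contains a product
  -- of neighbourhoods. The second factor supplies the radius `ρ` of uniqueness, common to all
  -- nearby parameters.
  rw [nhds_prod_eq] at e3
  obtain ⟨pa, hpa, pb, hpb, hab⟩ := eventually_prod_iff.1 e3
  obtain ⟨ρ, hρ, hball⟩ := Metric.eventually_nhds_iff_ball.1 hpb
  obtain ⟨N, hN, hNo, hpN⟩ := eventually_nhds_iff.1 (e1.and (e2.and hpa))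
  refine ⟨g, N, ρ, hρ, hNo, hpN, fun p hp => (hN p hp).1.contDiffWithinAt, hg0, fun p hp => ?_,
    fun p hp z hz hfix => ?_⟩
  · have := (hN p hp).2.1
    exact sub_eq_zero.1 this
  · have := (hab (hN p hp).2.2 (hball z (by simpa using hz))).1 (sub_eq_zero.2 hfix)
    exact this.symm

/-- The range of `ι` is closed, because `E` is complete and `ι` is bounded below. Difference
quotients of `ι ∘ f` lie in it, hence so do the values of the derivative, which therefore factors
through `ι`. The lower bound on `ι` carries the remainder estimate back to `E`. -/
theorem differentiableAt_of_comp_antilipschitz {E F G : Type} [NormedAddCommGroup E]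
    [NormedSpace ℝ E] [CompleteSpace E] [NormedAddCommGroup F] [NormedSpace ℝ F]
    [NormedAddCommGroup G] [NormedSpace ℝ G] (ι : E →L[ℝ] F) {C : ℝ} (hι : ∀ x, ‖x‖ ≤ C * ‖ι x‖)
    {f : G → E} {x : G} (h : DifferentiableAt ℝ (ι ∘ f) x) : DifferentiableAt ℝ f x := by
  have hinj : Function.Injective ι := by
    refine (injective_iff_map_eq_zero ι).2 fun y hy => ?_
    have := hι y
    rw [hy, norm_zero, mul_zero] at this
    exact norm_le_zero_iff.1 this
  have hanti : AntilipschitzWith (Real.toNNReal C) ι := by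
    refine AddMonoidHomClass.antilipschitz_of_bound ι fun y => (hι y).trans ?_
    gcongr
    exact Real.le_coe_toNNReal C
  have hcl : IsClosed (range ι) := hanti.isClosed_range ι.uniformContinuous
  set D := fderiv ℝ (ι ∘ f) x
  have hD : HasFDerivAt (ι ∘ f) D x := h.hasFDerivAt
  have hmem : ∀ v, D v ∈ LinearMap.range (ι : E →ₗ[ℝ] F) := by
    intro v
    have h1 : HasDerivAt (fun t : ℝ => (ι ∘ f) (x + t • v)) (D v) 0 := hD.hasLineDerivAt v
    have h2 := hasDerivAt_iff_tendsto_slope_zero.1 h1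
    refine hcl.mem_of_tendsto h2 (Eventually.of_forall fun t => ?_)
    refine ⟨t⁻¹ • (f (x + (0 + t) • v) - f (x + (0 : ℝ) • v)), ?_⟩
    rw [map_smul, map_sub]
    rfl
  let e := LinearEquiv.ofInjective (ι : E →ₗ[ℝ] F) hinj
  let L : G →ₗ[ℝ] E := e.symm.toLinearMap ∘ₗ (D : G →ₗ[ℝ] F).codRestrict _ hmem
  have hL : ∀ v, ι (L v) = D v := fun v => by
    have := LinearEquiv.apply_symm_apply e ⟨D v, hmem v⟩
    exact congrArg Subtype.val this
  let L' : G →L[ℝ] E := L.mkContinuous (|C| * ‖D‖) fun v => by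
    refine (hι (L v)).trans ?_
    rw [hL, mul_assoc]
    exact mul_le_mul (le_abs_self C) (D.le_opNorm v) (norm_nonneg _) (abs_nonneg C)
  refine HasFDerivAt.differentiableAt (f' := L') ?_
  rw [hasFDerivAt_iff_isLittleO] at hD ⊢
  refine Asymptotics.IsBigO.trans_isLittleO (Asymptotics.IsBigO.of_bound C
    (Eventually.of_forall fun y => ?_)) hD
  have : ι (f y - f x - L' (y - x)) = (ι ∘ f) y - (ι ∘ f) x - D (y - x) := by
    rw [map_sub, map_sub]
    congr 1
    exact hL _
  rw [← this]
  exact hι _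

/-- Induction on the order, applied to `fderiv ℝ f` and the embedding `A ↦ ι ∘ A` of operator
spaces, which is again bounded below. Since the target changes at each step, the spaces are
quantified inside the induction. -/
theorem contDiffOn_nat_of_comp_antilipschitz (n : ℕ) : ∀ {E F G : Type} [NormedAddCommGroup E]
    [NormedSpace ℝ E] [CompleteSpace E] [NormedAddCommGroup F] [NormedSpace ℝ F]
    [NormedAddCommGroup G] [NormedSpace ℝ G] (ι : E →L[ℝ] F) {C : ℝ}
    (_ : ∀ x, ‖x‖ ≤ C * ‖ι x‖) {f : G → E} {s : Set G} (_ : IsOpen s)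
    (_ : ContDiffOn ℝ n (ι ∘ f) s), ContDiffOn ℝ n f s := by
  induction n with
  | zero =>
    intro E F G _ _ _ _ _ _ _ ι C hι f s hs h
    simp only [CharP.cast_eq_zero, contDiffOn_zero] at h ⊢
    have hanti : AntilipschitzWith (Real.toNNReal C) ι := by
      refine AddMonoidHomClass.antilipschitz_of_bound ι fun y => (hι y).trans ?_
      gcongr
      exact Real.le_coe_toNNReal C
    exact (hanti.isUniformInducing ι.uniformContinuous).isInducing.continuousOn_iff.2 h
  | succ n ih =>
    intro E F G _ _ _ _ _ _ _ ι C hι f s hs h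
    have h' : ContDiffOn ℝ ((n : WithTop ℕ∞) + 1) (ι ∘ f) s := by exact_mod_cast h
    have goal : ContDiffOn ℝ ((n : WithTop ℕ∞) + 1) f s := by
      rw [contDiffOn_succ_iff_fderiv_of_isOpen hs] at h' ⊢
      have hdiff : ∀ x ∈ s, DifferentiableAt ℝ f x := fun x hx =>
        differentiableAt_of_comp_antilipschitz ι hι (h'.1.differentiableAt (hs.mem_nhds hx))
      refine ⟨fun x hx => (hdiff x hx).differentiableWithinAt, fun hn => by simp at hn, ?_⟩
      refine ih (ContinuousLinearMap.compL ℝ G E F ι) (C := |C|) (fun A => ?_) hs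
        (h'.2.2.congr fun x hx => ?_)
      · refine ContinuousLinearMap.opNorm_le_bound _ (by positivity) fun v => ?_
        refine (hι (A v)).trans ?_
        rw [mul_assoc]
        exact mul_le_mul (le_abs_self C) ((ι.comp A).le_opNorm v) (norm_nonneg _) (abs_nonneg C)
      · exact (ι.hasFDerivAt.comp x (hdiff x hx).hasFDerivAt).fderiv.symm
    exact_mod_cast goal

/-- A map is smooth if its composition with a closed linear embedding is. -/
theorem contDiffOn_of_comp_antilipschitz {E F G : Type} [NormedAddCommGroup E]
    [NormedSpace ℝ E] [CompleteSpace E] [NormedAddCommGroup F] [NormedSpace ℝ F]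
    [NormedAddCommGroup G] [NormedSpace ℝ G] (ι : E →L[ℝ] F) {C : ℝ}
    (hι : ∀ x, ‖x‖ ≤ C * ‖ι x‖) {f : G → E} {s : Set G} (hs : IsOpen s)
    (h : ContDiffOn ℝ ∞ (ι ∘ f) s) : ContDiffOn ℝ ∞ f s := by
  rw [contDiffOn_infty] at h ⊢
  exact fun n => contDiffOn_nat_of_comp_antilipschitz n ι hι hs (h n)

/-- Locally unique smooth families of small solutions, defined near every point of a compact set,
patch together. -/
theorem exists_smooth_family {P B X : Type*} [NormedAddCommGroup P] [NormedSpace ℝ P]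
    [NormedAddCommGroup B] [NormedSpace ℝ B] [NormedAddCommGroup X] [NormedSpace ℝ X]
    {K : Set P} (hK : IsCompact K) (Sol : P → B → X → Prop)
    (hloc : ∀ p₀ ∈ K, ∃ N : Set P, ∃ δ > 0, ∃ ρ > 0, ∃ f : P × B → X, IsOpen N ∧ p₀ ∈ N ∧
      ContDiffOn ℝ ∞ f (N ×ˢ Metric.ball 0 δ) ∧ (∀ p ∈ N, f (p, 0) = 0) ∧
      ∀ p ∈ N, ∀ b ∈ Metric.ball (0 : B) δ, Sol p b (f (p, b)) ∧
        ∀ U, ‖U‖ < ρ → Sol p b U → U = f (p, b)) :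
    ∃ Ω : Set P, ∃ δ > 0, ∃ ρ > 0, ∃ g : P × B → X, IsOpen Ω ∧ K ⊆ Ω ∧
      ContDiffOn ℝ ∞ g (Ω ×ˢ Metric.ball 0 δ) ∧ (∀ p ∈ Ω, g (p, 0) = 0) ∧
      ∀ p ∈ Ω, ∀ b ∈ Metric.ball (0 : B) δ, Sol p b (g (p, b)) ∧
        ∀ U, ‖U‖ < ρ → Sol p b U → U = g (p, b) := by
  classical
  -- A candidate without reference to a base point: any solution of norm less than `ρ`. Local
  -- uniqueness makes the choice agree with every local family, so no compatibility of the families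
  -- has to be arranged.
  let G : ℝ → P × B → X := fun ρ q =>
    if h : ∃ U, ‖U‖ < ρ ∧ Sol q.1 q.2 U then h.choose else 0
  -- The property is asked for all radii `ρ' ≤ ρ`, so that two sets can be united with a common
  -- radius and hence with the same candidate `G ρ'`.
  let Q : Set P → Prop := fun s => ∃ ρ > 0, ∀ ρ' > 0, ρ' ≤ ρ → ∃ Ω : Set P, ∃ δ > 0,
    IsOpen Ω ∧ s ⊆ Ω ∧ ContDiffOn ℝ ∞ (G ρ') (Ω ×ˢ Metric.ball 0 δ) ∧
    (∀ p ∈ Ω, G ρ' (p, 0) = 0) ∧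
      ∀ p ∈ Ω, ∀ b ∈ Metric.ball (0 : B) δ, Sol p b (G ρ' (p, b)) ∧
        ∀ U, ‖U‖ < ρ' → Sol p b U → U = G ρ' (p, b)
  suffices h : Q K by
    obtain ⟨ρ, hρ, h⟩ := h
    obtain ⟨Ω, δ, hδ, h1, h2, h3, h4, h5⟩ := h ρ hρ le_rfl
    exact ⟨Ω, δ, hδ, ρ, hρ, G ρ, h1, h2, h3, h4, h5⟩
  refine hK.induction_on (p := Q) ?_ ?_ ?_ ?_
  · refine ⟨1, one_pos, fun ρ' _ _ => ⟨∅, 1, one_pos, isOpen_empty, subset_rfl, ?_, ?_, ?_⟩⟩ <;>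
      simp
  · rintro s t hst ⟨ρ, hρ, h⟩
    refine ⟨ρ, hρ, fun ρ' h1 h2 => ?_⟩
    obtain ⟨Ω, δ, hδ, h1, h2, h3⟩ := h ρ' h1 h2
    exact ⟨Ω, δ, hδ, h1, hst.trans h2, h3⟩
  · rintro s t ⟨ρ₁, hρ₁, h₁⟩ ⟨ρ₂, hρ₂, h₂⟩
    refine ⟨min ρ₁ ρ₂, lt_min hρ₁ hρ₂, fun ρ' hρ' hle => ?_⟩
    obtain ⟨Ω₁, δ₁, hδ₁, o₁, s₁, c₁, z₁, u₁⟩ := h₁ ρ' hρ' (hle.trans (min_le_left _ _))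
    obtain ⟨Ω₂, δ₂, hδ₂, o₂, s₂, c₂, z₂, u₂⟩ := h₂ ρ' hρ' (hle.trans (min_le_right _ _))
    have b₁ : Metric.ball (0 : B) (min δ₁ δ₂) ⊆ Metric.ball 0 δ₁ :=
      Metric.ball_subset_ball (min_le_left _ _)
    have b₂ : Metric.ball (0 : B) (min δ₁ δ₂) ⊆ Metric.ball 0 δ₂ :=
      Metric.ball_subset_ball (min_le_right _ _)
    refine ⟨Ω₁ ∪ Ω₂, min δ₁ δ₂, lt_min hδ₁ hδ₂, o₁.union o₂, union_subset_union s₁ s₂, ?_, ?_, ?_⟩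
    · rw [union_prod]
      exact (c₁.mono (prod_mono le_rfl b₁)).union_of_isOpen (c₂.mono (prod_mono le_rfl b₂))
        (o₁.prod Metric.isOpen_ball) (o₂.prod Metric.isOpen_ball)
    · rintro p (hp | hp)
      exacts [z₁ p hp, z₂ p hp]
    · rintro p (hp | hp) b hb
      exacts [u₁ p hp b (b₁ hb), u₂ p hp b (b₂ hb)]
  · intro p₀ hp₀
    obtain ⟨N, δ, hδ, ρ, hρ, f, hN, hpN, hf, hf0, hu⟩ := hloc p₀ hp₀
    obtain ⟨r, hr, hrN⟩ := Metric.nhds_basis_closedBall.mem_iff.1 (hN.mem_nhds hpN)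
    refine ⟨K ∩ Metric.closedBall p₀ r,
      inter_mem_nhdsWithin K (Metric.closedBall_mem_nhds p₀ hr), ρ, hρ, fun ρ' hρ' hle => ?_⟩
    -- The chosen solution equals `f q` only if `f q` itself has norm below `ρ'`. This holds at `b =
    -- 0`, where `f` vanishes, and by the tube lemma near the compact piece of `K` for small `b`.
    have hopen : IsOpen ((N ×ˢ Metric.ball (0 : B) δ) ∩ f ⁻¹' Metric.ball 0 ρ') :=
      hf.continuousOn.isOpen_inter_preimage (hN.prod Metric.isOpen_ball) Metric.isOpen_ball
    obtain ⟨Ω, v, hΩ, hv, hsΩ, h0v, hsub⟩ := generalized_tube_lemma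
      (hK.inter_right (Metric.isClosed_closedBall (x := p₀) (ε := r)))
      (isCompact_singleton (x := (0 : B))) hopen (by
        rintro ⟨p, b⟩ ⟨hp, hb⟩
        rw [mem_singleton_iff] at hb
        subst hb
        have hpN' : p ∈ N := hrN hp.2
        refine ⟨⟨hpN', Metric.mem_ball_self hδ⟩, ?_⟩
        simp only [mem_preimage]
        rw [hf0 p hpN']
        exact Metric.mem_ball_self hρ')
    obtain ⟨δ', hδ', hball⟩ := Metric.isOpen_iff.1 hv 0 (h0v rfl)
    have hsub' : Ω ×ˢ Metric.ball (0 : B) δ' ⊆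
        (N ×ˢ Metric.ball (0 : B) δ) ∩ f ⁻¹' Metric.ball 0 ρ' :=
      (prod_mono le_rfl hball).trans hsub
    have hG : ∀ q ∈ Ω ×ˢ Metric.ball (0 : B) δ', G ρ' q = f q := by
      intro q hq
      have h1 := hsub' hq
      have hex : ∃ U, ‖U‖ < ρ' ∧ Sol q.1 q.2 U :=
        ⟨f q, by simpa using h1.2, (hu q.1 h1.1.1 q.2 h1.1.2).1⟩
      have h2 : G ρ' q = hex.choose := dif_pos hex
      rw [h2]
      exact (hu q.1 h1.1.1 q.2 h1.1.2).2 _ (hex.choose_spec.1.trans_le hle) hex.choose_spec.2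
    refine ⟨Ω, δ', hδ', hΩ, hsΩ, (hf.mono fun q hq => (hsub' hq).1).congr hG, fun p hp => ?_,
      fun p hp b hb => ?_⟩
    · have hq : (p, (0 : B)) ∈ Ω ×ˢ Metric.ball (0 : B) δ' := ⟨hp, Metric.mem_ball_self hδ'⟩
      rw [hG _ hq]
      exact hf0 p (hsub' hq).1.1
    · have hq : (p, b) ∈ Ω ×ˢ Metric.ball (0 : B) δ' := ⟨hp, hb⟩
      have h1 := hsub' hq
      rw [hG _ hq]
      exact ⟨(hu p h1.1.1 b h1.1.2).1, fun U hU hS =>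
        (hu p h1.1.1 b h1.1.2).2 U (hU.trans_le hle) hS⟩

/-! ### Elements of the weighted spaces -/

theorem half_subset : Ioo (-(1 / 2) : ℝ) (1 / 2) ⊆ Ioo (-1) 1 :=
  Ioo_subset_Ioo (by norm_num) (by norm_num)

theorem iteratedDeriv_succ_eq_of_hasDerivAt {s : Set ℝ} (hs : IsOpen s) {k : ℕ} {f g g' : ℝ → ℝ}
    (hk : ∀ x ∈ s, iteratedDeriv k f x = g x) (hg : ∀ x ∈ s, HasDerivAt g (g' x) x) :
    ∀ x ∈ s, iteratedDeriv (k + 1) f x = g' x := by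
  intro x hx
  rw [iteratedDeriv_succ, ← (hg x hx).deriv]
  refine EventuallyEq.deriv_eq ?_
  filter_upwards [hs.mem_nhds hx] with y hy using hk y hy

theorem contDiffOn_succ_of_hasDerivAt {s : Set ℝ} (hs : IsOpen s) {n : ℕ} {f f' : ℝ → ℝ}
    (hf : ∀ x ∈ s, HasDerivAt f (f' x) x) (h : ContDiffOn ℝ n f' s) :
    ContDiffOn ℝ (n + 1 : ℕ) f s := by
  have : ContDiffOn ℝ ((n : WithTop ℕ∞) + 1) f s := by
    rw [contDiffOn_succ_iff_deriv_of_isOpen hs]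
    exact ⟨fun x hx => (hf x hx).differentiableAt.differentiableWithinAt, fun hn => by simp at hn,
      h.congr fun x hx => (hf x hx).deriv⟩
  exact_mod_cast this

theorem continuousOn_iteratedDeriv {s : Set ℝ} (hs : IsOpen s) {k : ℕ} {f : ℝ → ℝ}
    (h : ContDiffOn ℝ k f s) : ContinuousOn (iteratedDeriv k f) s :=
  (h.continuousOn_iteratedDerivWithin le_rfl hs.uniqueDiffOn).congr fun _ hx =>
    (iteratedDerivWithin_of_isOpen hs hx).symm

theorem hasDerivAt_iteratedDeriv {s : Set ℝ} (hs : IsOpen s) {k : ℕ} {f : ℝ → ℝ}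
    (h : ContDiffOn ℝ (k + 1 : ℕ) f s) {x : ℝ} (hx : x ∈ s) :
    HasDerivAt (iteratedDeriv k f) (iteratedDeriv (k + 1) f x) x := by
  rw [iteratedDeriv_succ]
  refine DifferentiableAt.hasDerivAt ?_
  have h1 := h.differentiableOn_iteratedDerivWithin (m := k) (by exact_mod_cast Nat.lt_succ_self k)
    hs.uniqueDiffOn
  refine ((h1 x hx).differentiableAt (hs.mem_nhds hx)).congr_of_eventuallyEq ?_
  filter_upwards [hs.mem_nhds hx] with y hy using (iteratedDerivWithin_of_isOpen hs hy).symm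

theorem continuousOn_rpow_weight (e : ℝ) :
    ContinuousOn (fun x : ℝ => (1 - x ^ 2) ^ e) (Ioo (-1) 1) :=
  ContinuousOn.rpow_const (by fun_prop) fun _ hx => Or.inl (one_sub_sq_pos hx).ne'

theorem continuousOn_wt {s : Set ℝ} (hs : IsOpen s) (hsub : s ⊆ Ioo (-1) 1) {e : ℝ} {k : ℕ}
    {f : ℝ → ℝ} (h : ContDiffOn ℝ k f s) : ContinuousOn (wt e k f) s :=
  ((continuousOn_rpow_weight e).mono hsub).mul (continuousOn_iteratedDeriv hs h)

theorem continuousOn_Icc_of_bound {σ C : ℝ} (hσ : 0 < σ) {f : ℝ → ℝ}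
    (hf : ContinuousOn f (Ioo (-1) 1)) (hz : ∀ x ∉ Ioo (-1 : ℝ) 1, f x = 0)
    (hb : ∀ x ∈ Ioo (-1 : ℝ) 1, |f x| ≤ C * (1 - x ^ 2) ^ σ) : ContinuousOn f (Icc (-1) 1) := by
  intro x hx
  by_cases hx' : x ∈ Ioo (-1 : ℝ) 1
  · exact (hf.continuousAt (isOpen_Ioo.mem_nhds hx')).continuousWithinAt
  · have h1 : 1 - x ^ 2 = 0 := by
      have : x = -1 ∨ x = 1 := by
        by_contra hne
        push Not at hne
        exact hx' ⟨lt_of_le_of_ne hx.1 (Ne.symm hne.1), lt_of_le_of_ne hx.2 hne.2⟩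
      rcases this with h | h <;> rw [h] <;> norm_num
    have h2 : Tendsto (fun y : ℝ => C * (1 - y ^ 2) ^ σ) (𝓝[Icc (-1) 1] x) (𝓝 0) := by
      have h3 : Continuous fun y : ℝ => C * (1 - y ^ 2) ^ σ :=
        continuous_const.mul (Continuous.rpow_const (by fun_prop) fun y => Or.inr hσ.le)
      have h4 := h3.tendsto x
      rw [h1, Real.zero_rpow hσ.ne', mul_zero] at h4
      exact h4.mono_left nhdsWithin_le_nhds
    rw [ContinuousWithinAt, hz x hx', tendsto_zero_iff_abs_tendsto_zero]
    have h5 : ∀ y ∈ Icc (-1 : ℝ) 1, |f y| ≤ |C| * (1 - y ^ 2) ^ σ := by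
      intro y hy
      have hy2 : 0 ≤ 1 - y ^ 2 := by nlinarith [hy.1, hy.2]
      by_cases hy' : y ∈ Ioo (-1 : ℝ) 1
      · exact (hb y hy').trans (mul_le_mul_of_nonneg_right (le_abs_self C)
          (Real.rpow_nonneg hy2 σ))
      · rw [hz y hy', abs_zero]
        exact mul_nonneg (abs_nonneg C) (Real.rpow_nonneg hy2 σ)
    refine squeeze_zero' (Eventually.of_forall fun y => abs_nonneg _)
      (eventually_nhdsWithin_of_forall h5) ?_
    have h3 : Continuous fun y : ℝ => |C| * (1 - y ^ 2) ^ σ :=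
      continuous_const.mul (Continuous.rpow_const (by fun_prop) fun y => Or.inr hσ.le)
    have h4 := h3.tendsto x
    rw [h1, Real.zero_rpow hσ.ne', mul_zero] at h4
    exact h4.mono_left nhdsWithin_le_nhds

/-- The data by which an element of `M₁(ε)` is recognized: a function and its derivatives. -/
structure M1Data (ε : ℝ) (f f₁ f₂ f₃ : ℝ → ℝ) : Prop where
  deriv1 : ∀ x ∈ Ioo (-1 : ℝ) 1, HasDerivAt f (f₁ x) x
  deriv2 : ∀ x ∈ Ioo (-(1 / 2) : ℝ) (1 / 2), HasDerivAt f₁ (f₂ x) x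
  deriv3 : ∀ x ∈ Ioo (-(1 / 2) : ℝ) (1 / 2), HasDerivAt f₂ (f₃ x) x
  cont1 : ContinuousOn f₁ (Ioo (-1) 1)
  cont3 : ContinuousOn f₃ (Ioo (-(1 / 2)) (1 / 2))
  eq_zero : ∀ x ∉ Ioo (-1 : ℝ) 1, f x = 0
  bdd0 : ∃ C, ∀ x ∈ Ioo (-1 : ℝ) 1, |(1 - x ^ 2) ^ (-1 + 2 * ε) * f x| ≤ C
  bdd1 : ∃ C, ∀ x ∈ Ioo (-1 : ℝ) 1, |(1 - x ^ 2) ^ (2 * ε) * f₁ x| ≤ C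
  bdd2 : ∃ C, ∀ x ∈ Ioo (-(1 / 2) : ℝ) (1 / 2), |f₂ x| ≤ C
  bdd3 : ∃ C, ∀ x ∈ Ioo (-(1 / 2) : ℝ) (1 / 2), |f₃ x| ≤ C

theorem M1Data.iteratedDeriv_one {ε : ℝ} {f f₁ f₂ f₃ : ℝ → ℝ} (h : M1Data ε f f₁ f₂ f₃) :
    ∀ x ∈ Ioo (-1 : ℝ) 1, iteratedDeriv 1 f x = f₁ x :=
  iteratedDeriv_succ_eq_of_hasDerivAt isOpen_Ioo (k := 0) (g := f) (fun x _ => by simp) h.deriv1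

theorem M1Data.iteratedDeriv_two {ε : ℝ} {f f₁ f₂ f₃ : ℝ → ℝ} (h : M1Data ε f f₁ f₂ f₃) :
    ∀ x ∈ Ioo (-(1 / 2) : ℝ) (1 / 2), iteratedDeriv 2 f x = f₂ x :=
  iteratedDeriv_succ_eq_of_hasDerivAt isOpen_Ioo (k := 1)
    (fun x hx => h.iteratedDeriv_one x (half_subset hx)) h.deriv2

theorem M1Data.iteratedDeriv_three {ε : ℝ} {f f₁ f₂ f₃ : ℝ → ℝ} (h : M1Data ε f f₁ f₂ f₃) :
    ∀ x ∈ Ioo (-(1 / 2) : ℝ) (1 / 2), iteratedDeriv 3 f x = f₃ x :=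
  iteratedDeriv_succ_eq_of_hasDerivAt isOpen_Ioo (k := 2) h.iteratedDeriv_two h.deriv3

theorem abs_le_of_weight {x e f C : ℝ} (hx : x ∈ Ioo (-1 : ℝ) 1)
    (h : |(1 - x ^ 2) ^ (-e) * f| ≤ C) : |f| ≤ C * (1 - x ^ 2) ^ e := by
  have hp := Real.rpow_pos_of_pos (one_sub_sq_pos hx) e
  rw [abs_mul, Real.rpow_neg (one_sub_sq_pos hx).le, abs_of_pos (inv_pos.2 hp),
    inv_mul_le_iff₀ hp] at h
  linarith

theorem M1Data.memM1 {ε : ℝ} (hε : ε < 1 / 2) {f f₁ f₂ f₃ : ℝ → ℝ} (h : M1Data ε f f₁ f₂ f₃) :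
    MemM1 ε f where
  contDiffOn_half := by
    have h3 : ContDiffOn ℝ (0 : ℕ) f₃ (Ioo (-(1 / 2)) (1 / 2)) := by
      simpa using h.cont3
    have h2 := contDiffOn_succ_of_hasDerivAt isOpen_Ioo h.deriv3 h3
    have h1 := contDiffOn_succ_of_hasDerivAt isOpen_Ioo h.deriv2 h2
    have h0 := contDiffOn_succ_of_hasDerivAt isOpen_Ioo
      (fun x hx => h.deriv1 x (half_subset hx)) h1
    exact_mod_cast h0
  contDiffOn := by
    have h1 : ContDiffOn ℝ (0 : ℕ) f₁ (Ioo (-1) 1) := by simpa using h.cont1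
    exact_mod_cast contDiffOn_succ_of_hasDerivAt isOpen_Ioo h.deriv1 h1
  continuousOn := by
    obtain ⟨C, hC⟩ := h.bdd0
    refine continuousOn_Icc_of_bound (σ := 1 - 2 * ε) (C := C) (by linarith)
      (fun x hx => (h.deriv1 x hx).continuousAt.continuousWithinAt) h.eq_zero fun x hx => ?_
    refine abs_le_of_weight hx ?_
    convert hC x hx using 4
    ring
  eq_zero := h.eq_zero
  bdd0 := by
    obtain ⟨C, hC⟩ := h.bdd0
    exact bddOn_of_le (C := C) fun x hx => by simpa [wt] using hC x hx
  bdd1 := by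
    obtain ⟨C, hC⟩ := h.bdd1
    exact bddOn_of_le (C := C) fun x hx => by
      rw [wt, h.iteratedDeriv_one x hx]; exact hC x hx
  bdd2 := by
    obtain ⟨C, hC⟩ := h.bdd2
    exact bddOn_of_le (C := C) fun x hx => by rw [h.iteratedDeriv_two x hx]; exact hC x hx
  bdd3 := by
    obtain ⟨C, hC⟩ := h.bdd3
    exact bddOn_of_le (C := C) fun x hx => by rw [h.iteratedDeriv_three x hx]; exact hC x hx

/-- The data by which an element of `M₂(ε)` is recognized: a function and its derivatives. -/
structure M2Data (ε : ℝ) (f f₁ f₂ : ℝ → ℝ) : Prop where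
  deriv1 : ∀ x ∈ Ioo (-1 : ℝ) 1, HasDerivAt f (f₁ x) x
  deriv2 : ∀ x ∈ Ioo (-1 : ℝ) 1, HasDerivAt f₁ (f₂ x) x
  cont2 : ContinuousOn f₂ (Ioo (-1) 1)
  eq_zero : ∀ x ∉ Ioo (-1 : ℝ) 1, f x = 0
  bdd0 : ∃ C, ∀ x ∈ Ioo (-1 : ℝ) 1, |(1 - x ^ 2) ^ ε * f x| ≤ C
  bdd1 : ∃ C, ∀ x ∈ Ioo (-1 : ℝ) 1, |(1 - x ^ 2) ^ (1 + ε) * f₁ x| ≤ C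
  bdd2 : ∃ C, ∀ x ∈ Ioo (-1 : ℝ) 1, |(1 - x ^ 2) ^ (2 + ε) * f₂ x| ≤ C

theorem M2Data.iteratedDeriv_one {ε : ℝ} {f f₁ f₂ : ℝ → ℝ} (h : M2Data ε f f₁ f₂) :
    ∀ x ∈ Ioo (-1 : ℝ) 1, iteratedDeriv 1 f x = f₁ x :=
  iteratedDeriv_succ_eq_of_hasDerivAt isOpen_Ioo (k := 0) (g := f) (fun x _ => by simp) h.deriv1

theorem M2Data.iteratedDeriv_two {ε : ℝ} {f f₁ f₂ : ℝ → ℝ} (h : M2Data ε f f₁ f₂) :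
    ∀ x ∈ Ioo (-1 : ℝ) 1, iteratedDeriv 2 f x = f₂ x :=
  iteratedDeriv_succ_eq_of_hasDerivAt isOpen_Ioo (k := 1) h.iteratedDeriv_one h.deriv2

theorem M2Data.memM2 {ε : ℝ} {f f₁ f₂ : ℝ → ℝ} (h : M2Data ε f f₁ f₂) : MemM2 ε f where
  contDiffOn := by
    have h2 : ContDiffOn ℝ (0 : ℕ) f₂ (Ioo (-1) 1) := by simpa using h.cont2
    have h1 := contDiffOn_succ_of_hasDerivAt isOpen_Ioo h.deriv2 h2
    exact_mod_cast contDiffOn_succ_of_hasDerivAt isOpen_Ioo h.deriv1 h1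
  eq_zero := h.eq_zero
  bdd0 := by
    obtain ⟨C, hC⟩ := h.bdd0
    exact bddOn_of_le (C := C) fun x hx => by simpa [wt] using hC x hx
  bdd1 := by
    obtain ⟨C, hC⟩ := h.bdd1
    exact bddOn_of_le (C := C) fun x hx => by
      rw [wt, h.iteratedDeriv_one x hx]; exact hC x hx
  bdd2 := by
    obtain ⟨C, hC⟩ := h.bdd2
    exact bddOn_of_le (C := C) fun x hx => by
      rw [wt, h.iteratedDeriv_two x hx]; exact hC x hx

/-! ### The embedding of `X` into a product of spaces of bounded continuous functions -/

/-- The weighted derivative `(1-x²)^e f^{(k)}` as a bounded continuous function. -/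
def cmp (s : Set ℝ) (e : ℝ) (k : ℕ) (f : ℝ → ℝ) : Cb s := toCb s (wt e k f)

/-- The weighted derivative `(1-x²)^e f^{(k)}` is bounded and continuous on `s`. -/
def HasCmp (s : Set ℝ) (e : ℝ) (k : ℕ) (f : ℝ → ℝ) : Prop :=
  ContDiffOn ℝ k f s ∧ BddOn s (wt e k f)

theorem wt_zero_exponent (k : ℕ) (f : ℝ → ℝ) : wt 0 k f = iteratedDeriv k f := by
  funext x; simp [wt]

theorem ev_cmp {s : Set ℝ} (hs : IsOpen s) (hsub : s ⊆ Ioo (-1) 1) {e : ℝ} {k : ℕ} {f : ℝ → ℝ}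
    (h : HasCmp s e k f) {x : ℝ} (hx : x ∈ s) : ev (cmp s e k f) x = wt e k f x :=
  ev_toCb (continuousOn_wt hs hsub h.1) (fun _ hy => le_supOn h.2 hy) hx

theorem norm_cmp {s : Set ℝ} (hs : IsOpen s) (hsub : s ⊆ Ioo (-1) 1) {e : ℝ} {k : ℕ} {f : ℝ → ℝ}
    (h : HasCmp s e k f) : ‖cmp s e k f‖ = supOn s (wt e k f) := by
  refine le_antisymm (norm_le_of_ev (supOn_nonneg _ _) fun x hx => ?_)
    (supOn_le (norm_nonneg _) fun x hx => ?_)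
  · rw [ev_cmp hs hsub h hx]; exact le_supOn h.2 hx
  · rw [← ev_cmp hs hsub h hx]; exact abs_ev_le _ x

theorem cmp_add {s : Set ℝ} (hs : IsOpen s) (hsub : s ⊆ Ioo (-1) 1) {e : ℝ} {k : ℕ} {f g : ℝ → ℝ}
    (hf : HasCmp s e k f) (hg : HasCmp s e k g) :
    cmp s e k (f + g) = cmp s e k f + cmp s e k g := by
  have hfg : HasCmp s e k (f + g) := ⟨hf.1.add hg.1, bddOn_add hf.2 hg.2 (wt_add hs hf.1 hg.1)⟩
  refine ev_ext fun x hx => ?_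
  rw [ev_add, ev_cmp hs hsub hf hx, ev_cmp hs hsub hg hx, ev_cmp hs hsub hfg hx,
    wt_add hs hf.1 hg.1 x hx]

theorem cmp_smul {s : Set ℝ} (hs : IsOpen s) (hsub : s ⊆ Ioo (-1) 1) {e : ℝ} {k : ℕ} (r : ℝ)
    {f : ℝ → ℝ} (hf : HasCmp s e k f) : cmp s e k (r • f) = r • cmp s e k f := by
  have hrf : HasCmp s e k (r • f) :=
    ⟨contDiffOn_const.smul hf.1, bddOn_smul r hf.2 fun x _ => wt_smul _ _ r f x⟩
  refine ev_ext fun x hx => ?_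
  rw [ev_smul, ev_cmp hs hsub hf hx, ev_cmp hs hsub hrf hx, wt_smul]

theorem M1.hasCmp0 {ε : ℝ} (f : M1 ε) : HasCmp (Ioo (-1) 1) (-1 + 2 * ε) 0 f.toFun :=
  ⟨f.mem.contDiffOn.of_le (by norm_num), f.mem.bdd0⟩

theorem M1.hasCmp1 {ε : ℝ} (f : M1 ε) : HasCmp (Ioo (-1) 1) (2 * ε) 1 f.toFun :=
  ⟨f.mem.contDiffOn, f.mem.bdd1⟩

theorem M1.hasCmp2 {ε : ℝ} (f : M1 ε) : HasCmp (Ioo (-(1 / 2)) (1 / 2)) 0 2 f.toFun :=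
  ⟨f.mem.contDiffOn_half.of_le (by norm_num), by rw [wt_zero_exponent]; exact f.mem.bdd2⟩

theorem M1.hasCmp3 {ε : ℝ} (f : M1 ε) : HasCmp (Ioo (-(1 / 2)) (1 / 2)) 0 3 f.toFun :=
  ⟨f.mem.contDiffOn_half, by rw [wt_zero_exponent]; exact f.mem.bdd3⟩

theorem M2.hasCmp0 {ε : ℝ} (f : M2 ε) : HasCmp (Ioo (-1) 1) ε 0 f.toFun :=
  ⟨f.mem.contDiffOn.of_le (by norm_num), f.mem.bdd0⟩

theorem M2.hasCmp1 {ε : ℝ} (f : M2 ε) : HasCmp (Ioo (-1) 1) (1 + ε) 1 f.toFun :=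
  ⟨f.mem.contDiffOn.of_le (by norm_num), f.mem.bdd1⟩

theorem M2.hasCmp2 {ε : ℝ} (f : M2 ε) : HasCmp (Ioo (-1) 1) (2 + ε) 2 f.toFun :=
  ⟨f.mem.contDiffOn, f.mem.bdd2⟩

/-- The target of the embedding of `M₁(ε)`. -/
abbrev Y1 : Type := (Cb (Ioo (-1) 1) × Cb (Ioo (-1) 1)) ×
  (Cb (Ioo (-(1 / 2)) (1 / 2)) × Cb (Ioo (-(1 / 2)) (1 / 2)))

/-- The target of the embedding of `M₂(ε)`. -/
abbrev Y2 : Type := Cb (Ioo (-1) 1) × (Cb (Ioo (-1) 1) × Cb (Ioo (-1) 1))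

/-- An element of `M₁(ε)` as the tuple of its weighted derivatives. -/
def emb1 (ε : ℝ) : M1 ε →L[ℝ] Y1 :=
  LinearMap.mkContinuous
    { toFun := fun f => ((cmp (Ioo (-1) 1) (-1 + 2 * ε) 0 f.toFun,
          cmp (Ioo (-1) 1) (2 * ε) 1 f.toFun),
        (cmp (Ioo (-(1 / 2)) (1 / 2)) 0 2 f.toFun, cmp (Ioo (-(1 / 2)) (1 / 2)) 0 3 f.toFun))
      map_add' := fun f g => by
        simp only [M1.toFun_add]
        rw [cmp_add isOpen_Ioo subset_rfl f.hasCmp0 g.hasCmp0,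
          cmp_add isOpen_Ioo subset_rfl f.hasCmp1 g.hasCmp1,
          cmp_add isOpen_Ioo half_subset f.hasCmp2 g.hasCmp2,
          cmp_add isOpen_Ioo half_subset f.hasCmp3 g.hasCmp3]
        rfl
      map_smul' := fun r f => by
        simp only [M1.toFun_smul]
        rw [cmp_smul isOpen_Ioo subset_rfl r f.hasCmp0,
          cmp_smul isOpen_Ioo subset_rfl r f.hasCmp1,
          cmp_smul isOpen_Ioo half_subset r f.hasCmp2,
          cmp_smul isOpen_Ioo half_subset r f.hasCmp3]
        rfl } 1 fun f => by
    rw [one_mul, M1.norm_def]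
    have n0 := supOn_nonneg (Ioo (-1) 1) (wt (-1 + 2 * ε) 0 f.toFun)
    have n1 := supOn_nonneg (Ioo (-1) 1) (wt (2 * ε) 1 f.toFun)
    have n2 := supOn_nonneg (Ioo (-(1 / 2)) (1 / 2)) (iteratedDeriv 2 f.toFun)
    have n3 := supOn_nonneg (Ioo (-(1 / 2)) (1 / 2)) (iteratedDeriv 3 f.toFun)
    simp only [LinearMap.coe_mk, AddHom.coe_mk, Prod.norm_def, sup_le_iff]
    rw [norm_cmp isOpen_Ioo subset_rfl f.hasCmp0, norm_cmp isOpen_Ioo subset_rfl f.hasCmp1,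
      norm_cmp isOpen_Ioo half_subset f.hasCmp2, norm_cmp isOpen_Ioo half_subset f.hasCmp3,
      wt_zero_exponent, wt_zero_exponent]
    refine ⟨⟨?_, ?_⟩, ?_, ?_⟩ <;> linarith

theorem emb1_apply {ε : ℝ} (f : M1 ε) : emb1 ε f = ((cmp (Ioo (-1) 1) (-1 + 2 * ε) 0 f.toFun,
    cmp (Ioo (-1) 1) (2 * ε) 1 f.toFun),
    (cmp (Ioo (-(1 / 2)) (1 / 2)) 0 2 f.toFun, cmp (Ioo (-(1 / 2)) (1 / 2)) 0 3 f.toFun)) := rfl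

theorem norm_le_emb1 {ε : ℝ} (f : M1 ε) : ‖f‖ ≤ 4 * ‖emb1 ε f‖ := by
  rw [M1.norm_def, ← wt_zero_exponent, ← wt_zero_exponent,
    ← norm_cmp isOpen_Ioo subset_rfl f.hasCmp0, ← norm_cmp isOpen_Ioo subset_rfl f.hasCmp1,
    ← norm_cmp isOpen_Ioo half_subset f.hasCmp2, ← norm_cmp isOpen_Ioo half_subset f.hasCmp3]
  have h1 := (norm_fst_le (emb1 ε f).1).trans (norm_fst_le (emb1 ε f))
  have h2 := (norm_snd_le (emb1 ε f).1).trans (norm_fst_le (emb1 ε f))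
  have h3 := (norm_fst_le (emb1 ε f).2).trans (norm_snd_le (emb1 ε f))
  have h4 := (norm_snd_le (emb1 ε f).2).trans (norm_snd_le (emb1 ε f))
  simp only [emb1_apply] at h1 h2 h3 h4 ⊢
  linarith

/-- An element of `M₂(ε)` as the tuple of its weighted derivatives. -/
def emb2 (ε : ℝ) : M2 ε →L[ℝ] Y2 :=
  LinearMap.mkContinuous
    { toFun := fun f => (cmp (Ioo (-1) 1) ε 0 f.toFun,
        (cmp (Ioo (-1) 1) (1 + ε) 1 f.toFun, cmp (Ioo (-1) 1) (2 + ε) 2 f.toFun))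
      map_add' := fun f g => by
        simp only [M2.toFun_add]
        rw [cmp_add isOpen_Ioo subset_rfl f.hasCmp0 g.hasCmp0,
          cmp_add isOpen_Ioo subset_rfl f.hasCmp1 g.hasCmp1,
          cmp_add isOpen_Ioo subset_rfl f.hasCmp2 g.hasCmp2]
        rfl
      map_smul' := fun r f => by
        simp only [M2.toFun_smul]
        rw [cmp_smul isOpen_Ioo subset_rfl r f.hasCmp0,
          cmp_smul isOpen_Ioo subset_rfl r f.hasCmp1,
          cmp_smul isOpen_Ioo subset_rfl r f.hasCmp2]
        rfl } 1 fun f => by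
    rw [one_mul, M2.norm_def]
    have n0 := supOn_nonneg (Ioo (-1) 1) (wt ε 0 f.toFun)
    have n1 := supOn_nonneg (Ioo (-1) 1) (wt (1 + ε) 1 f.toFun)
    have n2 := supOn_nonneg (Ioo (-1) 1) (wt (2 + ε) 2 f.toFun)
    simp only [LinearMap.coe_mk, AddHom.coe_mk, Prod.norm_def, sup_le_iff]
    rw [norm_cmp isOpen_Ioo subset_rfl f.hasCmp0, norm_cmp isOpen_Ioo subset_rfl f.hasCmp1,
      norm_cmp isOpen_Ioo subset_rfl f.hasCmp2]
    refine ⟨?_, ?_, ?_⟩ <;> linarith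

theorem emb2_apply {ε : ℝ} (f : M2 ε) : emb2 ε f = (cmp (Ioo (-1) 1) ε 0 f.toFun,
    (cmp (Ioo (-1) 1) (1 + ε) 1 f.toFun, cmp (Ioo (-1) 1) (2 + ε) 2 f.toFun)) := rfl

theorem norm_le_emb2 {ε : ℝ} (f : M2 ε) : ‖f‖ ≤ 3 * ‖emb2 ε f‖ := by
  rw [M2.norm_def, ← norm_cmp isOpen_Ioo subset_rfl f.hasCmp0,
    ← norm_cmp isOpen_Ioo subset_rfl f.hasCmp1, ← norm_cmp isOpen_Ioo subset_rfl f.hasCmp2]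
  have h1 := norm_fst_le (emb2 ε f)
  have h2 := (norm_fst_le (emb2 ε f).2).trans (norm_snd_le (emb2 ε f))
  have h3 := (norm_snd_le (emb2 ε f).2).trans (norm_snd_le (emb2 ε f))
  simp only [emb2_apply] at h1 h2 h3 ⊢
  linarith

/-! ### Completeness -/

theorem tendsto_ev {s : Set ℝ} {z : ℕ → Cb s} {w : Cb s} (h : Tendsto z atTop (𝓝 w)) (x : ℝ) :
    Tendsto (fun n => ev (z n) x) atTop (𝓝 (ev w x)) :=
  ((evL x).continuous.tendsto w).comp h

/-- The derivatives pass to the limit if they converge after multiplication by a weight. -/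
theorem hasDerivAt_of_tendsto_weighted {s : Set ℝ} (hs : IsOpen s) {f : ℕ → ℝ → ℝ} {g W : ℝ → ℝ}
    (hW : ContinuousOn W s) {z : ℕ → Cb s} {w : Cb s} (hz : Tendsto z atTop (𝓝 w))
    (hf : ∀ n, ∀ x ∈ s, HasDerivAt (f n) (W x * ev (z n) x) x)
    (hg : ∀ x ∈ s, Tendsto (fun n => f n x) atTop (𝓝 (g x))) :
    ∀ x ∈ s, HasDerivAt g (W x * ev w x) x := by
  intro x hx
  refine hasDerivAt_of_tendstoLocallyUniformlyOn (l := atTop) hs (f := f)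
    (f' := fun n x => W x * ev (z n) x) (g' := fun x => W x * ev w x) ?_
    (Eventually.of_forall hf) hg hx
  rw [Metric.tendstoLocallyUniformlyOn_iff]
  intro r hr y hy
  have h1 : ∀ᶠ t in 𝓝[s] y, |W t| < |W y| + 1 :=
    (hW y hy).abs.eventually (gt_mem_nhds (lt_add_one _))
  refine ⟨_, h1, ?_⟩
  have h2 : 0 < r / (|W y| + 1) := by positivity
  filter_upwards [Metric.tendsto_nhds.1 hz _ h2] with n hn t ht
  have ht' : |W t| < |W y| + 1 := ht
  rw [dist_comm, Real.dist_eq, ← mul_sub, ← ev_sub, abs_mul]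
  rw [dist_eq_norm, lt_div_iff₀ (by positivity)] at hn
  calc |W t| * |ev (z n - w) t| ≤ (|W y| + 1) * ‖z n - w‖ :=
        mul_le_mul ht'.le (abs_ev_le _ _) (abs_nonneg _) (by positivity)
    _ < r := by linarith

theorem rpow_neg_mul_rpow {x : ℝ} (hx : x ∈ Ioo (-1 : ℝ) 1) (e : ℝ) :
    (1 - x ^ 2) ^ (-e) * (1 - x ^ 2) ^ e = 1 := by
  rw [← Real.rpow_add (one_sub_sq_pos hx)]
  simp

/-- The range of the embedding is closed. Uniform convergence of the weighted derivatives is locally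
uniform convergence of the derivatives, so the limits are again successive derivatives of one
function. The condition `ε < 1/2` gives its continuity up to `±1`. -/
theorem M1.exists_of_tendsto {ε : ℝ} (hε : ε < 1 / 2) {f : ℕ → M1 ε} {y : Y1}
    (h : Tendsto (fun n => emb1 ε (f n)) atTop (𝓝 y)) : ∃ g : M1 ε, emb1 ε g = y := by
  obtain ⟨⟨y0, y1⟩, y2, y3⟩ := y
  have t0 : Tendsto (fun n => (emb1 ε (f n)).1.1) atTop (𝓝 y0) :=
    ((continuous_fst.comp continuous_fst).tendsto _).comp h
  have t1 : Tendsto (fun n => (emb1 ε (f n)).1.2) atTop (𝓝 y1) :=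
    ((continuous_snd.comp continuous_fst).tendsto _).comp h
  have t2 : Tendsto (fun n => (emb1 ε (f n)).2.1) atTop (𝓝 y2) :=
    ((continuous_fst.comp continuous_snd).tendsto _).comp h
  have t3 : Tendsto (fun n => (emb1 ε (f n)).2.2) atTop (𝓝 y3) :=
    ((continuous_snd.comp continuous_snd).tendsto _).comp h
  simp only [emb1_apply] at t0 t1 t2 t3
  set F : ℝ → ℝ := fun x => (1 - x ^ 2) ^ (-(-1 + 2 * ε)) * ev y0 x
  set F1 : ℝ → ℝ := fun x => (1 - x ^ 2) ^ (-(2 * ε)) * ev y1 x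
  have l0 : ∀ x ∈ Ioo (-1 : ℝ) 1, Tendsto (fun n => (f n).toFun x) atTop (𝓝 (F x)) := by
    intro x hx
    refine ((tendsto_ev t0 x).const_mul ((1 - x ^ 2) ^ (-(-1 + 2 * ε)))).congr fun n => ?_
    rw [ev_cmp isOpen_Ioo subset_rfl (f n).hasCmp0 hx, wt, ← mul_assoc, rpow_neg_mul_rpow hx]
    simp
  have l1 : ∀ x ∈ Ioo (-1 : ℝ) 1,
      Tendsto (fun n => iteratedDeriv 1 (f n).toFun x) atTop (𝓝 (F1 x)) := by
    intro x hx
    refine ((tendsto_ev t1 x).const_mul ((1 - x ^ 2) ^ (-(2 * ε)))).congr fun n => ?_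
    rw [ev_cmp isOpen_Ioo subset_rfl (f n).hasCmp1 hx, wt, ← mul_assoc, rpow_neg_mul_rpow hx,
      one_mul]
  have l2 : ∀ x ∈ Ioo (-(1 / 2) : ℝ) (1 / 2),
      Tendsto (fun n => iteratedDeriv 2 (f n).toFun x) atTop (𝓝 (ev y2 x)) := by
    intro x hx
    refine (tendsto_ev t2 x).congr fun n => ?_
    rw [ev_cmp isOpen_Ioo half_subset (f n).hasCmp2 hx, wt_zero_exponent]
  have d1 : ∀ x ∈ Ioo (-1 : ℝ) 1, HasDerivAt F (F1 x) x := by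
    refine hasDerivAt_of_tendsto_weighted isOpen_Ioo (continuousOn_rpow_weight _) t1
      (fun n x hx => ?_) l0
    rw [ev_cmp isOpen_Ioo subset_rfl (f n).hasCmp1 hx, wt, ← mul_assoc, rpow_neg_mul_rpow hx,
      one_mul]
    simpa using hasDerivAt_iteratedDeriv isOpen_Ioo (k := 0)
      (by exact_mod_cast (f n).mem.contDiffOn) hx
  have d2 : ∀ x ∈ Ioo (-(1 / 2) : ℝ) (1 / 2), HasDerivAt F1 (ev y2 x) x := by
    intro x hx
    have := hasDerivAt_of_tendsto_weighted (W := fun _ => 1) (g := F1) isOpen_Ioo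
      continuousOn_const t2
      (f := fun n => iteratedDeriv 1 (f n).toFun) (fun n x hx => ?_)
      (fun x hx => l1 x (half_subset hx)) x hx
    · simpa using this
    · rw [ev_cmp isOpen_Ioo half_subset (f n).hasCmp2 hx, wt_zero_exponent, one_mul]
      exact hasDerivAt_iteratedDeriv isOpen_Ioo (f n).hasCmp2.1 hx
  have d3 : ∀ x ∈ Ioo (-(1 / 2) : ℝ) (1 / 2), HasDerivAt (ev y2) (ev y3 x) x := by
    intro x hx
    have := hasDerivAt_of_tendsto_weighted (W := fun _ => 1) (g := ev y2) isOpen_Ioo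
      continuousOn_const t3
      (f := fun n => iteratedDeriv 2 (f n).toFun) (fun n x hx => ?_) l2 x hx
    · simpa using this
    · rw [ev_cmp isOpen_Ioo half_subset (f n).hasCmp3 hx, wt_zero_exponent, one_mul]
      exact hasDerivAt_iteratedDeriv isOpen_Ioo (f n).hasCmp3.1 hx
  have w0 : ∀ x ∈ Ioo (-1 : ℝ) 1, (1 - x ^ 2) ^ (-1 + 2 * ε) * F x = ev y0 x := by
    intro x hx
    simp only [F]
    rw [← mul_assoc, mul_comm ((1 - x ^ 2) ^ _), rpow_neg_mul_rpow hx, one_mul]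
  have w1 : ∀ x ∈ Ioo (-1 : ℝ) 1, (1 - x ^ 2) ^ (2 * ε) * F1 x = ev y1 x := by
    intro x hx
    simp only [F1]
    rw [← mul_assoc, mul_comm ((1 - x ^ 2) ^ _), rpow_neg_mul_rpow hx, one_mul]
  have hdata : M1Data ε F F1 (ev y2) (ev y3) :=
    { deriv1 := d1
      deriv2 := d2
      deriv3 := d3
      cont1 := (continuousOn_rpow_weight _).mul (continuousOn_ev y1)
      cont3 := continuousOn_ev y3
      eq_zero := fun x hx => by simp only [F]; rw [ev_of_notMem _ hx, mul_zero]
      bdd0 := ⟨‖y0‖, fun x hx => by rw [w0 x hx]; exact abs_ev_le _ _⟩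
      bdd1 := ⟨‖y1‖, fun x hx => by rw [w1 x hx]; exact abs_ev_le _ _⟩
      bdd2 := ⟨‖y2‖, fun x _ => abs_ev_le _ _⟩
      bdd3 := ⟨‖y3‖, fun x _ => abs_ev_le _ _⟩ }
  let g : M1 ε := ⟨F, hdata.memM1 hε⟩
  have hg : g.toFun = F := rfl
  refine ⟨g, ?_⟩
  rw [emb1_apply]
  refine Prod.ext (Prod.ext (ev_ext fun x hx => ?_) (ev_ext fun x hx => ?_))
    (Prod.ext (ev_ext fun x hx => ?_) (ev_ext fun x hx => ?_))
  · rw [ev_cmp isOpen_Ioo subset_rfl g.hasCmp0 hx, wt, iteratedDeriv_zero, hg, w0 x hx]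
  · rw [ev_cmp isOpen_Ioo subset_rfl g.hasCmp1 hx, wt, hg, hdata.iteratedDeriv_one x hx, w1 x hx]
  · rw [ev_cmp isOpen_Ioo half_subset g.hasCmp2 hx, wt_zero_exponent, hg,
      hdata.iteratedDeriv_two x hx]
  · rw [ev_cmp isOpen_Ioo half_subset g.hasCmp3 hx, wt_zero_exponent, hg,
      hdata.iteratedDeriv_three x hx]

theorem M2.exists_of_tendsto {ε : ℝ} {f : ℕ → M2 ε} {y : Y2}
    (h : Tendsto (fun n => emb2 ε (f n)) atTop (𝓝 y)) : ∃ g : M2 ε, emb2 ε g = y := by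
  obtain ⟨y0, y1, y2⟩ := y
  have t0 : Tendsto (fun n => (emb2 ε (f n)).1) atTop (𝓝 y0) :=
    (continuous_fst.tendsto _).comp h
  have t1 : Tendsto (fun n => (emb2 ε (f n)).2.1) atTop (𝓝 y1) :=
    ((continuous_fst.comp continuous_snd).tendsto _).comp h
  have t2 : Tendsto (fun n => (emb2 ε (f n)).2.2) atTop (𝓝 y2) :=
    ((continuous_snd.comp continuous_snd).tendsto _).comp h
  simp only [emb2_apply] at t0 t1 t2
  set F : ℝ → ℝ := fun x => (1 - x ^ 2) ^ (-ε) * ev y0 x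
  set F1 : ℝ → ℝ := fun x => (1 - x ^ 2) ^ (-(1 + ε)) * ev y1 x
  set F2 : ℝ → ℝ := fun x => (1 - x ^ 2) ^ (-(2 + ε)) * ev y2 x
  have l0 : ∀ x ∈ Ioo (-1 : ℝ) 1, Tendsto (fun n => (f n).toFun x) atTop (𝓝 (F x)) := by
    intro x hx
    refine ((tendsto_ev t0 x).const_mul ((1 - x ^ 2) ^ (-ε))).congr fun n => ?_
    rw [ev_cmp isOpen_Ioo subset_rfl (f n).hasCmp0 hx, wt, ← mul_assoc, rpow_neg_mul_rpow hx]
    simp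
  have l1 : ∀ x ∈ Ioo (-1 : ℝ) 1,
      Tendsto (fun n => iteratedDeriv 1 (f n).toFun x) atTop (𝓝 (F1 x)) := by
    intro x hx
    refine ((tendsto_ev t1 x).const_mul ((1 - x ^ 2) ^ (-(1 + ε)))).congr fun n => ?_
    rw [ev_cmp isOpen_Ioo subset_rfl (f n).hasCmp1 hx, wt, ← mul_assoc, rpow_neg_mul_rpow hx,
      one_mul]
  have d1 : ∀ x ∈ Ioo (-1 : ℝ) 1, HasDerivAt F (F1 x) x := by
    refine hasDerivAt_of_tendsto_weighted isOpen_Ioo (continuousOn_rpow_weight _) t1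
      (fun n x hx => ?_) l0
    rw [ev_cmp isOpen_Ioo subset_rfl (f n).hasCmp1 hx, wt, ← mul_assoc, rpow_neg_mul_rpow hx,
      one_mul]
    simpa using hasDerivAt_iteratedDeriv isOpen_Ioo (k := 0) (f n).hasCmp1.1 hx
  have d2 : ∀ x ∈ Ioo (-1 : ℝ) 1, HasDerivAt F1 (F2 x) x := by
    refine hasDerivAt_of_tendsto_weighted isOpen_Ioo (continuousOn_rpow_weight _) t2
      (fun n x hx => ?_) l1
    rw [ev_cmp isOpen_Ioo subset_rfl (f n).hasCmp2 hx, wt, ← mul_assoc, rpow_neg_mul_rpow hx,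
      one_mul]
    exact hasDerivAt_iteratedDeriv isOpen_Ioo (f n).hasCmp2.1 hx
  have cancel : ∀ (e : ℝ) (z : Cb (Ioo (-1) 1)), ∀ x ∈ Ioo (-1 : ℝ) 1,
      (1 - x ^ 2) ^ e * ((1 - x ^ 2) ^ (-e) * ev z x) = ev z x := by
    intro e z x hx
    rw [← mul_assoc, mul_comm ((1 - x ^ 2) ^ _), rpow_neg_mul_rpow hx, one_mul]
  have hdata : M2Data ε F F1 F2 :=
    { deriv1 := d1
      deriv2 := d2
      cont2 := (continuousOn_rpow_weight _).mul (continuousOn_ev y2)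
      eq_zero := fun x hx => by simp only [F]; rw [ev_of_notMem _ hx, mul_zero]
      bdd0 := ⟨‖y0‖, fun x hx => by rw [cancel _ _ x hx]; exact abs_ev_le _ _⟩
      bdd1 := ⟨‖y1‖, fun x hx => by rw [cancel _ _ x hx]; exact abs_ev_le _ _⟩
      bdd2 := ⟨‖y2‖, fun x hx => by rw [cancel _ _ x hx]; exact abs_ev_le _ _⟩ }
  let g : M2 ε := ⟨F, hdata.memM2⟩
  have hg : g.toFun = F := rfl
  refine ⟨g, ?_⟩
  rw [emb2_apply]
  refine Prod.ext (ev_ext fun x hx => ?_) (Prod.ext (ev_ext fun x hx => ?_)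
    (ev_ext fun x hx => ?_))
  · rw [ev_cmp isOpen_Ioo subset_rfl g.hasCmp0 hx, wt, iteratedDeriv_zero, hg, cancel _ _ x hx]
  · rw [ev_cmp isOpen_Ioo subset_rfl g.hasCmp1 hx, wt, hg, hdata.iteratedDeriv_one x hx,
      cancel _ _ x hx]
  · rw [ev_cmp isOpen_Ioo subset_rfl g.hasCmp2 hx, wt, hg, hdata.iteratedDeriv_two x hx,
      cancel _ _ x hx]

theorem completeSpace_of_embedding {E F : Type*} [NormedAddCommGroup E] [NormedSpace ℝ E]
    [NormedAddCommGroup F] [NormedSpace ℝ F] [CompleteSpace F] (ι : E →L[ℝ] F) {C : ℝ}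
    (hι : ∀ x, ‖x‖ ≤ C * ‖ι x‖)
    (h : ∀ (f : ℕ → E) (y : F), Tendsto (fun n => ι (f n)) atTop (𝓝 y) → ∃ g, ι g = y) :
    CompleteSpace E := by
  refine Metric.complete_of_cauchySeq_tendsto fun f hf => ?_
  obtain ⟨y, hy⟩ := cauchySeq_tendsto_of_complete (ι.uniformContinuous.comp_cauchySeq hf)
  obtain ⟨g, rfl⟩ := h f y hy
  refine ⟨g, tendsto_iff_norm_sub_tendsto_zero.2 ?_⟩
  have h1 := (tendsto_iff_norm_sub_tendsto_zero.1 hy).const_mul C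
  rw [mul_zero] at h1
  refine squeeze_zero (fun n => norm_nonneg _) (fun n => ?_) h1
  have := hι (f n - g)
  rwa [map_sub] at this

theorem M1.completeSpace {ε : ℝ} (hε : ε < 1 / 2) : CompleteSpace (M1 ε) :=
  completeSpace_of_embedding (emb1 ε) norm_le_emb1 fun _ _ h => M1.exists_of_tendsto hε h

instance M2.completeSpace (ε : ℝ) : CompleteSpace (M2 ε) :=
  completeSpace_of_embedding (emb2 ε) norm_le_emb2 fun _ _ h => M2.exists_of_tendsto h

/-! ### Solutions without swirl: uniqueness and maximality -/

theorem continuous_P (c : Fin 3 → ℝ) : Continuous (P c) := by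
  unfold P; fun_prop

theorem IsNoSwirl.hasDerivAt {c : Fin 3 → ℝ} {U : ℝ → ℝ} (h : IsNoSwirl c U) {x : ℝ}
    (hx : x ∈ Ioo (-1 : ℝ) 1) :
    HasDerivAt U ((P c x - 2 * x * U x - (1 / 2) * U x ^ 2) / (1 - x ^ 2)) x := by
  have h1 : DifferentiableAt ℝ U x :=
    (h.1.contDiffAt (isOpen_Ioo.mem_nhds hx)).differentiableAt (by norm_num)
  refine h1.hasDerivAt.congr_deriv ?_
  rw [eq_div_iff (one_sub_sq_pos hx).ne']
  linarith [h.2 x hx]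

theorem IsNoSwirl.continuousOn {c : Fin 3 → ℝ} {U : ℝ → ℝ} (h : IsNoSwirl c U) :
    ContinuousOn U (Ioo (-1) 1) := h.1.continuousOn

theorem IsNoSwirl.of_hasDerivAt {c : Fin 3 → ℝ} {U : ℝ → ℝ} (h : ∀ x ∈ Ioo (-1 : ℝ) 1,
    HasDerivAt U ((P c x - 2 * x * U x - (1 / 2) * U x ^ 2) / (1 - x ^ 2)) x) :
    IsNoSwirl c U := by
  have hc : ContinuousOn U (Ioo (-1) 1) := fun x hx => (h x hx).continuousAt.continuousWithinAt
  refine ⟨?_, fun x hx => ?_⟩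
  · have h1 : ContDiffOn ℝ (0 : ℕ)
        (fun x => (P c x - 2 * x * U x - (1 / 2) * U x ^ 2) / (1 - x ^ 2)) (Ioo (-1) 1) := by
      simp only [CharP.cast_eq_zero, contDiffOn_zero]
      exact continuousOn_div_one_sub_sq ((((continuous_P c).continuousOn).sub
        ((by fun_prop : ContinuousOn (fun x : ℝ => 2 * x) _).mul hc)).sub
        (continuousOn_const.mul (hc.pow 2)))
    exact_mod_cast contDiffOn_succ_of_hasDerivAt isOpen_Ioo h h1
  · rw [(h x hx).deriv, mul_div_cancel₀ _ (one_sub_sq_pos hx).ne']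
    ring

theorem IsNoSwirl.hasDerivAt_sub {c : Fin 3 → ℝ} {U W : ℝ → ℝ} (hU : IsNoSwirl c U)
    (hW : IsNoSwirl c W) {x : ℝ} (hx : x ∈ Ioo (-1 : ℝ) 1) :
    HasDerivAt (fun x => W x - U x)
      (-((2 * x + (U x + W x) / 2) * (W x - U x)) / (1 - x ^ 2)) x := by
  refine ((hW.hasDerivAt hx).fun_sub (hU.hasDerivAt hx)).congr_deriv ?_
  rw [← sub_div]
  congr 1
  ring

/-- The difference of two solutions of the Riccati equation solves a homogeneous linear equation
with coefficient `2x + (U+W)/2`. It therefore has a constant sign, and solutions are ordered by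
their values at `0`. -/
theorem IsNoSwirl.sub_eq {c : Fin 3 → ℝ} {U W : ℝ → ℝ} (hU : IsNoSwirl c U)
    (hW : IsNoSwirl c W) {x : ℝ} (hx : x ∈ Ioo (-1 : ℝ) 1) :
    W x - U x = (W 0 - U 0) / gexp (fun x => 2 * x + (U x + W x) / 2) x :=
  eq_div_gexp (f := fun x => W x - U x) (ℓ := fun x => 2 * x + (U x + W x) / 2)
    ((by fun_prop : ContinuousOn (fun x : ℝ => 2 * x) _).add
      ((hU.continuousOn.add hW.continuousOn).div_const 2))
    (fun _ hx => hU.hasDerivAt_sub hW hx) hx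

theorem IsNoSwirl.eqOn {c : Fin 3 → ℝ} {U W : ℝ → ℝ} (hU : IsNoSwirl c U)
    (hW : IsNoSwirl c W) (h0 : W 0 = U 0) {x : ℝ} (hx : x ∈ Ioo (-1 : ℝ) 1) : W x = U x := by
  have := hU.sub_eq hW hx
  rw [h0, sub_self, zero_div] at this
  linarith

/-- Suppose `D = W - U > 0`. Then `1/D` solves the linear equation `(1-x²)(1/D)' = (2x+U)/D + 1/2`,
and `2x + U ≥ -C(1+x)` near `-1`. The source `1/2` thus makes `1/D`, up to a bounded factor, at most
a constant plus a positive multiple of `log(1+x)`, which becomes negative near `-1`. -/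
theorem IsNoSwirl.le_of_ge {c : Fin 3 → ℝ} {U W : ℝ → ℝ} (hU : IsNoSwirl c U)
    (hW : IsNoSwirl c W) {C : ℝ} (hC : ∀ x ∈ Ioc (-1 : ℝ) 0, 2 - C * (1 + x) ≤ U x) :
    W 0 ≤ U 0 := by
  by_contra! hlt
  have hpos : ∀ x ∈ Ioo (-1 : ℝ) 1, 0 < W x - U x := fun x hx => by
    rw [hU.sub_eq hW hx]
    exact div_pos (by linarith) (gexp_pos _ _)
  set C' := |C|
  -- The factor `exp(-C')` is a lower bound for `exp(C'x)` on `(-1,0]`, and `1/4` comes from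
  -- `(1/2)/(1-x²) ≥ 1/(4(1+x))`.
  set k := Real.exp (-C') / 4
  have hk : 0 < k := by positivity
  set F : ℝ → ℝ := fun x => Real.exp (C' * x) * (W x - U x)⁻¹ - k * Real.log (1 + x)
  have hsub : Ioc (-1 : ℝ) 0 ⊆ Ioo (-1) 1 := fun x hx => ⟨hx.1, hx.2.trans_lt one_pos⟩
  have hF : ∀ x ∈ Ioc (-1 : ℝ) 0, HasDerivAt F (Real.exp (C' * x) * C' * (W x - U x)⁻¹ +
      Real.exp (C' * x) * (((2 * x + U x) * (W x - U x)⁻¹ + 1 / 2) / (1 - x ^ 2)) -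
      k * (1 / (1 + x))) x := by
    intro x hx
    have hx' := hsub hx
    have p1 : 0 < 1 + x := by linarith [hx.1]
    have d1 : HasDerivAt (fun y => Real.exp (C' * y)) (Real.exp (C' * x) * C') x := by
      simpa using ((hasDerivAt_id x).const_mul C').exp
    have d2 := (hU.hasDerivAt_sub hW hx').fun_inv (hpos x hx').ne'
    have d3 : HasDerivAt (fun y => Real.log (1 + y)) (1 / (1 + x)) x :=
      (((hasDerivAt_id x).const_add 1)).log p1.ne'
    refine ((d1.fun_mul d2).fun_sub (d3.const_mul k)).congr_deriv ?_
    have hne := (hpos x hx').ne'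
    have := (one_sub_sq_pos hx').ne'
    congr 2
    field_simp
    ring
  have hmono : MonotoneOn F (Ioc (-1) 0) := by
    refine monotoneOn_of_deriv_nonneg (convex_Ioc (-1) 0)
      (fun y hy => (hF y hy).continuousAt.continuousWithinAt)
      (fun y hy => (hF y (interior_subset hy)).differentiableAt.differentiableWithinAt) ?_
    intro x hx
    have hx1 := interior_subset hx
    rw [(hF x hx1).deriv]
    have hx' := hsub hx1
    have p1 : 0 < 1 + x := by linarith [hx1.1]
    have p2 : 0 < 1 - x := by linarith [hx'.2]
    have hy := inv_pos.2 (hpos x hx')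
    set y := (W x - U x)⁻¹
    have e : 1 - x ^ 2 = (1 - x) * (1 + x) := by ring
    have h1 : -C' * (1 + x) * y + 1 / 2 ≤ (2 * x + U x) * y + 1 / 2 := by
      have : -C' * (1 + x) ≤ 2 * x + U x := by
        have h2 := hC x hx1
        have h3 : C * (1 + x) ≤ C' * (1 + x) :=
          mul_le_mul_of_nonneg_right (le_abs_self C) p1.le
        linarith
      have := mul_le_mul_of_nonneg_right this hy.le
      linarith
    have h2 : (-C' * (1 + x) * y + 1 / 2) / (1 - x ^ 2) ≥ -C' * y + 1 / (4 * (1 + x)) := by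
      rw [e, ge_iff_le, le_div_iff₀ (by positivity)]
      have : (-C' * y + 1 / (4 * (1 + x))) * ((1 - x) * (1 + x)) =
          -C' * y * ((1 - x) * (1 + x)) + (1 - x) / 4 := by
        field_simp
      rw [this]
      have h4 : 0 ≤ C' * y := mul_nonneg (abs_nonneg C) hy.le
      nlinarith [mul_nonneg h4 p1.le, hx1.2, hx1.1]
    have h3 := div_le_div_of_nonneg_right h1 (one_sub_sq_pos hx').le
    have h4 := mul_le_mul_of_nonneg_left (h2.le.trans h3) (Real.exp_pos (C' * x)).le
    have h5 : Real.exp (-C') ≤ Real.exp (C' * x) := Real.exp_le_exp.2 (by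
      nlinarith [abs_nonneg C, hx1.1])
    have h6 : k * (1 / (1 + x)) ≤ Real.exp (C' * x) * (1 / (4 * (1 + x))) := by
      have : k * (1 / (1 + x)) = Real.exp (-C') * (1 / (4 * (1 + x))) := by
        simp only [k]; field_simp
      rw [this]
      gcongr
    nlinarith [h4, h6]
  -- At `x = exp(-M) - 1` the logarithmic term of `F` equals `kM = F(0) + k`, so `F(x) > F(0)`,
  -- against monotonicity.
  set M := F 0 / k + 1
  have hM : 0 < M := by
    have : F 0 = (W 0 - U 0)⁻¹ := by simp [F]
    have h1 := inv_pos.2 (hpos 0 zero_mem_Ioo)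
    simp only [M]
    rw [this]
    positivity
  have hx0 : Real.exp (-M) - 1 ∈ Ioc (-1 : ℝ) 0 := by
    refine ⟨by linarith [Real.exp_pos (-M)], ?_⟩
    have : Real.exp (-M) ≤ 1 := Real.exp_le_one_iff.2 (by linarith)
    linarith
  have h1 := hmono hx0 (right_mem_Ioc.2 (by norm_num)) hx0.2
  have h2 : F (Real.exp (-M) - 1) = Real.exp (C' * (Real.exp (-M) - 1)) *
      (W (Real.exp (-M) - 1) - U (Real.exp (-M) - 1))⁻¹ + k * M := by
    simp only [F]
    rw [add_sub_cancel, Real.log_exp]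
    ring
  have h3 : 0 < Real.exp (C' * (Real.exp (-M) - 1)) *
      (W (Real.exp (-M) - 1) - U (Real.exp (-M) - 1))⁻¹ :=
    mul_pos (Real.exp_pos _) (inv_pos.2 (hpos _ (hsub hx0)))
  have h4 : k * M = F 0 + k := by simp only [M]; field_simp
  linarith

theorem Ubar_isNoSwirl {c : Fin 3 → ℝ} {γ : ℝ} (h : γ ∈ initialValues c) :
    IsNoSwirl c (Ubar c γ) ∧ Ubar c γ 0 = γ := by
  have h' : ∃ U : ℝ → ℝ, IsNoSwirl c U ∧ U 0 = γ := h
  rw [Ubar, dif_pos h']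
  exact h'.choose_spec

/-- By uniqueness for the initial value at `0`, the choice made in `Ubar` is immaterial on `(-1,1)`.
-/
theorem IsNoSwirl.Ubar_eq {c : Fin 3 → ℝ} {U : ℝ → ℝ} (hU : IsNoSwirl c U) {x : ℝ}
    (hx : x ∈ Ioo (-1 : ℝ) 1) : Ubar c (U 0) x = U x := by
  obtain ⟨h1, h2⟩ := Ubar_isNoSwirl (γ := U 0) ⟨U, hU, rfl⟩
  exact hU.eqOn h1 h2 hx

theorem IsNoSwirl.gammaPlus_eq {c : Fin 3 → ℝ} {U : ℝ → ℝ} (hU : IsNoSwirl c U) {C : ℝ}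
    (hC : ∀ x ∈ Ioc (-1 : ℝ) 0, 2 - C * (1 + x) ≤ U x) : gammaPlus c = U 0 := by
  refine IsLUB.csSup_eq ⟨?_, ?_⟩ ⟨U 0, U, hU, rfl⟩
  · rintro _ ⟨W, hW, rfl⟩
    exact hU.le_of_ge hW hC
  · exact fun b hb => hb ⟨U, hU, rfl⟩

/-! ### Reflection -/

/-- The constants of the reflected equation. -/
def swapC (c : Fin 3 → ℝ) : Fin 3 → ℝ := ![c 1, c 0, c 2]

@[simp] theorem swapC_swapC (c : Fin 3 → ℝ) : swapC (swapC c) = c := by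
  funext i; fin_cases i <;> rfl

theorem P_swapC (c : Fin 3 → ℝ) (x : ℝ) : P (swapC c) x = P c (-x) := by
  simp only [P, swapC, Matrix.cons_val_zero, Matrix.cons_val_one, Matrix.cons_val]
  ring

theorem IsNoSwirl.refl {c : Fin 3 → ℝ} {U : ℝ → ℝ} (h : IsNoSwirl c U) :
    IsNoSwirl (swapC c) fun x => -U (-x) := by
  refine IsNoSwirl.of_hasDerivAt fun x hx => ?_
  have h1 := ((h.hasDerivAt (neg_mem_Ioo hx)).comp x (hasDerivAt_neg x)).neg
  refine h1.congr_deriv ?_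
  rw [P_swapC]
  simp only [neg_sq]
  ring

theorem initialValues_swapC (c : Fin 3 → ℝ) : initialValues (swapC c) = -initialValues c := by
  ext γ
  rw [Set.mem_neg]
  constructor
  · rintro ⟨U, hU, rfl⟩
    refine ⟨fun x => -U (-x), ?_, by simp⟩
    simpa using hU.refl
  · rintro ⟨U, hU, h0⟩
    refine ⟨fun x => -U (-x), hU.refl, ?_⟩
    simp [h0]

/-- Reflection turns the smallest initial value into the largest one with `c₁`, `c₂` exchanged; the
lower profiles need no separate construction. -/
theorem gammaMinus_eq_neg_gammaPlus (c : Fin 3 → ℝ) : gammaMinus c = -gammaPlus (swapC c) := by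
  rw [gammaMinus, gammaPlus, initialValues_swapC, Real.sInf_def]

/-! ### Power series whose coefficients have ratio tending to `1` -/

/-- Positive coefficients whose successive quotients tend to `1`. -/
def UnitRatio (u : ℕ → ℝ) : Prop :=
  (∀ n, 0 < u n) ∧ Tendsto (fun n => u (n + 1) / u n) atTop (𝓝 1)

/-- The coefficients of the derivative of a power series. -/
def derivCoeff (u : ℕ → ℝ) (n : ℕ) : ℝ := (n + 1) * u (n + 1)

theorem UnitRatio.derivCoeff {u : ℕ → ℝ} (h : UnitRatio u) : UnitRatio (derivCoeff u) := by
  refine ⟨fun n => mul_pos (by positivity) (h.1 _), ?_⟩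
  have h1 : Tendsto (fun n : ℕ => u (n + 1 + 1) / u (n + 1)) atTop (𝓝 1) :=
    (tendsto_add_atTop_iff_nat (f := fun n => u (n + 1) / u n) 1).2 h.2
  have h2 : Tendsto (fun n : ℕ => 1 + 1 / ((n : ℝ) + 1)) atTop (𝓝 (1 + 0)) :=
    tendsto_one_div_add_atTop_nhds_zero_nat.const_add 1
  have h3 := h2.mul h1
  rw [add_zero, one_mul] at h3
  refine h3.congr fun n => ?_
  have := (h.1 (n + 1)).ne'
  have hn : (n : ℝ) + 1 ≠ 0 := by positivity
  simp only [HomNS.derivCoeff]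
  push_cast
  field_simp

theorem UnitRatio.summable {u : ℕ → ℝ} (h : UnitRatio u) {r : ℝ} (hr : |r| < 1) :
    Summable fun n => u n * r ^ n := by
  by_cases h0 : r = 0
  · subst h0
    refine summable_of_ne_finset_zero (s := {0}) fun n hn => ?_
    rw [zero_pow (by simpa using hn), mul_zero]
  · refine summable_of_ratio_test_tendsto_lt_one hr
      (Eventually.of_forall fun n => mul_ne_zero (h.1 n).ne' (pow_ne_zero n h0)) ?_
    have := h.2.mul_const |r|
    rw [one_mul] at this
    refine this.congr fun n => ?_
    rw [norm_mul, norm_mul, norm_pow, norm_pow, Real.norm_of_nonneg (h.1 _).le,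
      Real.norm_of_nonneg (h.1 _).le, pow_succ, Real.norm_eq_abs]
    have := (h.1 n).ne'
    have := abs_ne_zero.2 h0
    field_simp

/-- The sum of a power series. -/
def psum (u : ℕ → ℝ) (t : ℝ) : ℝ := ∑' n, u n * t ^ n

theorem UnitRatio.hasSum {u : ℕ → ℝ} (h : UnitRatio u) {t : ℝ} (ht : |t| < 1) :
    HasSum (fun n => u n * t ^ n) (psum u t) := (h.summable ht).hasSum

theorem hasSum_natCast_mul {u : ℕ → ℝ} {t s : ℝ}
    (h : HasSum (fun n => derivCoeff u n * t ^ n) s) :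
    HasSum (fun n : ℕ => (n : ℝ) * u n * t ^ n) (t * s) := by
  have h1 : HasSum (fun n : ℕ => ((n + 1 : ℕ) : ℝ) * u (n + 1) * t ^ (n + 1)) (t * s) := by
    refine (h.mul_left t).congr_fun ?_
    intro n
    simp only [derivCoeff]
    push_cast
    ring
  have h2 := (hasSum_nat_add_iff (f := fun n : ℕ => (n : ℝ) * u n * t ^ n) 1).1 h1
  simpa using h2

theorem UnitRatio.hasDerivAt {u : ℕ → ℝ} (h : UnitRatio u) {t : ℝ} (ht : |t| < 1) :
    HasDerivAt (psum u) (psum (HomNS.derivCoeff u) t) t := by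
  obtain ⟨r, hr1, hr2⟩ := exists_between ht
  have hr0 : 0 < r := (abs_nonneg t).trans_lt hr1
  have hball : ∀ y ∈ Ioo (-r) r, |y| < r := fun y hy => abs_lt.2 hy
  have htr : t ∈ Ioo (-r) r := abs_lt.1 hr1
  have hu : Summable fun n : ℕ => (n : ℝ) * u n * r ^ (n - 1) := by
    rw [← summable_nat_add_iff 1]
    refine (h.derivCoeff.summable (r := r) (by rwa [abs_of_pos hr0])).congr fun n => ?_
    simp [HomNS.derivCoeff]
  have h1 := hasDerivAt_tsum_of_isPreconnected (g := fun n y => u n * y ^ n)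
    (g' := fun n y => u n * ((n : ℝ) * y ^ (n - 1))) hu (isOpen_Ioo (a := -r) (b := r))
    isPreconnected_Ioo (fun n y _ => (hasDerivAt_pow n y).const_mul (u n)) (fun n y hy => ?_)
    htr (h.summable ht) htr
  · refine h1.congr_deriv ?_
    have h2 : Summable fun n : ℕ => u n * ((n : ℝ) * t ^ (n - 1)) := by
      refine Summable.of_norm_bounded hu fun n => ?_
      rw [norm_mul, norm_mul, norm_pow, Real.norm_of_nonneg (h.1 n).le,
        Real.norm_of_nonneg (Nat.cast_nonneg n), Real.norm_eq_abs, ← mul_assoc, mul_comm (u n)]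
      have := h.1 n
      gcongr
    rw [h2.tsum_eq_zero_add]
    simp only [psum, HomNS.derivCoeff, CharP.cast_eq_zero, zero_mul, mul_zero, zero_add,
      Nat.add_sub_cancel]
    refine tsum_congr fun n => ?_
    push_cast
    ring
  · rw [norm_mul, norm_mul, norm_pow, Real.norm_of_nonneg (h.1 n).le,
      Real.norm_of_nonneg (Nat.cast_nonneg n), Real.norm_eq_abs, ← mul_assoc, mul_comm (u n)]
    have := h.1 n
    have := (hball y hy).le
    gcongr

theorem UnitRatio.le_psum {u : ℕ → ℝ} (h : UnitRatio u) {t : ℝ} (h0 : 0 ≤ t) (h1 : t < 1) :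
    u 0 ≤ psum u t := by
  have := (h.summable (r := t) (by rwa [abs_of_nonneg h0])).le_tsum 0
    fun n _ => mul_nonneg (h.1 n).le (pow_nonneg h0 n)
  simpa [psum] using this

theorem UnitRatio.psum_le {u : ℕ → ℝ} (h : UnitRatio u) {t s : ℝ} (h0 : 0 ≤ t) (hts : t ≤ s)
    (h1 : s < 1) : psum u t ≤ psum u s := by
  refine (h.summable (by rw [abs_of_nonneg h0]; linarith)).tsum_le_tsum (fun n => ?_)
    (h.summable (by rw [abs_of_nonneg (h0.trans hts)]; linarith))
  exact mul_le_mul_of_nonneg_left (pow_le_pow_left₀ h0 hts n) (h.1 n).le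

/-! ### A hypergeometric equation -/

/-- The coefficients of the solution of
`t(1-t)h'' + ((1+k₁) - (2+k₁+k₂)t) h' = m h` that is regular at `0`. -/
def hyp (k₁ k₂ m : ℝ) : ℕ → ℝ
  | 0 => 1
  | n + 1 => hyp k₁ k₂ m n * ((n * (n + 1 + k₁ + k₂) + m) / ((n + 1) * (n + 1 + k₁)))

theorem hyp_unitRatio {k₁ k₂ m : ℝ} (h1 : 0 ≤ k₁) (h2 : 0 ≤ k₂) (hm : 0 < m) :
    UnitRatio (hyp k₁ k₂ m) := by
  have hpos : ∀ n, 0 < hyp k₁ k₂ m n := by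
    intro n
    induction n with
    | zero => simp [hyp]
    | succ n ih =>
      rw [hyp]
      positivity
  refine ⟨hpos, ?_⟩
  have e : ∀ n : ℕ, hyp k₁ k₂ m (n + 1) / hyp k₁ k₂ m n =
      (n * (n + 1 + k₁ + k₂) + m) / ((n + 1) * (n + 1 + k₁)) := fun n => by
    rw [hyp, mul_div_cancel_left₀ _ (hpos n).ne']
  simp only [e]
  have t1 : Tendsto (fun n : ℕ => 1 / ((n : ℝ) + 1)) atTop (𝓝 0) :=
    tendsto_one_div_add_atTop_nhds_zero_nat
  have t2 : Tendsto (fun n : ℕ => ((1 - 1 / ((n : ℝ) + 1)) * (1 + (k₁ + k₂) * (1 / ((n : ℝ) + 1))) +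
      m * (1 / ((n : ℝ) + 1)) ^ 2) / (1 + k₁ * (1 / ((n : ℝ) + 1)))) atTop
      (𝓝 (((1 - 0) * (1 + (k₁ + k₂) * 0) + m * 0 ^ 2) / (1 + k₁ * 0))) :=
    ((((t1.const_sub 1).mul ((t1.const_mul _).const_add 1)).add ((t1.pow 2).const_mul m)).div
      ((t1.const_mul k₁).const_add 1) (by norm_num))
  have t3 : ((1 - 0) * (1 + (k₁ + k₂) * 0) + m * 0 ^ 2) / (1 + k₁ * 0) = (1 : ℝ) := by norm_num
  rw [t3] at t2
  refine t2.congr fun n => ?_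
  have a1 : (n : ℝ) + 1 ≠ 0 := by positivity
  have a2 : (n : ℝ) + 1 + k₁ ≠ 0 := by positivity
  field_simp
  ring

/-- In terms of the Euler operator `E = t d/dt` the equation reads `t h'' + (1+k₁) h' = (E² +
(1+k₁+k₂) E + m) h`. Since `E` multiplies the `n`-th coefficient by `n`, comparing coefficients
gives precisely the recursion of `hyp`. -/
theorem hyp_ode {k₁ k₂ m : ℝ} (h1 : 0 ≤ k₁) (h2 : 0 ≤ k₂) (hm : 0 < m) {t : ℝ} (ht : |t| < 1) :
    t * (1 - t) * psum (derivCoeff (derivCoeff (hyp k₁ k₂ m))) t +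
      ((1 + k₁) - (2 + k₁ + k₂) * t) * psum (derivCoeff (hyp k₁ k₂ m)) t =
      m * psum (hyp k₁ k₂ m) t := by
  set u := hyp k₁ k₂ m with hu
  have hr : UnitRatio u := hyp_unitRatio h1 h2 hm
  have s0 := hr.hasSum ht
  have s1 := hr.derivCoeff.hasSum ht
  have s2 := hr.derivCoeff.derivCoeff.hasSum ht
  have sB := hasSum_natCast_mul s2
  have sA := hasSum_natCast_mul s1
  have sN : HasSum (fun n : ℕ => (n : ℝ) * ((n : ℝ) * u n) * t ^ n)
      (t * (t * psum (derivCoeff (derivCoeff u)) t + psum (derivCoeff u) t)) := by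
    refine hasSum_natCast_mul (u := fun n => (n : ℝ) * u n) ?_
    refine (sB.add s1).congr_fun ?_
    intro n
    simp only [derivCoeff]
    push_cast
    ring
  have L := sB.add (s1.mul_left (1 + k₁))
  have R := (sN.add (sA.mul_left (1 + k₁ + k₂))).add (s0.mul_left m)
  have e : (fun n : ℕ => (n : ℝ) * derivCoeff u n * t ^ n + (1 + k₁) * (derivCoeff u n * t ^ n)) =
      fun n : ℕ => (n : ℝ) * ((n : ℝ) * u n) * t ^ n +
        (1 + k₁ + k₂) * ((n : ℝ) * u n * t ^ n) + m * (u n * t ^ n) := by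
    funext n
    have a1 : (n : ℝ) + 1 ≠ 0 := by positivity
    have a2 : (n : ℝ) + 1 + k₁ ≠ 0 := by positivity
    have : u (n + 1) = u n * ((n * (n + 1 + k₁ + k₂) + m) / ((n + 1) * (n + 1 + k₁))) := by
      rw [hu, hyp]
    simp only [derivCoeff]
    rw [this]
    field_simp
    ring
  rw [e] at L
  have := L.unique R
  linarith

/-! ### The fencing argument at the right end -/

/-- As long as `f` is above `M`, the bound `f' ≤ -k/(1-x)` integrates to `k log(1-x)` plus a
constant, which tends to `-∞`; so `f` reaches the level `M` before `1`. It cannot cross back, its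
derivative being negative on that level. -/
theorem eventually_le_of_deriv_le {f f' : ℝ → ℝ} {a M k : ℝ} (ha : a < 1) (hk : 0 < k)
    (hf : ∀ x ∈ Ioo a 1, HasDerivAt f (f' x) x)
    (h : ∀ x ∈ Ioo a 1, M ≤ f x → f' x ≤ -k / (1 - x)) : ∀ᶠ x in 𝓝[<] (1 : ℝ), f x ≤ M := by
  have hex : ∃ x₁ ∈ Ioo a 1, f x₁ ≤ M := by
    by_contra! hcon
    set x₀ := (a + 1) / 2
    have hx₀ : x₀ ∈ Ioo a 1 := ⟨by simp only [x₀]; linarith, by simp only [x₀]; linarith⟩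
    have hd : ∀ x ∈ Ico x₀ 1, HasDerivAt (fun x => f x - k * Real.log (1 - x))
        (f' x - k * (-1 / (1 - x))) x := by
      intro x hx
      have p : 0 < 1 - x := by linarith [hx.2]
      have d1 : HasDerivAt (fun y => Real.log (1 - y)) (-1 / (1 - x)) x :=
        (((hasDerivAt_id x).const_sub 1)).log p.ne'
      exact (hf x ⟨hx₀.1.trans_le hx.1, hx.2⟩).fun_sub (d1.const_mul k)
    have hanti : AntitoneOn (fun x => f x - k * Real.log (1 - x)) (Ico x₀ 1) := by
      refine antitoneOn_of_deriv_nonpos (convex_Ico x₀ 1)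
        (fun y hy => (hd y hy).continuousAt.continuousWithinAt)
        (fun y hy => (hd y (interior_subset hy)).differentiableAt.differentiableWithinAt) ?_
      intro x hx
      have hx' := interior_subset hx
      have hx'' : x ∈ Ioo a 1 := ⟨hx₀.1.trans_le hx'.1, hx'.2⟩
      rw [(hd x hx').deriv]
      have := h x hx'' (hcon x hx'').le
      have e : k * (-1 / (1 - x)) = -k / (1 - x) := by ring
      rw [e]
      linarith
    set A := (f x₀ - k * Real.log (1 - x₀) - M) / k
    set y := max x₀ (1 - Real.exp (-A))
    have hy : y ∈ Ico x₀ 1 := ⟨le_max_left _ _, max_lt hx₀.2 (by linarith [Real.exp_pos (-A)])⟩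
    have h1 := hanti (left_mem_Ico.2 hx₀.2) hy hy.1
    have h2 := hcon y ⟨hx₀.1.trans_le hy.1, hy.2⟩
    have h3 : Real.log (1 - y) ≤ -A := by
      rw [Real.log_le_iff_le_exp (by linarith [hy.2])]
      linarith [le_max_right x₀ (1 - Real.exp (-A))]
    have h4 : k * A = f x₀ - k * Real.log (1 - x₀) - M := by
      simp only [A]; field_simp
    have h5 := mul_le_mul_of_nonneg_left h3 hk.le
    simp only at h1
    linarith
  obtain ⟨x₁, hx₁, hM⟩ := hex
  filter_upwards [Ioo_mem_nhdsLT hx₁.2] with x hx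
  have hsub : ∀ y ∈ Icc x₁ x, y ∈ Ioo a 1 := fun y hy =>
    ⟨hx₁.1.trans_le hy.1, hy.2.trans_lt hx.2⟩
  refine image_le_of_deriv_right_lt_deriv_boundary (f := f) (f' := f') (B := fun _ => M)
    (B' := fun _ => 0) (fun y hy => (hf y (hsub y hy)).continuousAt.continuousWithinAt)
    (fun y hy => (hf y (hsub y ⟨hy.1, hy.2.le⟩)).hasDerivWithinAt) hM
    (fun y => hasDerivAt_const y M) (fun y hy he => ?_) ⟨hx.1.le, le_rfl⟩
  have hy' := hsub y ⟨hy.1, hy.2.le⟩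
  refine (h y hy' he.ge).trans_lt ?_
  exact div_neg_of_neg_of_pos (by linarith) (by linarith [hy'.2])

/-- Positive solutions of a perturbed logistic equation tend to the stable equilibrium. -/
theorem tendsto_of_logistic {D A B : ℝ → ℝ} {k : ℝ} (hk : 0 < k)
    (hD : ∀ x ∈ Ioo (0 : ℝ) 1, 0 < D x) (hB : ∀ x ∈ Ioo (0 : ℝ) 1, 0 ≤ B x)
    (hd : ∀ x ∈ Ioo (0 : ℝ) 1, HasDerivAt D ((B x + A x * D x - D x ^ 2 / 2) / (1 - x ^ 2)) x)
    (hA : Tendsto A (𝓝[<] 1) (𝓝 k)) (hB0 : Tendsto B (𝓝[<] 1) (𝓝 0)) :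
    Tendsto D (𝓝[<] 1) (𝓝 (2 * k)) := by
  have hlog : ∀ x ∈ Ioo (0 : ℝ) 1, HasDerivAt (fun x => Real.log (D x))
      ((B x / D x + A x - D x / 2) / (1 - x ^ 2)) x := by
    intro x hx
    refine ((hd x hx).log (hD x hx).ne').congr_deriv ?_
    have := (hD x hx).ne'
    have : (1 - x ^ 2) ≠ 0 := by nlinarith [hx.1, hx.2]
    field_simp
  rw [Metric.tendsto_nhds]
  intro r hr
  -- The bound `η ≤ k` keeps the lower barrier `2k - η` positive, so that its logarithm can be used.
  set η := min (r / 2) k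
  have hη : 0 < η := lt_min (half_pos hr) hk
  have hηk : η ≤ k := min_le_right _ _
  have eA : ∀ᶠ x in 𝓝[<] (1 : ℝ), |A x - k| < η / 8 := by
    have := Metric.tendsto_nhds.1 hA (η / 8) (by positivity)
    simpa [Real.dist_eq] using this
  have eB : ∀ᶠ x in 𝓝[<] (1 : ℝ), B x < η / 8 * k :=
    hB0.eventually (gt_mem_nhds (by positivity))
  obtain ⟨a, ha, hsub⟩ := (mem_nhdsLT_iff_exists_Ioo_subset' (show (0 : ℝ) < 1 by norm_num)).1
    (eA.and eB)
  set b := max a 0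
  have hb1 : b < 1 := max_lt ha one_pos
  have hin : ∀ x ∈ Ioo b 1, x ∈ Ioo (0 : ℝ) 1 ∧ |A x - k| < η / 8 ∧ B x < η / 8 * k :=
    fun x hx => ⟨⟨(le_max_right _ _).trans_lt hx.1, hx.2⟩,
      hsub ⟨(le_max_left _ _).trans_lt hx.1, hx.2⟩⟩
  have key : ∀ x ∈ Ioo (0 : ℝ) 1, ∀ w, w ≤ -(η / 4) → w / (1 - x ^ 2) ≤ -(η / 8) / (1 - x) := by
    intro x hx w hw
    have p1 : 0 < 1 - x := by linarith [hx.2]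
    have p2 : 0 < 1 - x ^ 2 := by nlinarith [hx.1, hx.2]
    rw [div_le_div_iff₀ p2 p1]
    have e : 1 - x ^ 2 = (1 - x) * (1 + x) := by ring
    rw [e]
    nlinarith [mul_pos hη p1, hx.2, hx.1, mul_le_mul_of_nonneg_right hw p1.le]
  -- The fencing lemma is applied to `±log D`. The logarithmic derivative `(B/D + A - D/2)/(1-x²)`
  -- has numerator at most `-η/4` above `2k + η`, and at least `η/4` below `2k - η`, once `A` is
  -- close to `k` and `B` is small.
  have up := eventually_le_of_deriv_le (M := Real.log (2 * k + η)) hb1 (by positivity : 0 < η / 8)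
    (fun x hx => hlog x (hin x hx).1) (fun x hx hM => by
      obtain ⟨hx1, hx2, hx3⟩ := hin x hx
      refine key x hx1 _ ?_
      have hDx := (Real.log_le_log_iff (by positivity) (hD x hx1)).1 hM
      have h1 : B x / D x ≤ η / 8 := by
        rw [div_le_iff₀ (hD x hx1)]
        nlinarith
      linarith [(abs_lt.1 hx2).2])
  have lo := eventually_le_of_deriv_le (f := fun x => -Real.log (D x))
    (M := -Real.log (2 * k - η)) hb1 (by positivity : 0 < η / 8)
    (fun x hx => (hlog x (hin x hx).1).neg) (fun x hx hM => by
      obtain ⟨hx1, hx2, hx3⟩ := hin x hx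
      rw [← neg_div]
      refine key x hx1 _ ?_
      have hDx := (Real.log_le_log_iff (hD x hx1) (by linarith)).1 (neg_le_neg_iff.1 hM)
      have h1 : 0 ≤ B x / D x := div_nonneg (hB x hx1) (hD x hx1).le
      linarith [(abs_lt.1 hx2).1])
  filter_upwards [up, lo, Ioo_mem_nhdsLT (show (0 : ℝ) < 1 by norm_num)] with x h1 h2 hx
  have h1' := (Real.log_le_log_iff (hD x hx) (by positivity)).1 h1
  have h2' := (Real.log_le_log_iff (by linarith) (hD x hx)).1 (neg_le_neg_iff.1 h2)
  rw [Real.dist_eq, abs_lt]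
  have : η ≤ r / 2 := min_le_left _ _
  constructor <;> linarith

/-! ### The maximal solution -/

/-- `U` is the solution without swirl with the larger value at `-1` and the larger value at `1`. -/
structure IsTop (c : Fin 3 → ℝ) (U : ℝ → ℝ) : Prop where
  isNoSwirl : IsNoSwirl c U
  left : ∃ C, ∀ x ∈ Ioc (-1 : ℝ) 0, |U x - (2 + 2 * √(1 + c 0))| ≤ C * (1 + x)
  right : Tendsto U (𝓝[<] 1) (𝓝 (-2 + 2 * √(1 + c 1)))

/-- With `kᵢ = √(1+cᵢ)`, the affine function `(1+k₁)(1-x) - (1+k₂)(1+x)` absorbs `c₁` and `c₂`. The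
rest `D` satisfies a Riccati equation with source `2m(1-x²)`, `m = (c₃ - c̄₃)/2 > 0`, and `D =
(1-x²) h'(t)/h(t)` with `t = (1+x)/2` linearizes it to the hypergeometric equation of `hyp`. Its
regular solution has positive coefficients, so `h ≥ 1`, `h' > 0` and `D = O(1+x)` at `-1`. -/
theorem exists_isTop {c : Fin 3 → ℝ} (h0 : -1 ≤ c 0) (h1 : -1 < c 1)
    (h2 : c3bar (c 0) (c 1) < c 2) : ∃ U, IsTop c U := by
  set k₁ := √(1 + c 0) with hk₁
  set k₂ := √(1 + c 1) with hk₂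
  have p1 : 0 ≤ k₁ := Real.sqrt_nonneg _
  have p2 : 0 < k₂ := Real.sqrt_pos.2 (by linarith)
  have e1 : k₁ ^ 2 = 1 + c 0 := Real.sq_sqrt (by linarith)
  have e2 : k₂ ^ 2 = 1 + c 1 := Real.sq_sqrt (by linarith)
  set m := (c 2 - c3bar (c 0) (c 1)) / 2
  have hm : 0 < m := by simp only [m]; linarith
  have e3 : c 2 = -(1 / 2) * (k₁ + k₂) * (k₁ + k₂ + 2) + 2 * m := by
    simp only [m, c3bar]
    ring
  clear_value m
  set u := hyp k₁ k₂ m with hu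
  have hr : UnitRatio u := hyp_unitRatio p1 p2.le hm
  set H := psum u
  set H1 := psum (derivCoeff u)
  set H2 := psum (derivCoeff (derivCoeff u))
  have hu0 : u 0 = 1 := rfl
  have ht : ∀ x ∈ Ioo (-1 : ℝ) 1, 0 < (1 + x) / 2 ∧ (1 + x) / 2 < 1 := fun x hx =>
    ⟨by linarith [hx.1], by linarith [hx.2]⟩
  have hta : ∀ x ∈ Ioo (-1 : ℝ) 1, |(1 + x) / 2| < 1 := fun x hx => by
    rw [abs_of_pos (ht x hx).1]; exact (ht x hx).2
  have hH : ∀ x ∈ Ioo (-1 : ℝ) 1, 1 ≤ H ((1 + x) / 2) := fun x hx => by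
    rw [← hu0]; exact hr.le_psum (ht x hx).1.le (ht x hx).2
  have hH1 : ∀ x ∈ Ioo (-1 : ℝ) 1, 0 < H1 ((1 + x) / 2) := fun x hx =>
    (hr.derivCoeff.1 0).trans_le (hr.derivCoeff.le_psum (ht x hx).1.le (ht x hx).2)
  have hdt : ∀ x : ℝ, HasDerivAt (fun x : ℝ => (1 + x) / 2) (1 / 2) x := fun x =>
    ((hasDerivAt_id x).const_add 1).div_const 2
  have dH : ∀ x ∈ Ioo (-1 : ℝ) 1, HasDerivAt (fun x => H ((1 + x) / 2))
      (H1 ((1 + x) / 2) * (1 / 2)) x := fun x hx =>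
    HasDerivAt.comp (h₂ := H) x (hr.hasDerivAt (hta x hx)) (hdt x)
  have dH1 : ∀ x ∈ Ioo (-1 : ℝ) 1, HasDerivAt (fun x => H1 ((1 + x) / 2))
      (H2 ((1 + x) / 2) * (1 / 2)) x := fun x hx =>
    HasDerivAt.comp (h₂ := H1) x (hr.derivCoeff.hasDerivAt (hta x hx)) (hdt x)
  set D : ℝ → ℝ := fun x => (1 - x ^ 2) * H1 ((1 + x) / 2) / H ((1 + x) / 2)
  have hD0 : ∀ x ∈ Ioo (-1 : ℝ) 1, 0 < D x := fun x hx =>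
    div_pos (mul_pos (one_sub_sq_pos hx) (hH1 x hx)) (one_pos.trans_le (hH x hx))
  have dsq : ∀ x : ℝ, HasDerivAt (fun x : ℝ => 1 - x ^ 2) (-(2 * x)) x := fun x => by
    simpa using (hasDerivAt_pow 2 x).const_sub 1
  have dD : ∀ x ∈ Ioo (-1 : ℝ) 1, HasDerivAt D ((2 * m * (1 - x ^ 2) +
      (-(2 * k₁) + (k₁ + k₂) * (1 + x)) * D x - D x ^ 2 / 2) / (1 - x ^ 2)) x := by
    intro x hx
    have hne : H ((1 + x) / 2) ≠ 0 := (one_pos.trans_le (hH x hx)).ne'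
    refine (((dsq x).fun_mul (dH1 x hx)).fun_div (dH x hx) hne).congr_deriv ?_
    have ode := hyp_ode p1 p2.le hm (hta x hx)
    have hx2 := (one_sub_sq_pos hx).ne'
    simp only [D]
    change (1 + x) / 2 * (1 - (1 + x) / 2) * H2 ((1 + x) / 2) +
      ((1 + k₁) - (2 + k₁ + k₂) * ((1 + x) / 2)) * H1 ((1 + x) / 2) = m * H ((1 + x) / 2) at ode
    generalize H ((1 + x) / 2) = y0 at *
    generalize H1 ((1 + x) / 2) = y1 at *
    generalize H2 ((1 + x) / 2) = y2 at *
    field_simp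
    linear_combination 4 * y0 * ode
  set U : ℝ → ℝ := fun x => (1 + k₁) * (1 - x) - (1 + k₂) * (1 + x) + D x
  refine ⟨U, IsNoSwirl.of_hasDerivAt fun x hx => ?_, ?_, ?_⟩
  · have d1 : HasDerivAt (fun x : ℝ => (1 + k₁) * (1 - x) - (1 + k₂) * (1 + x))
        ((1 + k₁) * (-1) - (1 + k₂) * 1) x :=
      (((hasDerivAt_id x).const_sub 1).const_mul (1 + k₁)).fun_sub
        (((hasDerivAt_id x).const_add 1).const_mul (1 + k₂))
    refine (d1.fun_add (dD x hx)).congr_deriv ?_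
    have hx2 := (one_sub_sq_pos hx).ne'
    simp only [U, P]
    rw [e3, show c 0 = k₁ ^ 2 - 1 by linarith, show c 1 = k₂ ^ 2 - 1 by linarith]
    field_simp
    ring
  · refine ⟨2 * H1 (1 / 2) + (2 + k₁ + k₂), fun x hx => ?_⟩
    have hx' : x ∈ Ioo (-1 : ℝ) 1 := ⟨hx.1, hx.2.trans_lt one_pos⟩
    have q : 0 < 1 + x := by linarith [hx.1]
    have b1 : H1 ((1 + x) / 2) ≤ H1 (1 / 2) :=
      hr.derivCoeff.psum_le (ht x hx').1.le (by linarith [hx.2]) (by norm_num)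
    have b2 : D x ≤ 2 * H1 (1 / 2) * (1 + x) := by
      refine (div_le_self (mul_pos (one_sub_sq_pos hx') (hH1 x hx')).le (hH x hx')).trans ?_
      have b3 : (1 - x ^ 2) ≤ 2 * (1 + x) := by nlinarith
      have := mul_le_mul b3 b1 (hH1 x hx').le (by positivity)
      linarith
    have e : U x - (2 + 2 * k₁) = D x - (2 + k₁ + k₂) * (1 + x) := by simp only [U]; ring
    rw [e, abs_le]
    have := hD0 x hx'
    have q2 : 0 ≤ (2 + k₁ + k₂) * (1 + x) := by positivity
    have q3 : 0 ≤ 2 * H1 (1 / 2) * (1 + x) := this.le.trans b2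
    constructor <;> nlinarith
  · have hsub : ∀ x ∈ Ioo (0 : ℝ) 1, x ∈ Ioo (-1 : ℝ) 1 := fun x hx => ⟨by linarith [hx.1], hx.2⟩
    have lim : ∀ g : ℝ → ℝ, Continuous g → Tendsto g (𝓝[<] 1) (𝓝 (g 1)) := fun g hg =>
      (hg.tendsto 1).mono_left nhdsWithin_le_nhds
    have tA := lim (fun x => -(2 * k₁) + (k₁ + k₂) * (1 + x)) (by fun_prop)
    have tB := lim (fun x => 2 * m * (1 - x ^ 2)) (by fun_prop)
    have tU := lim (fun x => (1 + k₁) * (1 - x) - (1 + k₂) * (1 + x)) (by fun_prop)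
    -- At `1` the coefficient of `D` tends to `2k₂`, so `D` tends to `4k₂` and the solution to
    -- `-2(1+k₂) + 4k₂ = -2 + 2k₂`.
    have t1 := tendsto_of_logistic (k := 2 * k₂) (by positivity)
      (fun x hx => hD0 x (hsub x hx)) (B := fun x => 2 * m * (1 - x ^ 2))
      (A := fun x => -(2 * k₁) + (k₁ + k₂) * (1 + x))
      (fun x hx => mul_nonneg (by positivity) (one_sub_sq_pos (hsub x hx)).le)
      (fun x hx => dD x (hsub x hx)) (by convert tA using 2; ring) (by convert tB using 2; ring)
    convert tU.add t1 using 2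
    ring

/-! ### Smooth dependence of the extremal profiles on the constants -/

theorem ev_toCb_of_continuous {f : ℝ → ℝ} (hf : Continuous f) {x : ℝ} (hx : x ∈ Ioo (-1 : ℝ) 1) :
    ev (toCb (Ioo (-1) 1) f) x = f x := by
  obtain ⟨C, hC⟩ := (isCompact_Icc (a := (-1 : ℝ)) (b := 1)).exists_bound_of_continuousOn
    hf.continuousOn
  exact ev_toCb hf.continuousOn (fun y hy => hC y ⟨hy.1.le, hy.2.le⟩) hx

/-- The functions `f - r + 1` and `r - f + 1` both have the positive limit `1`, so the one-sided
bound applies to each. -/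
theorem exists_abs_le_of_tendsto_right {f : ℝ → ℝ} (hf : ContinuousOn f (Ico 0 1)) {r : ℝ}
    (h : Tendsto f (𝓝[<] 1) (𝓝 r)) : ∃ C, ∀ x ∈ Ico (0 : ℝ) 1, |f x| ≤ C := by
  obtain ⟨m, hm, N, hN, h1⟩ := exists_le_add_mul_of_tendsto (ℓ := fun x => f x - r + 1)
    (hr := one_pos) ((hf.sub continuousOn_const).add continuousOn_const) (by
      simpa using (h.sub_const r).add_const 1)
  obtain ⟨m', hm', N', hN', h2⟩ := exists_le_add_mul_of_tendsto (ℓ := fun x => r - f x + 1)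
    (hr := one_pos) ((continuousOn_const.sub hf).add continuousOn_const) (by
      simpa using (h.const_sub r).add_const 1)
  refine ⟨|r| + 1 + N + N', fun x hx => abs_le.2 ?_⟩
  have h3 := h1 x hx
  have h4 := h2 x hx
  have h5 := le_abs_self r
  have h6 := neg_abs_le r
  constructor <;> nlinarith [sq_nonneg x]

theorem IsTop.exists_abs_le {c : Fin 3 → ℝ} {U : ℝ → ℝ} (h : IsTop c U) :
    ∃ C, ∀ x ∈ Ioo (-1 : ℝ) 1, |U x| ≤ C := by
  obtain ⟨A, hA⟩ := h.left
  obtain ⟨B, hB⟩ := exists_abs_le_of_tendsto_right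
    (h.isNoSwirl.continuousOn.mono fun x hx => ⟨by linarith [hx.1], hx.2⟩) h.right
  refine ⟨|B| + (|2 + 2 * √(1 + c 0)| + |A|), fun x hx => ?_⟩
  rcases le_total x 0 with h0 | h0
  · have h1 := hA x ⟨hx.1, h0⟩
    have h2 : A * (1 + x) ≤ |A| := by
      have : A * (1 + x) ≤ |A| * (1 + x) :=
        mul_le_mul_of_nonneg_right (le_abs_self A) (by linarith [hx.1])
      nlinarith [abs_nonneg A]
    have h3 := abs_add_le (U x - (2 + 2 * √(1 + c 0))) (2 + 2 * √(1 + c 0))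
    rw [sub_add_cancel] at h3
    linarith [abs_nonneg B]
  · have := hB x ⟨h0, hx.2⟩
    linarith [le_abs_self B, abs_nonneg A, abs_nonneg (2 + 2 * √(1 + c 0))]

theorem IsTop.tendsto_left {c : Fin 3 → ℝ} {U : ℝ → ℝ} (h : IsTop c U) :
    Tendsto U (𝓝[>] (-1)) (𝓝 (2 + 2 * √(1 + c 0))) := by
  obtain ⟨A, hA⟩ := h.left
  rw [tendsto_iff_norm_sub_tendsto_zero]
  have h1 : Tendsto (fun x : ℝ => A * (1 + x)) (𝓝[>] (-1)) (𝓝 0) := by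
    have : Continuous fun x : ℝ => A * (1 + x) := by fun_prop
    simpa using (this.tendsto (-1)).mono_left nhdsWithin_le_nhds
  refine squeeze_zero' (Eventually.of_forall fun _ => norm_nonneg _) ?_ h1
  filter_upwards [Ioo_mem_nhdsGT (show (-1 : ℝ) < 0 by norm_num)] with x hx
  exact hA x ⟨hx.1, hx.2.le⟩

theorem tendsto_congr_left {f g : ℝ → ℝ} (h : ∀ x ∈ Ioo (-1 : ℝ) 1, f x = g x) {l : Filter ℝ}
    (hf : Tendsto f (𝓝[>] (-1)) l) : Tendsto g (𝓝[>] (-1)) l := by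
  refine hf.congr' ?_
  filter_upwards [Ioo_mem_nhdsGT (show (-1 : ℝ) < 1 by norm_num)] with x hx using h x hx

theorem tendsto_congr_right {f g : ℝ → ℝ} (h : ∀ x ∈ Ioo (-1 : ℝ) 1, f x = g x) {l : Filter ℝ}
    (hf : Tendsto f (𝓝[<] 1) l) : Tendsto g (𝓝[<] 1) l := by
  refine hf.congr' ?_
  filter_upwards [Ioo_mem_nhdsLT (show (-1 : ℝ) < 1 by norm_num)] with x hx using h x hx

/-- Near `c₀` the solutions of the equation with constants `m c` and initial value `g (m c)` are
bounded perturbations of `U₀`, depending smoothly on `c`; `U₀` has the boundary values `l`, `r`. -/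
structure IsLocalProfile (m : (Fin 3 → ℝ) → Fin 3 → ℝ) (g : (Fin 3 → ℝ) → ℝ) (c₀ : Fin 3 → ℝ)
    (U₀ : Cb (Ioo (-1) 1)) (l r : ℝ) : Prop where
  left : Tendsto (ev U₀) (𝓝[>] (-1)) (𝓝 l)
  right : Tendsto (ev U₀) (𝓝[<] 1) (𝓝 r)
  exists_family : ∃ N : Set (Fin 3 → ℝ), ∃ q : (Fin 3 → ℝ) → Cb (Ioo (-1) 1), IsOpen N ∧ c₀ ∈ N ∧
    ContDiffOn ℝ ∞ q N ∧ q c₀ = 0 ∧ ∀ c ∈ N, IsNoSwirl (m c) (ev (U₀ + q c)) ∧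
      g (m c) = ev (U₀ + q c) 0

/-- Perturbed profiles are sought as `U + (1+τx) z`. Then `(1-x²) z' + ℓ z = F - (1+τx) z²/2` with
`ℓ = 2x + U + τ(1-x)`, because `τ(1-x²) = (1+τx) τ(1-x)` for `τ ∈ {0,1}`. The limits of `ℓ` are
`2√(1+c₁) + 2τ` and `2√(1+c₂)`. For `c₁ > -1` the choice `τ = 0` makes both positive; for `c₁ = -1`
perturbations vanishing at `-1` are needed, hence `τ = 1`. -/
theorem IsTop.isLocalProfile {c₀ : Fin 3 → ℝ} {U : ℝ → ℝ} (hU : IsTop c₀ U) (h1 : -1 < c₀ 1)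
    {τ : ℝ} (hτ : τ = 1 ∨ τ = 0 ∧ -1 < c₀ 0) {m : (Fin 3 → ℝ) → Fin 3 → ℝ}
    {F : (Fin 3 → ℝ) → Cb (Ioo (-1) 1)} (hF : ContDiff ℝ ω F) (hF0 : F c₀ = 0)
    (hm : ∀ c, ∀ x ∈ Ioo (-1 : ℝ) 1, (1 + τ * x) * ev (F c) x = P (m c) x - P c₀ x) :
    IsLocalProfile m gammaPlus c₀ (toCb (Ioo (-1) 1) U) (2 + 2 * √(1 + c₀ 0))
      (-2 + 2 * √(1 + c₀ 1)) := by
  obtain ⟨B, hB⟩ := hU.exists_abs_le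
  have hev : ∀ x ∈ Ioo (-1 : ℝ) 1, ev (toCb (Ioo (-1) 1) U) x = U x := fun x hx =>
    ev_toCb hU.isNoSwirl.continuousOn hB hx
  have hl := tendsto_congr_left (fun x hx => (hev x hx).symm) hU.tendsto_left
  have hr := tendsto_congr_right (fun x hx => (hev x hx).symm) hU.right
  set U₀ := toCb (Ioo (-1) 1) U with hU₀
  refine ⟨hl, hr, ?_⟩
  set ℓ : ℝ → ℝ := fun x => 2 * x + ev U₀ x + τ * (1 - x) with hℓ
  have hℓc : ContinuousOn ℓ (Ioo (-1) 1) :=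
    ((by fun_prop : ContinuousOn (fun x : ℝ => 2 * x) _).add (continuousOn_ev U₀)).add
      (by fun_prop)
  have hκ₁ := Real.sqrt_nonneg (1 + c₀ 0)
  have hκ₂ : 0 < √(1 + c₀ 1) := Real.sqrt_pos.2 (by linarith)
  have hpos : PosEnds ℓ := by
    refine posEnds_of_tendsto hℓc (l := 2 * √(1 + c₀ 0) + 2 * τ) (r := 2 * √(1 + c₀ 1)) ?_
      (by positivity) ?_ ?_
    · rcases hτ with rfl | ⟨rfl, h⟩
      · linarith
      · have : 0 < √(1 + c₀ 0) := Real.sqrt_pos.2 (by linarith)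
        linarith
    · have h3 : Tendsto (fun x : ℝ => 2 * x) (𝓝[>] (-1)) (𝓝 (2 * (-1))) :=
        ((by fun_prop : Continuous fun x : ℝ => 2 * x).tendsto (-1)).mono_left nhdsWithin_le_nhds
      have h4 : Tendsto (fun x : ℝ => τ * (1 - x)) (𝓝[>] (-1)) (𝓝 (τ * (1 - (-1)))) :=
        ((by fun_prop : Continuous fun x : ℝ => τ * (1 - x)).tendsto (-1)).mono_left
          nhdsWithin_le_nhds
      have := (h3.add hl).add h4
      convert this using 2
      ring
    · have h3 : Tendsto (fun x : ℝ => 2 * x) (𝓝[<] 1) (𝓝 (2 * 1)) :=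
        ((by fun_prop : Continuous fun x : ℝ => 2 * x).tendsto 1).mono_left nhdsWithin_le_nhds
      have h4 : Tendsto (fun x : ℝ => τ * (1 - x)) (𝓝[<] 1) (𝓝 (τ * (1 - 1))) :=
        ((by fun_prop : Continuous fun x : ℝ => τ * (1 - x)).tendsto 1).mono_left
          nhdsWithin_le_nhds
      have := (h3.add hr).add h4
      convert this using 2
      ring
  obtain ⟨T, hT, -⟩ := exists_solver_left hℓc hpos
  set om : Cb (Ioo (-1) 1) := toCb (Ioo (-1) 1) fun x => 1 + τ * x with hom
  have hom' : ∀ x ∈ Ioo (-1 : ℝ) 1, ev om x = 1 + τ * x := fun x hx =>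
    ev_toCb_of_continuous (by fun_prop) hx
  set Φ : (Fin 3 → ℝ) × Cb (Ioo (-1) 1) → Cb (Ioo (-1) 1) :=
    fun y => T (F y.1 - (1 / 2 : ℝ) • (om * (y.2 * y.2)))
  have hΦ : ContDiff ℝ ω Φ := by
    refine T.contDiff.comp ((hF.comp contDiff_fst).sub (ContDiff.const_smul _ ?_))
    exact contDiff_const.mul (contDiff_snd.mul contDiff_snd)
  have hd : HasFDerivAt (fun z => Φ (c₀, z)) (0 : Cb (Ioo (-1) 1) →L[ℝ] Cb (Ioo (-1) 1)) 0 := by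
    have h2 : HasFDerivAt (fun z : Cb (Ioo (-1) 1) => z * z) _ 0 :=
      (hasFDerivAt_id (𝕜 := ℝ) (0 : Cb (Ioo (-1) 1))).mul' (hasFDerivAt_id _)
    have h3 := T.hasFDerivAt.comp (0 : Cb (Ioo (-1) 1))
      (((h2.const_mul om).const_smul (1 / 2 : ℝ)).const_sub (F c₀))
    refine h3.congr_fderiv ?_
    ext1 z
    simp
  obtain ⟨z, N, ρ, hρ, hN, hcN, hz, hz0, hzΦ, -⟩ :=
    exists_analytic_fixedPoint hΦ (p₀ := c₀) (by simp [Φ, hF0]) hd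
  -- To identify the new initial value with `γ⁺`, the perturbed profile must stay above `2 -
  -- C(1+x)`. For `τ = 1` the perturbation is `O(1+x)`; for `τ = 0` it must be smaller than the gap
  -- `2√(1+c₁)`.
  have hex : ∃ ρ > 0, ∀ s, |s| < ρ → ∃ C, ∀ x ∈ Ioc (-1 : ℝ) 0,
      (1 + τ * x) * |s| ≤ 2 * √(1 + c₀ 0) + C * (1 + x) := by
    rcases hτ with rfl | ⟨rfl, h⟩
    · exact ⟨1, one_pos, fun s _ => ⟨|s|, fun x hx => by nlinarith⟩⟩
    · have : 0 < √(1 + c₀ 0) := Real.sqrt_pos.2 (by linarith)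
      exact ⟨2 * √(1 + c₀ 0), by positivity, fun s hs => ⟨0, fun x hx => by nlinarith⟩⟩
  obtain ⟨ρ', hρ', hex⟩ := hex
  have hN' : IsOpen (N ∩ z ⁻¹' Metric.ball 0 ρ') :=
    hz.continuousOn.isOpen_inter_preimage hN Metric.isOpen_ball
  refine ⟨N ∩ z ⁻¹' Metric.ball 0 ρ', fun c => om * z c, hN', ⟨hcN, by simp [hz0, hρ']⟩,
    contDiffOn_const.mul ((hz.of_le le_top).mono inter_subset_left), by simp [hz0], ?_⟩
  rintro c ⟨hc, hcz⟩
  have hzc := hzΦ c hc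
  have hder : ∀ x ∈ Ioo (-1 : ℝ) 1, HasDerivAt (ev (z c))
      ((ev (F c) x - (1 / 2) * (ev om x * (ev (z c) x * ev (z c) x)) - ℓ x * ev (z c) x) /
        (1 - x ^ 2)) x := by
    intro x hx
    have h2 := hT.hasDerivAt (F c - (1 / 2 : ℝ) • (om * (z c * z c))) x hx
    have h3 : T (F c - (1 / 2 : ℝ) • (om * (z c * z c))) = z c := hzc.symm
    rw [h3] at h2
    simpa using h2
  have hns : IsNoSwirl (m c) (ev (U₀ + om * z c)) := by
    refine IsNoSwirl.of_hasDerivAt fun x hx => ?_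
    have hn : Ioo (-1 : ℝ) 1 ∈ 𝓝 x := isOpen_Ioo.mem_nhds hx
    have e1 : ev (U₀ + om * z c) =ᶠ[𝓝 x] fun y => U y + (1 + τ * y) * ev (z c) y := by
      filter_upwards [hn] with y hy
      simp [hev y hy, hom' y hy]
    have h3 : HasDerivAt (fun y => 1 + τ * y) τ x := by
      simpa using ((hasDerivAt_id x).const_mul τ).const_add 1
    have h4 := (hU.isNoSwirl.hasDerivAt hx).fun_add (h3.fun_mul (hder x hx))
    refine (h4.congr_of_eventuallyEq e1).congr_deriv ?_
    have hpos := one_sub_sq_pos hx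
    rw [e1.eq_of_nhds, eq_div_iff hpos.ne', hom' x hx]
    have h5 := hm c x hx
    have h6 : τ * (1 - x ^ 2) = (1 + τ * x) * (τ * (1 - x)) := by
      rcases hτ with rfl | ⟨rfl, -⟩ <;> ring
    simp only [hℓ, hev x hx]
    rw [add_mul, div_mul_cancel₀ _ hpos.ne', add_mul, mul_assoc (1 + τ * x),
      div_mul_cancel₀ _ hpos.ne']
    linear_combination h5 + (ev (z c) x) * h6
  refine ⟨hns, ?_⟩
  obtain ⟨A, hA⟩ := hU.left
  obtain ⟨C, hC⟩ := hex ‖z c‖ (by simpa using hcz)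
  refine hns.gammaPlus_eq (C := A + C) fun x hx => ?_
  have hx' : x ∈ Ioo (-1 : ℝ) 1 := ⟨hx.1, by linarith [hx.2]⟩
  rw [ev_add, ev_mul, hev x hx', hom' x hx']
  have h3 := (abs_le.1 (hA x hx)).1
  have h4 := hC x hx
  rw [abs_norm] at h4
  have h5 : 0 ≤ 1 + τ * x := by
    rcases hτ with rfl | ⟨rfl, -⟩ <;> linarith [hx.1]
  have h6 := (abs_le.1 (abs_ev_le (z c) x)).1
  have h7 := mul_le_mul_of_nonneg_left h6 h5
  linarith

theorem contDiff_linear_Cb {c₀ : Fin 3 → ℝ} (i : Fin 3) (y : Cb (Ioo (-1) 1)) :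
    ContDiff ℝ ω fun c : Fin 3 → ℝ => (c i - c₀ i) • y :=
  ((contDiff_apply ℝ ℝ i).sub contDiff_const).smul contDiff_const

theorem exists_localProfile_of_lt {c₀ : Fin 3 → ℝ} (h0 : -1 < c₀ 0) (h1 : -1 < c₀ 1)
    (h2 : c3bar (c₀ 0) (c₀ 1) < c₀ 2) :
    ∃ U₀, IsLocalProfile id gammaPlus c₀ U₀ (2 + 2 * √(1 + c₀ 0)) (-2 + 2 * √(1 + c₀ 1)) := by
  obtain ⟨U, hU⟩ := exists_isTop h0.le h1 h2
  refine ⟨_, hU.isLocalProfile h1 (τ := 0) (Or.inr ⟨rfl, h0⟩)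
    (F := fun c => (c 0 - c₀ 0) • toCb _ (fun x => 1 - x) + (c 1 - c₀ 1) • toCb _ (fun x => 1 + x) +
      (c 2 - c₀ 2) • toCb _ (fun x => 1 - x ^ 2)) ?_ (by simp) fun c x hx => ?_⟩
  · exact ((contDiff_linear_Cb _ _).add (contDiff_linear_Cb _ _)).add (contDiff_linear_Cb _ _)
  · simp only [ev_add, ev_smul]
    rw [ev_toCb_of_continuous (by fun_prop) hx, ev_toCb_of_continuous (by fun_prop) hx,
      ev_toCb_of_continuous (by fun_prop) hx]
    simp only [P, id]
    ring

/-- With `c₁` frozen at `-1`, the difference of the polynomials is divisible by `1+x`, as `τ = 1`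
requires. Overwriting `c₁` by `-1` defines the family on an open set of constants although the
profiles of interest lie on a hyperplane. -/
theorem exists_localProfile_of_eq {c₀ : Fin 3 → ℝ} (h0 : c₀ 0 = -1) (h1 : -1 < c₀ 1)
    (h2 : c3bar (c₀ 0) (c₀ 1) < c₀ 2) :
    ∃ U₀, IsLocalProfile (fun c => Function.update c 0 (-1)) gammaPlus c₀ U₀
      (2 + 2 * √(1 + c₀ 0)) (-2 + 2 * √(1 + c₀ 1)) := by
  obtain ⟨U, hU⟩ := exists_isTop h0.ge h1 h2
  refine ⟨_, hU.isLocalProfile h1 (τ := 1) (Or.inl rfl)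
    (F := fun c => (c 1 - c₀ 1) • toCb _ (fun _ => 1) + (c 2 - c₀ 2) • toCb _ (fun x => 1 - x))
    ?_ (by simp) fun c x hx => ?_⟩
  · exact (contDiff_linear_Cb _ _).add (contDiff_linear_Cb _ _)
  · simp only [ev_add, ev_smul]
    rw [ev_toCb_of_continuous (by fun_prop) hx, ev_toCb_of_continuous (by fun_prop) hx]
    simp only [P, Function.update_self, ne_eq, one_ne_zero, not_false_eq_true,
      Function.update_of_ne, h0, show (2 : Fin 3) ≠ 0 by decide]
    ring

theorem contDiff_swapC : ContDiff ℝ ∞ swapC := by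
  rw [contDiff_pi]
  intro i
  fin_cases i <;> exact contDiff_apply ℝ ℝ _

theorem IsLocalProfile.refl {m : (Fin 3 → ℝ) → Fin 3 → ℝ} {c₀ : Fin 3 → ℝ}
    {U₀ : Cb (Ioo (-1) 1)} {l r : ℝ} (h : IsLocalProfile m gammaPlus (swapC c₀) U₀ l r) :
    IsLocalProfile (fun c => swapC (m (swapC c))) gammaMinus c₀ (-reflCb U₀) (-r) (-l) := by
  obtain ⟨hl, hr, N, q, hN, hc, hq, hq0, hNS⟩ := h
  have e : ∀ z : Cb (Ioo (-1) 1), ev (-reflCb z) = fun x => -ev z (-x) := fun z => by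
    funext x
    rw [ev_neg, ev_reflCb]
  refine ⟨?_, ?_, swapC ⁻¹' N, fun c => -reflCb (q (swapC c)), ?_, hc, ?_, ?_, fun c hcN => ?_⟩
  · rw [e]
    exact (hr.comp (by simpa using tendsto_neg_nhdsGT (a := (-1 : ℝ)))).neg
  · rw [e]
    exact (hl.comp tendsto_neg_nhdsLT_one).neg
  · exact hN.preimage contDiff_swapC.continuous
  · refine (reflCb.contDiff.comp_contDiffOn (hq.comp contDiff_swapC.contDiffOn fun c hc => hc)).neg
  · simp [hq0]
  · obtain ⟨h1, h2⟩ := hNS _ hcN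
    have e2 : -reflCb U₀ + -reflCb (q (swapC c)) = -reflCb (U₀ + q (swapC c)) := by
      rw [map_add]; abel
    rw [e2, e]
    refine ⟨h1.refl, ?_⟩
    rw [gammaMinus_eq_neg_gammaPlus, swapC_swapC, h2]
    simp only [neg_zero]

/-! ### Powers of `1 - x²` -/

/-- The weight `(1-x²)^e`. -/
def pw (e x : ℝ) : ℝ := (1 - x ^ 2) ^ e

theorem pw_pos (e : ℝ) {x : ℝ} (hx : x ∈ Ioo (-1 : ℝ) 1) : 0 < pw e x :=
  Real.rpow_pos_of_pos (one_sub_sq_pos hx) e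

@[simp] theorem pw_at_zero (e : ℝ) : pw e 0 = 1 := by simp [pw]

theorem pw_mul (d e : ℝ) {x : ℝ} (hx : x ∈ Ioo (-1 : ℝ) 1) : pw d x * pw e x = pw (d + e) x :=
  (Real.rpow_add (one_sub_sq_pos hx) d e).symm

theorem pw_mul_one_sub_sq (d : ℝ) {x : ℝ} (hx : x ∈ Ioo (-1 : ℝ) 1) :
    pw d x * (1 - x ^ 2) = pw (d + 1) x := by
  have := pw_mul d 1 hx
  rwa [pw, pw, Real.rpow_one] at this

theorem pw_neg_mul (e : ℝ) {x : ℝ} (hx : x ∈ Ioo (-1 : ℝ) 1) : pw (-e) x * pw e x = 1 :=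
  rpow_neg_mul_rpow hx e

theorem continuousOn_pw (e : ℝ) : ContinuousOn (pw e) (Ioo (-1) 1) := continuousOn_rpow_weight e

theorem hasDerivAt_pw (e : ℝ) {x : ℝ} (hx : x ∈ Ioo (-1 : ℝ) 1) :
    HasDerivAt (pw e) (-(2 * e * x) * pw e x / (1 - x ^ 2)) x := by
  have h1 : HasDerivAt (fun y : ℝ => 1 - y ^ 2) (-(2 * x)) x := by
    simpa using (hasDerivAt_pow 2 x).const_sub 1
  have h2 := h1.rpow_const (p := e) (Or.inl (one_sub_sq_pos hx).ne')
  refine h2.congr_deriv ?_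
  rw [Real.rpow_sub_one (one_sub_sq_pos hx).ne', pw]
  ring

theorem pw_le_one {e : ℝ} (he : 0 ≤ e) {x : ℝ} (hx : x ∈ Ioo (-1 : ℝ) 1) : pw e x ≤ 1 :=
  Real.rpow_le_one (one_sub_sq_pos hx).le (by nlinarith [sq_nonneg x]) he

/-- The weight `(1-x²)^e`, `0 ≤ e`, as a bounded continuous function. -/
def pwCb (e : ℝ) : Cb (Ioo (-1) 1) := toCb _ (pw e)

theorem ev_pwCb {e : ℝ} (he : 0 ≤ e) {x : ℝ} (hx : x ∈ Ioo (-1 : ℝ) 1) : ev (pwCb e) x = pw e x :=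
  ev_toCb (continuousOn_pw e) (C := 1) (fun y hy => by
    rw [abs_of_pos (pw_pos e hy)]; exact pw_le_one he hy) hx

theorem gexp_eq_of_hasDerivAt {ℓ F : ℝ → ℝ} (hℓ : ContinuousOn ℓ (Ioo (-1) 1)) (h0 : F 0 = 1)
    (hF : ∀ x ∈ Ioo (-1 : ℝ) 1, HasDerivAt F (F x * (ℓ x / (1 - x ^ 2))) x)
    {x : ℝ} (hx : x ∈ Ioo (-1 : ℝ) 1) : gexp ℓ x = F x := by
  have h := eq_div_gexp (ℓ := fun x => -ℓ x) hℓ.neg (f := F) (fun y hy =>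
    (hF y hy).congr_deriv (by ring)) hx
  have e : gexp (fun x => -ℓ x) x = (gexp ℓ x)⁻¹ := by
    simp only [gexp, neg_div]
    rw [intervalIntegral.integral_neg, Real.exp_neg]
  rw [h, h0, e, one_div, inv_inv]

theorem gexp_linear (e : ℝ) {x : ℝ} (hx : x ∈ Ioo (-1 : ℝ) 1) :
    gexp (fun x => 2 * e * x) x = pw (-e) x :=
  gexp_eq_of_hasDerivAt (by fun_prop) (pw_at_zero _) (fun y hy =>
    (hasDerivAt_pw (-e) hy).congr_deriv (by ring)) hx

theorem outEnds_linear {e : ℝ} (he : 0 < e) : OutEnds fun x => 2 * e * x := by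
  have h : Continuous fun x : ℝ => 2 * e * x := by fun_prop
  refine outEnds_of_tendsto h.continuousOn (l := 2 * e * (-1)) (r := 2 * e * 1) (by linarith)
    (by linarith) ?_ ?_
  · exact (h.tendsto _).mono_left nhdsWithin_le_nhds
  · exact (h.tendsto _).mono_left nhdsWithin_le_nhds

theorem exists_initSolver_linear {e : ℝ} (he : 0 < e) :
    ∃ T, IsInitSolver (fun x => 2 * e * x) T :=
  (exists_initSolver (by fun_prop) (outEnds_linear he)).1

/-- Integration in weighted form: since `(1-x²)^e f` solves the equation with `ℓ = 2ex`, a bound on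
`(1-x²)^{e+1} f'` yields one on `(1-x²)^e f`, through a fixed bounded operator. -/
theorem IsInitSolver.eq_linear {e : ℝ} {T : Cb (Ioo (-1) 1) →L[ℝ] Cb (Ioo (-1) 1)}
    (h : IsInitSolver (fun x => 2 * e * x) T) {f g : ℝ → ℝ} {y : Cb (Ioo (-1) 1)}
    (hf : ∀ x ∈ Ioo (-1 : ℝ) 1, HasDerivAt f (g x) x)
    (hg : ∀ x ∈ Ioo (-1 : ℝ) 1, pw (e + 1) x * g x = ev y x) {x : ℝ}
    (hx : x ∈ Ioo (-1 : ℝ) 1) : pw e x * f x = f 0 * pw e x + ev (T y) x := by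
  have h1 := h.eq (f := fun x => pw e x * f x) (y := y) (fun x hx => by
    refine ((hasDerivAt_pw e hx).fun_mul (hf x hx)).congr_deriv ?_
    have := (one_sub_sq_pos hx).ne'
    rw [← hg x hx, ← pw_mul_one_sub_sq e hx]
    field_simp
    ring) hx
  rw [h1, gexp_linear e hx]
  have h2 := pw_neg_mul e hx
  have h3 := (pw_pos (-e) hx).ne'
  simp only [pw_at_zero, one_mul]
  rw [div_eq_iff_mul_eq h3 |>.2 (show f 0 * pw e x * pw (-e) x = f 0 by
    rw [mul_assoc, mul_comm (pw e x), h2, mul_one])]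

/-! ### The operators that represent `ψ` -/

/-- Integration operators in weighted form: `Z`, `S₂`, `S₁` integrate from `0`, and `A`, `B`
from `-1` and `1`. -/
structure SwirlOps (ε : ℝ) where
  Z : Cb (Ioo (-1) 1) →L[ℝ] Cb (Ioo (-1) 1)
  S₂ : Cb (Ioo (-1) 1) →L[ℝ] Cb (Ioo (-1) 1)
  S₁ : Cb (Ioo (-1) 1) →L[ℝ] Cb (Ioo (-1) 1)
  A : Cb (Ioo (-1) 1) →L[ℝ] Cb (Ioo (-1) 1)
  B : Cb (Ioo (-1) 1) →L[ℝ] Cb (Ioo (-1) 1)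
  isZ : IsInitSolver (fun x => 2 * ε * x) Z
  isS₂ : IsInitSolver (fun x => 2 * (1 + 2 * ε) * x) S₂
  isS₁ : IsInitSolver (fun x => 2 * (2 * ε) * x) S₁
  A_eq : ∀ y, ∀ x ∈ Ioo (-1 : ℝ) 1,
    IntervalIntegrable (fun s => pw (-(2 * ε)) s * ev y s) MeasureTheory.volume (-1) x ∧
    pw (1 - 2 * ε) x * ev (A y) x = (1 - x) * ∫ s in (-1 : ℝ)..x, pw (-(2 * ε)) s * ev y s
  B_eq : ∀ y, ∀ x ∈ Ioo (-1 : ℝ) 1,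
    IntervalIntegrable (fun s => pw (-(2 * ε)) s * ev y s) MeasureTheory.volume 1 x ∧
    pw (1 - 2 * ε) x * ev (B y) x = (1 + x) * ∫ s in (1 : ℝ)..x, pw (-(2 * ε)) s * ev y s

theorem intervalIntegrable_refl {f : ℝ → ℝ} {x : ℝ}
    (h : IntervalIntegrable f MeasureTheory.volume (-1) (-x)) :
    IntervalIntegrable (fun s => f (-s)) MeasureTheory.volume 1 x := by
  simpa using h.comp_sub_left 0

theorem exists_integral_from_left {ε : ℝ} (h0 : 0 < ε) (h1 : ε < 1 / 2) :
    ∃ A : Cb (Ioo (-1) 1) →L[ℝ] Cb (Ioo (-1) 1), ∀ y, ∀ x ∈ Ioo (-1 : ℝ) 1,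
    IntervalIntegrable (fun s => pw (-(2 * ε)) s * ev y s) MeasureTheory.volume (-1) x ∧
    pw (1 - 2 * ε) x * ev (A y) x =
      (1 - x) * ∫ s in (-1 : ℝ)..x, pw (-(2 * ε)) s * ev y s := by
  -- This `ℓ` has integrating factor `(1-x²)^{1-2ε}/(1-x)`, and its end values `2(1-2ε)` and `4ε`
  -- are positive. The solver applied to `(1-x) y` is then the required weighted integral.
  set ℓ : ℝ → ℝ := fun x => 1 + x - 2 * (1 - 2 * ε) * x with hℓ
  have hc : Continuous ℓ := by fun_prop
  have hp : PosEnds ℓ := by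
    refine posEnds_of_tendsto hc.continuousOn (l := ℓ (-1)) (r := ℓ 1) ?_ ?_
      ((hc.tendsto _).mono_left nhdsWithin_le_nhds) ((hc.tendsto _).mono_left nhdsWithin_le_nhds)
    · simp only [hℓ]; linarith
    · simp only [hℓ]; linarith
  obtain ⟨T, -, hT⟩ := exists_solver_left hc.continuousOn hp
  have hg : ∀ x ∈ Ioo (-1 : ℝ) 1, gexp ℓ x = pw (1 - 2 * ε) x / (1 - x) := fun x hx => by
    refine gexp_eq_of_hasDerivAt (F := fun x => pw (1 - 2 * ε) x / (1 - x)) hc.continuousOn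
      (by simp) (fun y hy => ?_) hx
    have hy1 : 1 - y ≠ 0 := by linarith [hy.2]
    have hy2 : 1 + y ≠ 0 := by linarith [hy.1]
    refine ((hasDerivAt_pw (1 - 2 * ε) hy).fun_div ((hasDerivAt_id y).const_sub 1)
      hy1).congr_deriv ?_
    rw [show 1 - y ^ 2 = (1 - y) * (1 + y) by ring]
    simp only [hℓ, id]
    field_simp
    ring
  set m : Cb (Ioo (-1) 1) := toCb _ fun x => 1 - x
  have hm : ∀ x ∈ Ioo (-1 : ℝ) 1, ev m x = 1 - x := fun x hx =>
    ev_toCb_of_continuous (by fun_prop) hx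
  have hin : ∀ y : Cb (Ioo (-1) 1), ∀ s ∈ Ioo (-1 : ℝ) 1,
      gexp ℓ s / (1 - s ^ 2) * ev (m * y) s = pw (-(2 * ε)) s * ev y s := by
    intro y s hs
    have hs1 : 1 - s ≠ 0 := by linarith [hs.2]
    have h2 := pw_mul_one_sub_sq (-(2 * ε)) hs
    rw [show -(2 * ε) + 1 = 1 - 2 * ε by ring] at h2
    have := (one_sub_sq_pos hs).ne'
    rw [ev_mul, hm s hs, hg s hs, ← h2]
    field_simp
  refine ⟨T.comp (ContinuousLinearMap.mul ℝ _ m), fun y x hx => ?_⟩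
  have hsub : Ioo (-1) x ⊆ Ioo (-1 : ℝ) 1 := fun s hs => ⟨hs.1, hs.2.trans hx.2⟩
  constructor
  · have := intervalIntegrable_mul_ev (by norm_num) hx
      (intervalIntegrable_gexp_left hc.continuousOn hp hx) (m * y)
    refine this.congr_uIoo ?_
    rw [uIoo_of_le hx.1.le]
    exact fun s hs => hin y s (hsub hs)
  · rw [ContinuousLinearMap.comp_apply, ContinuousLinearMap.mul_apply', hT _ x hx,
      intervalIntegral.integral_congr_Ioo_of_le hx.1.le fun s hs => hin y s (hsub hs), hg x hx]
    have := (pw_pos (1 - 2 * ε) hx).ne'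
    have hx1 : 1 - x ≠ 0 := by linarith [hx.2]
    field_simp

theorem pw_even (e x : ℝ) : pw e (-x) = pw e x := by simp [pw]

theorem exists_integral_from_right {ε : ℝ} (h0 : 0 < ε) (h1 : ε < 1 / 2) :
    ∃ B : Cb (Ioo (-1) 1) →L[ℝ] Cb (Ioo (-1) 1), ∀ y, ∀ x ∈ Ioo (-1 : ℝ) 1,
    IntervalIntegrable (fun s => pw (-(2 * ε)) s * ev y s) MeasureTheory.volume 1 x ∧
    pw (1 - 2 * ε) x * ev (B y) x =
      (1 + x) * ∫ s in (1 : ℝ)..x, pw (-(2 * ε)) s * ev y s := by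
  obtain ⟨A, hA⟩ := exists_integral_from_left h0 h1
  refine ⟨-(reflCb.comp (A.comp reflCb)), fun y x hx => ?_⟩
  obtain ⟨h2, h3⟩ := hA (reflCb y) (-x) (neg_mem_Ioo hx)
  have e : ∀ s, pw (-(2 * ε)) (-s) * ev (reflCb y) (-s) = pw (-(2 * ε)) s * ev y s := fun s => by
    rw [pw_even, ev_reflCb, neg_neg]
  constructor
  · have := intervalIntegrable_refl h2
    simpa only [e] using this
  · rw [neg_apply, ev_neg, ContinuousLinearMap.comp_apply, ev_reflCb,
      ContinuousLinearMap.comp_apply, ← pw_even (1 - 2 * ε), mul_neg, h3]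
    have h4 := intervalIntegral.integral_comp_neg (a := 1) (b := x)
      fun s => pw (-(2 * ε)) s * ev (reflCb y) s
    simp only [e] at h4
    rw [h4, intervalIntegral.integral_symm (-1) (-x)]
    ring

theorem nonempty_swirlOps {ε : ℝ} (h0 : 0 < ε) (h1 : ε < 1 / 2) : Nonempty (SwirlOps ε) := by
  obtain ⟨Z, hZ⟩ := exists_initSolver_linear h0
  obtain ⟨S₂, hS₂⟩ := exists_initSolver_linear (e := 1 + 2 * ε) (by linarith)
  obtain ⟨S₁, hS₁⟩ := exists_initSolver_linear (e := 2 * ε) (by linarith)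
  obtain ⟨A, hA⟩ := exists_integral_from_left h0 h1
  obtain ⟨B, hB⟩ := exists_integral_from_right h0 h1
  exact ⟨⟨Z, S₂, S₁, A, B, hZ, hS₂, hS₁, hA, hB⟩⟩

/-! ### The weighted form of `ψ` and of its defect from linear interpolation -/

namespace SwirlOps

variable {ε : ℝ} (O : SwirlOps ε)

/-- `(1-x²)^{1+2ε} ψ''` as a function of `(1-x²)^{1+2ε} v v'`. -/
def χ₂ : Cb (Ioo (-1) 1) →L[ℝ] Cb (Ioo (-1) 1) := (2 : ℝ) • O.S₂

/-- `(1-x²)^{2ε} ψ'` as a function of `(1-x²)^{1+2ε} v v'`. -/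
def χ₁ : Cb (Ioo (-1) 1) →L[ℝ] Cb (Ioo (-1) 1) := O.S₁.comp O.χ₂

/-- `(1-x²)^{-1+2ε} (ψ(-1)(1-x)/2 + ψ(1)(1+x)/2 - ψ)` as a function of
`(1-x²)^{1+2ε} v v'`. -/
def κ : Cb (Ioo (-1) 1) →L[ℝ] Cb (Ioo (-1) 1) := (-(1 / 2) : ℝ) • (O.A + O.B).comp O.χ₁

theorem χ₂_apply_zero (y : Cb (Ioo (-1) 1)) : ev (O.χ₂ y) 0 = 0 := by
  simp [χ₂, O.isS₂.apply_zero]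

theorem hasDerivAt_χ₁ (y : Cb (Ioo (-1) 1)) {x : ℝ} (hx : x ∈ Ioo (-1 : ℝ) 1) :
    HasDerivAt (fun x => pw (-(2 * ε)) x * ev (O.χ₁ y) x)
      (pw (-(1 + 2 * ε)) x * ev (O.χ₂ y) x) x := by
  refine ((hasDerivAt_pw (-(2 * ε)) hx).fun_mul (O.isS₁.hasDerivAt (O.χ₂ y) x hx)).congr_deriv ?_
  have h1 := pw_mul_one_sub_sq (-(1 + 2 * ε)) hx
  rw [show -(1 + 2 * ε) + 1 = -(2 * ε) by ring] at h1
  have h2 := (one_sub_sq_pos hx).ne'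
  rw [show O.S₁ (O.χ₂ y) = O.χ₁ y from rfl, ← h1]
  field_simp
  ring

variable {v : ℝ → ℝ} {ζ η : Cb (Ioo (-1) 1)}

/-- The integrand is `2(1-x²)^{-2-2ε} ζη`, and each integration from `0` lowers the singular
exponent by one; after two of them `(1-x²)^{-2ε}` is left, integrable up to the ends. -/
theorem psi_primitives
    (hd : ∀ x ∈ Ioo (-1 : ℝ) 1, HasDerivAt v (pw (-(1 + ε)) x * ev η x) x)
    (hv : ∀ x ∈ Ioo (-1 : ℝ) 1, v x = pw (-ε) x * ev ζ x) :
    (∀ x ∈ Ioo (-1 : ℝ) 1, (∫ t in (0 : ℝ)..x, ∫ s in (0 : ℝ)..t, 2 * v s * deriv v s / (1 - s ^ 2))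
      = pw (-(2 * ε)) x * ev (O.χ₁ (ζ * η)) x) := by
  have e1 : ∀ s ∈ Ioo (-1 : ℝ) 1, pw (1 + 2 * ε + 1) s * (2 * v s * deriv v s / (1 - s ^ 2)) =
      ev ((2 : ℝ) • (ζ * η)) s := by
    intro s hs
    rw [(hd s hs).deriv, hv s hs, ev_smul, ev_mul]
    have h1 := pw_mul_one_sub_sq (1 + 2 * ε) hs
    have h2 := (one_sub_sq_pos hs).ne'
    have h3 : pw (1 + 2 * ε) s * pw (-ε) s * pw (-(1 + ε)) s = 1 := by
      rw [pw_mul _ _ hs, pw_mul _ _ hs, show 1 + 2 * ε + -ε + -(1 + ε) = 0 by ring]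
      simp [pw]
    rw [← h1]
    field_simp
    linear_combination (ev ζ s * ev η s) * h3
  have hc : ContinuousOn (fun s => 2 * v s * deriv v s / (1 - s ^ 2)) (Ioo (-1) 1) := by
    refine continuousOn_div_one_sub_sq ((continuousOn_const.mul fun x hx =>
      (hd x hx).continuousAt.continuousWithinAt).mul ?_)
    exact ((continuousOn_pw _).mul (continuousOn_ev η)).congr fun x hx => (hd x hx).deriv
  have f2 : ∀ x ∈ Ioo (-1 : ℝ) 1, pw (2 * ε + 1) x *
      (∫ s in (0 : ℝ)..x, 2 * v s * deriv v s / (1 - s ^ 2)) = ev (O.χ₂ (ζ * η)) x := by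
    intro x hx
    have := O.isS₂.eq_linear (fun x hx => hasDerivAt_integral_Ioo hc hx) e1 hx
    simp only [intervalIntegral.integral_same, zero_mul, zero_add] at this
    rw [add_comm (2 * ε), this]
    simp [χ₂]
  have hc2 : ContinuousOn (fun x => ∫ s in (0 : ℝ)..x, 2 * v s * deriv v s / (1 - s ^ 2))
      (Ioo (-1) 1) := fun x hx => (hasDerivAt_integral_Ioo hc hx).continuousAt.continuousWithinAt
  intro x hx
  have := O.isS₁.eq_linear (fun x hx => hasDerivAt_integral_Ioo hc2 hx) f2 hx
  simp only [intervalIntegral.integral_same, zero_mul, zero_add] at this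
  rw [show O.χ₁ (ζ * η) = O.S₁ (O.χ₂ (ζ * η)) from rfl, ← this, ← mul_assoc, pw_neg_mul _ hx,
    one_mul]

theorem hasDerivAt_psi
    (hd : ∀ x ∈ Ioo (-1 : ℝ) 1, HasDerivAt v (pw (-(1 + ε)) x * ev η x) x)
    (hv : ∀ x ∈ Ioo (-1 : ℝ) 1, v x = pw (-ε) x * ev ζ x)
    {x : ℝ} (hx : x ∈ Ioo (-1 : ℝ) 1) :
    HasDerivAt (psi v v) (pw (-(2 * ε)) x * ev (O.χ₁ (ζ * η)) x) x := by
  have h := O.psi_primitives hd hv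
  have hc : ContinuousOn (fun l => ∫ t in (0 : ℝ)..l, ∫ s in (0 : ℝ)..t,
      2 * v s * deriv v s / (1 - s ^ 2)) (Ioo (-1) 1) :=
    ((continuousOn_pw _).mul (continuousOn_ev _)).congr h
  have := hasDerivAt_integral_Ioo hc hx
  rwa [h x hx] at this

theorem psi_sub_left
    (hd : ∀ x ∈ Ioo (-1 : ℝ) 1, HasDerivAt v (pw (-(1 + ε)) x * ev η x) x)
    (hv : ∀ x ∈ Ioo (-1 : ℝ) 1, v x = pw (-ε) x * ev ζ x)
    {x : ℝ} (hx : x ∈ Ioo (-1 : ℝ) 1) :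
    (1 - x) * (psi v v x - psi v v (-1)) =
      pw (1 - 2 * ε) x * ev (O.A (O.χ₁ (ζ * η))) x := by
  have h := O.psi_primitives hd hv
  set y := O.χ₁ (ζ * η)
  have h1 : psi v v (-1) = ∫ s in (0 : ℝ)..(-1), pw (-(2 * ε)) s * ev y s := by
    -- The formula for `ψ'` is available only inside `(-1,1)`, so the integrands are compared on the
    -- open interval.
    refine intervalIntegral.integral_congr_uIoo fun s hs => ?_
    rw [uIoo_of_ge (by norm_num)] at hs
    exact h s ⟨hs.1, hs.2.trans one_pos⟩
  have h2 : psi v v x = ∫ s in (0 : ℝ)..x, pw (-(2 * ε)) s * ev y s :=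
    intervalIntegral.integral_congr fun s hs => h s (uIcc_subset_Ioo zero_mem_Ioo hx hs)
  obtain ⟨i1, h3⟩ := O.A_eq y x hx
  obtain ⟨i0, -⟩ := O.A_eq y 0 zero_mem_Ioo
  rw [h3, h1, h2, intervalIntegral.integral_interval_sub_left (i0.symm.trans i1) i0.symm]

theorem psi_sub_right
    (hd : ∀ x ∈ Ioo (-1 : ℝ) 1, HasDerivAt v (pw (-(1 + ε)) x * ev η x) x)
    (hv : ∀ x ∈ Ioo (-1 : ℝ) 1, v x = pw (-ε) x * ev ζ x)
    {x : ℝ} (hx : x ∈ Ioo (-1 : ℝ) 1) :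
    (1 + x) * (psi v v x - psi v v 1) =
      pw (1 - 2 * ε) x * ev (O.B (O.χ₁ (ζ * η))) x := by
  have h := O.psi_primitives hd hv
  set y := O.χ₁ (ζ * η)
  have h1 : psi v v 1 = ∫ s in (0 : ℝ)..1, pw (-(2 * ε)) s * ev y s := by
    refine intervalIntegral.integral_congr_uIoo fun s hs => ?_
    rw [uIoo_of_le (by norm_num)] at hs
    exact h s ⟨by linarith [hs.1], hs.2⟩
  have h2 : psi v v x = ∫ s in (0 : ℝ)..x, pw (-(2 * ε)) s * ev y s :=
    intervalIntegral.integral_congr fun s hs => h s (uIcc_subset_Ioo zero_mem_Ioo hx hs)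
  obtain ⟨i1, h3⟩ := O.B_eq y x hx
  obtain ⟨i0, -⟩ := O.B_eq y 0 zero_mem_Ioo
  rw [h3, h1, h2, intervalIntegral.integral_interval_sub_left (i0.symm.trans i1) i0.symm]

/-- The defect is `-1/2` times the sum of `(1-x)(ψ(x) - ψ(-1))` and `(1+x)(ψ(x) - ψ(1))`. Both are
`O((1-x²)^{1-2ε})`, the decay required of `Ũθ`. -/
theorem psi_interpolation
    (hd : ∀ x ∈ Ioo (-1 : ℝ) 1, HasDerivAt v (pw (-(1 + ε)) x * ev η x) x)
    (hv : ∀ x ∈ Ioo (-1 : ℝ) 1, v x = pw (-ε) x * ev ζ x)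
    {x : ℝ} (hx : x ∈ Ioo (-1 : ℝ) 1) :
    psi v v (-1) * (1 - x) / 2 + psi v v 1 * (1 + x) / 2 - psi v v x =
      pw (1 - 2 * ε) x * ev (O.κ (ζ * η)) x := by
  have h1 := O.psi_sub_left hd hv hx
  have h2 := O.psi_sub_right hd hv hx
  have h3 : ev (O.κ (ζ * η)) x = -(1 / 2) * (ev (O.A (O.χ₁ (ζ * η))) x +
      ev (O.B (O.χ₁ (ζ * η))) x) := by
    simp [κ]
    ring
  rw [h3]
  linear_combination (-1 / 2) * h1 + (-1 / 2) * h2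

end SwirlOps

/-! ### The fixed point equation -/

/-- The parameters `(Uθ(0), Uφ'(0), Uφ(0))` or `(β₂, β₃, β₄)`. -/
abbrev B3 : Type := EuclideanSpace ℝ (Fin 3)

/-- A coordinate of the parameters. -/
def crd (i : Fin 3) : B3 →L[ℝ] ℝ := EuclideanSpace.proj i

@[simp] theorem crd_apply (i : Fin 3) (b : B3) : crd i b = b i := rfl

/-- Solution operators of the equations linearized at a profile `U₀`, in weighted form: `T` for
`Uθ`, `R` for `Uφ'`, and `G` spans the solutions of the homogeneous equation for `Uφ'`. -/
structure LocalOps (ε : ℝ) where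
  O : SwirlOps ε
  U₀ : Cb (Ioo (-1) 1)
  T : Cb (Ioo (-1) 1) →L[ℝ] Cb (Ioo (-1) 1)
  R : Cb (Ioo (-1) 1) →L[ℝ] Cb (Ioo (-1) 1)
  G : Cb (Ioo (-1) 1)
  pos : 0 < ε
  lt_half : ε < 1 / 2
  isT : IsSolver (fun x => 2 * x + ev U₀ x - 2 * (1 - 2 * ε) * x) T
  T_ne : ev (T (pwCb (2 * ε))) 0 ≠ 0
  isR : IsInitSolver (fun x => ev U₀ x + 2 * (1 + ε) * x) R
  G_eq : ∀ x ∈ Ioo (-1 : ℝ) 1, ev G x = (gexp (fun x => ev U₀ x + 2 * (1 + ε) * x) x)⁻¹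

/-! ### The fixed point map and its derivative -/

namespace LocalOps

variable {ε : ℝ} (S : LocalOps ε)

/-- `(1-x²)^ε Uφ`. -/
def ζ (b : B3) (w : Cb (Ioo (-1) 1) × Cb (Ioo (-1) 1)) : Cb (Ioo (-1) 1) :=
  b 2 • pwCb ε + S.O.Z w.2

/-- The nonlinear terms of the equation for `Uθ`. -/
def rhs (q : Cb (Ioo (-1) 1)) (b : B3) (w : Cb (Ioo (-1) 1) × Cb (Ioo (-1) 1)) :
    Cb (Ioo (-1) 1) :=
  S.O.κ (S.ζ b w * w.2) - (1 / 2 : ℝ) • (pwCb (1 - 2 * ε) * (w.1 * w.1)) - q * w.1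

/-- The increment of the third constant. -/
def d (q : Cb (Ioo (-1) 1)) (b : B3) (w : Cb (Ioo (-1) 1) × Cb (Ioo (-1) 1)) : ℝ :=
  (ev (S.T (pwCb (2 * ε))) 0)⁻¹ * (b 0 - evL 0 (S.T (S.rhs q b w)))

/-- The fixed points of `Φ((q,b),·)` are the solutions close to `U₀ + q` with data `b`. -/
def Φ (y : (Cb (Ioo (-1) 1) × B3) × (Cb (Ioo (-1) 1) × Cb (Ioo (-1) 1))) :
    Cb (Ioo (-1) 1) × Cb (Ioo (-1) 1) :=
  (S.T (S.d y.1.1 y.1.2 y.2 • pwCb (2 * ε) + S.rhs y.1.1 y.1.2 y.2),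
    y.1.2 1 • S.G + S.R (-((y.1.1 + pwCb (1 - 2 * ε) * y.2.1) * y.2.2)))

/-- The derivative of the solution with respect to the data at `U₀`. -/
def lin : B3 →L[ℝ] Cb (Ioo (-1) 1) × Cb (Ioo (-1) 1) :=
  (((ev (S.T (pwCb (2 * ε))) 0)⁻¹ • crd 0).smulRight (S.T (pwCb (2 * ε)))).prod
  ((crd 1).smulRight S.G)

theorem contDiff_coord (i : Fin 3) : ContDiff ℝ ω fun b : B3 => b i :=
  (crd i).contDiff

variable {E : Type*} [NormedAddCommGroup E] [NormedSpace ℝ E]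

theorem contDiff_ζ {b : E → B3} {w : E → Cb (Ioo (-1) 1) × Cb (Ioo (-1) 1)}
    (hb : ContDiff ℝ ω b) (hw : ContDiff ℝ ω w) : ContDiff ℝ ω fun y => S.ζ (b y) (w y) :=
  (((contDiff_coord 2).comp hb).smul contDiff_const).add (S.O.Z.contDiff.comp hw.snd)

theorem contDiff_rhs {q : E → Cb (Ioo (-1) 1)} {b : E → B3}
    {w : E → Cb (Ioo (-1) 1) × Cb (Ioo (-1) 1)} (hq : ContDiff ℝ ω q)
    (hb : ContDiff ℝ ω b) (hw : ContDiff ℝ ω w) :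
    ContDiff ℝ ω fun y => S.rhs (q y) (b y) (w y) :=
  ((S.O.κ.contDiff.comp ((S.contDiff_ζ hb hw).mul hw.snd)).sub
    ((contDiff_const.mul (hw.fst.mul hw.fst)).const_smul _)).sub (hq.mul hw.fst)

theorem contDiff_d {q : E → Cb (Ioo (-1) 1)} {b : E → B3}
    {w : E → Cb (Ioo (-1) 1) × Cb (Ioo (-1) 1)} (hq : ContDiff ℝ ω q)
    (hb : ContDiff ℝ ω b) (hw : ContDiff ℝ ω w) :
    ContDiff ℝ ω fun y => S.d (q y) (b y) (w y) :=
  contDiff_const.mul (((contDiff_coord 0).comp hb).sub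
    ((evL 0).contDiff.comp (S.T.contDiff.comp (S.contDiff_rhs hq hb hw))))

theorem contDiff_Φ : ContDiff ℝ ω S.Φ := by
  have hq : ContDiff ℝ ω fun y : (Cb (Ioo (-1) 1) × B3) × (Cb (Ioo (-1) 1) × Cb (Ioo (-1) 1)) =>
    y.1.1 := contDiff_fst.fst
  have hb : ContDiff ℝ ω fun y : (Cb (Ioo (-1) 1) × B3) × (Cb (Ioo (-1) 1) × Cb (Ioo (-1) 1)) =>
    y.1.2 := contDiff_fst.snd
  have hw : ContDiff ℝ ω fun y : (Cb (Ioo (-1) 1) × B3) × (Cb (Ioo (-1) 1) × Cb (Ioo (-1) 1)) =>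
    y.2 := contDiff_snd
  refine ContDiff.prodMk (S.T.contDiff.comp (((S.contDiff_d hq hb hw).smul contDiff_const).add
    (S.contDiff_rhs hq hb hw))) ?_
  exact (((contDiff_coord 1).comp hb).smul contDiff_const).add
    (S.R.contDiff.comp ((hq.add (contDiff_const.mul hw.fst)).mul hw.snd).neg)

theorem hasFDerivAt_mul_zero {f g : E → Cb (Ioo (-1) 1)} {y : E} (hf : DifferentiableAt ℝ f y)
    (hg : DifferentiableAt ℝ g y) (hf0 : f y = 0) (hg0 : g y = 0) :
    HasFDerivAt (fun y => f y * g y) (0 : E →L[ℝ] Cb (Ioo (-1) 1)) y := by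
  refine (hf.hasFDerivAt.mul' hg.hasFDerivAt).congr_fderiv ?_
  ext1 z
  simp [hf0, hg0]

/-- At `q = 0` every nonlinear term is a product with two factors vanishing at `y` (`ζ` vanishes
there because `b` and `w` do), so only the explicit linear dependence on `b` survives. The lemma
serves twice: with `b = 0` for the implicit function theorem, and along the family of fixed points
for its first derivative. -/
theorem hasFDerivAt_Φ {b : E → B3} {b' : E →L[ℝ] B3}
    {w : E → Cb (Ioo (-1) 1) × Cb (Ioo (-1) 1)} {y : E} (hb : HasFDerivAt b b' y) (hb0 : b y = 0)
    (hw : DifferentiableAt ℝ w y) (hw0 : w y = 0) :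
    HasFDerivAt (fun y => S.Φ ((0, b y), w y)) (S.lin ∘L b') y := by
  have hc : ∀ i, HasFDerivAt (fun y => b y i)
      ((crd i) ∘L b') y := fun i =>
    (crd i).hasFDerivAt.comp y hb
  have hw1 : DifferentiableAt ℝ (fun y => (w y).1) y := hw.fst
  have hw2 : DifferentiableAt ℝ (fun y => (w y).2) y := hw.snd
  have w10 : (w y).1 = 0 := by rw [hw0]; rfl
  have w20 : (w y).2 = 0 := by rw [hw0]; rfl
  have hζ : DifferentiableAt ℝ (fun y => S.ζ (b y) (w y)) y :=
    ((hc 2).differentiableAt.smul_const _).add (S.O.Z.differentiableAt.comp y hw2)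
  have h1 := hasFDerivAt_mul_zero hζ hw2 (by simp [ζ, hb0, w20]) w20
  have h2 := hasFDerivAt_mul_zero hw1 hw1 w10 w10
  have h3 := hasFDerivAt_mul_zero ((differentiableAt_const (pwCb (1 - 2 * ε))).mul hw1) hw2
    (by simp [w10]) w20
  have hr : HasFDerivAt (fun y => S.rhs 0 (b y) (w y)) (0 : E →L[ℝ] Cb (Ioo (-1) 1)) y := by
    have h4 := (S.O.κ.hasFDerivAt.comp y h1).fun_sub
      ((h2.const_mul (pwCb (1 - 2 * ε))).const_smul (1 / 2 : ℝ))
    refine (h4.congr_of_eventuallyEq (Eventually.of_forall fun y => ?_)).congr_fderiv ?_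
    · simp [rhs]
    · ext1 z; simp
  have hd : HasFDerivAt (fun y => S.d 0 (b y) (w y)) ((ev (S.T (pwCb (2 * ε))) 0)⁻¹ •
      ((crd 0) ∘L b')) y := by
    have h5 := ((hc 0).fun_sub ((evL 0).hasFDerivAt.comp y
      (S.T.hasFDerivAt.comp y hr))).const_mul (ev (S.T (pwCb (2 * ε))) 0)⁻¹
    refine h5.congr_fderiv ?_
    ext1 z; simp
  have hΦ1 := S.T.hasFDerivAt.comp y ((hd.smul_const (pwCb (2 * ε))).fun_add hr)
  have hΦ2 := ((hc 1).smul_const S.G).fun_add (S.R.hasFDerivAt.comp y h3.fun_neg)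
  refine ((hΦ1.prodMk hΦ2).congr_of_eventuallyEq
    (Eventually.of_forall fun y => ?_)).congr_fderiv ?_
  · simp [Φ]
  · refine ContinuousLinearMap.ext fun z => ?_
    simp [lin]

theorem Φ_zero (q : Cb (Ioo (-1) 1)) : S.Φ ((q, 0), 0) = 0 := by
  simp [Φ, d, rhs]

/-- The solution of the fixed point equation. -/
theorem exists_fixedPoint : ∃ h : Cb (Ioo (-1) 1) × B3 → Cb (Ioo (-1) 1) × Cb (Ioo (-1) 1),
    ∃ N : Set (Cb (Ioo (-1) 1) × B3), ∃ ρ > 0, IsOpen N ∧ (0, 0) ∈ N ∧ ContDiffOn ℝ ω h N ∧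
      HasFDerivAt (fun b => h (0, b)) S.lin 0 ∧ (∀ y ∈ N, h y = S.Φ (y, h y)) ∧
      (∀ y ∈ N, ∀ w, ‖w‖ < ρ → w = S.Φ (y, w) → w = h y) ∧ ∀ y ∈ N, y.2 = 0 → h y = 0 := by
  obtain ⟨h, N, ρ, hρ, hN, h0N, hh, hh0, hfix, huniq⟩ := exists_analytic_fixedPoint
    S.contDiff_Φ (p₀ := (0, 0)) (S.Φ_zero 0) (by
      have := S.hasFDerivAt_Φ (b := fun _ : Cb (Ioo (-1) 1) × Cb (Ioo (-1) 1) => (0 : B3))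
        (hasFDerivAt_const 0 0) rfl differentiableAt_id rfl
      simpa using this)
  refine ⟨h, N, ρ, hρ, hN, h0N, hh, ?_, hfix, huniq, ?_⟩
  · have hdiff : DifferentiableAt ℝ (fun b : B3 => h (0, b)) 0 := by
      have h1 : DifferentiableAt ℝ h (0, (0 : B3)) :=
        (hh.contDiffAt (hN.mem_nhds h0N)).differentiableAt (by simp)
      exact h1.comp (0 : B3) ((differentiableAt_const _).prodMk differentiableAt_id)
    -- The derivative of the family is read off by differentiating the identity `h(0,b) = Φ((0,b),
    -- h(0,b))`.
    have h2 := S.hasFDerivAt_Φ (b := fun b : B3 => b) (hasFDerivAt_id 0) rfl hdiff hh0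
    have hev : (fun b : B3 => h (0, b)) =ᶠ[𝓝 0] fun b => S.Φ ((0, b), h (0, b)) := by
      have : Tendsto (fun b : B3 => ((0 : Cb (Ioo (-1) 1)), b)) (𝓝 0) (𝓝 (0, 0)) :=
        (Continuous.prodMk_right _).tendsto _
      filter_upwards [this.eventually (hN.mem_nhds h0N)] with b hb using hfix _ hb
    refine (h2.congr_of_eventuallyEq hev).congr_fderiv ?_
    simp
  · rintro ⟨q, b⟩ hy rfl
    exact (huniq _ hy 0 (by simpa using hρ) (S.Φ_zero q).symm).symm

end LocalOps

/-! ### Solutions from fixed points -/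

theorem ev_one {s : Set ℝ} {x : ℝ} (hx : x ∈ s) : ev (1 : Cb s) x = 1 := by
  rw [ev_of_mem _ hx]; rfl

theorem ev_toCb_half {f : ℝ → ℝ} (hf : ContinuousOn f (Ioo (-1) 1)) {x : ℝ}
    (hx : x ∈ Ioo (-(1 / 2) : ℝ) (1 / 2)) : ev (toCb (Ioo (-(1 / 2)) (1 / 2)) f) x = f x := by
  obtain ⟨C, hC⟩ := (isCompact_Icc (a := (-(1 / 2) : ℝ)) (b := 1 / 2)).exists_bound_of_continuousOn
    (hf.mono fun y hy => ⟨by linarith [hy.1], by linarith [hy.2]⟩)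
  exact ev_toCb (hf.mono half_subset) (fun y hy => hC y ⟨hy.1.le, hy.2.le⟩) hx

/-- The form in which an equation solved for the derivative is differentiated once more: `g =
n/(1-x²)` satisfies `(1-x²) g' = n' + 2x g`. -/
theorem hasDerivAt_div_one_sub_sq {n : ℝ → ℝ} {n' x : ℝ} (hn : HasDerivAt n n' x)
    (hx : x ∈ Ioo (-1 : ℝ) 1) : HasDerivAt (fun y => n y / (1 - y ^ 2))
      ((n' + 2 * x * (n x / (1 - x ^ 2))) / (1 - x ^ 2)) x := by
  have h1 : HasDerivAt (fun y : ℝ => 1 - y ^ 2) (-(2 * x)) x := by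
    simpa using (hasDerivAt_pow 2 x).const_sub 1
  have h2 := (one_sub_sq_pos hx).ne'
  refine (hn.fun_div h1 h2).congr_deriv ?_
  field_simp
  ring

theorem hasDerivAt_P (c : Fin 3 → ℝ) (x : ℝ) :
    HasDerivAt (P c) (c 1 - c 0 - 2 * c 2 * x) x := by
  have h1 : HasDerivAt (fun y : ℝ => 1 - y) (-1) x := by
    simpa using (hasDerivAt_id x).const_sub 1
  have h2 : HasDerivAt (fun y : ℝ => 1 + y) 1 x := by
    simpa using (hasDerivAt_id x).const_add 1
  have h3 : HasDerivAt (fun y : ℝ => 1 - y ^ 2) (-(2 * x)) x := by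
    simpa using (hasDerivAt_pow 2 x).const_sub 1
  refine (((h1.const_mul (c 0)).fun_add (h2.const_mul (c 1))).fun_add
    (h3.const_mul (c 2))).congr_deriv ?_
  ring

theorem pw_neg_one (x : ℝ) : pw (-1) x = (1 - x ^ 2)⁻¹ := by
  rw [pw, Real.rpow_neg_one]

theorem SolvesNSE.congr {chat : Fin 3 → ℝ} {f g v : ℝ → ℝ} (h : SolvesNSE chat f v)
    (hfg : ∀ x ∈ Ioo (-1 : ℝ) 1, g x = f x) : SolvesNSE chat g v := by
  refine ⟨h.1.congr hfg, h.2.1, fun x hx => ?_⟩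
  have : g =ᶠ[𝓝 x] f := by
    filter_upwards [isOpen_Ioo.mem_nhds hx] with y hy using hfg y hy
  rw [this.deriv_eq, this.eq_of_nhds]
  exact h.2.2 x hx

/-- The weight `(1-x²)^e` on `(-1/2,1/2)`. -/
def pwH (e : ℝ) : Cb (Ioo (-(1 / 2)) (1 / 2)) := toCb _ (pw e)

theorem ev_pwH (e : ℝ) {x : ℝ} (hx : x ∈ Ioo (-(1 / 2) : ℝ) (1 / 2)) : ev (pwH e) x = pw e x :=
  ev_toCb_half (continuousOn_pw e) hx

/-- The function `x` on `(-1/2,1/2)`. -/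
def idH : Cb (Ioo (-(1 / 2)) (1 / 2)) := toCb _ fun x => x

theorem ev_idH {x : ℝ} (hx : x ∈ Ioo (-(1 / 2) : ℝ) (1 / 2)) : ev idH x = x :=
  ev_toCb_half continuousOn_id hx

/-- The polynomial `P_c` on `(-1/2,1/2)`. -/
def PH (c : Fin 3 → ℝ) : Cb (Ioo (-(1 / 2)) (1 / 2)) :=
  c 0 • (1 - idH) + c 1 • (1 + idH) + c 2 • (1 - idH * idH)

theorem ev_PH (c : Fin 3 → ℝ) {x : ℝ} (hx : x ∈ Ioo (-(1 / 2) : ℝ) (1 / 2)) :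
    ev (PH c) x = P c x := by
  simp only [PH, P, ev_add, ev_smul, ev_sub, ev_mul, ev_one hx, ev_idH hx]
  ring

/-! ### The components belonging to a fixed point and the equations they satisfy -/

namespace LocalOps

variable {ε : ℝ} (S : LocalOps ε)

/-- The component `Uθ` that belongs to `w`. -/
def θ (_ : LocalOps ε) (w : Cb (Ioo (-1) 1) × Cb (Ioo (-1) 1)) (x : ℝ) : ℝ :=
  pw (1 - 2 * ε) x * ev w.1 x

/-- The component `Uφ` that belongs to `w`. -/
def φ (b : B3) (w : Cb (Ioo (-1) 1) × Cb (Ioo (-1) 1)) (x : ℝ) : ℝ :=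
  pw (-ε) x * ev (S.ζ b w) x

/-- `(1-x²)^{2ε} Uθ'`. -/
def θ₁ (q : Cb (Ioo (-1) 1)) (b : B3) (w : Cb (Ioo (-1) 1) × Cb (Ioo (-1) 1)) :
    Cb (Ioo (-1) 1) :=
  S.d q b w • pwCb (2 * ε) + S.rhs q b w - (toCb _ (fun x => 2 * x) + S.U₀) * w.1

/-- `(1-x²)^{2+ε} Uφ''`. -/
def φ₂ (q : Cb (Ioo (-1) 1)) (w : Cb (Ioo (-1) 1) × Cb (Ioo (-1) 1)) : Cb (Ioo (-1) 1) :=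
  -((S.U₀ + q + pwCb (1 - 2 * ε) * w.1) * w.2)

/-- The profile on `(-1/2,1/2)`. -/
def prof (q : Cb (Ioo (-1) 1)) : Cb (Ioo (-(1 / 2)) (1 / 2)) := resCb half_subset (S.U₀ + q)

/-- The derivative of the profile on `(-1/2,1/2)`. -/
def prof₁ (c : Fin 3 → ℝ) (q : Cb (Ioo (-1) 1)) : Cb (Ioo (-(1 / 2)) (1 / 2)) :=
  pwH (-1) * (PH c - (2 : ℝ) • (idH * S.prof q) - (1 / 2 : ℝ) • (S.prof q * S.prof q))

/-- The second derivative of the profile on `(-1/2,1/2)`. -/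
def prof₂ (c : Fin 3 → ℝ) (q : Cb (Ioo (-1) 1)) : Cb (Ioo (-(1 / 2)) (1 / 2)) :=
  pwH (-1) * ((c 1 - c 0) • (1 : Cb (Ioo (-(1 / 2)) (1 / 2))) - (2 * c 2) • idH -
    (2 : ℝ) • S.prof q - S.prof q * S.prof₁ c q)

/-- `Uθ` on `(-1/2,1/2)`. -/
def θH (_ : LocalOps ε) (w : Cb (Ioo (-1) 1) × Cb (Ioo (-1) 1)) : Cb (Ioo (-(1 / 2)) (1 / 2)) :=
  pwH (1 - 2 * ε) * resCb half_subset w.1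

/-- `Uθ'` on `(-1/2,1/2)`. -/
def θH₁ (q : Cb (Ioo (-1) 1)) (b : B3) (w : Cb (Ioo (-1) 1) × Cb (Ioo (-1) 1)) :
    Cb (Ioo (-(1 / 2)) (1 / 2)) :=
  pwH (-(2 * ε)) * resCb half_subset (S.θ₁ q b w)

/-- The derivative of `ψ(-1)(1-x)/2 + ψ(1)(1+x)/2 - ψ` on `(-1/2,1/2)`. -/
def swirl₁ (b : B3) (w : Cb (Ioo (-1) 1) × Cb (Ioo (-1) 1)) : Cb (Ioo (-(1 / 2)) (1 / 2)) :=
  ((1 / 2) * (evL 0 (S.O.A (S.O.χ₁ (S.ζ b w * w.2))) - evL 0 (S.O.B (S.O.χ₁ (S.ζ b w * w.2))))) •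
    (1 : Cb (Ioo (-(1 / 2)) (1 / 2))) -
    pwH (-(2 * ε)) * resCb half_subset (S.O.χ₁ (S.ζ b w * w.2))

/-- The second derivative of `ψ(-1)(1-x)/2 + ψ(1)(1+x)/2 - ψ` on `(-1/2,1/2)`. -/
def swirl₂ (b : B3) (w : Cb (Ioo (-1) 1) × Cb (Ioo (-1) 1)) : Cb (Ioo (-(1 / 2)) (1 / 2)) :=
  -(pwH (-(1 + 2 * ε)) * resCb half_subset (S.O.χ₂ (S.ζ b w * w.2)))

/-- `Uθ''` on `(-1/2,1/2)`. -/
def θH₂ (c : Fin 3 → ℝ) (q : Cb (Ioo (-1) 1)) (b : B3)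
    (w : Cb (Ioo (-1) 1) × Cb (Ioo (-1) 1)) : Cb (Ioo (-(1 / 2)) (1 / 2)) :=
  pwH (-1) * (S.swirl₁ b w - (2 : ℝ) • S.θH w - S.prof₁ c q * S.θH w - S.prof q * S.θH₁ q b w -
    S.θH w * S.θH₁ q b w - (2 * S.d q b w) • idH)

/-- `Uθ'''` on `(-1/2,1/2)`. -/
def θH₃ (c : Fin 3 → ℝ) (q : Cb (Ioo (-1) 1)) (b : B3)
    (w : Cb (Ioo (-1) 1) × Cb (Ioo (-1) 1)) : Cb (Ioo (-(1 / 2)) (1 / 2)) :=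
  pwH (-1) * (S.swirl₂ b w - (2 : ℝ) • S.θH₁ q b w - S.prof₂ c q * S.θH w -
    (2 : ℝ) • (S.prof₁ c q * S.θH₁ q b w) - S.prof q * S.θH₂ c q b w -
    S.θH₁ q b w * S.θH₁ q b w - S.θH w * S.θH₂ c q b w -
    (2 * S.d q b w) • (1 : Cb (Ioo (-(1 / 2)) (1 / 2))) + (2 : ℝ) • (idH * S.θH₂ c q b w))

variable {c : Fin 3 → ℝ} {q : Cb (Ioo (-1) 1)} {b : B3} {w : Cb (Ioo (-1) 1) × Cb (Ioo (-1) 1)}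

theorem ev_θ₁ {x : ℝ} (hx : x ∈ Ioo (-1 : ℝ) 1) : ev (S.θ₁ q b w) x =
    S.d q b w * pw (2 * ε) x + ev (S.O.κ (S.ζ b w * w.2)) x -
      (1 / 2) * (pw (1 - 2 * ε) x * ev w.1 x ^ 2) - (2 * x + ev (S.U₀ + q) x) * ev w.1 x := by
  have h1 := ev_toCb_of_continuous (f := fun x => 2 * x) (by fun_prop) hx
  simp only [θ₁, rhs, ev_add, ev_sub, ev_smul, ev_mul, h1, ev_pwCb (show 0 ≤ 2 * ε by
    linarith [S.pos]) hx, ev_pwCb (show 0 ≤ 1 - 2 * ε by linarith [S.lt_half]) hx]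
  ring

theorem hasDerivAt_φ (x : ℝ) (hx : x ∈ Ioo (-1 : ℝ) 1) :
    HasDerivAt (S.φ b w) (pw (-(1 + ε)) x * ev w.2 x) x := by
  have hn := isOpen_Ioo.mem_nhds hx
  have e1 : S.φ b w =ᶠ[𝓝 x] fun y => b 2 + pw (-ε) y * ev (S.O.Z w.2) y := by
    filter_upwards [hn] with y hy
    simp only [φ, ζ, ev_add, ev_smul, ev_pwCb S.pos.le hy]
    rw [mul_add, mul_left_comm, pw_neg_mul _ hy, mul_one]
  refine ((((hasDerivAt_pw (-ε) hx).fun_mul (S.O.isZ.hasDerivAt w.2 x hx)).const_add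
    (b 2)).congr_of_eventuallyEq e1).congr_deriv ?_
  have h1 := pw_mul_one_sub_sq (-(1 + ε)) hx
  rw [show -(1 + ε) + 1 = -ε by ring] at h1
  have h2 := (one_sub_sq_pos hx).ne'
  rw [← h1]
  field_simp
  ring

theorem hasDerivAt_θ (hfix : w = S.Φ ((q, b), w)) (x : ℝ) (hx : x ∈ Ioo (-1 : ℝ) 1) :
    HasDerivAt (S.θ w) (pw (-(2 * ε)) x * ev (S.θ₁ q b w) x) x := by
  have hw : w.1 = S.T (S.d q b w • pwCb (2 * ε) + S.rhs q b w) := congrArg Prod.fst hfix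
  have h1 := S.isT.hasDerivAt (S.d q b w • pwCb (2 * ε) + S.rhs q b w) x hx
  rw [← hw] at h1
  refine ((hasDerivAt_pw (1 - 2 * ε) hx).fun_mul h1).congr_deriv ?_
  have h3 := pw_mul_one_sub_sq (-(2 * ε)) hx
  rw [show -(2 * ε) + 1 = 1 - 2 * ε by ring] at h3
  have h2 := (one_sub_sq_pos hx).ne'
  have h4 := ev_toCb_of_continuous (f := fun x => 2 * x) (by fun_prop) hx
  simp only [θ₁, ev_add, ev_sub, ev_mul, h4]
  rw [← h3]
  field_simp
  ring

theorem hasDerivAt_φ₁ (hfix : w = S.Φ ((q, b), w)) (x : ℝ) (hx : x ∈ Ioo (-1 : ℝ) 1) :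
    HasDerivAt (fun x => pw (-(1 + ε)) x * ev w.2 x) (pw (-(2 + ε)) x * ev (S.φ₂ q w) x) x := by
  have hw : w.2 = b 1 • S.G + S.R (-((q + pwCb (1 - 2 * ε) * w.1) * w.2)) :=
    congrArg Prod.snd hfix
  set y := -((q + pwCb (1 - 2 * ε) * w.1) * w.2) with hy
  have hG : HasDerivAt (ev S.G) (-((ev S.U₀ x + 2 * (1 + ε) * x) * ev S.G x) / (1 - x ^ 2)) x := by
    have h1 := (hasDerivAt_gexp S.isR.continuousOn hx).fun_inv (gexp_pos _ x).ne'
    have e1 : ev S.G =ᶠ[𝓝 x] fun y => (gexp (fun x => ev S.U₀ x + 2 * (1 + ε) * x) y)⁻¹ := by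
      filter_upwards [isOpen_Ioo.mem_nhds hx] with y hy using S.G_eq y hy
    refine (h1.congr_of_eventuallyEq e1).congr_deriv ?_
    rw [e1.eq_of_nhds]
    have := (gexp_pos (fun x => ev S.U₀ x + 2 * (1 + ε) * x) x).ne'
    field_simp
  have hη : HasDerivAt (ev w.2) ((ev y x - (ev S.U₀ x + 2 * (1 + ε) * x) * ev w.2 x) /
      (1 - x ^ 2)) x := by
    have e1 : ev w.2 = fun x => b 1 * ev S.G x + ev (S.R y) x := by
      funext t
      conv_lhs => rw [hw]
      simp
    have h1 := (hG.const_mul (b 1)).fun_add (S.isR.hasDerivAt y x hx)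
    rw [← e1] at h1
    refine h1.congr_deriv ?_
    rw [congrFun e1 x]
    ring
  refine ((hasDerivAt_pw (-(1 + ε)) hx).fun_mul hη).congr_deriv ?_
  have h3 := pw_mul_one_sub_sq (-(2 + ε)) hx
  rw [show -(2 + ε) + 1 = -(1 + ε) by ring] at h3
  have h2 := (one_sub_sq_pos hx).ne'
  simp only [φ₂, hy, ev_add, ev_neg, ev_mul]
  rw [← h3]
  field_simp
  ring

theorem psi_hasDerivAt (x : ℝ) (hx : x ∈ Ioo (-1 : ℝ) 1) : HasDerivAt (psi (S.φ b w) (S.φ b w))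
    (pw (-(2 * ε)) x * ev (S.O.χ₁ (S.ζ b w * w.2)) x) x :=
  S.O.hasDerivAt_psi S.hasDerivAt_φ (fun _ _ => rfl) hx

/-- The equation for `Uθ`. -/
theorem equation_θ {x : ℝ} (hx : x ∈ Ioo (-1 : ℝ) 1) :
    (1 - x ^ 2) * (pw (-(2 * ε)) x * ev (S.θ₁ q b w) x) =
      psi (S.φ b w) (S.φ b w) (-1) * (1 - x) / 2 + psi (S.φ b w) (S.φ b w) 1 * (1 + x) / 2 -
        psi (S.φ b w) (S.φ b w) x + S.d q b w * (1 - x ^ 2) -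
        (2 * x + ev (S.U₀ + q) x) * S.θ w x - (1 / 2) * S.θ w x ^ 2 := by
  rw [S.O.psi_interpolation S.hasDerivAt_φ (fun _ _ => rfl) hx, S.ev_θ₁ hx, θ]
  have h1 := pw_mul_one_sub_sq (-(2 * ε)) hx
  rw [show -(2 * ε) + 1 = 1 - 2 * ε by ring] at h1
  have h2 : pw (1 - 2 * ε) x * pw (2 * ε) x = 1 - x ^ 2 := by
    rw [pw_mul _ _ hx, show 1 - 2 * ε + 2 * ε = 1 by ring, pw, Real.rpow_one]
  linear_combination (S.d q b w * pw (2 * ε) x + ev (S.O.κ (S.ζ b w * w.2)) x -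
      (1 / 2) * (pw (1 - 2 * ε) x * ev w.1 x ^ 2) - (2 * x + ev (S.U₀ + q) x) * ev w.1 x) * h1 +
      S.d q b w * h2

/-- The interpolating part of `ψ` and the term `d(1-x²)` in `equation_θ` are combinations of `1-x`,
`1+x`, `1-x²`, hence a change of the constants. Adding the equation of the profile gives the system.
-/
theorem solvesNSE (hfix : w = S.Φ ((q, b), w)) (hU : IsNoSwirl c (ev (S.U₀ + q))) :
    SolvesNSE ![c 0 + (1 / 2) * psi (S.φ b w) (S.φ b w) (-1),
      c 1 + (1 / 2) * psi (S.φ b w) (S.φ b w) 1, c 2 + S.d q b w]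
      (fun x => ev (S.U₀ + q) x + S.θ w x) (S.φ b w) := by
  have hd : ∀ x ∈ Ioo (-1 : ℝ) 1, HasDerivAt (fun x => ev (S.U₀ + q) x + S.θ w x) _ x :=
    fun x hx => (hU.hasDerivAt hx).fun_add (S.hasDerivAt_θ hfix x hx)
  have i2 : ∀ x ∈ Ioo (-1 : ℝ) 1, iteratedDeriv 2 (S.φ b w) x = pw (-(2 + ε)) x *
      ev (S.φ₂ q w) x := by
    refine iteratedDeriv_succ_eq_of_hasDerivAt isOpen_Ioo (k := 1) ?_ (S.hasDerivAt_φ₁ hfix)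
    exact iteratedDeriv_succ_eq_of_hasDerivAt isOpen_Ioo (k := 0) (g := S.φ b w)
      (fun x _ => by simp) S.hasDerivAt_φ
  refine ⟨?_, ?_, fun x hx => ⟨?_, ?_⟩⟩
  · refine hU.1.add ?_
    have h0 : ContDiffOn ℝ (0 : ℕ) (fun x => pw (-(2 * ε)) x * ev (S.θ₁ q b w) x) (Ioo (-1) 1) := by
      simp only [CharP.cast_eq_zero, contDiffOn_zero]
      exact (continuousOn_pw _).mul (continuousOn_ev (S.θ₁ q b w))
    exact_mod_cast contDiffOn_succ_of_hasDerivAt isOpen_Ioo (S.hasDerivAt_θ hfix) h0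
  · have h0 : ContDiffOn ℝ (0 : ℕ) (fun x => pw (-(2 + ε)) x * ev (S.φ₂ q w) x) (Ioo (-1) 1) := by
      simp only [CharP.cast_eq_zero, contDiffOn_zero]
      exact (continuousOn_pw _).mul (continuousOn_ev (S.φ₂ q w))
    have h1 := contDiffOn_succ_of_hasDerivAt isOpen_Ioo (S.hasDerivAt_φ₁ hfix) h0
    exact_mod_cast contDiffOn_succ_of_hasDerivAt isOpen_Ioo S.hasDerivAt_φ h1
  · rw [(hd x hx).deriv]
    have h1 := S.equation_θ (q := q) (b := b) (w := w) hx
    have h2 := (one_sub_sq_pos hx).ne'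
    rw [mul_add, mul_div_cancel₀ _ h2, h1]
    simp only [P, Matrix.cons_val_zero, Matrix.cons_val_one, Matrix.cons_val]
    ring
  · rw [i2 x hx, (S.hasDerivAt_φ x hx).deriv]
    have h3 := pw_mul_one_sub_sq (-(2 + ε)) hx
    rw [show -(2 + ε) + 1 = -(1 + ε) by ring] at h3
    simp only [φ₂, θ, ev_neg, ev_mul, ev_add, ev_pwCb (show 0 ≤ 1 - 2 * ε by
      linarith [S.lt_half]) hx]
    rw [← h3]
    ring

end LocalOps

/-! ### Derivatives up to order three near `0`, and membership in `X` -/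

namespace LocalOps

variable {ε : ℝ} (S : LocalOps ε) {c : Fin 3 → ℝ} {q : Cb (Ioo (-1) 1)} {b : B3}
  {w : Cb (Ioo (-1) 1) × Cb (Ioo (-1) 1)}

theorem ev_prof {x : ℝ} (hx : x ∈ Ioo (-(1 / 2) : ℝ) (1 / 2)) :
    ev (S.prof q) x = ev (S.U₀ + q) x := ev_resCb half_subset _ hx

theorem ev_prof₁ {x : ℝ} (hx : x ∈ Ioo (-(1 / 2) : ℝ) (1 / 2)) : ev (S.prof₁ c q) x =
    (P c x - 2 * x * ev (S.U₀ + q) x - (1 / 2) * ev (S.U₀ + q) x ^ 2) / (1 - x ^ 2) := by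
  simp only [prof₁, ev_mul, ev_sub, ev_smul, ev_PH c hx, ev_idH hx, S.ev_prof hx, ev_pwH _ hx,
    pw_neg_one]
  ring

theorem ev_θH {x : ℝ} (hx : x ∈ Ioo (-(1 / 2) : ℝ) (1 / 2)) : ev (S.θH w) x = S.θ w x := by
  simp only [θH, θ, ev_mul, ev_pwH _ hx, ev_resCb half_subset _ hx]

theorem ev_θH₁ {x : ℝ} (hx : x ∈ Ioo (-(1 / 2) : ℝ) (1 / 2)) :
    ev (S.θH₁ q b w) x = pw (-(2 * ε)) x * ev (S.θ₁ q b w) x := by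
  simp only [θH₁, ev_mul, ev_pwH _ hx, ev_resCb half_subset _ hx]

theorem ev_θH₂ {x : ℝ} (hx : x ∈ Ioo (-(1 / 2) : ℝ) (1 / 2)) : ev (S.θH₂ c q b w) x =
    (ev (S.swirl₁ b w) x - 2 * S.θ w x - ev (S.prof₁ c q) x * S.θ w x -
      ev (S.prof q) x * ev (S.θH₁ q b w) x - S.θ w x * ev (S.θH₁ q b w) x -
      2 * S.d q b w * x) / (1 - x ^ 2) := by
  simp only [θH₂, ev_mul, ev_sub, ev_smul, ev_idH hx, S.ev_θH hx, ev_pwH _ hx,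
    pw_neg_one]
  ring

theorem hasDerivAt_prof (hU : IsNoSwirl c (ev (S.U₀ + q))) {x : ℝ}
    (hx : x ∈ Ioo (-(1 / 2) : ℝ) (1 / 2)) :
    HasDerivAt (ev (S.prof q)) (ev (S.prof₁ c q) x) x := by
  have e1 : ev (S.prof q) =ᶠ[𝓝 x] ev (S.U₀ + q) := by
    filter_upwards [isOpen_Ioo.mem_nhds hx] with y hy using S.ev_prof hy
  rw [S.ev_prof₁ hx]
  exact (hU.hasDerivAt (half_subset hx)).congr_of_eventuallyEq e1

theorem hasDerivAt_prof₁ (hU : IsNoSwirl c (ev (S.U₀ + q))) {x : ℝ}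
    (hx : x ∈ Ioo (-(1 / 2) : ℝ) (1 / 2)) :
    HasDerivAt (ev (S.prof₁ c q)) (ev (S.prof₂ c q) x) x := by
  have e1 : ev (S.prof₁ c q) =ᶠ[𝓝 x] fun y =>
      (P c y - 2 * y * ev (S.prof q) y - (1 / 2) * ev (S.prof q) y ^ 2) / (1 - y ^ 2) := by
    filter_upwards [isOpen_Ioo.mem_nhds hx] with y hy
    rw [S.ev_prof₁ hy, S.ev_prof hy]
  have h1 := S.hasDerivAt_prof hU hx
  have h2 : HasDerivAt (fun y : ℝ => 2 * y) 2 x := by simpa using (hasDerivAt_id x).const_mul 2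
  have h3 := ((hasDerivAt_P c x).fun_sub (h2.fun_mul h1)).fun_sub ((h1.fun_pow 2).const_mul (1 / 2))
  refine ((hasDerivAt_div_one_sub_sq h3 (half_subset hx)).congr_of_eventuallyEq
    e1).congr_deriv ?_
  rw [← e1.eq_of_nhds]
  simp only [prof₂, ev_mul, ev_sub, ev_smul, ev_idH hx, ev_one hx, ev_pwH _ hx, pw_neg_one]
  push_cast
  ring

theorem hasDerivAt_θH (hfix : w = S.Φ ((q, b), w)) {x : ℝ}
    (hx : x ∈ Ioo (-(1 / 2) : ℝ) (1 / 2)) :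
    HasDerivAt (S.θ w) (ev (S.θH₁ q b w) x) x := by
  rw [S.ev_θH₁ hx]
  exact S.hasDerivAt_θ hfix x (half_subset hx)

theorem hasDerivAt_swirl {x : ℝ} (hx : x ∈ Ioo (-(1 / 2) : ℝ) (1 / 2)) :
    HasDerivAt (fun x => psi (S.φ b w) (S.φ b w) (-1) * (1 - x) / 2 +
      psi (S.φ b w) (S.φ b w) 1 * (1 + x) / 2 - psi (S.φ b w) (S.φ b w) x)
      (ev (S.swirl₁ b w) x) x := by
  have h1 : HasDerivAt (fun y : ℝ => 1 - y) (-1) x := by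
    simpa using (hasDerivAt_id x).const_sub 1
  have h2 : HasDerivAt (fun y : ℝ => 1 + y) 1 x := by
    simpa using (hasDerivAt_id x).const_add 1
  refine ((((h1.const_mul _).div_const 2).fun_add ((h2.const_mul _).div_const 2)).fun_sub
    (S.psi_hasDerivAt x (half_subset hx))).congr_deriv ?_
  have h3 := S.O.psi_sub_left (S.hasDerivAt_φ (b := b) (w := w)) (fun _ _ => rfl) zero_mem_Ioo
  have h4 := S.O.psi_sub_right (S.hasDerivAt_φ (b := b) (w := w)) (fun _ _ => rfl) zero_mem_Ioo
  simp only [swirl₁, ev_sub, ev_smul, ev_mul, ev_one hx, ev_pwH _ hx, ev_resCb half_subset _ hx,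
    evL_apply]
  simp only [pw_at_zero] at h3 h4
  linear_combination (1 / 2) * h3 - (1 / 2) * h4

theorem hasDerivAt_swirl₁ {x : ℝ} (hx : x ∈ Ioo (-(1 / 2) : ℝ) (1 / 2)) :
    HasDerivAt (ev (S.swirl₁ b w)) (ev (S.swirl₂ b w) x) x := by
  have h1 := (S.O.hasDerivAt_χ₁ (S.ζ b w * w.2) (half_subset hx)).const_sub
    ((1 / 2) * (evL 0 (S.O.A (S.O.χ₁ (S.ζ b w * w.2))) - evL 0 (S.O.B (S.O.χ₁ (S.ζ b w * w.2)))))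
  refine (h1.congr_of_eventuallyEq ?_).congr_deriv ?_
  · filter_upwards [isOpen_Ioo.mem_nhds hx] with y hy
    simp only [swirl₁, ev_sub, ev_smul, ev_mul, ev_one hy, ev_pwH _ hy, ev_resCb half_subset _ hy]
    ring
  · simp only [swirl₂, ev_neg, ev_mul, ev_pwH _ hx, ev_resCb half_subset _ hx]

/-- The first order equation, solved for `Uθ'`, is differentiated. No information beyond the
equations of `Uθ` and of the profile is needed to control the higher derivatives. -/
theorem hasDerivAt_θH₁ (hfix : w = S.Φ ((q, b), w)) (hU : IsNoSwirl c (ev (S.U₀ + q))) {x : ℝ}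
    (hx : x ∈ Ioo (-(1 / 2) : ℝ) (1 / 2)) :
    HasDerivAt (ev (S.θH₁ q b w)) (ev (S.θH₂ c q b w) x) x := by
  have e1 : ev (S.θH₁ q b w) =ᶠ[𝓝 x] fun y =>
      (psi (S.φ b w) (S.φ b w) (-1) * (1 - y) / 2 + psi (S.φ b w) (S.φ b w) 1 * (1 + y) / 2 -
        psi (S.φ b w) (S.φ b w) y + S.d q b w * (1 - y ^ 2) -
        (2 * y + ev (S.prof q) y) * S.θ w y - (1 / 2) * S.θ w y ^ 2) / (1 - y ^ 2) := by
    filter_upwards [isOpen_Ioo.mem_nhds hx] with y hy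
    rw [S.ev_θH₁ hy, eq_div_iff (one_sub_sq_pos (half_subset hy)).ne', mul_comm,
      S.equation_θ (half_subset hy), S.ev_prof hy]
  have h1 := S.hasDerivAt_prof hU hx
  have h2 : HasDerivAt (fun y : ℝ => 2 * y) 2 x := by simpa using (hasDerivAt_id x).const_mul 2
  have h0 : HasDerivAt (fun y : ℝ => 1 - y ^ 2) (-(2 * x)) x := by
    simpa using (hasDerivAt_pow 2 x).const_sub 1
  have ht := S.hasDerivAt_θH hfix hx
  have h3 := (((S.hasDerivAt_swirl (b := b) (w := w) hx).fun_add
    (h0.const_mul (S.d q b w))).fun_sub ((h2.fun_add h1).fun_mul ht)).fun_sub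
    ((ht.fun_pow 2).const_mul (1 / 2))
  refine ((hasDerivAt_div_one_sub_sq h3 (half_subset hx)).congr_of_eventuallyEq
    e1).congr_deriv ?_
  rw [← e1.eq_of_nhds, S.ev_θH₂ hx]
  congr 1
  push_cast
  ring

theorem hasDerivAt_θH₂ (hfix : w = S.Φ ((q, b), w)) (hU : IsNoSwirl c (ev (S.U₀ + q))) {x : ℝ}
    (hx : x ∈ Ioo (-(1 / 2) : ℝ) (1 / 2)) :
    HasDerivAt (ev (S.θH₂ c q b w)) (ev (S.θH₃ c q b w) x) x := by
  have e1 : ev (S.θH₂ c q b w) =ᶠ[𝓝 x] fun y =>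
      (ev (S.swirl₁ b w) y - 2 * S.θ w y - ev (S.prof₁ c q) y * S.θ w y -
      ev (S.prof q) y * ev (S.θH₁ q b w) y - S.θ w y * ev (S.θH₁ q b w) y -
      2 * S.d q b w * y) / (1 - y ^ 2) := by
    filter_upwards [isOpen_Ioo.mem_nhds hx] with y hy using S.ev_θH₂ hy
  have hp := S.hasDerivAt_prof hU hx
  have hp1 := S.hasDerivAt_prof₁ hU hx
  have ht := S.hasDerivAt_θH hfix hx
  have ht1 := S.hasDerivAt_θH₁ hfix hU hx
  have h3 := (((((S.hasDerivAt_swirl₁ (b := b) (w := w) hx).fun_sub (ht.const_mul 2)).fun_sub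
    (hp1.fun_mul ht)).fun_sub (hp.fun_mul ht1)).fun_sub (ht.fun_mul ht1)).fun_sub
    ((hasDerivAt_id x).const_mul (2 * S.d q b w))
  refine ((hasDerivAt_div_one_sub_sq h3 (half_subset hx)).congr_of_eventuallyEq
    e1).congr_deriv ?_
  have e2 := e1.eq_of_nhds
  simp only [id] at e2 ⊢
  rw [← e2]
  simp only [θH₃, ev_mul, ev_sub, ev_add, ev_smul, ev_idH hx, ev_one hx, ev_pwH _ hx, pw_neg_one,
    S.ev_θH hx]
  ring

/-- The formula for `d` results from solving this condition, which is linear in the increment of the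
third constant with coefficient `T((1-x²)^{2ε})(0) ≠ 0`. -/
theorem θ_zero (hfix : w = S.Φ ((q, b), w)) : S.θ w 0 = b 0 := by
  have hw : w.1 = S.T (S.d q b w • pwCb (2 * ε) + S.rhs q b w) := congrArg Prod.fst hfix
  rw [θ, pw_at_zero, one_mul, hw, map_add, map_smul, ev_add, ev_smul, d, evL_apply]
  have := S.T_ne
  field_simp
  ring

theorem φ_zero : S.φ b w 0 = b 2 := by
  simp [φ, ζ, ev_pwCb S.pos.le zero_mem_Ioo, S.O.isZ.apply_zero]

theorem deriv_φ_zero (hfix : w = S.Φ ((q, b), w)) : deriv (S.φ b w) 0 = b 1 := by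
  have hw : w.2 = b 1 • S.G + S.R (-((q + pwCb (1 - 2 * ε) * w.1) * w.2)) :=
    congrArg Prod.snd hfix
  rw [(S.hasDerivAt_φ 0 zero_mem_Ioo).deriv, hw]
  simp [S.isR.apply_zero, S.G_eq 0 zero_mem_Ioo]

theorem cancel_weight (e : ℝ) (z : Cb (Ioo (-1) 1)) {x : ℝ} (hx : x ∈ Ioo (-1 : ℝ) 1) :
    (1 - x ^ 2) ^ e * (pw (-e) x * ev z x) = ev z x := by
  have := pw_neg_mul e hx
  rw [← mul_assoc, mul_comm ((1 - x ^ 2) ^ e), show (1 - x ^ 2) ^ e = pw e x from rfl, this,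
    one_mul]

theorem m1Data (hfix : w = S.Φ ((q, b), w)) (hU : IsNoSwirl c (ev (S.U₀ + q))) :
    M1Data ε (S.θ w) (fun x => pw (-(2 * ε)) x * ev (S.θ₁ q b w) x) (ev (S.θH₂ c q b w))
      (ev (S.θH₃ c q b w)) where
  deriv1 := S.hasDerivAt_θ hfix
  deriv2 := fun x hx => (S.hasDerivAt_θH₁ hfix hU hx).congr_of_eventuallyEq (by
    filter_upwards [isOpen_Ioo.mem_nhds hx] with y hy using (S.ev_θH₁ hy).symm)
  deriv3 := fun x hx => S.hasDerivAt_θH₂ hfix hU hx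
  cont1 := (continuousOn_pw _).mul (continuousOn_ev _)
  cont3 := continuousOn_ev _
  eq_zero := fun x hx => by rw [θ, ev_of_notMem _ hx, mul_zero]
  bdd0 := ⟨‖w.1‖, fun x hx => by
    have := cancel_weight (-1 + 2 * ε) w.1 hx
    rw [show -(-1 + 2 * ε) = 1 - 2 * ε by ring] at this
    rw [θ, this]
    exact abs_ev_le _ _⟩
  bdd1 := ⟨‖S.θ₁ q b w‖, fun x hx => by rw [cancel_weight _ _ hx]; exact abs_ev_le _ _⟩
  bdd2 := ⟨‖S.θH₂ c q b w‖, fun x _ => abs_ev_le _ _⟩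
  bdd3 := ⟨‖S.θH₃ c q b w‖, fun x _ => abs_ev_le _ _⟩

theorem m2Data (hfix : w = S.Φ ((q, b), w)) :
    M2Data ε (S.φ b w) (fun x => pw (-(1 + ε)) x * ev w.2 x)
      (fun x => pw (-(2 + ε)) x * ev (S.φ₂ q w) x) where
  deriv1 := S.hasDerivAt_φ
  deriv2 := S.hasDerivAt_φ₁ hfix
  cont2 := (continuousOn_pw _).mul (continuousOn_ev _)
  eq_zero := fun x hx => by rw [φ, ev_of_notMem _ hx, mul_zero]
  bdd0 := ⟨‖S.ζ b w‖, fun x hx => by rw [φ, cancel_weight _ _ hx]; exact abs_ev_le _ _⟩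
  bdd1 := ⟨‖w.2‖, fun x hx => by rw [cancel_weight _ _ hx]; exact abs_ev_le _ _⟩
  bdd2 := ⟨‖S.φ₂ q w‖, fun x hx => by rw [cancel_weight _ _ hx]; exact abs_ev_le _ _⟩

/-- The components of the solution that belongs to a fixed point. -/
def image (c : Fin 3 → ℝ) (q : Cb (Ioo (-1) 1)) (b : B3)
    (w : Cb (Ioo (-1) 1) × Cb (Ioo (-1) 1)) : Y1 × Y2 :=
  (((w.1, S.θ₁ q b w), (S.θH₂ c q b w, S.θH₃ c q b w)), (S.ζ b w, (w.2, S.φ₂ q w)))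

/-- Besides membership, the image under the embedding is recorded: it is an explicit expression in
the constants, `q`, `b` and `w`, from which smoothness in `X` will follow. -/
theorem exists_element (hfix : w = S.Φ ((q, b), w)) (hU : IsNoSwirl c (ev (S.U₀ + q))) :
    ∃ U : X ε, U.θ = S.θ w ∧ U.φ = S.φ b w ∧
      (emb1 ε U.fst, emb2 ε U.snd) = S.image c q b w := by
  have hd := S.m1Data hfix hU
  have hd2 := S.m2Data hfix
  let f : M1 ε := ⟨S.θ w, hd.memM1 S.lt_half⟩
  let g : M2 ε := ⟨S.φ b w, hd2.memM2⟩
  have hf : f.toFun = S.θ w := rfl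
  have hg : g.toFun = S.φ b w := rfl
  refine ⟨WithLp.toLp 1 (f, g), hf, hg, ?_⟩
  change (emb1 ε f, emb2 ε g) = _
  rw [emb1_apply, emb2_apply, image]
  refine Prod.ext (Prod.ext (Prod.ext (ev_ext fun x hx => ?_) (ev_ext fun x hx => ?_))
    (Prod.ext (ev_ext fun x hx => ?_) (ev_ext fun x hx => ?_)))
    (Prod.ext (ev_ext fun x hx => ?_) (Prod.ext (ev_ext fun x hx => ?_)
    (ev_ext fun x hx => ?_)))
  · have := cancel_weight (-1 + 2 * ε) w.1 hx
    rw [show -(-1 + 2 * ε) = 1 - 2 * ε by ring] at this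
    rw [ev_cmp isOpen_Ioo subset_rfl f.hasCmp0 hx, wt, iteratedDeriv_zero, hf, θ, this]
  · rw [ev_cmp isOpen_Ioo subset_rfl f.hasCmp1 hx, wt, hf, hd.iteratedDeriv_one x hx,
      cancel_weight _ _ hx]
  · rw [ev_cmp isOpen_Ioo half_subset f.hasCmp2 hx, wt_zero_exponent, hf,
      hd.iteratedDeriv_two x hx]
  · rw [ev_cmp isOpen_Ioo half_subset f.hasCmp3 hx, wt_zero_exponent, hf,
      hd.iteratedDeriv_three x hx]
  · rw [ev_cmp isOpen_Ioo subset_rfl g.hasCmp0 hx, wt, iteratedDeriv_zero, hg, φ,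
      cancel_weight _ _ hx]
  · rw [ev_cmp isOpen_Ioo subset_rfl g.hasCmp1 hx, wt, hg, hd2.iteratedDeriv_one x hx,
      cancel_weight _ _ hx]
  · rw [ev_cmp isOpen_Ioo subset_rfl g.hasCmp2 hx, wt, hg, hd2.iteratedDeriv_two x hx,
      cancel_weight _ _ hx]

end LocalOps

/-! ### Fixed points from solutions -/

/-- The bound extends to the closed interval by continuity; at `±1` its right side vanishes and only
`2|e₁|`, respectively `2|e₀|`, remains on the left. -/
theorem eq_zero_of_boundary_bound {e₀ e₁ d σ C : ℝ} (hσ : 0 < σ)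
    (h : ∀ x ∈ Ioo (-1 : ℝ) 1, |e₀ * (1 - x) + e₁ * (1 + x) + d * (1 - x ^ 2)| ≤ C * pw σ x) :
    e₀ = 0 ∧ e₁ = 0 := by
  have hc1 : Continuous fun x : ℝ => |e₀ * (1 - x) + e₁ * (1 + x) + d * (1 - x ^ 2)| := by
    fun_prop
  have hc2 : Continuous fun x : ℝ => C * pw σ x :=
    continuous_const.mul (Continuous.rpow_const (by fun_prop) fun y => Or.inr hσ.le)
  have h' : ∀ x ∈ Icc (-1 : ℝ) 1, |e₀ * (1 - x) + e₁ * (1 + x) + d * (1 - x ^ 2)| ≤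
      C * pw σ x := by
    rw [← closure_Ioo (by norm_num)]
    exact fun x hx => le_on_closure h hc1.continuousOn hc2.continuousOn hx
  have h1 := h' (-1) (by norm_num)
  have h2 := h' 1 (by norm_num)
  simp only [pw, one_pow, sub_self, Real.zero_rpow hσ.ne', mul_zero, even_two, Even.neg_pow,
    add_neg_cancel, add_zero, abs_nonpos_iff, zero_add] at h1 h2
  constructor <;> linarith

theorem M1.hasDerivAt {ε : ℝ} (f : M1 ε) {x : ℝ} (hx : x ∈ Ioo (-1 : ℝ) 1) :
    HasDerivAt f.toFun (pw (-(2 * ε)) x * ev (emb1 ε f).1.2 x) x := by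
  rw [emb1_apply]
  simp only
  rw [ev_cmp isOpen_Ioo subset_rfl f.hasCmp1 hx, wt, pw, ← mul_assoc, rpow_neg_mul_rpow hx,
    one_mul]
  simpa using hasDerivAt_iteratedDeriv isOpen_Ioo (k := 0)
    (by exact_mod_cast f.mem.contDiffOn) hx

theorem M1.eq_weight {ε : ℝ} (f : M1 ε) (x : ℝ) :
    f.toFun x = pw (1 - 2 * ε) x * ev (emb1 ε f).1.1 x := by
  rw [emb1_apply]
  simp only
  by_cases hx : x ∈ Ioo (-1 : ℝ) 1
  · rw [ev_cmp isOpen_Ioo subset_rfl f.hasCmp0 hx, wt, pw, ← mul_assoc,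
      show 1 - 2 * ε = -(-1 + 2 * ε) by ring, rpow_neg_mul_rpow hx, one_mul, iteratedDeriv_zero]
  · rw [ev_of_notMem _ hx, mul_zero, f.mem.eq_zero x hx]

theorem M2.hasDerivAt {ε : ℝ} (f : M2 ε) {x : ℝ} (hx : x ∈ Ioo (-1 : ℝ) 1) :
    HasDerivAt f.toFun (pw (-(1 + ε)) x * ev (emb2 ε f).2.1 x) x := by
  rw [emb2_apply]
  simp only
  rw [ev_cmp isOpen_Ioo subset_rfl f.hasCmp1 hx, wt, pw, ← mul_assoc, rpow_neg_mul_rpow hx,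
    one_mul]
  simpa using hasDerivAt_iteratedDeriv isOpen_Ioo (k := 0) f.hasCmp1.1 hx

theorem M2.ev_emb_deriv {ε : ℝ} (f : M2 ε) {x : ℝ} (hx : x ∈ Ioo (-1 : ℝ) 1) :
    ev (emb2 ε f).2.1 x = pw (1 + ε) x * deriv f.toFun x := by
  rw [emb2_apply]
  simp only
  rw [ev_cmp isOpen_Ioo subset_rfl f.hasCmp1 hx, wt, iteratedDeriv_one, pw]

/-- The data `(Uθ(0), Uφ'(0), Uφ(0))`. -/
def X.data {ε : ℝ} (U : X ε) : B3 := !₂[U.θ 0, deriv U.φ 0, U.φ 0]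

namespace LocalOps

variable {ε : ℝ} (S : LocalOps ε) {c chat : Fin 3 → ℝ} {q : Cb (Ioo (-1) 1)} {U : X ε}

/-- The unknowns of the fixed point equation that belong to an element of `X`. -/
def unknowns (U : X ε) : Cb (Ioo (-1) 1) × Cb (Ioo (-1) 1) :=
  ((emb1 ε U.fst).1.1, (emb2 ε U.snd).2.1)

theorem θ_unknowns : U.θ = S.θ (unknowns U) := funext fun x => U.fst.eq_weight x

theorem φ_unknowns : U.φ = S.φ U.data (unknowns U) := by
  funext x
  by_cases hx : x ∈ Ioo (-1 : ℝ) 1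
  · have h := S.O.isZ.eq_linear (f := U.φ) (y := (unknowns U).2)
      (fun x hx => U.snd.hasDerivAt hx) (fun x hx => by
        have := pw_neg_mul (1 + ε) hx
        rw [add_comm ε, ← mul_assoc, mul_comm (pw _ x), this, one_mul]
        rfl) hx
    rw [φ, ζ, ev_add, ev_smul, ev_pwCb S.pos.le hx]
    change U.φ x = pw (-ε) x * (U.φ 0 * pw ε x + ev (S.O.Z (unknowns U).2) x)
    rw [← h, ← mul_assoc, pw_neg_mul _ hx, one_mul]
  · rw [φ, ev_of_notMem _ hx, mul_zero]
    exact U.snd.mem.eq_zero x hx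

theorem hasDerivAt_unknown_η (hs : SolvesNSE chat (fun x => ev (S.U₀ + q) x + U.θ x) U.φ) {x : ℝ}
    (hx : x ∈ Ioo (-1 : ℝ) 1) : HasDerivAt (ev (unknowns U).2)
      ((ev (-((q + pwCb (1 - 2 * ε) * (unknowns U).1) * (unknowns U).2)) x -
        (ev S.U₀ x + 2 * (1 + ε) * x) * ev (unknowns U).2 x) / (1 - x ^ 2)) x := by
  have e1 : ev (unknowns U).2 =ᶠ[𝓝 x] fun y => pw (1 + ε) y * deriv U.φ y := by
    filter_upwards [isOpen_Ioo.mem_nhds hx] with y hy using U.snd.ev_emb_deriv hy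
  have h1 := hasDerivAt_iteratedDeriv isOpen_Ioo (k := 1) (f := U.φ)
    (by exact_mod_cast U.snd.mem.contDiffOn) hx
  rw [iteratedDeriv_one] at h1
  refine (((hasDerivAt_pw (1 + ε) hx).fun_mul h1).congr_of_eventuallyEq e1).congr_deriv ?_
  have h2 := (hs.2.2 x hx).2
  have h3 := (one_sub_sq_pos hx).ne'
  have h4 : U.θ x = pw (1 - 2 * ε) x * ev (unknowns U).1 x := U.fst.eq_weight x
  simp only [ev_neg, ev_mul, ev_add, ev_pwCb (show 0 ≤ 1 - 2 * ε by linarith [S.lt_half]) hx] at h2 ⊢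
  rw [← h4, e1.eq_of_nhds, eq_div_iff h3, add_mul, div_mul_eq_mul_div, div_mul_cancel₀ _ h3]
  simp only [Nat.reduceAdd]
  linear_combination (pw (1 + ε) x) * h2

theorem equation_unknowns (hU : IsNoSwirl c (ev (S.U₀ + q)))
    (hs : SolvesNSE chat (fun x => ev (S.U₀ + q) x + U.θ x) U.φ) {x : ℝ}
    (hx : x ∈ Ioo (-1 : ℝ) 1) :
    (1 - x ^ 2) * deriv U.θ x + (2 * x + ev (S.U₀ + q) x) * U.θ x + (1 / 2) * U.θ x ^ 2 =
      P chat x - P c x - psi U.φ U.φ x := by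
  have h1 := (hs.2.2 x hx).1
  have h2 := hU.2 x hx
  have h3 : HasDerivAt U.θ _ x := U.fst.hasDerivAt hx
  rw [((hU.hasDerivAt hx).differentiableAt.hasDerivAt.fun_add
    h3.differentiableAt.hasDerivAt).deriv] at h1
  linear_combination h1 - h2

/-- Subtracting the profile equation and using the interpolation of `ψ`, the combination of `1-x`
and `1+x` with the errors `e₀`, `e₁` plus a multiple of `1-x²` is `(1-x²)^{1-2ε}` times a bounded
function. As `1-2ε > 0`, both errors vanish. -/
theorem boundary_constants (hU : IsNoSwirl c (ev (S.U₀ + q)))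
    (hs : SolvesNSE chat (fun x => ev (S.U₀ + q) x + U.θ x) U.φ) :
    chat 0 = c 0 + (1 / 2) * psi U.φ U.φ (-1) ∧ chat 1 = c 1 + (1 / 2) * psi U.φ U.φ 1 ∧
    ∀ x ∈ Ioo (-1 : ℝ) 1, ev (emb1 ε U.fst).1.2 x = (chat 2 - c 2) * pw (2 * ε) x +
      ev (S.rhs q U.data (unknowns U)) x - (2 * x + ev S.U₀ x) * ev (unknowns U).1 x := by
  set w := unknowns U with hw
  set f₁ := (emb1 ε U.fst).1.2 with hf₁
  set e₀ := chat 0 - c 0 - (1 / 2) * psi U.φ U.φ (-1) with he₀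
  set e₁ := chat 1 - c 1 - (1 / 2) * psi U.φ U.φ 1 with he₁
  have hφ := S.φ_unknowns (U := U)
  set y : Cb (Ioo (-1) 1) := f₁ + toCb _ (fun x => 2 * x) * w.1 + S.U₀ * w.1 -
    S.rhs q U.data w with hy
  have key : ∀ x ∈ Ioo (-1 : ℝ) 1, e₀ * (1 - x) + e₁ * (1 + x) + (chat 2 - c 2) * (1 - x ^ 2) =
      pw (1 - 2 * ε) x * ev y x := by
    intro x hx
    have h1 := S.equation_unknowns hU hs hx
    have h2 := S.O.psi_interpolation (S.hasDerivAt_φ (b := U.data) (w := w)) (fun _ _ => rfl) hx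
    rw [← hφ] at h2
    have h3 : U.θ x = pw (1 - 2 * ε) x * ev w.1 x := U.fst.eq_weight x
    have h4 : deriv U.θ x = pw (-(2 * ε)) x * ev f₁ x := (U.fst.hasDerivAt hx).deriv
    have h5 := pw_mul_one_sub_sq (-(2 * ε)) hx
    rw [show -(2 * ε) + 1 = 1 - 2 * ε by ring] at h5
    have h6 := ev_toCb_of_continuous (f := fun x => 2 * x) (by fun_prop) hx
    rw [h3, h4] at h1
    simp only [hy, he₀, he₁, P, rhs, ev_sub, ev_add, ev_mul, ev_smul, h6,
      ev_pwCb (show 0 ≤ 1 - 2 * ε by linarith [S.lt_half]) hx] at h1 ⊢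
    linear_combination -h1 + (ev f₁ x) * h5 - h2
  obtain ⟨h0, h1⟩ := eq_zero_of_boundary_bound (C := ‖y‖) (σ := 1 - 2 * ε)
    (by linarith [S.lt_half]) fun x hx => by
      rw [key x hx, abs_mul, abs_of_pos (pw_pos _ hx), mul_comm]
      exact mul_le_mul_of_nonneg_right (abs_ev_le y x) (pw_pos _ hx).le
  refine ⟨by linarith, by linarith, fun x hx => ?_⟩
  have h2 := key x hx
  rw [h0, h1] at h2
  have h3 : pw (1 - 2 * ε) x * pw (2 * ε) x = 1 - x ^ 2 := by
    rw [pw_mul _ _ hx, show 1 - 2 * ε + 2 * ε = 1 by ring, pw, Real.rpow_one]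
  have h6 := ev_toCb_of_continuous (f := fun x => 2 * x) (by fun_prop) hx
  have h4 : ev y x = (chat 2 - c 2) * pw (2 * ε) x := by
    refine mul_left_cancel₀ (pw_pos (1 - 2 * ε) hx).ne' ?_
    rw [← h2, ← h3]
    ring
  simp only [hy, ev_sub, ev_add, ev_mul, h6] at h4
  linear_combination h4

/-- The converse of `solvesNSE`. Membership in `X` makes the first unknown bounded, so it must be
the solution given by `T`; its value at `0` then fixes the increment of the third constant. The
second unknown is determined by its initial value. -/
theorem unknowns_fixed (hU : IsNoSwirl c (ev (S.U₀ + q)))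
    (hs : SolvesNSE chat (fun x => ev (S.U₀ + q) x + U.θ x) U.φ) :
    unknowns U = S.Φ ((q, U.data), unknowns U) := by
  obtain ⟨-, -, hf⟩ := S.boundary_constants hU hs
  set w := unknowns U with hw
  have hz : w.1 = S.T ((chat 2 - c 2) • pwCb (2 * ε) + S.rhs q U.data w) := by
    refine S.isT.eq fun x hx => ?_
    have e1 : ev w.1 =ᶠ[𝓝 x] fun y => pw (-(1 - 2 * ε)) y * U.θ y := by
      filter_upwards [isOpen_Ioo.mem_nhds hx] with y hy
      rw [show U.θ y = pw (1 - 2 * ε) y * ev w.1 y from U.fst.eq_weight y, ← mul_assoc,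
        pw_neg_mul _ hy, one_mul]
    have h1 := (hasDerivAt_pw (-(1 - 2 * ε)) hx).fun_mul (U.fst.hasDerivAt hx)
    refine (h1.congr_of_eventuallyEq e1).congr_deriv ?_
    have h2 := hf x hx
    have h3 : pw (-(1 - 2 * ε)) x * pw (-(2 * ε)) x = (1 - x ^ 2)⁻¹ := by
      rw [pw_mul _ _ hx, show -(1 - 2 * ε) + -(2 * ε) = -1 by ring, pw_neg_one]
    have h4 : pw (-(1 - 2 * ε)) x * U.fst.toFun x = ev w.1 x := e1.eq_of_nhds.symm
    simp only [ev_add, ev_smul, ev_pwCb (show 0 ≤ 2 * ε by linarith [S.pos]) hx]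
    linear_combination (2 * (1 - 2 * ε) * x / (1 - x ^ 2)) * h4 +
      (ev (emb1 ε U.fst).1.2 x) * h3 + (1 - x ^ 2)⁻¹ * h2
  have hd : chat 2 - c 2 = S.d q U.data w := by
    have h1 : U.θ 0 = ev w.1 0 := by
      rw [show U.θ 0 = pw (1 - 2 * ε) 0 * ev w.1 0 from U.fst.eq_weight 0, pw_at_zero, one_mul]
    have h2 : U.θ 0 = (chat 2 - c 2) * ev (S.T (pwCb (2 * ε))) 0 +
        ev (S.T (S.rhs q U.data w)) 0 := by
      rw [h1]
      conv_lhs => rw [hz]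
      rw [map_add, map_smul, ev_add, ev_smul]
    rw [d, show U.data 0 = U.θ 0 from rfl, h2, evL_apply]
    have := S.T_ne
    field_simp
    ring
  refine Prod.ext ?_ (ev_ext fun x hx => ?_)
  · conv_lhs => rw [hz, hd]
    rfl
  · have h1 := S.isR.eq (f := ev w.2) (fun x hx => S.hasDerivAt_unknown_η hs hx) hx
    rw [h1]
    have h2 : ev w.2 0 = deriv U.φ 0 := by
      have := U.snd.ev_emb_deriv zero_mem_Ioo
      rw [pw_at_zero, one_mul] at this
      exact this
    change _ = ev (U.data 1 • S.G + S.R (-((q + pwCb (1 - 2 * ε) * w.1) * w.2))) x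
    rw [ev_add, ev_smul, S.G_eq x hx, h2, div_eq_mul_inv]
    rfl

/-- The third constant is determined by the second derivative of the `θ`-equation at `0`. -/
theorem third_constant (hU : IsNoSwirl c (ev (S.U₀ + q)))
    (hs : SolvesNSE chat (fun x => ev (S.U₀ + q) x + U.θ x) U.φ) {F : ℝ → ℝ}
    (hF : ∀ x ∈ Ioo (-1 : ℝ) 1, F x = (1 - x ^ 2) * deriv U.θ x +
      (2 * x + ev (S.U₀ + q) x) * U.θ x + (1 / 2) * U.θ x ^ 2) :
    chat 2 = c 2 - (1 / 2) * iteratedDeriv 2 F 0 := by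
  have hφ := S.φ_unknowns (U := U)
  set y := S.ζ U.data (unknowns U) * (unknowns U).2
  have hF' : ∀ x ∈ Ioo (-1 : ℝ) 1, F x = P chat x - P c x - psi U.φ U.φ x := fun x hx => by
    rw [hF x hx, S.equation_unknowns hU hs hx]
  have hψ : ∀ x ∈ Ioo (-1 : ℝ) 1, HasDerivAt (psi U.φ U.φ)
      (pw (-(2 * ε)) x * ev (S.O.χ₁ y) x) x := fun x hx => by
    rw [hφ]; exact S.psi_hasDerivAt x hx
  have d1 : ∀ x ∈ Ioo (-1 : ℝ) 1, HasDerivAt (fun x => P chat x - P c x - psi U.φ U.φ x)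
      (chat 1 - chat 0 - 2 * chat 2 * x - (c 1 - c 0 - 2 * c 2 * x) -
        pw (-(2 * ε)) x * ev (S.O.χ₁ y) x) x := fun x hx =>
    ((hasDerivAt_P chat x).fun_sub (hasDerivAt_P c x)).fun_sub (hψ x hx)
  have d2 : ∀ x ∈ Ioo (-1 : ℝ) 1, HasDerivAt (fun x => chat 1 - chat 0 - 2 * chat 2 * x -
      (c 1 - c 0 - 2 * c 2 * x) - pw (-(2 * ε)) x * ev (S.O.χ₁ y) x)
      (-(2 * chat 2) + 2 * c 2 - pw (-(1 + 2 * ε)) x * ev (S.O.χ₂ y) x) x := fun x hx => by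
    have h1 : HasDerivAt (fun x : ℝ => 2 * chat 2 * x) (2 * chat 2) x := by
      simpa using (hasDerivAt_id x).const_mul (2 * chat 2)
    have h2 : HasDerivAt (fun x : ℝ => 2 * c 2 * x) (2 * c 2) x := by
      simpa using (hasDerivAt_id x).const_mul (2 * c 2)
    refine (((h1.const_sub (chat 1 - chat 0)).fun_sub (h2.const_sub (c 1 - c 0))).fun_sub
      (S.O.hasDerivAt_χ₁ y hx)).congr_deriv ?_
    ring
  have i1 := iteratedDeriv_succ_eq_of_hasDerivAt isOpen_Ioo (k := 0) (f := F)
    (fun x hx => by simpa using hF' x hx) d1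
  have i2 := iteratedDeriv_succ_eq_of_hasDerivAt isOpen_Ioo (k := 1) i1 d2 0 zero_mem_Ioo
  -- The second derivative of `ψ` vanishes at `0`, the innermost integral starting there.
  rw [S.O.χ₂_apply_zero, mul_zero] at i2
  change iteratedDeriv 2 F 0 = _ at i2
  rw [i2]
  ring

end LocalOps

/-! ### The family of solutions near one profile -/

theorem X.ext {ε : ℝ} {U V : X ε} (h1 : U.θ = V.θ) (h2 : U.φ = V.φ) : U = V :=
  WithLp.ofLp_injective 1 (Prod.ext (M1.ext h1) (M2.ext h2))

/-- The embedding of `X` into a product of spaces of bounded continuous functions. -/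
def embX (ε : ℝ) : X ε →L[ℝ] Y1 × Y2 :=
  (((emb1 ε).comp (ContinuousLinearMap.fst ℝ _ _)).prod
    ((emb2 ε).comp (ContinuousLinearMap.snd ℝ _ _))).comp
    (WithLp.prodContinuousLinearEquiv 1 ℝ (M1 ε) (M2 ε)).toContinuousLinearMap

theorem embX_apply {ε : ℝ} (U : X ε) : embX ε U = (emb1 ε U.fst, emb2 ε U.snd) := rfl

theorem norm_le_embX {ε : ℝ} (U : X ε) : ‖U‖ ≤ 7 * ‖embX ε U‖ := by
  rw [X.norm_eq, embX_apply]
  have h1 := norm_le_emb1 U.fst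
  have h2 := norm_le_emb2 U.snd
  have h3 := norm_fst_le (emb1 ε U.fst, emb2 ε U.snd)
  have h4 := norm_snd_le (emb1 ε U.fst, emb2 ε U.snd)
  simp only at h3 h4
  linarith

/-- Evaluation of the `θ`-component at a point. -/
def evalθ (ε x : ℝ) : X ε →L[ℝ] ℝ :=
  pw (1 - 2 * ε) x • (evL x).comp ((ContinuousLinearMap.fst ℝ _ _).comp
    ((ContinuousLinearMap.fst ℝ _ _).comp ((ContinuousLinearMap.fst ℝ _ _).comp (embX ε))))

theorem evalθ_apply {ε : ℝ} (x : ℝ) (U : X ε) : evalθ ε x U = U.θ x :=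
  (U.fst.eq_weight x).symm

/-- Evaluation of the `φ`-component at a point. -/
def evalφ (ε x : ℝ) : X ε →L[ℝ] ℝ :=
  pw (-ε) x • (evL x).comp ((ContinuousLinearMap.fst ℝ _ _).comp
    ((ContinuousLinearMap.snd ℝ _ _).comp (embX ε)))

theorem M2.eq_weight {ε : ℝ} (f : M2 ε) (x : ℝ) : f.toFun x = pw (-ε) x * ev (emb2 ε f).1 x := by
  rw [emb2_apply]
  simp only
  by_cases hx : x ∈ Ioo (-1 : ℝ) 1
  · rw [ev_cmp isOpen_Ioo subset_rfl f.hasCmp0 hx, wt, pw, ← mul_assoc, rpow_neg_mul_rpow hx,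
      one_mul, iteratedDeriv_zero]
  · rw [ev_of_notMem _ hx, mul_zero, f.mem.eq_zero x hx]

theorem evalφ_apply {ε : ℝ} (x : ℝ) (U : X ε) : evalφ ε x U = U.φ x :=
  (U.snd.eq_weight x).symm

/-- Evaluation of the derivative of the `φ`-component at `0`. -/
def evalφ' (ε : ℝ) : X ε →L[ℝ] ℝ :=
  (evL 0).comp ((ContinuousLinearMap.fst ℝ _ _).comp
    ((ContinuousLinearMap.snd ℝ _ _).comp ((ContinuousLinearMap.snd ℝ _ _).comp (embX ε))))

theorem evalφ'_apply {ε : ℝ} (U : X ε) : evalφ' ε U = deriv U.φ 0 := by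
  have := U.snd.ev_emb_deriv zero_mem_Ioo
  rw [pw_at_zero, one_mul] at this
  exact this

/-- `U` is a solution with data `b` when added to the profile `Ub p`. -/
def Sol {ε : ℝ} (Ub : (Fin 3 → ℝ) × ℝ → ℝ → ℝ) (p : (Fin 3 → ℝ) × ℝ) (b : B3) (U : X ε) : Prop :=
  (∃ chat, SolvesNSE chat (fun x => Ub p x + U.θ x) U.φ) ∧ U.data = b

/-! ### Smoothness of the family in `X` and its first order term -/

namespace LocalOps

variable {ε : ℝ} (S : LocalOps ε)

theorem contDiff_PH : ContDiff ℝ ω PH :=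
  ((((contDiff_apply ℝ ℝ 0).smul contDiff_const).add
    ((contDiff_apply ℝ ℝ 1).smul contDiff_const)).add
    ((contDiff_apply ℝ ℝ 2).smul contDiff_const))

section Smooth

variable {E : Type*} [NormedAddCommGroup E] [NormedSpace ℝ E] {c : E → Fin 3 → ℝ}
  {q : E → Cb (Ioo (-1) 1)} {b : E → B3} {w : E → Cb (Ioo (-1) 1) × Cb (Ioo (-1) 1)}

theorem contDiff_prof (hq : ContDiff ℝ ω q) : ContDiff ℝ ω fun y => S.prof (q y) :=
  (resCb half_subset).contDiff.comp (contDiff_const.add hq)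

theorem contDiff_prof₁ (hc : ContDiff ℝ ω c) (hq : ContDiff ℝ ω q) :
    ContDiff ℝ ω fun y => S.prof₁ (c y) (q y) :=
  have hp := S.contDiff_prof hq
  contDiff_const.mul (((contDiff_PH.comp hc).sub ((contDiff_const.mul hp).const_smul _)).sub
    ((hp.mul hp).const_smul _))

theorem contDiff_prof₂ (hc : ContDiff ℝ ω c) (hq : ContDiff ℝ ω q) :
    ContDiff ℝ ω fun y => S.prof₂ (c y) (q y) := by
  have hp := S.contDiff_prof hq
  have hp1 := S.contDiff_prof₁ hc hq
  have hi : ∀ i, ContDiff ℝ ω fun y => c y i := fun i => (contDiff_apply ℝ ℝ i).comp hc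
  exact contDiff_const.mul ((((((hi 1).sub (hi 0)).smul contDiff_const).sub
    ((contDiff_const.mul (hi 2)).smul contDiff_const)).sub (hp.const_smul _)).sub (hp.mul hp1))

theorem contDiff_image (hc : ContDiff ℝ ω c) (hq : ContDiff ℝ ω q) (hb : ContDiff ℝ ω b)
    (hw : ContDiff ℝ ω w) : ContDiff ℝ ω fun y => S.image (c y) (q y) (b y) (w y) := by
  have hp := S.contDiff_prof hq
  have hp1 := S.contDiff_prof₁ hc hq
  have hp2 := S.contDiff_prof₂ hc hq
  have hζ := S.contDiff_ζ hb hw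
  have hd := S.contDiff_d hq hb hw
  have hr : ∀ {f : E → Cb (Ioo (-1) 1)}, ContDiff ℝ ω f →
      ContDiff ℝ ω fun y => resCb half_subset (f y) := fun hf =>
    (resCb half_subset).contDiff.comp hf
  have hθ₁ : ContDiff ℝ ω fun y => S.θ₁ (q y) (b y) (w y) :=
    ((hd.smul contDiff_const).add (S.contDiff_rhs hq hb hw)).sub (contDiff_const.mul hw.fst)
  have ht : ContDiff ℝ ω fun y => S.θH (w y) := contDiff_const.mul (hr hw.fst)
  have ht1 : ContDiff ℝ ω fun y => S.θH₁ (q y) (b y) (w y) := contDiff_const.mul (hr hθ₁)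
  have hχ : ContDiff ℝ ω fun y => S.O.χ₁ (S.ζ (b y) (w y) * (w y).2) :=
    S.O.χ₁.contDiff.comp (hζ.mul hw.snd)
  have hs1 : ContDiff ℝ ω fun y => S.swirl₁ (b y) (w y) :=
    ((contDiff_const.mul (((evL 0).contDiff.comp (S.O.A.contDiff.comp hχ)).sub
      ((evL 0).contDiff.comp (S.O.B.contDiff.comp hχ)))).smul contDiff_const).sub
      (contDiff_const.mul (hr hχ))
  have hs2 : ContDiff ℝ ω fun y => S.swirl₂ (b y) (w y) :=
    (contDiff_const.mul (hr (S.O.χ₂.contDiff.comp (hζ.mul hw.snd)))).neg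
  have h2d := contDiff_const (c := (2 : ℝ)).mul hd
  have ht2 : ContDiff ℝ ω fun y => S.θH₂ (c y) (q y) (b y) (w y) :=
    contDiff_const.mul (((((hs1.sub (ht.const_smul _)).sub (hp1.mul ht)).sub (hp.mul ht1)).sub
      (ht.mul ht1)).sub (h2d.smul contDiff_const))
  have ht3 : ContDiff ℝ ω fun y => S.θH₃ (c y) (q y) (b y) (w y) :=
    contDiff_const.mul ((((((((hs2.sub (ht1.const_smul _)).sub (hp2.mul ht)).sub
      ((hp1.mul ht1).const_smul _)).sub (hp.mul ht2)).sub (ht1.mul ht1)).sub (ht.mul ht2)).sub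
      (h2d.smul contDiff_const)).add ((contDiff_const.mul ht2).const_smul _))
  have hφ₂ : ContDiff ℝ ω fun y => S.φ₂ (q y) (w y) :=
    (((contDiff_const.add hq).add (contDiff_const.mul hw.fst)).mul hw.snd).neg
  exact ((hw.fst.prodMk hθ₁).prodMk (ht2.prodMk ht3)).prodMk (hζ.prodMk (hw.snd.prodMk hφ₂))

end Smooth

theorem norm_unknowns_le (U : X ε) : ‖unknowns U‖ ≤ ‖embX ε U‖ := by
  rw [embX_apply]
  refine max_le ?_ ?_
  · exact (norm_fst_le (emb1 ε U.fst).1).trans ((norm_fst_le (emb1 ε U.fst)).trans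
      (norm_fst_le (emb1 ε U.fst, emb2 ε U.snd)))
  · exact (norm_fst_le (emb2 ε U.snd).2).trans ((norm_snd_le (emb2 ε U.snd)).trans
      (norm_snd_le (emb1 ε U.fst, emb2 ε U.snd)))

theorem data_eq {b : B3} {U : X ε} (h0 : U.θ 0 = b 0) (h1 : deriv U.φ 0 = b 1)
    (h2 : U.φ 0 = b 2) : U.data = b := by
  ext i
  fin_cases i
  · exact h0
  · exact h1
  · exact h2

/-- Point evaluations are continuous linear forms on `X`, so the derivative of the family in `X` can
be computed pointwise from the derivative `lin` of the fixed points. -/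
theorem deriv_eval {f : B3 → X ε} {Y : B3 →L[ℝ] X ε} (hf : HasFDerivAt f Y 0)
    {h : B3 → Cb (Ioo (-1) 1) × Cb (Ioo (-1) 1)} (hh : HasFDerivAt h S.lin 0)
    (hfh : ∀ᶠ b in 𝓝 (0 : B3), (f b).θ = S.θ (h b) ∧ (f b).φ = S.φ b (h b)) (b : B3) {x : ℝ}
    (hx : x ∈ Ioo (-1 : ℝ) 1) :
    (Y b).θ x = b 0 * ((ev (S.T (pwCb (2 * ε))) 0)⁻¹ *
      (pw (1 - 2 * ε) x * ev (S.T (pwCb (2 * ε))) x)) ∧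
    (Y b).φ x = b 1 * (pw (-ε) x * ev (S.O.Z S.G) x) + b 2 := by
  constructor
  · have h1 : HasFDerivAt (fun b => evalθ ε x (f b)) (evalθ ε x ∘L Y) 0 :=
      ((evalθ ε x).hasFDerivAt (x := f 0)).comp (0 : B3) hf
    set Λ : Cb (Ioo (-1) 1) × Cb (Ioo (-1) 1) →L[ℝ] ℝ :=
      pw (1 - 2 * ε) x • (evL x).comp (ContinuousLinearMap.fst ℝ _ _) with hΛ
    have h2 : HasFDerivAt (fun b => Λ (h b)) (Λ ∘L S.lin) 0 :=
      (Λ.hasFDerivAt (x := h 0)).comp (0 : B3) hh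
    have e : (fun b => evalθ ε x (f b)) =ᶠ[𝓝 0] fun b => Λ (h b) := by
      filter_upwards [hfh] with b hb
      rw [evalθ_apply, hb.1]
      rfl
    have h3 := DFunLike.congr_fun ((h2.congr_of_eventuallyEq e).unique h1) b
    rw [ContinuousLinearMap.comp_apply, ContinuousLinearMap.comp_apply, evalθ_apply] at h3
    rw [← h3]
    simp only [hΛ, lin, smul_apply, ContinuousLinearMap.comp_apply, ContinuousLinearMap.prod_apply,
      ContinuousLinearMap.coe_fst', ContinuousLinearMap.smulRight_apply, evL_apply, ev_smul,
      crd_apply, smul_eq_mul]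
    ring
  · have h1 : HasFDerivAt (fun b => evalφ ε x (f b)) (evalφ ε x ∘L Y) 0 :=
      ((evalφ ε x).hasFDerivAt (x := f 0)).comp (0 : B3) hf
    set Λ : Cb (Ioo (-1) 1) × Cb (Ioo (-1) 1) →L[ℝ] ℝ :=
      pw (-ε) x • (evL x).comp (S.O.Z.comp (ContinuousLinearMap.snd ℝ _ _)) with hΛ
    have h2 : HasFDerivAt (fun b => crd 2 b + Λ (h b)) (crd 2 + Λ ∘L S.lin) 0 :=
      ((crd 2).hasFDerivAt (x := (0 : B3))).fun_add ((Λ.hasFDerivAt (x := h 0)).comp (0 : B3) hh)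
    have h4 := pw_neg_mul ε hx
    have e : (fun b => evalφ ε x (f b)) =ᶠ[𝓝 0] fun b => crd 2 b + Λ (h b) := by
      filter_upwards [hfh] with b hb
      rw [evalφ_apply, hb.2]
      simp only [φ, ζ, ev_add, ev_smul, ev_pwCb S.pos.le hx, hΛ, smul_apply,
        ContinuousLinearMap.comp_apply, ContinuousLinearMap.coe_snd', evL_apply, crd_apply,
        smul_eq_mul]
      linear_combination (b 2) * h4
    have h3 := DFunLike.congr_fun ((h2.congr_of_eventuallyEq e).unique h1) b
    rw [add_apply, ContinuousLinearMap.comp_apply, ContinuousLinearMap.comp_apply,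
      evalφ_apply] at h3
    rw [← h3]
    simp only [hΛ, lin, smul_apply, ContinuousLinearMap.comp_apply, ContinuousLinearMap.prod_apply,
      ContinuousLinearMap.coe_snd', ContinuousLinearMap.smulRight_apply, evL_apply, crd_apply,
      smul_eq_mul, map_smul]
    ring

/-- Existence and local uniqueness are translated from the fixed point equation, with the change of
profile `q p` and the data `b` as parameters. The conclusion concerns a whole neighbourhood; the
explicit derivative is needed only at the base point. -/
theorem exists_local_family {N : Set ((Fin 3 → ℝ) × ℝ)} (hN : IsOpen N) {p₀ : (Fin 3 → ℝ) × ℝ}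
    (hp₀ : p₀ ∈ N) {q : (Fin 3 → ℝ) × ℝ → Cb (Ioo (-1) 1)} (hq : ContDiffOn ℝ ∞ q N)
    (hq0 : q p₀ = 0) {m : (Fin 3 → ℝ) × ℝ → Fin 3 → ℝ} (hm : ContDiff ℝ ∞ m)
    (hU : ∀ p ∈ N, IsNoSwirl (m p) (ev (S.U₀ + q p))) {Ub : (Fin 3 → ℝ) × ℝ → ℝ → ℝ}
    (hUb : ∀ p ∈ N, ∀ x ∈ Ioo (-1 : ℝ) 1, Ub p x = ev (S.U₀ + q p) x) :
    ∃ N' : Set ((Fin 3 → ℝ) × ℝ), ∃ δ > 0, ∃ ρ > 0, ∃ f : ((Fin 3 → ℝ) × ℝ) × B3 → X ε,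
      (IsOpen N' ∧ p₀ ∈ N' ∧ ContDiffOn ℝ ∞ f (N' ×ˢ Metric.ball 0 δ) ∧ (∀ p ∈ N', f (p, 0) = 0) ∧
      ∀ p ∈ N', ∀ b ∈ Metric.ball (0 : B3) δ, Sol Ub p b (f (p, b)) ∧
        ∀ U, ‖U‖ < ρ → Sol Ub p b U → U = f (p, b)) ∧
      ∃ Y : B3 →L[ℝ] X ε, HasFDerivAt (fun b => f (p₀, b)) Y 0 ∧ ∀ b, ∀ x ∈ Ioo (-1 : ℝ) 1,
        (Y b).θ x = b 0 * ((ev (S.T (pwCb (2 * ε))) 0)⁻¹ *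
          (pw (1 - 2 * ε) x * ev (S.T (pwCb (2 * ε))) x)) ∧
        (Y b).φ x = b 1 * (pw (-ε) x * ev (S.O.Z S.G) x) + b 2 := by
  have := M1.completeSpace S.lt_half
  obtain ⟨h, M, ρ, hρ, hM, h0M, hh, hhd, hfix, huniq, hzero⟩ := S.exists_fixedPoint
  set pr : ((Fin 3 → ℝ) × ℝ) × B3 → Cb (Ioo (-1) 1) × B3 := fun y => (q y.1, y.2) with hpr
  have hprc : ContDiffOn ℝ ∞ pr (N ×ˢ univ) :=
    (hq.comp contDiffOn_fst fun y hy => hy.1).prodMk contDiffOn_snd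
  have hW : IsOpen ((N ×ˢ univ) ∩ pr ⁻¹' M) :=
    hprc.continuousOn.isOpen_inter_preimage (hN.prod isOpen_univ) hM
  have hp₀W : ((p₀, 0) : ((Fin 3 → ℝ) × ℝ) × B3) ∈ (N ×ˢ univ) ∩ pr ⁻¹' M :=
    ⟨⟨hp₀, mem_univ _⟩, by simpa [hpr, hq0] using h0M⟩
  obtain ⟨N', V, hN', hV, hpN', h0V, hsub⟩ := isOpen_prod_iff.1 hW p₀ 0 hp₀W
  obtain ⟨δ, hδ, hδV⟩ := Metric.isOpen_iff.1 hV 0 h0V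
  have hsub' : N' ×ˢ Metric.ball (0 : B3) δ ⊆ (N ×ˢ univ) ∩ pr ⁻¹' M := fun y hy =>
    hsub ⟨hy.1, hδV hy.2⟩
  have hopen : IsOpen (N' ×ˢ Metric.ball (0 : B3) δ) := hN'.prod Metric.isOpen_ball
  have hex : ∀ y ∈ N' ×ˢ Metric.ball (0 : B3) δ, ∃ U : X ε, U.θ = S.θ (h (pr y)) ∧
      U.φ = S.φ y.2 (h (pr y)) ∧ embX ε U = S.image (m y.1) (q y.1) y.2 (h (pr y)) :=
    fun y hy => S.exists_element (hfix _ (hsub' hy).2) (hU _ (hsub' hy).1.1)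
  choose! f hfθ hfφ hfe using hex
  have hw : ContDiffOn ℝ ∞ (fun y => h (pr y)) (N' ×ˢ Metric.ball (0 : B3) δ) :=
    (hh.of_le le_top).comp (hprc.mono fun y hy => (hsub' hy).1) fun y hy => (hsub' hy).2
  have hf : ContDiffOn ℝ ∞ f (N' ×ˢ Metric.ball (0 : B3) δ) := by
    -- After the embedding, `f` becomes `image`, a smooth expression in the constants, `q`, `b` and
    -- the fixed point.
    refine contDiffOn_of_comp_antilipschitz (embX ε) norm_le_embX hopen ?_
    have h1 := (S.contDiff_image (E := (Fin 3 → ℝ) × (Cb (Ioo (-1) 1) × (B3 ×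
      (Cb (Ioo (-1) 1) × Cb (Ioo (-1) 1))))) (c := fun y => y.1) (q := fun y => y.2.1)
      (b := fun y => y.2.2.1) (w := fun y => y.2.2.2) contDiff_fst contDiff_snd.fst
      contDiff_snd.snd.fst contDiff_snd.snd.snd).of_le (m := ∞) le_top
    have h2 : ContDiffOn ℝ ∞ (fun y : ((Fin 3 → ℝ) × ℝ) × B3 =>
        (m y.1, (q y.1, (y.2, h (pr y))))) (N' ×ˢ Metric.ball (0 : B3) δ) :=
      (hm.comp_contDiffOn contDiffOn_fst).prodMk
        ((hq.comp contDiffOn_fst fun y hy => (hsub' hy).1.1).prodMk (contDiffOn_snd.prodMk hw))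
    exact (h1.comp_contDiffOn h2).congr fun y hy => hfe y hy
  have hball0 : (0 : B3) ∈ Metric.ball (0 : B3) δ := Metric.mem_ball_self hδ
  have hcongr : ∀ p ∈ N', ∀ {chat : Fin 3 → ℝ} {U : X ε},
      SolvesNSE chat (fun x => Ub p x + U.θ x) U.φ ↔
      SolvesNSE chat (fun x => ev (S.U₀ + q p) x + U.θ x) U.φ := by
    intro p hp chat U
    have hpN : p ∈ N := (hsub' (show (p, (0 : B3)) ∈ _ from ⟨hp, hball0⟩)).1.1
    exact ⟨fun hs => hs.congr fun x hx => by rw [hUb p hpN x hx],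
      fun hs => hs.congr fun x hx => by rw [hUb p hpN x hx]⟩
  have hC : 0 < ‖embX ε‖ + 1 := by positivity
  -- The radius makes the unknowns of a small `U` smaller than `ρ`, where fixed points are unique.
  refine ⟨N', δ, hδ, ρ / (‖embX ε‖ + 1), by positivity, f, ⟨hN', hpN', hf, ?_, ?_⟩, ?_⟩
  · intro p hp
    have hy : (p, (0 : B3)) ∈ N' ×ˢ Metric.ball (0 : B3) δ := ⟨hp, hball0⟩
    have h1 := hzero _ (hsub' hy).2 rfl
    refine X.ext ?_ ?_
    · rw [hfθ _ hy, h1]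
      funext x
      exact (mul_eq_zero_of_right _ (ev_zero x))
    · rw [hfφ _ hy, h1]
      funext x
      refine mul_eq_zero_of_right _ ?_
      simp [ζ]
  · intro p hp b hb
    have hy : (p, b) ∈ N' ×ˢ Metric.ball (0 : B3) δ := ⟨hp, hb⟩
    have hM' := (hsub' hy).2
    have hN'' := (hsub' hy).1.1
    obtain ⟨chat, hs⟩ : ∃ chat, SolvesNSE chat
        (fun x => ev (S.U₀ + q p) x + (f (p, b)).θ x) (f (p, b)).φ := by
      rw [hfθ _ hy, hfφ _ hy]
      exact ⟨_, S.solvesNSE (hfix _ hM') (hU _ hN'')⟩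
    refine ⟨⟨⟨chat, (hcongr p hp).2 hs⟩, data_eq ?_ ?_ ?_⟩, ?_⟩
    · rw [hfθ _ hy]; exact S.θ_zero (hfix _ hM')
    · rw [hfφ _ hy]; exact S.deriv_φ_zero (hfix _ hM')
    · rw [hfφ _ hy]; exact S.φ_zero
    · rintro U hUn ⟨⟨chat, hs⟩, hdat⟩
      have h1 := S.unknowns_fixed (hU _ hN'') ((hcongr p hp).1 hs)
      rw [hdat] at h1
      have h2 : ‖unknowns U‖ < ρ := by
        have h3 := (norm_unknowns_le U).trans ((embX ε).le_opNorm U)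
        rw [lt_div_iff₀ hC] at hUn
        nlinarith [norm_nonneg U]
      have h3 := huniq _ hM' _ h2 h1
      refine X.ext ?_ ?_
      · rw [hfθ _ hy, S.θ_unknowns, h3]
      · rw [hfφ _ hy, S.φ_unknowns, h3, hdat]
  · have hdiff : DifferentiableAt ℝ (fun b => f (p₀, b)) 0 := by
      have hmem : ((p₀, 0) : ((Fin 3 → ℝ) × ℝ) × B3) ∈ N' ×ˢ Metric.ball (0 : B3) δ :=
        mk_mem_prod hpN' hball0
      have h1 := (hf.contDiffAt (hopen.mem_nhds hmem)).differentiableAt (by simp)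
      exact h1.comp (0 : B3) ((differentiableAt_const p₀).prodMk differentiableAt_id)
    refine ⟨fderiv ℝ (fun b => f (p₀, b)) 0, hdiff.hasFDerivAt, fun b x hx => ?_⟩
    refine S.deriv_eval hdiff.hasFDerivAt hhd ?_ b hx
    filter_upwards [Metric.ball_mem_nhds (0 : B3) hδ] with b hb
    have hy : (p₀, b) ∈ N' ×ˢ Metric.ball (0 : B3) δ := ⟨hpN', hb⟩
    rw [hfθ _ hy, hfφ _ hy, hpr]
    simp only [hq0, and_self]

end LocalOps

/-! ### The linearized operators at the extremal profiles -/

theorem gexp_add_linear {ℓ : ℝ → ℝ} (hℓ : ContinuousOn ℓ (Ioo (-1) 1)) (e : ℝ) {x : ℝ}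
    (hx : x ∈ Ioo (-1 : ℝ) 1) : gexp (fun x => ℓ x + 2 * e * x) x = gexp ℓ x * pw (-e) x := by
  refine gexp_eq_of_hasDerivAt (F := fun x => gexp ℓ x * pw (-e) x)
    (by exact hℓ.add (by fun_prop)) (by simp) (fun y hy => ?_) hx
  refine ((hasDerivAt_gexp hℓ hy).fun_mul (hasDerivAt_pw (-e) hy)).congr_deriv ?_
  ring

theorem continuousOn_weighted (U₀ : Cb (Ioo (-1) 1)) (ε : ℝ) :
    ContinuousOn (fun x => 2 * x + ev U₀ x - 2 * (1 - 2 * ε) * x) (Ioo (-1) 1) :=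
  ((by fun_prop : ContinuousOn (fun x : ℝ => 2 * x) _).add (continuousOn_ev U₀)).sub
    (by fun_prop)

@[simp] theorem a_zero (c : Fin 3 → ℝ) (γ : ℝ) : a c γ 0 = 0 := by simp [a]

theorem tendsto_add_continuous {U f : ℝ → ℝ} {F : Filter ℝ} {l e : ℝ} (hU : Tendsto U F (𝓝 l))
    (hf : Continuous f) (hF : F ≤ 𝓝 e) : Tendsto (fun x => U x + f x) F (𝓝 (l + f e)) :=
  hU.add ((hf.tendsto e).mono_left hF)

section

variable {c : Fin 3 → ℝ} {γ : ℝ} {U₀ : Cb (Ioo (-1) 1)}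

theorem exp_a_eq (hU : ∀ x ∈ Ioo (-1 : ℝ) 1, Ubar c γ x = ev U₀ x)
    {x : ℝ} (hx : x ∈ Ioo (-1 : ℝ) 1) :
    Real.exp (a c γ x) = gexp (fun x => 2 * x + ev U₀ x) x := by
  rw [gexp, a]
  congr 1
  refine intervalIntegral.integral_congr fun s hs => ?_
  rw [hU s (uIcc_subset_Ioo zero_mem_Ioo hx hs)]

theorem exp_b_eq (hU : ∀ x ∈ Ioo (-1 : ℝ) 1, Ubar c γ x = ev U₀ x)
    {x : ℝ} (hx : x ∈ Ioo (-1 : ℝ) 1) :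
    Real.exp (-b c γ x) = (gexp (ev U₀) x)⁻¹ := by
  rw [gexp, b, Real.exp_neg]
  congr 2
  refine intervalIntegral.integral_congr fun s hs => ?_
  rw [hU s (uIcc_subset_Ioo zero_mem_Ioo hx hs)]

theorem gexp_weighted (hU : ∀ x ∈ Ioo (-1 : ℝ) 1, Ubar c γ x = ev U₀ x)
    {ε x : ℝ} (hx : x ∈ Ioo (-1 : ℝ) 1) :
    gexp (fun x => 2 * x + ev U₀ x - 2 * (1 - 2 * ε) * x) x =
      Real.exp (a c γ x) * pw (1 - 2 * ε) x := by
  have h := gexp_add_linear (ℓ := fun x => 2 * x + ev U₀ x)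
    ((by fun_prop : ContinuousOn (fun x : ℝ => 2 * x) _).add (continuousOn_ev U₀))
    (-(1 - 2 * ε)) hx
  rw [neg_neg, ← exp_a_eq hU hx] at h
  rw [← h]
  congr 1
  funext y
  ring

/-- All weights cancel and leave `e^a`; this identifies the response of `Uθ` to the third constant
with `V^{2a}` or `V^{2b}`. -/
theorem weight_integrand (hU : ∀ x ∈ Ioo (-1 : ℝ) 1, Ubar c γ x = ev U₀ x)
    {ε s : ℝ} (h0 : 0 < ε) (hs : s ∈ Ioo (-1 : ℝ) 1) :
    gexp (fun x => 2 * x + ev U₀ x - 2 * (1 - 2 * ε) * x) s / (1 - s ^ 2) *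
      ev (pwCb (2 * ε)) s = Real.exp (a c γ s) := by
  have h1 : pw (1 - 2 * ε) s * pw (2 * ε) s = 1 - s ^ 2 := by
    rw [pw_mul _ _ hs, show 1 - 2 * ε + 2 * ε = 1 by ring, pw, Real.rpow_one]
  rw [gexp_weighted hU hs, ev_pwCb (by linarith) hs, div_mul_eq_mul_div, mul_assoc, h1,
    mul_div_cancel_right₀ _ (one_sub_sq_pos hs).ne']

/-- The weighted coefficient has the limits `l - 4ε` and `r + 4ε`, both positive, so the bounded
solution is the integral from `-1`. Its response to `(1-x²)^{2ε}` at `0` is the integral of the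
positive function `e^a`. -/
theorem exists_solver_V2a (hU : ∀ x ∈ Ioo (-1 : ℝ) 1, Ubar c γ x = ev U₀ x)
    {ε l r : ℝ} (h0 : 0 < ε) (hl : Tendsto (ev U₀) (𝓝[>] (-1)) (𝓝 l))
    (hr : Tendsto (ev U₀) (𝓝[<] 1) (𝓝 r)) (h1 : 0 < l - 4 * ε) (h2 : 0 < r + 4 * ε) :
    ∃ T, IsSolver (fun x => 2 * x + ev U₀ x - 2 * (1 - 2 * ε) * x) T ∧
      ev (T (pwCb (2 * ε))) 0 ≠ 0 ∧ ∀ x ∈ Ioo (-1 : ℝ) 1,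
      pw (1 - 2 * ε) x * ev (T (pwCb (2 * ε))) x = V2a c γ x := by
  have hc := continuousOn_weighted U₀ ε
  have hf : Continuous fun x : ℝ => 2 * x - 2 * (1 - 2 * ε) * x := by fun_prop
  have hp : PosEnds fun x => 2 * x + ev U₀ x - 2 * (1 - 2 * ε) * x := by
    refine posEnds_of_tendsto hc h1 h2 ?_ ?_
    · have := tendsto_add_continuous hl hf nhdsWithin_le_nhds
      convert this using 2 <;> ring
    · have := tendsto_add_continuous hr hf nhdsWithin_le_nhds
      convert this using 2 <;> ring
  obtain ⟨T, hT, hform⟩ := exists_solver_left hc hp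
  have hV : ∀ x ∈ Ioo (-1 : ℝ) 1, pw (1 - 2 * ε) x * ev (T (pwCb (2 * ε))) x = V2a c γ x := by
    intro x hx
    rw [hform _ x hx, V2a, intervalIntegral.integral_congr_Ioo_of_le hx.1.le fun s hs =>
      weight_integrand hU h0 ⟨hs.1, hs.2.trans hx.2⟩, gexp_weighted hU hx, Real.exp_neg]
    have := (pw_pos (1 - 2 * ε) hx).ne'
    field_simp
  refine ⟨T, hT, ?_, hV⟩
  have h3 := hV 0 zero_mem_Ioo
  rw [pw_at_zero, one_mul, V2a, a_zero, neg_zero, Real.exp_zero, one_mul] at h3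
  rw [h3]
  refine (intervalIntegral.intervalIntegral_pos_of_pos_on ?_ (fun x _ => Real.exp_pos _)
    (by norm_num)).ne'
  refine (intervalIntegrable_mul_ev (by norm_num) zero_mem_Ioo
    (intervalIntegrable_gexp_left hc hp zero_mem_Ioo) (pwCb (2 * ε))).congr_uIoo ?_
  rw [uIoo_of_le (by norm_num)]
  exact fun s hs => weight_integrand hU h0 ⟨hs.1, hs.2.trans one_pos⟩

/-- Here both limits are negative, and the bounded solution is the integral from `1`. -/
theorem exists_solver_V2b (hU : ∀ x ∈ Ioo (-1 : ℝ) 1, Ubar c γ x = ev U₀ x)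
    {ε l r : ℝ} (h0 : 0 < ε) (hl : Tendsto (ev U₀) (𝓝[>] (-1)) (𝓝 l))
    (hr : Tendsto (ev U₀) (𝓝[<] 1) (𝓝 r)) (h1 : l - 4 * ε < 0) (h2 : r + 4 * ε < 0) :
    ∃ T, IsSolver (fun x => 2 * x + ev U₀ x - 2 * (1 - 2 * ε) * x) T ∧
      ev (T (pwCb (2 * ε))) 0 ≠ 0 ∧ ∀ x ∈ Ioo (-1 : ℝ) 1,
      pw (1 - 2 * ε) x * ev (T (pwCb (2 * ε))) x = V2b c γ x := by
  set ℓ : ℝ → ℝ := fun x => 2 * x + ev U₀ x - 2 * (1 - 2 * ε) * x with hℓ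
  have hc : ContinuousOn ℓ (Ioo (-1) 1) := continuousOn_weighted U₀ ε
  have hf : Continuous fun x : ℝ => 2 * x - 2 * (1 - 2 * ε) * x := by fun_prop
  have hp : PosEnds fun x => -ℓ (-x) := by
    refine posEnds_of_tendsto (continuousOn_neg_refl hc) (l := -(r + 4 * ε)) (r := -(l - 4 * ε))
      (by linarith) (by linarith) ?_ ?_
    · have := tendsto_add_continuous hr hf nhdsWithin_le_nhds
      refine ((this.comp (by simpa using tendsto_neg_nhdsGT (a := (-1 : ℝ)))).neg).congr'
        (Eventually.of_forall fun x => ?_) |>.trans_eq ?_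
      · simp only [hℓ, Function.comp_apply]; ring
      · congr 1; ring
    · have := tendsto_add_continuous hl hf nhdsWithin_le_nhds
      refine ((this.comp tendsto_neg_nhdsLT_one).neg).congr'
        (Eventually.of_forall fun x => ?_) |>.trans_eq ?_
      · simp only [hℓ, Function.comp_apply]; ring
      · congr 1; ring
  obtain ⟨T, hT, hform⟩ := exists_solver_right hc hp
  have hV : ∀ x ∈ Ioo (-1 : ℝ) 1, pw (1 - 2 * ε) x * ev (T (pwCb (2 * ε))) x = V2b c γ x := by
    intro x hx
    rw [hform _ x hx, V2b, intervalIntegral.integral_congr_uIoo (a := 1) (b := x) fun s hs =>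
      weight_integrand hU h0 (by
        rw [uIoo_of_ge hx.2.le] at hs
        exact ⟨hx.1.trans hs.1, hs.2⟩), gexp_weighted hU hx, Real.exp_neg]
    have := (pw_pos (1 - 2 * ε) hx).ne'
    field_simp
  refine ⟨T, hT, ?_, hV⟩
  have h3 := hV 0 zero_mem_Ioo
  rw [pw_at_zero, one_mul, V2b, a_zero, neg_zero, Real.exp_zero, one_mul,
    intervalIntegral.integral_symm] at h3
  rw [h3, neg_ne_zero]
  refine (intervalIntegral.intervalIntegral_pos_of_pos_on ?_ (fun x _ => Real.exp_pos _)
    (by norm_num)).ne'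
  have h4 : IntervalIntegrable (fun s => gexp ℓ s / (1 - s ^ 2)) MeasureTheory.volume 1 0 := by
    have := intervalIntegrable_refl (x := 0) (by
      simpa using intervalIntegrable_gexp_left (continuousOn_neg_refl hc) hp zero_mem_Ioo)
    simpa only [gexp_neg_refl, neg_sq] using this
  refine (intervalIntegrable_mul_ev (by norm_num) zero_mem_Ioo h4
    (pwCb (2 * ε))).symm.congr_uIoo ?_
  rw [uIoo_of_le (by norm_num)]
  exact fun s hs => weight_integrand hU h0 ⟨by linarith [hs.1], hs.2⟩

/-- The bounds on `l` and `r` make the coefficient of the equation for `η` negative at `-1` and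
positive at `1`. Then `G` is bounded, and integrating `(1-x²)^{-1-ε} G = e^{-b}` from `0` gives
`V^3`. -/
theorem exists_localOps (hU : ∀ x ∈ Ioo (-1 : ℝ) 1, Ubar c γ x = ev U₀ x)
    {ε l r : ℝ} {V₂ : (Fin 3 → ℝ) → ℝ → ℝ → ℝ} (h0 : 0 < ε) (h0' : ε < 1 / 2)
    (hl : Tendsto (ev U₀) (𝓝[>] (-1)) (𝓝 l)) (hr : Tendsto (ev U₀) (𝓝[<] 1) (𝓝 r))
    (h1 : l < 2 * (1 + ε)) (h2 : -(2 * (1 + ε)) < r)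
    (hT : ∃ T, IsSolver (fun x => 2 * x + ev U₀ x - 2 * (1 - 2 * ε) * x) T ∧
      ev (T (pwCb (2 * ε))) 0 ≠ 0 ∧ ∀ x ∈ Ioo (-1 : ℝ) 1,
      pw (1 - 2 * ε) x * ev (T (pwCb (2 * ε))) x = V₂ c γ x) :
    ∃ S : LocalOps ε, S.U₀ = U₀ ∧ ∀ x ∈ Ioo (-1 : ℝ) 1,
      pw (1 - 2 * ε) x * ev (S.T (pwCb (2 * ε))) x = V₂ c γ x ∧
      pw (-ε) x * ev (S.O.Z S.G) x = V3 c γ x := by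
  obtain ⟨T, hT, hT0, hV⟩ := hT
  obtain ⟨O⟩ := nonempty_swirlOps h0 h0'
  have hf : Continuous fun x : ℝ => 2 * (1 + ε) * x := by fun_prop
  have hc : ContinuousOn (fun x => ev U₀ x + 2 * (1 + ε) * x) (Ioo (-1) 1) :=
    (continuousOn_ev U₀).add hf.continuousOn
  obtain ⟨⟨R, hR⟩, hG⟩ := exists_initSolver hc (outEnds_of_tendsto hc
    (l := l + 2 * (1 + ε) * (-1)) (r := r + 2 * (1 + ε) * 1) (by linarith) (by linarith)
    (tendsto_add_continuous hl hf nhdsWithin_le_nhds)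
    (tendsto_add_continuous hr hf nhdsWithin_le_nhds))
  refine ⟨⟨O, U₀, T, R, _, h0, h0', hT, hT0, hR, hG⟩, rfl, fun x hx => ⟨hV x hx, ?_⟩⟩
  have hd : ∀ x ∈ Ioo (-1 : ℝ) 1, HasDerivAt (V3 c γ) (gexp (ev U₀) x)⁻¹ x := by
    intro x hx
    have hcb : ContinuousOn (fun t => Real.exp (-b c γ t)) (Ioo (-1) 1) :=
      ((continuousOn_gexp (continuousOn_ev U₀)).inv₀ fun x _ => (gexp_pos _ x).ne').congr
        fun x hx => exp_b_eq hU hx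
    have := hasDerivAt_integral_Ioo hcb hx
    rwa [exp_b_eq hU hx] at this
  have h3 := O.isZ.eq_linear hd (fun x hx => by
    rw [hG x hx, gexp_add_linear (continuousOn_ev U₀) _ hx, mul_inv, mul_comm]
    congr 1
    rw [pw, pw, Real.rpow_neg (one_sub_sq_pos hx).le, inv_inv, add_comm]) hx
  rw [show V3 c γ 0 = 0 by simp [V3], zero_mul, zero_add] at h3
  change pw (-ε) x * ev (O.Z _) x = _
  rw [← h3, ← mul_assoc, pw_neg_mul _ hx, one_mul]

end

theorem IsLocalProfile.Ubar_eq {m : (Fin 3 → ℝ) → Fin 3 → ℝ} {g : (Fin 3 → ℝ) → ℝ}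
    {c₀ : Fin 3 → ℝ} {U₀ : Cb (Ioo (-1) 1)} {l r : ℝ} (h : IsLocalProfile m g c₀ U₀ l r)
    (hm : m c₀ = c₀) {x : ℝ} (hx : x ∈ Ioo (-1 : ℝ) 1) : Ubar c₀ (g c₀) x = ev U₀ x := by
  obtain ⟨N, q, -, hc, -, hq0, hN⟩ := h.exists_family
  obtain ⟨h1, h2⟩ := hN c₀ hc
  rw [hm, hq0, add_zero] at h1 h2
  rw [h2]
  exact h1.Ubar_eq hx

theorem IsLocalProfile.UbarLeft_eq {m : (Fin 3 → ℝ) → Fin 3 → ℝ} {g : (Fin 3 → ℝ) → ℝ}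
    {c₀ : Fin 3 → ℝ} {U₀ : Cb (Ioo (-1) 1)} {l r : ℝ} (h : IsLocalProfile m g c₀ U₀ l r)
    (hm : m c₀ = c₀) : UbarLeft c₀ (g c₀) = l :=
  (tendsto_congr_left (fun _ hx => (h.Ubar_eq hm hx).symm) h.left).limUnder_eq

theorem IsLocalProfile.UbarRight_eq {m : (Fin 3 → ℝ) → Fin 3 → ℝ} {g : (Fin 3 → ℝ) → ℝ}
    {c₀ : Fin 3 → ℝ} {U₀ : Cb (Ioo (-1) 1)} {l r : ℝ} (h : IsLocalProfile m g c₀ U₀ l r)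
    (hm : m c₀ = c₀) : UbarRight c₀ (g c₀) = r :=
  (tendsto_congr_right (fun _ hx => (h.Ubar_eq hm hx).symm) h.right).limUnder_eq

/-! ### Admissible exponents and the four parameter sets -/

/-- Near `p` the profiles `U^{c,γ}` with `c` in the range of `m` and `γ = g c` depend smoothly on
the parameters, and the linearized operators at `p` are solvable for every admissible exponent. -/
structure IsRegularAt (m : (Fin 3 → ℝ) → Fin 3 → ℝ) (g : (Fin 3 → ℝ) → ℝ)
    (V₂ : (Fin 3 → ℝ) → ℝ → ℝ → ℝ) (p : (Fin 3 → ℝ) × ℝ) : Prop where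
  fixed : m p.1 = p.1
  value : g p.1 = p.2
  exists_ops : ∀ ε, 0 < ε → ε < 1 / 2 → AdmissibleAt ε p.1 p.2 → ∃ S : LocalOps ε,
    (∃ l r, IsLocalProfile m g p.1 S.U₀ l r) ∧ ∀ x ∈ Ioo (-1 : ℝ) 1,
      pw (1 - 2 * ε) x * ev (S.T (pwCb (2 * ε))) x = V₂ p.1 p.2 x ∧
      pw (-ε) x * ev (S.O.Z S.G) x = V3 p.1 p.2 x

section

variable {m : (Fin 3 → ℝ) → Fin 3 → ℝ} {c : Fin 3 → ℝ} {U₀ : Cb (Ioo (-1) 1)} {κ₁ κ₂ : ℝ}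

/-- At an upper profile `Uθ(-1) ≥ 2` and `Uθ(1) > -2`, so only the second and third clauses of
admissibility are active. -/
theorem IsLocalProfile.admissibleAt_iff_top
    (h : IsLocalProfile m gammaPlus c U₀ (2 + 2 * κ₁) (-2 + 2 * κ₂)) (hm : m c = c) (h1 : 0 ≤ κ₁)
    (h2 : 0 < κ₂) {ε : ℝ} :
    AdmissibleAt ε c (gammaPlus c) ↔ κ₁ < ε ∧ (1 - κ₂) / 2 < ε := by
  rw [AdmissibleAt, h.UbarLeft_eq hm, h.UbarRight_eq hm]
  constructor
  · rintro ⟨-, h3, h4, -⟩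
    exact ⟨by linarith [h3 (by linarith)], by linarith [h4 (by linarith)]⟩
  · rintro ⟨h3, h4⟩
    exact ⟨fun _ => by linarith, fun _ => by linarith, fun _ => by linarith, fun _ => by linarith⟩

theorem IsLocalProfile.admissibleAt_iff_bottom
    (h : IsLocalProfile m gammaMinus c U₀ (2 - 2 * κ₁) (-2 - 2 * κ₂)) (hm : m c = c) (h1 : 0 < κ₁)
    (h2 : 0 ≤ κ₂) {ε : ℝ} :
    AdmissibleAt ε c (gammaMinus c) ↔ κ₂ < ε ∧ (1 - κ₁) / 2 < ε := by
  rw [AdmissibleAt, h.UbarLeft_eq hm, h.UbarRight_eq hm]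
  constructor
  · rintro ⟨h3, -, -, h4⟩
    exact ⟨by linarith [h4 (by linarith)], by linarith [h3 (by linarith)]⟩
  · rintro ⟨h3, h4⟩
    exact ⟨fun _ => by linarith, fun _ => by linarith, fun _ => by linarith, fun _ => by linarith⟩

/-- The required signs: `2 + 2κ₁ - 4ε > 0` by `ε < 1/2`, `-2 + 2κ₂ + 4ε > 0` by `ε > (1-κ₂)/2`, and
`2 + 2κ₁ < 2(1+ε)` by `ε > κ₁`. The remaining bound at `1` is automatic. -/
theorem IsLocalProfile.isRegularAt_top
    (h : IsLocalProfile m gammaPlus c U₀ (2 + 2 * κ₁) (-2 + 2 * κ₂)) (hm : m c = c) (h1 : 0 ≤ κ₁)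
    (h2 : 0 < κ₂) : IsRegularAt m gammaPlus V2a (c, gammaPlus c) where
  fixed := hm
  value := rfl
  exists_ops := by
    intro ε h0 h0' hε
    obtain ⟨h3, h4⟩ := (h.admissibleAt_iff_top hm h1 h2).1 hε
    have hU : ∀ x ∈ Ioo (-1 : ℝ) 1, Ubar c (gammaPlus c) x = ev U₀ x := fun x hx =>
      h.Ubar_eq hm hx
    obtain ⟨S, hS, hV⟩ := exists_localOps hU h0 h0' h.left h.right (by linarith) (by linarith)
      (exists_solver_V2a hU h0 h.left h.right (by linarith) (by linarith))
    exact ⟨S, ⟨_, _, hS ▸ h⟩, hV⟩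

theorem IsLocalProfile.isRegularAt_bottom
    (h : IsLocalProfile m gammaMinus c U₀ (2 - 2 * κ₁) (-2 - 2 * κ₂)) (hm : m c = c) (h1 : 0 < κ₁)
    (h2 : 0 ≤ κ₂) : IsRegularAt m gammaMinus V2b (c, gammaMinus c) where
  fixed := hm
  value := rfl
  exists_ops := by
    intro ε h0 h0' hε
    obtain ⟨h3, h4⟩ := (h.admissibleAt_iff_bottom hm h1 h2).1 hε
    have hU : ∀ x ∈ Ioo (-1 : ℝ) 1, Ubar c (gammaMinus c) x = ev U₀ x := fun x hx =>
      h.Ubar_eq hm hx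
    obtain ⟨S, hS, hV⟩ := exists_localOps hU h0 h0' h.left h.right (by linarith) (by linarith)
      (exists_solver_V2b hU h0 h.left h.right (by linarith) (by linarith))
    exact ⟨S, ⟨_, _, hS ▸ h⟩, hV⟩

end

theorem IsLocalProfile.refl' {m : (Fin 3 → ℝ) → Fin 3 → ℝ} {c : Fin 3 → ℝ}
    {U₀ : Cb (Ioo (-1) 1)} (h : IsLocalProfile m gammaPlus (swapC c) U₀
      (2 + 2 * √(1 + swapC c 0)) (-2 + 2 * √(1 + swapC c 1))) :
    IsLocalProfile (fun c => swapC (m (swapC c))) gammaMinus c (-reflCb U₀)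
      (2 - 2 * √(1 + c 0)) (-2 - 2 * √(1 + c 1)) := by
  have h1 := h.refl
  rw [show -(-2 + 2 * √(1 + swapC c 1)) = 2 - 2 * √(1 + c 0) by
      rw [show swapC c 1 = c 0 from rfl]; ring,
    show -(2 + 2 * √(1 + swapC c 0)) = -2 - 2 * √(1 + c 1) by
      rw [show swapC c 0 = c 1 from rfl]; ring] at h1
  exact h1

/-- The condition `cᵢ < -3/4` means `√(1+cᵢ) < 1/2`, and `cⱼ > -1` means `(1 - √(1+cⱼ))/2 < 1/2`. By
compactness the larger of the two has a maximum over `K`, still below `1/2`. -/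
theorem exists_lt_of_compact {K : Set ((Fin 3 → ℝ) × ℝ)} (hK : IsCompact K) {i j : Fin 3}
    (hi : ∀ p ∈ K, p.1 i < -(3 / 4)) (hj : ∀ p ∈ K, -1 < p.1 j) :
    ∃ ε, 0 < ε ∧ ε < 1 / 2 ∧ ∀ p ∈ K, √(1 + p.1 i) < ε ∧ (1 - √(1 + p.1 j)) / 2 < ε := by
  rcases K.eq_empty_or_nonempty with rfl | hne
  · exact ⟨1 / 4, by norm_num, by norm_num, fun p hp => hp.elim⟩
  have hc : Continuous fun p : (Fin 3 → ℝ) × ℝ =>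
      max (√(1 + p.1 i)) ((1 - √(1 + p.1 j)) / 2) := by fun_prop
  obtain ⟨p, hp, hmax⟩ := hK.exists_isMaxOn hne hc.continuousOn
  have h1 : √(1 + p.1 i) < 1 / 2 := by
    rw [Real.sqrt_lt' (by norm_num)]
    linarith [hi p hp]
  have h2 : 0 < √(1 + p.1 j) := Real.sqrt_pos.2 (by linarith [hj p hp])
  obtain ⟨ε, h3, h4⟩ := exists_between (max_lt h1 (show (1 - √(1 + p.1 j)) / 2 < 1 / 2 by linarith))
  refine ⟨ε, ?_, h4, fun p' hp' => ?_⟩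
  · exact ((Real.sqrt_nonneg _).trans (le_max_left _ _)).trans_lt h3
  · exact max_lt_iff.1 ((hmax hp').trans_lt h3)

theorem contDiff_update (i : Fin 3) :
    ContDiff ℝ ∞ fun c : Fin 3 → ℝ => Function.update c i (-1) := by
  rw [contDiff_pi]
  intro j
  by_cases h : j = i
  · subst h
    simpa using contDiff_const
  · simpa [h] using contDiff_apply ℝ ℝ j

theorem update_eq_of_eq {c : Fin 3 → ℝ} {i : Fin 3} (h : c i = -1) :
    Function.update c i (-1) = c := by
  rw [← h]; exact Function.update_eq_self i c

theorem c3bar_swap (x y : ℝ) : c3bar x y = c3bar y x := by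
  unfold c3bar; ring

theorem exists_regular_top {K : Set ((Fin 3 → ℝ) × ℝ)} (hK : IsCompact K)
    (h : K ⊆ I12 ∨ K ⊆ I22) : ∃ m : (Fin 3 → ℝ) → Fin 3 → ℝ, ContDiff ℝ ∞ m ∧
      (∀ p ∈ K, IsRegularAt m gammaPlus V2a p) ∧ ∃ ε, Admissible ε K := by
  have key : ∃ m : (Fin 3 → ℝ) → Fin 3 → ℝ, ContDiff ℝ ∞ m ∧ ∀ p ∈ K, m p.1 = p.1 ∧
      p.2 = gammaPlus p.1 ∧ p.1 0 < -(3 / 4) ∧ -1 < p.1 1 ∧ ∃ U₀,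
      IsLocalProfile m gammaPlus p.1 U₀ (2 + 2 * √(1 + p.1 0)) (-2 + 2 * √(1 + p.1 1)) := by
    rcases h with h | h
    · refine ⟨id, contDiff_id, fun p hp => ?_⟩
      obtain ⟨-, ⟨-, h0, h1, h2⟩, h3, h4⟩ := h hp
      exact ⟨rfl, h4, h3, h1, exists_localProfile_of_lt h0 h1 h2⟩
    · refine ⟨_, contDiff_update 0, fun p hp => ?_⟩
      obtain ⟨-, ⟨-, h0, h1, h2⟩, h3, h4⟩ := h hp
      exact ⟨update_eq_of_eq h0, h4, h3, h1, exists_localProfile_of_eq h0 h1 h2⟩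
  obtain ⟨m, hm, hprof⟩ := key
  have hpos : ∀ p ∈ K, 0 < √(1 + p.1 1) := fun p hp =>
    Real.sqrt_pos.2 (by linarith [(hprof p hp).2.2.2.1])
  refine ⟨m, hm, fun p hp => ?_, ?_⟩
  · obtain ⟨h1, h2, h3, h4, U₀, hU⟩ := hprof p hp
    have := hU.isRegularAt_top h1 (Real.sqrt_nonneg _) (hpos p hp)
    rwa [← h2] at this
  · obtain ⟨ε, h0, h0', hε⟩ := exists_lt_of_compact hK (i := 0) (j := 1)
      (fun p hp => (hprof p hp).2.2.1) (fun p hp => (hprof p hp).2.2.2.1)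
    refine ⟨ε, h0, h0', fun p hp => ?_⟩
    obtain ⟨h1, h2, h3, h4, U₀, hU⟩ := hprof p hp
    rw [h2]
    exact (hU.admissibleAt_iff_top h1 (Real.sqrt_nonneg _) (hpos p hp)).2 (hε p hp)

theorem exists_regular_bottom {K : Set ((Fin 3 → ℝ) × ℝ)} (hK : IsCompact K)
    (h : K ⊆ I13 ∨ K ⊆ I33) : ∃ m : (Fin 3 → ℝ) → Fin 3 → ℝ, ContDiff ℝ ∞ m ∧
      (∀ p ∈ K, IsRegularAt m gammaMinus V2b p) ∧ ∃ ε, Admissible ε K := by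
  have key : ∃ m : (Fin 3 → ℝ) → Fin 3 → ℝ, ContDiff ℝ ∞ m ∧ ∀ p ∈ K, m p.1 = p.1 ∧
      p.2 = gammaMinus p.1 ∧ p.1 1 < -(3 / 4) ∧ -1 < p.1 0 ∧ ∃ U₀,
      IsLocalProfile m gammaMinus p.1 U₀ (2 - 2 * √(1 + p.1 0)) (-2 - 2 * √(1 + p.1 1)) := by
    rcases h with h | h
    · refine ⟨_, (contDiff_swapC.comp contDiff_id).comp contDiff_swapC, fun p hp => ?_⟩
      obtain ⟨-, ⟨-, h0, h1, h2⟩, h3, h4⟩ := h hp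
      obtain ⟨U₀, hU⟩ := exists_localProfile_of_lt (c₀ := swapC p.1) h1 h0
        (by rw [c3bar_swap]; exact h2)
      exact ⟨swapC_swapC _, h4, h3, h0, _, hU.refl'⟩
    · refine ⟨_, (contDiff_swapC.comp (contDiff_update 0)).comp contDiff_swapC, fun p hp => ?_⟩
      obtain ⟨-, ⟨-, h0, h1, h2⟩, h3, h4⟩ := h hp
      obtain ⟨U₀, hU⟩ := exists_localProfile_of_eq (c₀ := swapC p.1) h1 h0
        (by rw [c3bar_swap]; exact h2)
      refine ⟨?_, h4, h3, h0, _, hU.refl'⟩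
      simp only [Function.comp_apply]
      rw [update_eq_of_eq (show swapC p.1 0 = -1 from h1), swapC_swapC]
  obtain ⟨m, hm, hprof⟩ := key
  have hpos : ∀ p ∈ K, 0 < √(1 + p.1 0) := fun p hp =>
    Real.sqrt_pos.2 (by linarith [(hprof p hp).2.2.2.1])
  refine ⟨m, hm, fun p hp => ?_, ?_⟩
  · obtain ⟨h1, h2, h3, h4, U₀, hU⟩ := hprof p hp
    have := hU.isRegularAt_bottom h1 (hpos p hp) (Real.sqrt_nonneg _)
    rwa [← h2] at this
  · obtain ⟨ε, h0, h0', hε⟩ := exists_lt_of_compact hK (i := 1) (j := 0)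
      (fun p hp => (hprof p hp).2.2.1) (fun p hp => (hprof p hp).2.2.2.1)
    refine ⟨ε, h0, h0', fun p hp => ?_⟩
    obtain ⟨h1, h2, h3, h4, U₀, hU⟩ := hprof p hp
    rw [h2]
    exact (hU.admissibleAt_iff_bottom h1 (hpos p hp) (Real.sqrt_nonneg _)).2 (hε p hp)

theorem exists_regular {K : Set ((Fin 3 → ℝ) × ℝ)} (hK : IsCompact K)
    {V₂ : (Fin 3 → ℝ) → ℝ → ℝ → ℝ}
    (hKV : ((K ⊆ I12 ∨ K ⊆ I22) ∧ V₂ = V2a) ∨ ((K ⊆ I13 ∨ K ⊆ I33) ∧ V₂ = V2b)) :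
    ∃ m : (Fin 3 → ℝ) → Fin 3 → ℝ, ∃ g : (Fin 3 → ℝ) → ℝ, ContDiff ℝ ∞ m ∧
      (∀ p ∈ K, IsRegularAt m g V₂ p) ∧ ∃ ε, Admissible ε K := by
  rcases hKV with ⟨h, rfl⟩ | ⟨h, rfl⟩
  · obtain ⟨m, h1⟩ := exists_regular_top hK h
    exact ⟨m, _, h1⟩
  · obtain ⟨m, h1⟩ := exists_regular_bottom hK h
    exact ⟨m, _, h1⟩

/-! ### The family of solutions near a compact set of profiles -/

theorem hasFDerivAt_partial {P B X : Type*} [NormedAddCommGroup P] [NormedSpace ℝ P]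
    [NormedAddCommGroup B] [NormedSpace ℝ B] [NormedAddCommGroup X] [NormedSpace ℝ X]
    {Ω : Set P} (hΩ : IsOpen Ω) {δ : ℝ} (hδ : 0 < δ) {g : P × B → X}
    (hg : ContDiffOn ℝ ∞ g (Ω ×ˢ Metric.ball 0 δ)) {p : P} (hp : p ∈ Ω) :
    HasFDerivAt (fun b => g (p, b)) ((fderiv ℝ g (p, 0)).comp (ContinuousLinearMap.inr ℝ P B))
      0 := by
  have hmem : ((p, 0) : P × B) ∈ Ω ×ˢ Metric.ball (0 : B) δ :=
    mk_mem_prod hp (Metric.mem_ball_self hδ)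
  have h1 := ((hg.contDiffAt ((hΩ.prod Metric.isOpen_ball).mem_nhds hmem)).differentiableAt
    (by simp)).hasFDerivAt
  exact h1.comp (0 : B) (hasFDerivAt_prodMk_right p 0)

/-- The remainder of the first order expansion of a smooth family in a rescaled parameter. -/
theorem exists_remainder {P B X : Type*} [NormedAddCommGroup P] [NormedSpace ℝ P]
    [NormedAddCommGroup B] [NormedSpace ℝ B] [NormedAddCommGroup X] [NormedSpace ℝ X]
    {K Ω : Set P} (hK : IsCompact K) (hΩ : IsOpen Ω) (hKΩ : K ⊆ Ω) {δ : ℝ} (hδ : 0 < δ)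
    {g : P × B → X} (hg : ContDiffOn ℝ ∞ g (Ω ×ˢ Metric.ball 0 δ)) {L : P → B →L[ℝ] B}
    (hL : ContDiffOn ℝ ∞ L Ω) :
    ∃ Ω' ⊆ Ω, ∃ δ' > 0, IsOpen Ω' ∧ K ⊆ Ω' ∧
      (∀ p ∈ Ω', ∀ β ∈ Metric.ball (0 : B) δ', L p β ∈ Metric.ball 0 δ) ∧
      ContDiffOn ℝ ∞ (fun y : P × B => g (y.1, L y.1 y.2) - fderiv ℝ g (y.1, 0) (0, L y.1 y.2))
        (Ω' ×ˢ Metric.ball 0 δ') ∧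
      ∀ p ∈ Ω', HasFDerivAt (fun β => g (p, L p β) - fderiv ℝ g (p, 0) (0, L p β))
        (0 : B →L[ℝ] X) 0 := by
  obtain ⟨C, hC⟩ := hK.exists_bound_of_continuousOn (hL.continuousOn.mono hKΩ)
  set C' := |C| + 1 with hC'
  have hC'0 : 0 < C' := by positivity
  have hopen : IsOpen (Ω ×ˢ Metric.ball (0 : B) δ) := hΩ.prod Metric.isOpen_ball
  have hmaps : ∀ p ∈ Ω ∩ L ⁻¹' Metric.ball 0 C', ∀ β ∈ Metric.ball (0 : B) (δ / C'),
      L p β ∈ Metric.ball 0 δ := by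
    rintro p ⟨-, hp⟩ β hβ
    rw [mem_preimage, mem_ball_zero_iff] at hp
    rw [mem_ball_zero_iff, lt_div_iff₀ hC'0] at hβ
    rw [mem_ball_zero_iff]
    have := (L p).le_opNorm β
    nlinarith [norm_nonneg β]
  refine ⟨Ω ∩ L ⁻¹' Metric.ball 0 C', inter_subset_left, δ / C', by positivity,
    hL.continuousOn.isOpen_inter_preimage hΩ Metric.isOpen_ball, fun p hp => ⟨hKΩ hp, ?_⟩,
    hmaps, ?_, fun p hp => ?_⟩
  · rw [mem_preimage, mem_ball_zero_iff]
    linarith [hC p hp, le_abs_self C]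
  · have hLβ : ContDiffOn ℝ ∞ (fun y : P × B => L y.1 y.2)
        ((Ω ∩ L ⁻¹' Metric.ball 0 C') ×ˢ Metric.ball 0 (δ / C')) :=
      (hL.comp contDiffOn_fst fun y hy => hy.1.1).clm_apply contDiffOn_snd
    refine ContDiffOn.sub ?_ ?_
    · exact hg.comp (contDiffOn_fst.prodMk hLβ) fun y hy =>
        mk_mem_prod hy.1.1 (hmaps _ hy.1 _ hy.2)
    · have h1 : ContDiffOn ℝ ∞ (fderiv ℝ g) (Ω ×ˢ Metric.ball 0 δ) :=
        hg.fderiv_of_isOpen hopen (by simp)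
      exact (h1.comp (contDiffOn_fst.prodMk contDiffOn_const) fun y hy =>
        mk_mem_prod hy.1.1 (Metric.mem_ball_self hδ)).clm_apply (contDiffOn_const.prodMk hLβ)
  · have h1 := hasFDerivAt_partial hΩ hδ hg hp.1
    have h2 := h1.fun_sub ((fderiv ℝ g (p, 0)).comp
      (ContinuousLinearMap.inr ℝ P B)).hasFDerivAt
    have h3 : HasFDerivAt (fun b => g (p, b) - (fderiv ℝ g (p, 0)).comp
        (ContinuousLinearMap.inr ℝ P B) b) (0 : B →L[ℝ] X) (L p 0) := by
      rw [map_zero]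
      exact h2.congr_fderiv (sub_self _)
    exact (h3.comp (0 : B) (L p).hasFDerivAt).congr_fderiv (ContinuousLinearMap.zero_comp _)

/-- The data as a continuous linear map. -/
def dataL (ε : ℝ) : X ε →L[ℝ] B3 :=
  (PiLp.continuousLinearEquiv 2 ℝ fun _ : Fin 3 => ℝ).symm.toContinuousLinearMap.comp
    (ContinuousLinearMap.pi ![evalθ ε 0, evalφ' ε, evalφ ε 0])

theorem dataL_apply {ε : ℝ} (U : X ε) : dataL ε U = U.data := by
  refine (LocalOps.data_eq ?_ ?_ ?_).symm
  · exact (evalθ_apply 0 U).symm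
  · exact (evalφ'_apply U).symm
  · exact (evalφ_apply 0 U).symm

theorem mem_X2_iff {ε : ℝ} {U : X ε} : U ∈ X2 ε ↔ dataL ε U = 0 := by
  rw [dataL_apply]
  refine ⟨fun h => LocalOps.data_eq h.1 h.2.1 h.2.2, fun h => ⟨?_, ?_, ?_⟩⟩
  · exact congrArg (fun b : B3 => b 0) h
  · exact congrArg (fun b : B3 => b 1) h
  · exact congrArg (fun b : B3 => b 2) h

theorem X2.completeSpace {ε : ℝ} (hε : ε < 1 / 2) : CompleteSpace (X2 ε) := by
  have := M1.completeSpace hε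
  have h : IsClosed (X2 ε : Set (X ε)) := by
    have : (X2 ε : Set (X ε)) = dataL ε ⁻¹' {0} := by
      ext U
      exact mem_X2_iff
    rw [this]
    exact isClosed_singleton.preimage (dataL ε).continuous
  exact h.completeSpace_coe

/-- Evaluation of the derivative of the `θ`-component at `0`. -/
def evalθ' (ε : ℝ) : X ε →L[ℝ] ℝ :=
  (evL 0).comp ((ContinuousLinearMap.snd ℝ _ _).comp ((ContinuousLinearMap.fst ℝ _ _).comp
    ((ContinuousLinearMap.fst ℝ _ _).comp (embX ε))))

theorem evalθ'_apply {ε : ℝ} (U : X ε) : evalθ' ε U = deriv U.θ 0 := by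
  have := (U.fst.hasDerivAt zero_mem_Ioo).deriv
  rw [pw_at_zero, one_mul] at this
  exact this.symm

/-- Multiplication of the first coordinate by `l`. -/
def scale (l : ℝ) : B3 →L[ℝ] B3 :=
  ContinuousLinearMap.id ℝ B3 + (l - 1) • (crd 0).smulRight (EuclideanSpace.single 0 1)

@[simp] theorem scale_apply_zero (l : ℝ) (b : B3) : scale l b 0 = l * b 0 := by
  simp [scale]; ring

@[simp] theorem scale_apply_one (l : ℝ) (b : B3) : scale l b 1 = b 1 := by
  simp [scale]

@[simp] theorem scale_apply_two (l : ℝ) (b : B3) : scale l b 2 = b 2 := by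
  simp [scale]

theorem scale_scale {k l : ℝ} (h : k * l = 1) (b : B3) : scale k (scale l b) = b := by
  ext i
  fin_cases i
  · simp [← mul_assoc, h]
  · simp
  · simp

theorem contDiff_scale : ContDiff ℝ ∞ scale :=
  contDiff_const.add ((contDiff_id.sub contDiff_const).smul contDiff_const)

/-- From `V₂' + (2x + Uθ)V₂/(1-x²) = 1` one gets `V₂'(0) = 1 - Uθ(0) V₂(0)`, which expresses `V₂(0)`
through the normalized function `V₂/V₂(0)`. -/
theorem LocalOps.hasDerivAt_normalized {ε : ℝ} (S : LocalOps ε) :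
    HasDerivAt (fun x => pw (1 - 2 * ε) x * ev (S.T (pwCb (2 * ε))) x)
      (1 - ev S.U₀ 0 * ev (S.T (pwCb (2 * ε))) 0) 0 := by
  refine ((hasDerivAt_pw (1 - 2 * ε) zero_mem_Ioo).fun_mul
    (S.isT.hasDerivAt (pwCb (2 * ε)) 0 zero_mem_Ioo)).congr_deriv ?_
  rw [ev_pwCb (by linarith [S.pos]) zero_mem_Ioo]
  simp

/-- The properties of a smooth family of profiles near one of them, and of the linearized operators
at this one. -/
theorem IsRegularAt.exists_profiles {m : (Fin 3 → ℝ) → Fin 3 → ℝ} {g : (Fin 3 → ℝ) → ℝ}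
    {V₂ : (Fin 3 → ℝ) → ℝ → ℝ → ℝ} {p : (Fin 3 → ℝ) × ℝ} (h : IsRegularAt m g V₂ p) {ε : ℝ}
    (h0 : 0 < ε) (h1 : ε < 1 / 2) (ha : AdmissibleAt ε p.1 p.2) :
    ∃ S : LocalOps ε, ∃ N : Set ((Fin 3 → ℝ) × ℝ), ∃ q : (Fin 3 → ℝ) × ℝ → Cb (Ioo (-1) 1),
      IsOpen N ∧ p ∈ N ∧ ContDiffOn ℝ ∞ q N ∧ q p = 0 ∧
      (∀ p' ∈ N, IsNoSwirl (m p'.1) (ev (S.U₀ + q p'))) ∧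
      (∀ p' ∈ N, ∀ x ∈ Ioo (-1 : ℝ) 1, Ubar (m p'.1) (g (m p'.1)) x = ev (S.U₀ + q p') x) ∧
      ∀ x ∈ Ioo (-1 : ℝ) 1, pw (1 - 2 * ε) x * ev (S.T (pwCb (2 * ε))) x = V₂ p.1 p.2 x ∧
        pw (-ε) x * ev (S.O.Z S.G) x = V3 p.1 p.2 x := by
  obtain ⟨S, ⟨l, r, hS⟩, hV⟩ := h.exists_ops ε h0 h1 ha
  obtain ⟨N, q, hN, hp, hq, hq0, hU⟩ := hS.exists_family
  refine ⟨S, Prod.fst ⁻¹' N, fun p' => q p'.1, hN.preimage continuous_fst, hp,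
    hq.comp contDiffOn_fst fun _ hy => hy, hq0, fun p' hp' => (hU _ hp').1,
    fun p' hp' x hx => ?_, hV⟩
  rw [(hU _ hp').2]
  exact (hU _ hp').1.Ubar_eq hx

theorem IsRegularAt.Ubar_eq {m : (Fin 3 → ℝ) → Fin 3 → ℝ} {g : (Fin 3 → ℝ) → ℝ}
    {V₂ : (Fin 3 → ℝ) → ℝ → ℝ → ℝ} {p : (Fin 3 → ℝ) × ℝ} (h : IsRegularAt m g V₂ p) :
    Ubar (m p.1) (g (m p.1)) = Ubar p.1 p.2 := by
  rw [h.fixed, h.value]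

/-! ### The family over `K`, parametrized by its data -/

section

variable {K : Set ((Fin 3 → ℝ) × ℝ)} {V₂ : (Fin 3 → ℝ) → ℝ → ℝ → ℝ}
  {m : (Fin 3 → ℝ) → Fin 3 → ℝ} {g : (Fin 3 → ℝ) → ℝ} {ε : ℝ}

theorem IsRegularAt.constants {p : (Fin 3 → ℝ) × ℝ} (h : IsRegularAt m g V₂ p) (h0 : 0 < ε)
    (h1 : ε < 1 / 2) (ha : AdmissibleAt ε p.1 p.2) {U : X ε} {chat : Fin 3 → ℝ}
    (hs : SolvesNSE chat (fun x => Ubar p.1 p.2 x + U.θ x) U.φ) :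
    chat = ![p.1 0 + (1 / 2) * psi U.φ U.φ (-1), p.1 1 + (1 / 2) * psi U.φ U.φ 1,
      p.1 2 - (1 / 2) * iteratedDeriv 2 (phi p.1 p.2 U.θ) 0] := by
  obtain ⟨S, N, q, hN, hp, hq, hq0, hU, hUb, hV⟩ := h.exists_profiles h0 h1 ha
  have hU' := hU p hp
  have hUb' := hUb p hp
  rw [h.Ubar_eq] at hUb'
  rw [h.fixed] at hU'
  have hs' : SolvesNSE chat (fun x => ev (S.U₀ + q p) x + U.θ x) U.φ :=
    hs.congr fun x hx => by rw [hUb' x hx]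
  obtain ⟨e0, e1, -⟩ := S.boundary_constants hU' hs'
  have e2 := S.third_constant hU' hs' (F := phi p.1 p.2 U.θ) fun x hx => by
    rw [phi, hUb' x hx]
  ext i
  fin_cases i
  exacts [e0, e1, e2]

/-- The solutions near the profiles are parametrized smoothly by their data. -/
theorem exists_data_family (hK : IsCompact K) (hm : ContDiff ℝ ∞ m)
    (hreg : ∀ p ∈ K, IsRegularAt m g V₂ p) (hε : Admissible ε K) :
    ∃ Ω : Set ((Fin 3 → ℝ) × ℝ), ∃ δ > 0, ∃ ρ > 0, ∃ f : ((Fin 3 → ℝ) × ℝ) × B3 → X ε,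
      IsOpen Ω ∧ K ⊆ Ω ∧ ContDiffOn ℝ ∞ f (Ω ×ˢ Metric.ball 0 δ) ∧
      (∀ p ∈ Ω, f (p, 0) = 0) ∧
      (∀ p ∈ Ω, ∀ b ∈ Metric.ball (0 : B3) δ,
        Sol (fun p => Ubar (m p.1) (g (m p.1))) p b (f (p, b)) ∧
        ∀ U, ‖U‖ < ρ → Sol (fun p => Ubar (m p.1) (g (m p.1))) p b U → U = f (p, b)) ∧
      ∀ p ∈ K, V₂ p.1 p.2 0 ≠ 0 ∧
        (∀ b, ∀ x ∈ Ioo (-1 : ℝ) 1,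
          (fderiv ℝ f (p, 0) (0, b)).θ x = b 0 * ((V₂ p.1 p.2 0)⁻¹ * V₂ p.1 p.2 x) ∧
          (fderiv ℝ f (p, 0) (0, b)).φ x = b 1 * V3 p.1 p.2 x + b 2) ∧
        evalθ' ε (fderiv ℝ f (p, 0) (0, EuclideanSpace.single 0 1)) + Ubar p.1 p.2 0 =
          (V₂ p.1 p.2 0)⁻¹ := by
  have hloc := fun p hp => (hreg p hp).exists_profiles hε.1 hε.2.1 (hε.2.2 p hp)
  obtain ⟨Ω, δ, hδ, ρ, hρ, f, hΩ, hKΩ, hf, hf0, hu⟩ := exists_smooth_family hK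
    (Sol (ε := ε) fun p => Ubar (m p.1) (g (m p.1))) fun p hp => by
      obtain ⟨S, N, q, hN, hpN, hq, hq0, hU, hUb, -⟩ := hloc p hp
      obtain ⟨N', δ, hδ, ρ, hρ, f, h, -⟩ := S.exists_local_family hN hpN hq hq0
        (hm.comp contDiff_fst) hU hUb
      exact ⟨N', δ, hδ, ρ, hρ, f, h⟩
  refine ⟨Ω, δ, hδ, ρ, hρ, f, hΩ, hKΩ, hf, hf0, hu, fun p hp => ?_⟩
  obtain ⟨S, N, q, hN, hpN, hq, hq0, hU, hUb, hV⟩ := hloc p hp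
  obtain ⟨N', δ', hδ', ρ', hρ', f', ⟨hN', hpN', hf', hf0', hu'⟩, Y, hY, hYe⟩ :=
    S.exists_local_family hN hpN hq hq0 (hm.comp contDiff_fst) hU hUb
  have hT : ev (S.T (pwCb (2 * ε))) 0 = V₂ p.1 p.2 0 := by
    rw [← (hV 0 zero_mem_Ioo).1, pw_at_zero, one_mul]
  have hne : V₂ p.1 p.2 0 ≠ 0 := hT ▸ S.T_ne
  have hU0 : Ubar p.1 p.2 0 = ev S.U₀ 0 := by
    rw [← (hreg p hp).Ubar_eq, hUb p hpN 0 zero_mem_Ioo, hq0, add_zero]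
  have hpart := hasFDerivAt_partial hΩ hδ hf (hKΩ hp)
  -- For small `b` the glued family is a small solution with data `b`, hence the local one around
  -- `p`, whose derivative is explicit.
  have heq : (fun b => f (p, b)) =ᶠ[𝓝 0] fun b => f' (p, b) := by
    have h1 : ∀ᶠ b in 𝓝 (0 : B3), ‖f (p, b)‖ < ρ' := by
      have := hpart.continuousAt.norm.tendsto
      simp only [hf0 p (hKΩ hp), norm_zero] at this
      exact this.eventually_lt_const hρ'
    filter_upwards [h1, Metric.ball_mem_nhds 0 hδ, Metric.ball_mem_nhds 0 hδ'] with b h1 h2 h3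
    exact (hu' p hpN' b h3).2 _ h1 (hu p (hKΩ hp) b h2).1
  have hYD : ∀ b, fderiv ℝ f (p, 0) (0, b) = Y b := fun b =>
    DFunLike.congr_fun ((hY.congr_of_eventuallyEq heq).unique hpart) b |>.symm
  have hform : ∀ b, ∀ x ∈ Ioo (-1 : ℝ) 1,
      (fderiv ℝ f (p, 0) (0, b)).θ x = b 0 * ((V₂ p.1 p.2 0)⁻¹ * V₂ p.1 p.2 x) ∧
      (fderiv ℝ f (p, 0) (0, b)).φ x = b 1 * V3 p.1 p.2 x + b 2 := fun b x hx => by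
    rw [hYD, (hYe b x hx).1, (hYe b x hx).2, hT, (hV x hx).1, (hV x hx).2]
    exact ⟨rfl, rfl⟩
  refine ⟨hne, hform, ?_⟩
  rw [evalθ'_apply, hU0]
  have h1 : (fderiv ℝ f (p, 0) (0, EuclideanSpace.single 0 1)).θ =ᶠ[𝓝 0]
      fun x => (V₂ p.1 p.2 0)⁻¹ * (pw (1 - 2 * ε) x * ev (S.T (pwCb (2 * ε))) x) := by
    filter_upwards [isOpen_Ioo.mem_nhds zero_mem_Ioo] with x hx
    rw [(hform _ x hx).1, (hV x hx).1]
    simp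
  -- With `V₂'(0) = 1 - Uθ(0) V₂(0)`, the sum `V₂'(0)/V₂(0) + Uθ(0)` equals `1/V₂(0)`.
  rw [((S.hasDerivAt_normalized.const_mul _).congr_of_eventuallyEq h1).deriv, hT]
  field_simp
  ring

theorem exists_contDiffOn_value (hm : ∀ p ∈ K, IsRegularAt m g V₂ p) (hε : Admissible ε K) :
    ∃ Ω : Set ((Fin 3 → ℝ) × ℝ), IsOpen Ω ∧ K ⊆ Ω ∧
      ContDiffOn ℝ ∞ (fun p => Ubar (m p.1) (g (m p.1)) 0) Ω := by
  set F : (Fin 3 → ℝ) × ℝ → ℝ := fun p => Ubar (m p.1) (g (m p.1)) 0 with hF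
  refine ⟨interior {p | ContDiffAt ℝ ∞ F p}, isOpen_interior, fun p hp => ?_, fun p hp => ?_⟩
  · obtain ⟨S, N, q, hN, hpN, hq, hq0, hU, hUb, -⟩ :=
      (hm p hp).exists_profiles hε.1 hε.2.1 (hε.2.2 p hp)
    have h1 : ContDiffOn ℝ ∞ F N :=
      ((evL 0).contDiff.comp_contDiffOn (contDiffOn_const (c := S.U₀).add hq)).congr
        fun p hp => hUb p hp 0 zero_mem_Ioo
    exact mem_interior.2 ⟨N, fun p' hp' => h1.contDiffAt (hN.mem_nhds hp'), hN, hpN⟩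
  · have h1 : ContDiffAt ℝ ∞ F p := interior_subset hp
    exact h1.contDiffWithinAt

/-- A smooth extension of `V₂(0)`. -/
theorem exists_scaling (hm : ∀ p ∈ K, IsRegularAt m g V₂ p) (hε : Admissible ε K)
    {Ω : Set ((Fin 3 → ℝ) × ℝ)} (hΩ : IsOpen Ω) (hKΩ : K ⊆ Ω) {δ : ℝ} (hδ : 0 < δ)
    {f : ((Fin 3 → ℝ) × ℝ) × B3 → X ε} (hf : ContDiffOn ℝ ∞ f (Ω ×ˢ Metric.ball 0 δ))
    (hV : ∀ p ∈ K, V₂ p.1 p.2 0 ≠ 0 ∧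
      evalθ' ε (fderiv ℝ f (p, 0) (0, EuclideanSpace.single 0 1)) + Ubar p.1 p.2 0 =
        (V₂ p.1 p.2 0)⁻¹) :
    ∃ Ω' ⊆ Ω, ∃ l : (Fin 3 → ℝ) × ℝ → ℝ, IsOpen Ω' ∧ K ⊆ Ω' ∧ ContDiffOn ℝ ∞ l Ω' ∧
      ∀ p ∈ K, l p = V₂ p.1 p.2 0 := by
  obtain ⟨Ω₁, hΩ₁, hK₁, hc⟩ := exists_contDiffOn_value hm hε
  -- Smoothness of `V₂(0)` off `K` is not available directly. This `κ` is smooth near `K`, being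
  -- built from the family and the profiles, and equals `1/V₂(0)` on `K`.
  set κ : (Fin 3 → ℝ) × ℝ → ℝ := fun p =>
    evalθ' ε (fderiv ℝ f (p, 0) (0, EuclideanSpace.single 0 1)) + Ubar (m p.1) (g (m p.1)) 0
    with hκ
  have hκK : ∀ p ∈ K, κ p = (V₂ p.1 p.2 0)⁻¹ := fun p hp => by
    rw [← (hV p hp).2, ← (hm p hp).Ubar_eq]
  have h1 : ContDiffOn ℝ ∞ (fderiv ℝ f) (Ω ×ˢ Metric.ball 0 δ) :=
    hf.fderiv_of_isOpen (hΩ.prod Metric.isOpen_ball) (by simp)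
  have h2 : ContDiffOn ℝ ∞ (fun p : (Fin 3 → ℝ) × ℝ => fderiv ℝ f (p, (0 : B3))) (Ω ∩ Ω₁) :=
    h1.comp (contDiffOn_id.prodMk contDiffOn_const) fun y hy =>
      mk_mem_prod hy.1 (Metric.mem_ball_self hδ)
  have hκc : ContDiffOn ℝ ∞ κ (Ω ∩ Ω₁) :=
    ((evalθ' ε).contDiff.comp_contDiffOn (h2.clm_apply contDiffOn_const)).add
      (hc.mono inter_subset_right)
  refine ⟨(Ω ∩ Ω₁) ∩ κ ⁻¹' {0}ᶜ, inter_subset_left.trans inter_subset_left, fun p => (κ p)⁻¹,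
    hκc.continuousOn.isOpen_inter_preimage (hΩ.inter hΩ₁) isOpen_compl_singleton,
    fun p hp => ⟨⟨hKΩ hp, hK₁ hp⟩, ?_⟩, ?_, fun p hp => ?_⟩
  · rw [mem_preimage, hκK p hp]
    exact inv_ne_zero (hV p hp).1
  · exact (hκc.mono inter_subset_left).inv fun p hp => hp.2
  · simp only [hκK p hp, inv_inv]

end

/-- The inclusion of `X2` is linear and injective, so a derivative that vanishes in `X` vanishes in
the subspace. -/
theorem hasFDerivAt_zero_of_coe {ε : ℝ} {F : B3 → X ε} {V : B3 → X2 ε}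
    (hF : HasFDerivAt F (0 : B3 →L[ℝ] X ε) 0) (hV : DifferentiableAt ℝ V 0)
    (hVF : (fun β => (V β : X ε)) =ᶠ[𝓝 0] F) : HasFDerivAt V (0 : B3 →L[ℝ] X2 ε) 0 := by
  have h1 : HasFDerivAt (fun β => (V β : X ε)) ((X2 ε).subtypeL ∘L fderiv ℝ V 0) 0 :=
    ((X2 ε).subtypeL.hasFDerivAt (x := V 0)).comp (0 : B3) hV.hasFDerivAt
  have h2 := h1.unique (hF.congr_of_eventuallyEq hVF)
  refine hV.hasFDerivAt.congr_fderiv (ContinuousLinearMap.ext fun b => Subtype.ext ?_)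
  exact DFunLike.congr_fun h2 b

/-- The linear part of a family parametrized by its data has the same data. -/
theorem data_fderiv {ε : ℝ} {Ω : Set ((Fin 3 → ℝ) × ℝ)} (hΩ : IsOpen Ω) {δ : ℝ} (hδ : 0 < δ)
    {f : ((Fin 3 → ℝ) × ℝ) × B3 → X ε} (hf : ContDiffOn ℝ ∞ f (Ω ×ˢ Metric.ball 0 δ))
    (hd : ∀ p ∈ Ω, ∀ b ∈ Metric.ball (0 : B3) δ, (f (p, b)).data = b) {p : (Fin 3 → ℝ) × ℝ}
    (hp : p ∈ Ω) (b : B3) : dataL ε (fderiv ℝ f (p, 0) (0, b)) = b := by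
  have h1 := ((dataL ε).hasFDerivAt (x := f (p, 0))).comp (0 : B3) (hasFDerivAt_partial hΩ hδ hf hp)
  have h2 : (dataL ε ∘ fun b => f (p, b)) =ᶠ[𝓝 0] id := by
    filter_upwards [Metric.ball_mem_nhds 0 hδ] with b hb
    exact (dataL_apply _).trans (hd p hp b hb)
  exact DFunLike.congr_fun (h1.unique ((hasFDerivAt_id (0 : B3)).congr_of_eventuallyEq h2)) b

/-- The first coordinate of the data is the value at `0`, whereas `β₀` is the coefficient of `V₂`;
scaling by `V₂(0)` passes from one to the other. The remainder after the linear part is `V`, and on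
`K` the linear part is `β₀ V₂`, `β₁ V³ + β₂`. -/
theorem exists_solution_family {K : Set ((Fin 3 → ℝ) × ℝ)} {V₂ : (Fin 3 → ℝ) → ℝ → ℝ → ℝ}
    {m : (Fin 3 → ℝ) → Fin 3 → ℝ} {g : (Fin 3 → ℝ) → ℝ} {ε : ℝ} (hK : IsCompact K)
    (hm : ContDiff ℝ ∞ m) (hreg : ∀ p ∈ K, IsRegularAt m g V₂ p) (hε : Admissible ε K) :
    ∃ δ > 0, ∃ V : ((Fin 3 → ℝ) × ℝ) × B3 → X2 ε,
      (∃ Ω : Set ((Fin 3 → ℝ) × ℝ), IsOpen Ω ∧ K ⊆ Ω ∧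
        ContDiffOn ℝ ∞ V (Ω ×ˢ Metric.ball 0 δ)) ∧
      (∀ p ∈ K, V (p, 0) = 0) ∧
      (∀ p ∈ K, HasFDerivAt (fun β => V (p, β)) (0 : B3 →L[ℝ] X2 ε) 0) ∧
      (∀ p ∈ K, ∀ β ∈ Metric.ball (0 : B3) δ, ∃ U : X ε,
        (∀ x ∈ Ioo (-1 : ℝ) 1, U.θ x = β 0 * V₂ p.1 p.2 x + (V (p, β)).1.θ x ∧
          U.φ x = β 1 * V3 p.1 p.2 x + β 2 + (V (p, β)).1.φ x) ∧
        ∃ chat, SolvesNSE chat (fun x => Ubar p.1 p.2 x + U.θ x) U.φ) ∧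
      ∃ δ' > 0, ∀ p ∈ K, ∀ U : X ε, ‖U‖ < δ' →
        (∃ chat, SolvesNSE chat (fun x => Ubar p.1 p.2 x + U.θ x) U.φ) →
        ∃ β ∈ Metric.ball (0 : B3) δ, ∀ x ∈ Ioo (-1 : ℝ) 1,
          U.θ x = β 0 * V₂ p.1 p.2 x + (V (p, β)).1.θ x ∧
          U.φ x = β 1 * V3 p.1 p.2 x + β 2 + (V (p, β)).1.φ x := by
  classical
  have := X2.completeSpace hε.2.1
  obtain ⟨Ω₁, δ₁, hδ₁, ρ, hρ, f, hΩ₁, hK₁, hf, hf0, hsol, hder⟩ :=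
    exists_data_family hK hm hreg hε
  obtain ⟨Ω₂, hΩ₂₁, l, hΩ₂, hK₂, hl, hlK⟩ := exists_scaling hreg hε hΩ₁ hK₁ hδ₁ hf
    fun p hp => ⟨(hder p hp).1, (hder p hp).2.2⟩
  have hf₂ : ContDiffOn ℝ ∞ f (Ω₂ ×ˢ Metric.ball 0 δ₁) := hf.mono (prod_mono hΩ₂₁ le_rfl)
  obtain ⟨Ω, hΩ₂', δ, hδ, hΩ, hKΩ, hmaps, hW, hWd⟩ := exists_remainder hK hΩ₂ hK₂ hδ₁ hf₂
    (L := fun p => scale (l p)) (contDiff_scale.comp_contDiffOn hl)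
  set W : ((Fin 3 → ℝ) × ℝ) × B3 → X ε := fun y =>
    f (y.1, scale (l y.1) y.2) - fderiv ℝ f (y.1, 0) (0, scale (l y.1) y.2) with hWdef
  -- The family and its linear part have the same data, because the data of `f(p,b)` are `b` itself;
  -- so the difference lies in the common kernel.
  have hW2 : ∀ p ∈ Ω, ∀ β ∈ Metric.ball (0 : B3) δ, W (p, β) ∈ X2 ε := by
    intro p hp β hβ
    rw [mem_X2_iff, hWdef]
    simp only
    rw [map_sub, data_fderiv hΩ₁ hδ₁ hf (fun p hp b hb => (hsol p hp b hb).1.2)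
      (hΩ₂₁ (hΩ₂' hp)), dataL_apply, (hsol p (hΩ₂₁ (hΩ₂' hp)) _ (hmaps p hp β hβ)).1.2]
    exact sub_self _
  set V : ((Fin 3 → ℝ) × ℝ) × B3 → X2 ε := fun y =>
    if h : W y ∈ X2 ε then ⟨W y, h⟩ else 0 with hVdef
  have hVW : ∀ p ∈ Ω, ∀ β ∈ Metric.ball (0 : B3) δ, (V (p, β) : X ε) = W (p, β) := by
    intro p hp β hβ
    rw [hVdef]
    simp only
    rw [dif_pos (hW2 p hp β hβ)]
  have hopen : IsOpen (Ω ×ˢ Metric.ball (0 : B3) δ) := hΩ.prod Metric.isOpen_ball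
  have hVc : ContDiffOn ℝ ∞ V (Ω ×ˢ Metric.ball 0 δ) := by
    refine contDiffOn_of_comp_antilipschitz (X2 ε).subtypeL (C := 1) (fun x => ?_) hopen ?_
    · rw [one_mul]; rfl
    · exact hW.congr fun y hy => hVW y.1 hy.1 y.2 hy.2
  have hsum : ∀ p ∈ K, ∀ β ∈ Metric.ball (0 : B3) δ, ∀ x ∈ Ioo (-1 : ℝ) 1,
      (f (p, scale (l p) β)).θ x = β 0 * V₂ p.1 p.2 x + (V (p, β)).1.θ x ∧
      (f (p, scale (l p) β)).φ x = β 1 * V3 p.1 p.2 x + β 2 + (V (p, β)).1.φ x := by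
    intro p hp β hβ x hx
    have e : f (p, scale (l p) β) =
        fderiv ℝ f (p, 0) (0, scale (l p) β) + (V (p, β) : X ε) := by
      rw [hVW p (hKΩ hp) β hβ, hWdef]
      simp only
      rw [add_sub_cancel]
    obtain ⟨h1, h2, -⟩ := hder p hp
    obtain ⟨h3, h4⟩ := h2 (scale (l p) β) x hx
    rw [scale_apply_zero] at h3
    rw [← hlK p hp] at h1 h3
    rw [scale_apply_one, scale_apply_two] at h4
    constructor
    · rw [e, ← evalθ_apply, map_add, evalθ_apply, evalθ_apply, h3]
      field_simp
    · rw [e, ← evalφ_apply, map_add, evalφ_apply, evalφ_apply, h4]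
  have h0δ : (0 : B3) ∈ Metric.ball (0 : B3) δ := Metric.mem_ball_self hδ
  refine ⟨δ, hδ, V, ⟨Ω, hΩ, hKΩ, hVc⟩, fun p hp => Subtype.ext ?_, fun p hp => ?_,
    fun p hp β hβ => ⟨_, hsum p hp β hβ, ?_⟩, ?_⟩
  · rw [hVW p (hKΩ hp) 0 h0δ, hWdef]
    simp only [map_zero, hf0 p (hK₁ hp), Prod.mk_zero_zero, sub_zero, ZeroMemClass.coe_zero]
  · have hmem : ((p, 0) : ((Fin 3 → ℝ) × ℝ) × B3) ∈ Ω ×ˢ Metric.ball (0 : B3) δ :=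
      mk_mem_prod (hKΩ hp) h0δ
    have h1 := (hVc.contDiffAt (hopen.mem_nhds hmem)).differentiableAt (by simp)
    refine hasFDerivAt_zero_of_coe (hWd p (hKΩ hp))
      (h1.comp (0 : B3) ((differentiableAt_const p).prodMk differentiableAt_id)) ?_
    filter_upwards [Metric.ball_mem_nhds 0 hδ] with β hβ
    exact hVW p (hKΩ hp) β hβ
  · have h1 := (hsol p (hK₁ hp) _ (hmaps p (hKΩ hp) β hβ)).1.1
    simp only [(hreg p hp).Ubar_eq] at h1
    exact h1
  · have hlc : ContinuousOn (fun p => scale (l p)⁻¹) K := by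
      refine contDiff_scale.continuous.comp_continuousOn
        ((hl.continuousOn.mono hK₂).inv₀ fun p hp => ?_)
      rw [hlK p hp]
      exact (hder p hp).1
    obtain ⟨C, hC⟩ := hK.exists_bound_of_continuousOn hlc
    have hCpos : 0 < |C| + 1 := by positivity
    have hDpos : 0 < ‖dataL ε‖ + 1 := by positivity
    -- The data must lie in the domain of `f`, and the parameters rescaled by `1/V₂(0)`, with
    -- operator norm bounded by `C` on `K`, in the ball of radius `δ`.
    set r := min δ₁ (δ / (|C| + 1)) with hr
    have hrpos : 0 < r := lt_min hδ₁ (by positivity)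
    refine ⟨min ρ (r / (‖dataL ε‖ + 1)), lt_min hρ (by positivity), fun p hp U hU hs => ?_⟩
    obtain ⟨hUρ, hUr⟩ := lt_min_iff.1 hU
    have hb : ‖U.data‖ < r := by
      rw [lt_div_iff₀ hDpos] at hUr
      have := (dataL ε).le_opNorm U
      rw [dataL_apply] at this
      nlinarith [norm_nonneg U]
    obtain ⟨hb1, hb2⟩ := lt_min_iff.1 hb
    have hlp : l p ≠ 0 := by
      rw [hlK p hp]
      exact (hder p hp).1
    have hβ : scale (l p)⁻¹ U.data ∈ Metric.ball (0 : B3) δ := by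
      rw [mem_ball_zero_iff]
      rw [lt_div_iff₀ hCpos] at hb2
      have h1 := (scale (l p)⁻¹).le_opNorm U.data
      have h2 := (hC p hp).trans (le_abs_self C)
      nlinarith [norm_nonneg U.data]
    refine ⟨_, hβ, ?_⟩
    have hUf : U = f (p, scale (l p) (scale (l p)⁻¹ U.data)) := by
      rw [scale_scale (mul_inv_cancel₀ hlp)]
      refine (hsol p (hK₁ hp) U.data (mem_ball_zero_iff.2 hb1)).2 U hUρ ⟨?_, rfl⟩
      simp only [(hreg p hp).Ubar_eq]
      exact hs
    intro x hx
    have := hsum p hp _ hβ x hx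
    rwa [← hUf] at this

end

end HomNS

theorem theorem3p2
    (K : Set ((Fin 3 → ℝ) × ℝ)) (hK : IsCompact K)
    (V₂ : (Fin 3 → ℝ) → ℝ → ℝ → ℝ)
    (hKV : ((K ⊆ HomNS.I12 ∨ K ⊆ HomNS.I22) ∧ V₂ = HomNS.V2a) ∨
      ((K ⊆ HomNS.I13 ∨ K ⊆ HomNS.I33) ∧ V₂ = HomNS.V2b)) :
    (∃ ε : ℝ, HomNS.Admissible ε K) ∧
    ∀ ε : ℝ, HomNS.Admissible ε K →
      ∃ δ > 0, ∃ V : ((Fin 3 → ℝ) × ℝ) × EuclideanSpace ℝ (Fin 3) → HomNS.X2 ε,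
        -- `V` is smooth on a neighbourhood of `K` times the ball `B_δ(0)`
        (∃ Ω : Set ((Fin 3 → ℝ) × ℝ), IsOpen Ω ∧ K ⊆ Ω ∧
          ContDiffOn ℝ ∞ V (Ω ×ˢ Metric.ball 0 δ)) ∧
        (∀ p ∈ K, V (p, 0) = 0) ∧
        (∀ p ∈ K, ∀ i : Fin 3,
          HasDerivAt (fun t : ℝ => V (p, EuclideanSpace.single i t)) 0 0) ∧
        -- the family consists of solutions
        (∀ c γ, (c, γ) ∈ K → ∀ β ∈ Metric.ball (0 : EuclideanSpace ℝ (Fin 3)) δ,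
          ∃ U : HomNS.X ε,
            (∀ x ∈ Set.Ioo (-1 : ℝ) 1,
              U.θ x = β 0 * V₂ c γ x + (V ((c, γ), β)).1.θ x ∧
              U.φ x = β 1 * HomNS.V3 c γ x + β 2 + (V ((c, γ), β)).1.φ x) ∧
            HomNS.SolvesNSE
              ![c 0 + (1 / 2) * HomNS.psi U.φ U.φ (-1),
                c 1 + (1 / 2) * HomNS.psi U.φ U.φ 1,
                c 2 - (1 / 2) * iteratedDeriv 2 (HomNS.phi c γ U.θ) 0]
              (fun x => HomNS.Ubar c γ x + U.θ x) U.φ) ∧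
        -- every solution near `U^{c,γ}` in `X` belongs to the family
        (∃ δ' > 0, ∀ c γ, (c, γ) ∈ K → ∀ U : HomNS.X ε, ‖U‖ < δ' →
          (∃ chat : Fin 3 → ℝ,
            HomNS.SolvesNSE chat (fun x => HomNS.Ubar c γ x + U.θ x) U.φ) →
          ∃ β ∈ Metric.ball (0 : EuclideanSpace ℝ (Fin 3)) δ, ∀ x ∈ Set.Ioo (-1 : ℝ) 1,
            U.θ x = β 0 * V₂ c γ x + (V ((c, γ), β)).1.θ x ∧
            U.φ x = β 1 * HomNS.V3 c γ x + β 2 + (V ((c, γ), β)).1.φ x) := by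
  obtain ⟨m, g, hm, hreg, hadm⟩ := HomNS.exists_regular hK hKV
  refine ⟨hadm, fun ε hε => ?_⟩
  obtain ⟨δ, hδ, V, hV, hV0, hVd, hsol, δ', hδ', huniq⟩ :=
    HomNS.exists_solution_family hK hm hreg hε
  refine ⟨δ, hδ, V, hV, hV0, fun p hp i => ?_, fun c γ hp β hβ => ?_,
    δ', hδ', fun c γ hp => huniq (c, γ) hp⟩
  · have h1 : HasFDerivAt (fun β => V (p, β)) (0 : HomNS.B3 →L[ℝ] HomNS.X2 ε)
        (EuclideanSpace.single i (0 : ℝ)) := by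
      rw [show (EuclideanSpace.single i (0 : ℝ) : HomNS.B3) = 0 by simp]
      exact hVd p hp
    have h2 : HasDerivAt (fun t : ℝ => (EuclideanSpace.single i t : HomNS.B3))
        (EuclideanSpace.single i 1) 0 := by
      have := (hasDerivAt_id (0 : ℝ)).smul_const (EuclideanSpace.single i (1 : ℝ) : HomNS.B3)
      rw [one_smul] at this
      refine this.congr_of_eventuallyEq (Filter.Eventually.of_forall fun t => ?_)
      ext j
      simp
    exact h1.comp_hasDerivAt (0 : ℝ) h2
  · obtain ⟨U, hU, chat, hs⟩ := hsol (c, γ) hp β hβ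
    refine ⟨U, hU, ?_⟩
    -- The constants of a solution with `Ũ ∈ X` are forced, so those found in the construction are
    -- the prescribed ones.
    rw [← (hreg (c, γ) hp).constants hε.1 hε.2.1 (hε.2.2 _ hp) hs]
    exact hs
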